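/- **Conventions.** All dga's are graded commutative, non-negatively graded and unital. A filtered dga $(A,W)$ over a field $\mathbf k$ of characteristic $0$ is a dga with an increasing, exhaustive, multiplicative filtration $W$ by subcomplexes with $1\in W_0A^0$; $W$ is regular if for each $n$ there is $p$ with $W_pA^n=0$. Put $\mathrm{Dec}W_pA^n=\{x\in W_{p-n}A^n: dx\in W_{p-n-1}A^{n+1}\}$. A morphism of filtered dga's is an $E_1$-quasi-isomorphism if it induces an isomorphism on $E_2$ of the spectral sequences of $W$. The $1$-path $P_1(B)$ is $B\otimes\Lambda(t,dt)$ with $W_pP_1(B)=(W_pB\otimes\Lambda(t))\oplus(W_{p+1}B\otimes\Lambda(t)dt)$; a $1$-homotopy from $f$ to $g:A\to B$ is a morphism of filtered dga's $h:A\to P_1(B)$ with $h|_{t=0}=f$ and $h|_{t=1}=g$. A mixed Hodge structure $(V,W,F)$ over $\mathbb Q$ may be infinite-dimensional: it is then a directed union of finite-dimensional rational subspaces on which $W$ and $F$ induce ordinary mixed Hodge structures. **Mixed Hodge diagrams.** Fix a zig-zag $I=\{0\to1\leftarrow2\to\cdots\leftarrow s\}$, $s\ge 2$ even. A *mixed Hodge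 diagram* $A$ consists of a filtered dga $(A_{\mathbb Q},W)$ over $\mathbb Q$, a bifiltered dga $(A_{\mathbb C},W,F)$ over $\mathbb C$ ($F$ decreasing and multiplicative), filtered dga's $(A_i,W)$ over $\mathbb C$ for $i\in I$ with $A_0=A_{\mathbb Q}\otimes\mathbb C$ and $A_s=A_{\mathbb C}$, and $E_1$-quasi-isomorphisms $\varphi_u:(A_i,W)\to(A_j,W)$ for all $u:i\to j$ of $I$, such that: the filtrations $W$ are regular and exhaustive, $F$ is biregular, and each $H^n(A_{\mathbb Q})$ is finite-dimensional; for all $p$ the differential of $Gr^W_pA_{\mathbb C}$ is strictly compatible with $F$; for all $n,p$ the maps $\varphi_u$ identify $H^n(Gr^W_pA_{\mathbb Q})\otimes\mathbb C$ with $H^n(Gr_p^WA_{\mathbb C})$, and the filtration induced by $F$ defines a pure Hodge structure of weight $p+n$ on $H^n(Gr^W_pA_{\mathbb Q})$. It is *$0$-connected* if the unit induces $\mathbb Q\cong H^0(A_{\mathbb Q})$. A *ho-morphism* $f:A\rightsquigarrow B$ consists of a filtered morphism $f_{\mathbb Q}:A_{\mathbb Q}\to B_{\mathbb Q}$, a bifiltered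 morphism $f_{\mathbb C}:A_{\mathbb C}\to B_{\mathbb C}$, and filtered morphisms $f_i:A_i\to B_i$ with $f_0=f_{\mathbb Q}\otimes\mathbb C$ and $f_s=f_{\mathbb C}$, together with $1$-homotopies $f_j\varphi^A_u\simeq\varphi^B_uf_i$ for all $u:i\to j$. It is a *quasi-isomorphism* if $f_{\mathbb Q}$, $f_{\mathbb C}$ and all $f_i$ are quasi-isomorphisms. **Mixed Hodge dga's.** A *mixed Hodge dga* is a filtered dga $(A,W)$ over $\mathbb Q$ with a filtration $F$ of $A\otimes\mathbb C$ such that each $(A^n,\mathrm{Dec}W,F)$ is a mixed Hodge structure and the differential and products are morphisms of mixed Hodge structures. It is regarded as a diagram of type $I$ with $A_{\mathbb C}=A_i=A\otimes\mathbb C$ and identities as comparison morphisms. A *minimal mixed Hodge extension* of $A$ of degree $n\ge1$ is a mixed Hodge dga $A\otimes_\xi\Lambda(V)$, where $V$ is a filtered vector space $(V,W)$ in degree $n$, with a filtration $F$ of $V\otimes\mathbb C$ for which $(V,\mathrm{Dec}W,F)$ is a mixed Hodge structure ($\mathrm{Dec}W_pV=W_{p-n}V$), and $\xi:V\to A^{n+1}$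 is linear with $d\xi=0$, $\xi(W_pV)\subset W_{p-1}A^{n+1}$ and $\xi(V)\subset A^+\cdot A^+$. Here the differential is the multiplicative extension of that of $A$ and of $\xi$, and $W$ is the multiplicative extension of the filtrations of $A$ and $V$; the filtration $F$ of $(A\otimes_\xi\Lambda(V))\otimes\mathbb C$ is the multiplicative extension of the filtrations $F$ of $A\otimes\mathbb C$ and of $V\otimes\mathbb C$ along a linear map $j:V\otimes\mathbb C\to(A\otimes_\xi\Lambda(V))^n\otimes\mathbb C$ such that $j-\mathrm{incl}$ sends $W_p$ into $W_pA^n\otimes\mathbb C$ and $d\circ j$ sends $F^q(V\otimes\mathbb C)$ into $F^q(A^{n+1}\otimes\mathbb C)$. A mixed Hodge dga is *minimal* if it is the colimit of a sequence of minimal mixed Hodge extensions starting from $\mathbb Q$ with the trivial mixed Hodge structure. **Theorem.** For every $0$-connected mixed Hodge diagram $A$ there exist a minimal mixed Hodge dga $M$ and a ho-morphism $\rho:M\rightsquigarrow A$ which is a quasi-isomorphism. If moreover $H^1(A_{\mathbb Q})$ has no negative weights, that is, if every cocycle in $W_{-2}A^1_{\mathbb Q}$ is a coboundary, then $M$ can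 be chosen so that its filtration $W$ is also regular. -/

import Mathlib

open scoped TensorProduct Polynomial

universe u

/-! ## Graded commutative algebras -/

/-- A graded commutative algebra over `k`, graded by the non-negative integers;
`gr n` is the part of degree `n`. -/
structure GCAlg (k : Type) [Field k] where
  carrier : Type u
  [ring : Ring carrier]
  [algebra : Algebra k carrier]
  gr : ℕ → Submodule k carrier
  [graded : GradedAlgebra gr]
  comm : ∀ {n m : ℕ} {x y : carrier}, x ∈ gr n → y ∈ gr m →
    x * y = (-1 : k) ^ (n * m) • (y * x)

attribute [instance] GCAlg.ring GCAlg.algebra GCAlg.graded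

/-- Morphisms of graded algebras. -/
@[ext] structure GCHom {k : Type} [Field k] (A B : GCAlg.{u} k) where
  toFun : A.carrier →ₐ[k] B.carrier
  map_gr : ∀ (n : ℕ) (x : A.carrier), x ∈ A.gr n → toFun x ∈ B.gr n

/-- Shift of a family of subspaces by one degree: `(shiftDeg S) n = S (n - 1)`, zero for `n = 0`. -/
def shiftDeg {k X : Type*} [Field k] [AddCommGroup X] [Module k X]
    (S : ℕ → Submodule k X) : ℕ → Submodule k X
  | 0 => ⊥
  | n + 1 => S n

/-! ## Filtered dga's -/

/-- A filtered commutative dga over `k`: `d` has degree `1`, `W p n` is the piece `W_p A^n` of an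
increasing exhaustive multiplicative filtration by subcomplexes, with `1 ∈ W_0 A^0`. -/
structure FDGA (k : Type) [Field k] extends GCAlg.{u} k where
  d : carrier →ₗ[k] carrier
  d_gr : ∀ (n : ℕ) (x : carrier), x ∈ gr n → d x ∈ gr (n + 1)
  d_d : ∀ x : carrier, d (d x) = 0
  leibniz : ∀ (n : ℕ) (x y : carrier), x ∈ gr n → d (x * y) = d x * y + (-1 : k) ^ n • (x * d y)
  W : ℤ → ℕ → Submodule k carrier
  W_le : ∀ p n, W p n ≤ gr n
  W_mono : ∀ n, Monotone fun p => W p n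
  W_exhaustive : ∀ (n : ℕ) (x : carrier), x ∈ gr n → ∃ p, x ∈ W p n
  one_W : (1 : carrier) ∈ W 0 0
  mul_W : ∀ (p q : ℤ) (n m : ℕ) (x y : carrier), x ∈ W p n → y ∈ W q m →
    x * y ∈ W (p + q) (n + m)
  d_W : ∀ (p : ℤ) (n : ℕ) (x : carrier), x ∈ W p n → d x ∈ W p (n + 1)

/-- Morphisms of filtered dga's. -/
@[ext] structure FDGAHom {k : Type} [Field k] (A B : FDGA.{u} k) extends
    GCHom A.toGCAlg B.toGCAlg where
  map_d : ∀ x, toFun (A.d x) = B.d (toFun x)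
  map_W : ∀ (p : ℤ) (n : ℕ) (x : A.carrier), x ∈ A.W p n → toFun x ∈ B.W p n

namespace FDGAHom

variable {k : Type} [Field k] {A B C : FDGA.{u} k}

def id (A : FDGA.{u} k) : FDGAHom A A where
  toFun := AlgHom.id k A.carrier
  map_gr _ _ h := h
  map_d _ := rfl
  map_W _ _ _ h := h

def comp (g : FDGAHom B C) (f : FDGAHom A B) : FDGAHom A C where
  toFun := g.toFun.comp f.toFun
  map_gr n x h := g.map_gr n _ (f.map_gr n x h)
  map_d x := by simp [f.map_d, g.map_d]
  map_W p n x h := g.map_W p n _ (f.map_W p n x h)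

end FDGAHom

namespace FDGA

variable {k : Type} [Field k]

/-- The filtration is regular: for each `n` there is `p` with `W_p A^n = 0`. -/
def IsRegular (A : FDGA.{u} k) : Prop := ∀ n, ∃ p, A.W p n = ⊥

/-- Deligne's décalage: `Dec W_p A^n = {x ∈ W_{p-n} A^n | d x ∈ W_{p-n-1} A^{n+1}}`. -/
def Dec (A : FDGA.{u} k) (p : ℤ) (n : ℕ) : Submodule k A.carrier :=
  A.W (p - n) n ⊓ (A.W (p - n - 1) (n + 1)).comap A.d

/-- Cocycles of degree `n`. -/
def cocycles (A : FDGA.{u} k) (n : ℕ) : Submodule k A.carrier := A.gr n ⊓ LinearMap.ker A.d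

/-- Coboundaries of degree `n`. -/
def coboundaries (A : FDGA.{u} k) (n : ℕ) : Submodule k A.carrier :=
  (shiftDeg A.gr n).map A.d

/-- The cohomology `H^n(A)`. -/
abbrev H (A : FDGA.{u} k) (n : ℕ) : Type u :=
  ↥(A.cocycles n) ⧸ (A.coboundaries n).submoduleOf (A.cocycles n)

/-- `{x ∈ W_p A^n | d x ∈ W_{p-r} A^{n+1}}`. -/
def Z (A : FDGA.{u} k) (r p : ℤ) (n : ℕ) : Submodule k A.carrier :=
  A.W p n ⊓ (A.W (p - r) (n + 1)).comap A.d

/-- The subspace by which `Z r p n` is divided to obtain the `r`-th term of the spectral sequence: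
`Z_{r-1}^{p-1,n} + d Z_{r-1}^{p+r-1,n-1}`. -/
def bd (A : FDGA.{u} k) (r p : ℤ) (n : ℕ) : Submodule k A.carrier :=
  A.Z (r - 1) (p - 1) n ⊔ (shiftDeg (A.Z (r - 1) (p + r - 1)) n).map A.d

/-- The term `E_r^{-p,n+p}(A)` of the spectral sequence of `(A, W)`. In particular
`E 1 p n = H^n(Gr_p^W A)`. -/
abbrev E (A : FDGA.{u} k) (r p : ℤ) (n : ℕ) : Type u :=
  ↥(A.Z r p n) ⧸ (A.bd r p n).submoduleOf (A.Z r p n)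

end FDGA

namespace FDGAHom

variable {k : Type} [Field k] {A B : FDGA.{u} k} (f : FDGAHom A B)

theorem map_cocycles (n : ℕ) (x : A.carrier) (hx : x ∈ A.cocycles n) :
    f.toFun x ∈ B.cocycles n := by
  refine ⟨f.map_gr n x hx.1, ?_⟩
  have h : A.d x = 0 := hx.2
  simp [← f.map_d, h]

theorem map_coboundaries (n : ℕ) (x : A.carrier) (hx : x ∈ A.coboundaries n) :
    f.toFun x ∈ B.coboundaries n := by
  obtain ⟨y, hy, rfl⟩ := hx
  refine ⟨f.toFun y, ?_, (f.map_d y).symm⟩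
  cases n with
  | zero =>
    have h : y = 0 := hy
    simp [h]
  | succ n => exact f.map_gr n y hy

/-- The induced map in cohomology. -/
def mapH (n : ℕ) : A.H n →ₗ[k] B.H n :=
  Submodule.mapQ _ _ (f.toFun.toLinearMap.restrict (f.map_cocycles n))
    fun x hx => f.map_coboundaries n x hx

theorem map_Z (r p : ℤ) (n : ℕ) (x : A.carrier) (hx : x ∈ A.Z r p n) :
    f.toFun x ∈ B.Z r p n := by
  refine ⟨f.map_W p n x hx.1, ?_⟩
  have h := f.map_W _ _ _ hx.2
  rw [f.map_d] at h
  exact h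

theorem map_bd (r p : ℤ) (n : ℕ) (x : A.carrier) (hx : x ∈ A.bd r p n) :
    f.toFun x ∈ B.bd r p n := by
  obtain ⟨y, hy, z, ⟨w, hw, rfl⟩, rfl⟩ := Submodule.mem_sup.1 hx
  rw [map_add, f.map_d]
  refine Submodule.add_mem_sup (f.map_Z _ _ _ y hy) ⟨f.toFun w, ?_, rfl⟩
  cases n with
  | zero =>
    have h : w = 0 := hw
    simp [h]
  | succ n => exact f.map_Z _ _ n w hw

/-- The induced map on the `r`-th term of the spectral sequences. -/
def mapE (r p : ℤ) (n : ℕ) : A.E r p n →ₗ[k] B.E r p n :=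
  Submodule.mapQ _ _ (f.toFun.toLinearMap.restrict (f.map_Z r p n))
    fun x hx => f.map_bd r p n x hx

/-- `f` induces isomorphisms in cohomology. -/
def IsQuasiIso : Prop := ∀ n, Function.Bijective (f.mapH n)

/-- `f` is an `E_r`-quasi-isomorphism: `E_{r+1}(f)` is an isomorphism. -/
def IsEQuasiIso (r : ℕ) : Prop := ∀ (p : ℤ) (n : ℕ), Function.Bijective (f.mapE (r + 1) p n)

end FDGAHom

/-! ## Extension of scalars from `ℚ` to `ℂ` -/

namespace FDGA

theorem baseChange_mul_mem {A : Type u} [Ring A] [Algebra ℚ A] {S T U : Submodule ℚ A}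
    (h : ∀ x ∈ S, ∀ y ∈ T, x * y ∈ U) (x y : ℂ ⊗[ℚ] A)
    (hx : x ∈ S.baseChange ℂ) (hy : y ∈ T.baseChange ℂ) : x * y ∈ U.baseChange ℂ := by
  rw [Submodule.baseChange_eq_span] at hx hy
  induction hx using Submodule.span_induction with
  | mem x hx =>
    obtain ⟨a, ha, rfl⟩ := hx
    induction hy using Submodule.span_induction with
    | mem y hy =>
      obtain ⟨b, hb, rfl⟩ := hy
      simpa using Submodule.tmul_mem_baseChange_of_mem (1 : ℂ) (h a ha b hb)
    | zero => simp
    | add y z _ _ hy hz => rw [mul_add]; exact add_mem hy hz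
    | smul c y _ hy => rw [mul_smul_comm]; exact Submodule.smul_mem _ c hy
  | zero => simp
  | add x z _ _ hx hz => rw [add_mul]; exact add_mem hx hz
  | smul c x _ hx => rw [smul_mul_assoc]; exact Submodule.smul_mem _ c hx

theorem baseChange_map_mem {A B : Type u} [AddCommGroup A] [Module ℚ A] [AddCommGroup B]
    [Module ℚ B] {S : Submodule ℚ A} {T : Submodule ℚ B} (f : A →ₗ[ℚ] B)
    (h : ∀ x ∈ S, f x ∈ T) (x : ℂ ⊗[ℚ] A) (hx : x ∈ S.baseChange ℂ) :
    f.baseChange ℂ x ∈ T.baseChange ℂ := by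
  rw [Submodule.baseChange_eq_span] at hx
  induction hx using Submodule.span_induction with
  | mem x hx =>
    obtain ⟨a, ha, rfl⟩ := hx
    exact Submodule.tmul_mem_baseChange_of_mem (1 : ℂ) (h a ha)
  | zero => simp
  | add x z _ _ hx hz => rw [map_add]; exact add_mem hx hz
  | smul c x _ hx => rw [map_smul]; exact Submodule.smul_mem _ c hx

/-- The filtered dga `A ⊗ ℂ`. -/
noncomputable def baseChange (A : FDGA.{u} ℚ) : FDGA.{u} ℂ where
  carrier := ℂ ⊗[ℚ] A.carrier
  gr n := (A.gr n).baseChange ℂ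
  graded := GradedAlgebra.baseChange A.gr
  comm {n m x y} hx hy := by
    rw [Submodule.baseChange_eq_span] at hx hy
    induction hx using Submodule.span_induction with
    | mem x hx =>
      obtain ⟨a, ha, rfl⟩ := hx
      induction hy using Submodule.span_induction with
      | mem y hy =>
        obtain ⟨b, hb, rfl⟩ := hy
        simp only [TensorProduct.mk_apply, Algebra.TensorProduct.tmul_mul_tmul, mul_one,
          A.comm ha hb]
        rcases neg_one_pow_eq_or ℚ (n * m) with h | h <;>
          rcases neg_one_pow_eq_or ℂ (n * m) with h' | h'
        · simp [h, h']
        · exfalso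
          have := congrArg (algebraMap ℚ ℂ) h
          rw [map_pow, map_neg, map_one, h'] at this
          norm_num at this
        · exfalso
          have := congrArg (algebraMap ℚ ℂ) h
          rw [map_pow, map_neg, map_one, h'] at this
          norm_num at this
        · simp [h, h', TensorProduct.tmul_neg]
      | zero => simp
      | add y z _ _ hy hz => rw [mul_add, hy, hz, add_mul, smul_add]
      | smul c y _ hy => rw [mul_smul_comm, hy, smul_mul_assoc, smul_comm]
    | zero => simp
    | add x z _ _ hx hz => rw [add_mul, hx, hz, mul_add, smul_add]
    | smul c x _ hx => rw [mul_smul_comm, smul_mul_assoc, hx, smul_comm]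
  d := A.d.baseChange ℂ
  d_gr n := baseChange_map_mem A.d (A.d_gr n)
  d_d x := by
    induction x using TensorProduct.induction_on with
    | zero => simp
    | tmul z a => simp [A.d_d]
    | add x y hx hy => simp [hx, hy]
  leibniz n x y hx := by
    rw [Submodule.baseChange_eq_span] at hx
    induction hx using Submodule.span_induction with
    | mem x hx =>
      obtain ⟨a, ha, rfl⟩ := hx
      induction y using TensorProduct.induction_on with
      | zero => simp
      | tmul z b =>
        simp only [TensorProduct.mk_apply, Algebra.TensorProduct.tmul_mul_tmul, one_mul,
          LinearMap.baseChange_tmul, A.leibniz n a b ha, TensorProduct.tmul_add,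
          TensorProduct.tmul_smul]
        congr 1
        rw [TensorProduct.smul_tmul', TensorProduct.smul_tmul']
        congr 1
        simp [Algebra.smul_def]
      | add y z hy hz => rw [mul_add, map_add, hy, hz, map_add, mul_add, mul_add, smul_add]; abel
    | zero => simp
    | add x z _ _ hx hz =>
      rw [add_mul, map_add, hx, hz, map_add, add_mul, add_mul, smul_add]; abel
    | smul c x _ hx =>
      rw [smul_mul_assoc, map_smul, hx, map_smul, smul_mul_assoc, smul_mul_assoc, smul_add,
        smul_comm c]
  W p n := (A.W p n).baseChange ℂ
  W_le p n := Submodule.baseChange_mono ℂ (A.W_le p n)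
  W_mono n p q h := Submodule.baseChange_mono ℂ (A.W_mono n h)
  W_exhaustive n x hx := by
    rw [Submodule.baseChange_eq_span] at hx
    induction hx using Submodule.span_induction with
    | mem x hx =>
      obtain ⟨a, ha, rfl⟩ := hx
      obtain ⟨p, hp⟩ := A.W_exhaustive n a ha
      exact ⟨p, Submodule.tmul_mem_baseChange_of_mem (1 : ℂ) hp⟩
    | zero => exact ⟨0, zero_mem _⟩
    | add x z _ _ hx hz =>
      obtain ⟨p, hp⟩ := hx
      obtain ⟨q, hq⟩ := hz
      exact ⟨max p q, add_mem
        (Submodule.baseChange_mono ℂ (A.W_mono n (le_max_left p q)) hp)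
        (Submodule.baseChange_mono ℂ (A.W_mono n (le_max_right p q)) hq)⟩
    | smul c x _ hx =>
      obtain ⟨p, hp⟩ := hx
      exact ⟨p, Submodule.smul_mem _ c hp⟩
  one_W := Submodule.tmul_mem_baseChange_of_mem (1 : ℂ) A.one_W
  mul_W p q n m := baseChange_mul_mem fun x hx y hy => A.mul_W p q n m x y hx hy
  d_W p n := baseChange_map_mem A.d (A.d_W p n)

/-- The canonical map `A → A ⊗ ℂ`. -/
noncomputable def toBC (A : FDGA.{u} ℚ) : A.carrier →ₗ[ℚ] ℂ ⊗[ℚ] A.carrier :=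
  (TensorProduct.mk ℚ ℂ A.carrier 1)

theorem toBC_mem_Z (A : FDGA.{u} ℚ) (r p : ℤ) (n : ℕ) (x : A.carrier) (hx : x ∈ A.Z r p n) :
    A.toBC x ∈ A.baseChange.Z r p n :=
  ⟨Submodule.tmul_mem_baseChange_of_mem (1 : ℂ) hx.1,
    Submodule.tmul_mem_baseChange_of_mem (1 : ℂ) hx.2⟩

end FDGA

/-- The morphism `f ⊗ ℂ`. -/
noncomputable def FDGAHom.baseChange {A B : FDGA.{u} ℚ} (f : FDGAHom A B) :
    FDGAHom A.baseChange B.baseChange where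
  toFun := Algebra.TensorProduct.map (AlgHom.id ℂ ℂ) f.toFun
  map_gr n := FDGA.baseChange_map_mem f.toFun.toLinearMap (f.map_gr n)
  map_d x := by
    change Algebra.TensorProduct.map (AlgHom.id ℂ ℂ) f.toFun (A.d.baseChange ℂ x) =
      B.d.baseChange ℂ (Algebra.TensorProduct.map (AlgHom.id ℂ ℂ) f.toFun x)
    induction x using TensorProduct.induction_on with
    | zero => simp
    | tmul z a => simp [f.map_d]
    | add x y hx hy => simp only [map_add, hx, hy]
  map_W p n := FDGA.baseChange_map_mem f.toFun.toLinearMap (f.map_W p n)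

/-! ## The path object `P_r(A) = A ⊗ Λ(t, dt)` and homotopies -/

/-- Polynomials in `t` with all coefficients in `S`. -/
def polySub {k A : Type*} [Field k] [Ring A] [Algebra k A] (S : Submodule k A) :
    Submodule k A[X] where
  carrier := {p | ∀ i, p.coeff i ∈ S}
  add_mem' hp hq i := by rw [Polynomial.coeff_add]; exact add_mem (hp i) (hq i)
  zero_mem' i := by simp
  smul_mem' c p hp i := by rw [Polynomial.coeff_smul]; exact S.smul_mem c (hp i)

theorem polySub_mul {k A : Type*} [Field k] [Ring A] [Algebra k A] {S T U : Submodule k A}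
    (h : ∀ x ∈ S, ∀ y ∈ T, x * y ∈ U) (p q : A[X]) (hp : p ∈ polySub S) (hq : q ∈ polySub T) :
    p * q ∈ polySub U := by
  intro i
  rw [Polynomial.coeff_mul]
  exact sum_mem fun x _ => h _ (hp x.1) _ (hq x.2)

theorem polySub_mono {k A : Type*} [Field k] [Ring A] [Algebra k A] {S T : Submodule k A}
    (h : S ≤ T) : polySub S ≤ polySub T := fun _ hp i => h (hp i)

theorem polySub_bot {k A : Type*} [Field k] [Ring A] [Algebra k A] {p : A[X]}
    (h : p ∈ polySub (⊥ : Submodule k A)) : p = 0 := Polynomial.ext fun i => by simpa using h i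

theorem polySub_comm {k A : Type*} [Field k] [Ring A] [Algebra k A] {S T : Submodule k A} {c : k}
    (h : ∀ x ∈ S, ∀ y ∈ T, x * y = c • (y * x)) (p q : A[X]) (hp : p ∈ polySub S)
    (hq : q ∈ polySub T) : p * q = c • (q * p) := by
  ext i
  rw [Polynomial.coeff_smul, Polynomial.coeff_mul, Polynomial.coeff_mul,
    ← Finset.Nat.sum_antidiagonal_swap, Finset.smul_sum]
  exact Finset.sum_congr rfl fun x _ => h _ (hp _) _ (hq _)

theorem polySub_derivative {k A : Type*} [Field k] [Ring A] [Algebra k A] {S : Submodule k A}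
    (p : A[X]) (hp : p ∈ polySub S) : Polynomial.derivative p ∈ polySub S := by
  intro i
  rw [Polynomial.coeff_derivative, ← Nat.cast_succ, ← nsmul_eq_mul']
  exact S.smul_of_tower_mem _ (hp _)

/-- A linear map applied to the coefficients of a polynomial. -/
noncomputable def polyMap {k A B : Type*} [Field k] [Ring A] [Algebra k A] [Ring B] [Algebra k B]
    (f : A →ₗ[k] B) : A[X] →ₗ[k] B[X] :=
  Polynomial.lsum fun i => (Polynomial.monomial (R := B) i).restrictScalars k ∘ₗ f

theorem coeff_polyMap {k A B : Type*} [Field k] [Ring A] [Algebra k A] [Ring B] [Algebra k B]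
    (f : A →ₗ[k] B) (p : A[X]) (i : ℕ) : (polyMap f p).coeff i = f (p.coeff i) := by
  change (p.sum fun j a => Polynomial.monomial j (f a)).coeff i = _
  rw [Polynomial.sum, Polynomial.finsetSum_coeff]
  simp only [Polynomial.coeff_monomial]
  rw [Finset.sum_ite_eq']
  split_ifs with h
  · rfl
  · rw [Polynomial.notMem_support_iff.1 h, map_zero]

namespace GCAlg

variable {k : Type} [Field k] (A : GCAlg.{u} k)

/-- The grading involution, `a ↦ (-1)^n a` for `a` of degree `n`, as a linear map. -/
noncomputable def signLin : A.carrier →ₗ[k] A.carrier :=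
  (DirectSum.toModule k ℕ A.carrier fun n => (-1 : k) ^ n • (A.gr n).subtype) ∘ₗ
    (DirectSum.decomposeLinearEquiv A.gr).toLinearMap

theorem signLin_of_mem {n : ℕ} {x : A.carrier} (hx : x ∈ A.gr n) :
    A.signLin x = (-1 : k) ^ n • x := by
  lift x to A.gr n using hx
  simp [signLin]

theorem hom_induction {P : A.carrier → Prop} (h : ∀ (n : ℕ) (x : A.carrier), x ∈ A.gr n → P x)
    (ha : ∀ x y, P x → P y → P (x + y)) (x : A.carrier) : P x :=
  DirectSum.Decomposition.inductionOn A.gr (h 0 0 (zero_mem _)) (fun m => h _ _ m.2) ha x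

/-- The grading involution, `a ↦ (-1)^n a` for `a` of degree `n`. -/
noncomputable def sign : A.carrier →ₐ[k] A.carrier :=
  AlgHom.ofLinearMap A.signLin
    (by rw [A.signLin_of_mem (SetLike.GradedOne.one_mem : (1 : A.carrier) ∈ A.gr 0)]; simp)
    (by
      intro x y
      induction x using A.hom_induction with
      | h n x hx =>
        induction y using A.hom_induction with
        | h m y hy =>
          rw [A.signLin_of_mem hx, A.signLin_of_mem hy,
            A.signLin_of_mem (SetLike.GradedMul.mul_mem hx hy), pow_add, smul_mul_smul_comm]
        | ha y z hy hz => rw [mul_add, map_add, hy, hz, map_add, mul_add]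
      | ha x z hx hz => rw [add_mul, map_add, hx, hz, map_add, add_mul])

theorem sign_of_mem {n : ℕ} {x : A.carrier} (hx : x ∈ A.gr n) :
    A.sign x = (-1 : k) ^ n • x := A.signLin_of_mem hx

theorem sign_sign (x : A.carrier) : A.sign (A.sign x) = x := by
  induction x using A.hom_induction with
  | h n x hx => rw [A.sign_of_mem hx, map_smul, A.sign_of_mem hx, smul_smul, ← mul_pow]; simp
  | ha x y hx hy => rw [map_add, map_add, hx, hy]

/-- The grading involution on the coefficients of polynomials in `t`. -/
noncomputable def psign : A.carrier[X] →ₐ[k] A.carrier[X] := Polynomial.mapAlgHom A.sign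

theorem coeff_psign (p : A.carrier[X]) (i : ℕ) : (A.psign p).coeff i = A.sign (p.coeff i) := by
  simp [psign]

theorem psign_of_mem {n : ℕ} {p : A.carrier[X]} (hp : p ∈ polySub (A.gr n)) :
    A.psign p = (-1 : k) ^ n • p := by
  ext i
  rw [coeff_psign, Polynomial.coeff_smul, A.sign_of_mem (hp i)]

/-- The underlying space of `A ⊗ Λ(t, dt) = A[t] ⊕ A[t] dt`; the pair `(p, q)` stands for
`p + q dt`. -/
def PathCarrier : Type u := A.carrier[X] × A.carrier[X]

namespace PathCarrier

variable {A}

noncomputable instance : AddCommGroup A.PathCarrier :=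
  inferInstanceAs (AddCommGroup (A.carrier[X] × A.carrier[X]))

noncomputable instance : Module k A.PathCarrier :=
  inferInstanceAs (Module k (A.carrier[X] × A.carrier[X]))

@[ext] theorem ext' {x y : A.PathCarrier} (h : x.1 = y.1) (h' : x.2 = y.2) : x = y :=
  Prod.ext h h'

/-- As `dt a = (-1)^n a dt` for `a` of degree `n` and `dt dt = 0`, one has
`(p + q dt)(p' + q' dt) = p p' + (p q' + q τ(p')) dt` with the grading involution `τ`. -/
noncomputable instance : Mul A.PathCarrier :=
  ⟨fun x y => (x.1 * y.1, x.1 * y.2 + x.2 * A.psign y.1)⟩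

noncomputable instance : One A.PathCarrier := ⟨((1 : A.carrier[X]), (0 : A.carrier[X]))⟩

@[simp] theorem fst_mul (x y : A.PathCarrier) : (x * y).1 = x.1 * y.1 := rfl
@[simp] theorem snd_mul (x y : A.PathCarrier) : (x * y).2 = x.1 * y.2 + x.2 * A.psign y.1 := rfl
@[simp] theorem fst_one : (1 : A.PathCarrier).1 = 1 := rfl
@[simp] theorem snd_one : (1 : A.PathCarrier).2 = 0 := rfl
@[simp] theorem fst_add (x y : A.PathCarrier) : (x + y).1 = x.1 + y.1 := rfl
@[simp] theorem snd_add (x y : A.PathCarrier) : (x + y).2 = x.2 + y.2 := rfl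
@[simp] theorem fst_zero : (0 : A.PathCarrier).1 = 0 := rfl
@[simp] theorem snd_zero : (0 : A.PathCarrier).2 = 0 := rfl
@[simp] theorem fst_smul (c : k) (x : A.PathCarrier) : (c • x).1 = c • x.1 := rfl
@[simp] theorem snd_smul (c : k) (x : A.PathCarrier) : (c • x).2 = c • x.2 := rfl

noncomputable instance : Ring A.PathCarrier :=
  { (inferInstance : AddCommGroup A.PathCarrier), (inferInstance : Mul A.PathCarrier),
    (inferInstance : One A.PathCarrier) with
    left_distrib := fun x y z => by ext1 <;> simp [mul_add]; abel
    right_distrib := fun x y z => by ext1 <;> simp [add_mul]; abel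
    zero_mul := fun x => by ext1 <;> simp
    mul_zero := fun x => by ext1 <;> simp
    mul_assoc := fun x y z => by ext1 <;> simp [mul_add, add_mul, mul_assoc, add_assoc]
    one_mul := fun x => by ext1 <;> simp
    mul_one := fun x => by ext1 <;> simp }

noncomputable instance : Algebra k A.PathCarrier :=
  Algebra.ofModule (fun c x y => by ext1 <;> simp [smul_add])
    (fun c x y => by ext1 <;> simp [smul_add])

end PathCarrier

/-- For a family `S` of subspaces of `A` and a family `T`, the elements `p + q dt` with
coefficients of `p` in `S n` and coefficients of `q` in `T (n - 1)`. -/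
noncomputable def pathSub (S T : ℕ → Submodule k A.carrier) (n : ℕ) : Submodule k A.PathCarrier :=
  (polySub (S n)).prod (polySub (shiftDeg T n))

theorem mul_mem_pathSub {S S' S'' T T' T'' : ℕ → Submodule k A.carrier} {n m : ℕ}
    (h1 : ∀ x ∈ S n, ∀ y ∈ S' m, x * y ∈ S'' (n + m))
    (h2 : ∀ m', m' + 1 = m → ∀ x ∈ S n, ∀ y ∈ T' m', x * y ∈ T'' (n + m'))
    (h3 : ∀ n', n' + 1 = n → ∀ x ∈ T n', ∀ y ∈ S' m, x * y ∈ T'' (n' + m))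
    (hS : S' m ≤ A.gr m)
    {x y : A.PathCarrier} (hx : x ∈ A.pathSub S T n) (hy : y ∈ A.pathSub S' T' m) :
    x * y ∈ A.pathSub S'' T'' (n + m) := by
  refine ⟨polySub_mul h1 _ _ hx.1 hy.1, ?_⟩
  change x.1 * y.2 + x.2 * A.psign y.1 ∈ _
  refine add_mem ?_ ?_
  · cases m with
    | zero => rw [polySub_bot hy.2, mul_zero]; exact zero_mem _
    | succ m => exact polySub_mul (h2 m rfl) _ _ hx.1 hy.2
  · cases n with
    | zero => rw [polySub_bot hx.2, zero_mul]; exact zero_mem _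
    | succ n =>
      rw [A.psign_of_mem (polySub_mono hS hy.1), mul_smul_comm]
      refine Submodule.smul_mem _ _ ?_
      have := polySub_mul (h3 n rfl) _ _ hx.2 hy.1
      rwa [Nat.succ_add]

/-- The element `a t^i`. -/
noncomputable def tMon (i : ℕ) : A.carrier →ₗ[k] A.PathCarrier :=
  LinearMap.inl k A.carrier[X] A.carrier[X] ∘ₗ
    (Polynomial.monomial (R := A.carrier) i).restrictScalars k

/-- The element `a t^i dt`. -/
noncomputable def dtMon (i : ℕ) : A.carrier →ₗ[k] A.PathCarrier :=
  LinearMap.inr k A.carrier[X] A.carrier[X] ∘ₗ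
    (Polynomial.monomial (R := A.carrier) i).restrictScalars k

theorem tMon_mem {S T : ℕ → Submodule k A.carrier} (i n : ℕ) (x : A.carrier) (hx : x ∈ S n) :
    A.tMon i x ∈ A.pathSub S T n := by
  refine ⟨fun j => ?_, zero_mem _⟩
  change (Polynomial.monomial i x).coeff j ∈ S n
  rw [Polynomial.coeff_monomial]
  split_ifs
  exacts [hx, zero_mem _]

theorem dtMon_mem {S T : ℕ → Submodule k A.carrier} (i n : ℕ) (x : A.carrier) (hx : x ∈ T n) :
    A.dtMon i x ∈ A.pathSub S T (n + 1) := by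
  refine ⟨zero_mem _, fun j => ?_⟩
  change (Polynomial.monomial i x).coeff j ∈ T n
  rw [Polynomial.coeff_monomial]
  split_ifs
  exacts [hx, zero_mem _]

theorem path_eq_sum (x : A.PathCarrier) :
    x = x.1.sum (fun i a => A.tMon i a) + x.2.sum (fun i a => A.dtMon i a) := by
  have h : ∀ p : A.carrier[X], p.sum (fun i a => A.tMon i a) =
      LinearMap.inl k A.carrier[X] A.carrier[X] p := fun p => by
    conv_rhs => rw [← Polynomial.sum_monomial_eq p, Polynomial.sum, map_sum]
    rfl
  have h' : ∀ p : A.carrier[X], p.sum (fun i a => A.dtMon i a) =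
      LinearMap.inr k A.carrier[X] A.carrier[X] p := fun p => by
    conv_rhs => rw [← Polynomial.sum_monomial_eq p, Polynomial.sum, map_sum]
    rfl
  rw [h, h']
  exact Prod.ext (add_zero _).symm (zero_add _).symm

/-- The grading by total degree. -/
noncomputable abbrev pathGr : ℕ → Submodule k A.PathCarrier := A.pathSub A.gr A.gr

/-- Decomposition of `a t^i` into homogeneous components. -/
noncomputable def tDec (i : ℕ) : A.carrier →ₗ[k] DirectSum ℕ fun n => A.pathGr n :=
  (DirectSum.toModule k ℕ _ fun n => DirectSum.lof k ℕ (fun n => A.pathGr n) n ∘ₗ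
    (A.tMon i).restrict (A.tMon_mem i n)) ∘ₗ (DirectSum.decomposeLinearEquiv A.gr).toLinearMap

/-- Decomposition of `a t^i dt` into homogeneous components. -/
noncomputable def dtDec (i : ℕ) : A.carrier →ₗ[k] DirectSum ℕ fun n => A.pathGr n :=
  (DirectSum.toModule k ℕ _ fun n => DirectSum.lof k ℕ (fun n => A.pathGr n) (n + 1) ∘ₗ
    (A.dtMon i).restrict (A.dtMon_mem i n)) ∘ₗ (DirectSum.decomposeLinearEquiv A.gr).toLinearMap

theorem tDec_of_mem (i n : ℕ) (x : A.carrier) (hx : x ∈ A.gr n) :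
    A.tDec i x = DirectSum.lof k ℕ (fun n => A.pathGr n) n ⟨A.tMon i x, A.tMon_mem i n x hx⟩ := by
  lift x to A.gr n using hx
  simp only [tDec, LinearMap.comp_apply, LinearEquiv.coe_coe,
    DirectSum.decomposeLinearEquiv_apply, DirectSum.decompose_coe]
  erw [DirectSum.toModule_lof]
  rfl

theorem dtDec_of_mem (i n : ℕ) (x : A.carrier) (hx : x ∈ A.gr n) :
    A.dtDec i x =
      DirectSum.lof k ℕ (fun n => A.pathGr n) (n + 1) ⟨A.dtMon i x, A.dtMon_mem i n x hx⟩ := by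
  lift x to A.gr n using hx
  simp only [dtDec, LinearMap.comp_apply, LinearEquiv.coe_coe,
    DirectSum.decomposeLinearEquiv_apply, DirectSum.decompose_coe]
  erw [DirectSum.toModule_lof]
  rfl

/-- Decomposition into homogeneous components. -/
noncomputable def pathDec : A.PathCarrier →ₗ[k] DirectSum ℕ fun n => A.pathGr n :=
  LinearMap.coprod (Polynomial.lsum A.tDec) (Polynomial.lsum A.dtDec)

theorem pathDec_apply (x : A.PathCarrier) :
    A.pathDec x = x.1.sum (fun i a => A.tDec i a) + x.2.sum (fun i a => A.dtDec i a) := rfl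

theorem coe_pathDec (x : A.PathCarrier) : DirectSum.coeLinearMap A.pathGr (A.pathDec x) = x := by
  have h : ∀ i a, DirectSum.coeLinearMap A.pathGr (A.tDec i a) = A.tMon i a := fun i a => by
    induction a using A.hom_induction with
    | h n a ha => rw [A.tDec_of_mem i n a ha, DirectSum.coeLinearMap_lof]
    | ha a b ha hb => rw [map_add, map_add, map_add, ha, hb]
  have h' : ∀ i a, DirectSum.coeLinearMap A.pathGr (A.dtDec i a) = A.dtMon i a := fun i a => by
    induction a using A.hom_induction with
    | h n a ha => rw [A.dtDec_of_mem i n a ha, DirectSum.coeLinearMap_lof]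
    | ha a b ha hb => rw [map_add, map_add, map_add, ha, hb]
  rw [pathDec_apply, map_add, Polynomial.sum, Polynomial.sum, map_sum, map_sum]
  simp only [h, h']
  exact (A.path_eq_sum x).symm

theorem pathDec_coe (n : ℕ) (x : A.PathCarrier) (hx : x ∈ A.pathGr n) :
    A.pathDec x = DirectSum.lof k ℕ (fun n => A.pathGr n) n ⟨x, hx⟩ := by
  have hr : A.pathDec x ∈ LinearMap.range (DirectSum.lof k ℕ (fun n => A.pathGr n) n) := by
    rw [pathDec_apply]
    refine add_mem (Submodule.sum_mem _ fun i _ => ?_) (Submodule.sum_mem _ fun i _ => ?_)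
    · change A.tDec i (x.1.coeff i) ∈ _
      rw [A.tDec_of_mem i n _ (hx.1 i)]
      exact ⟨_, rfl⟩
    · cases n with
      | zero =>
        have h0 : x.2 = 0 := polySub_bot hx.2
        rw [h0]
        simp
      | succ n =>
        change A.dtDec i (x.2.coeff i) ∈ _
        rw [A.dtDec_of_mem i n _ (hx.2 i)]
        exact ⟨_, rfl⟩
  obtain ⟨y, hy⟩ := hr
  have := A.coe_pathDec x
  rw [← hy, DirectSum.coeLinearMap_lof] at this
  subst this
  exact hy.symm

noncomputable instance : GradedAlgebra A.pathGr where
  one_mem := by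
    refine ⟨fun i => ?_, zero_mem _⟩
    change (1 : A.carrier[X]).coeff i ∈ A.gr 0
    rw [Polynomial.coeff_one]
    split_ifs
    exacts [SetLike.GradedOne.one_mem, zero_mem _]
  mul_mem n m x y hx hy := A.mul_mem_pathSub
    (fun _ hx _ hy => SetLike.GradedMul.mul_mem hx hy)
    (fun _ _ _ hx _ hy => SetLike.GradedMul.mul_mem hx hy)
    (fun _ _ _ hx _ hy => SetLike.GradedMul.mul_mem hx hy) le_rfl hx hy
  toDecomposition := DirectSum.Decomposition.ofLinearMap A.pathGr A.pathDec
    (LinearMap.ext A.coe_pathDec)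
    (by
      refine DirectSum.linearMap_ext _ fun n => LinearMap.ext fun x => ?_
      simp only [LinearMap.comp_apply, DirectSum.coeLinearMap_lof, LinearMap.id_apply]
      exact A.pathDec_coe n x x.2)

/-- The graded commutative algebra `A ⊗ Λ(t, dt)`. -/
noncomputable def path : GCAlg.{u} k where
  carrier := A.PathCarrier
  gr := A.pathGr
  comm {n m x y} hx hy := by
    ext1
    · exact polySub_comm (fun _ ha _ hb => A.comm ha hb) _ _ hx.1 hy.1
    · change x.1 * y.2 + x.2 * A.psign y.1 =
        (-1 : k) ^ (n * m) • (y.1 * x.2 + y.2 * A.psign x.1)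
      rw [A.psign_of_mem hx.1, A.psign_of_mem hy.1, smul_add, add_comm, mul_smul_comm,
        mul_smul_comm, smul_smul]
      congr 1
      · cases n with
        | zero => rw [polySub_bot hx.2]; simp
        | succ n =>
          rw [polySub_comm (c := (-1 : k) ^ (n * m)) (fun _ ha _ hb => A.comm ha hb) _ _
            hx.2 hy.1, smul_smul]
          congr 1
          ring
      · cases m with
        | zero => rw [polySub_bot hy.2]; simp
        | succ m =>
          rw [polySub_comm (c := (-1 : k) ^ (n * m)) (fun _ ha _ hb => A.comm ha hb) _ _
            hx.1 hy.2]
          congr 1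
          have h : (-1 : k) ^ n * (-1) ^ n = 1 := by rw [← mul_pow]; simp
          rw [mul_add, pow_add, mul_one, mul_assoc, h, mul_one]

end GCAlg

namespace FDGA

variable {k : Type} [Field k] (A : FDGA.{u} k)

theorem d_sign (x : A.carrier) : A.d (A.sign x) = -A.sign (A.d x) := by
  induction x using A.hom_induction with
  | h n x hx =>
    rw [A.sign_of_mem hx, map_smul, A.sign_of_mem (A.d_gr n x hx), pow_succ]
    simp
  | ha x y hx hy => rw [map_add, map_add, hx, hy, map_add, map_add, neg_add]

theorem d_mul (x y : A.carrier) : A.d (x * y) = A.d x * y + A.sign x * A.d y := by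
  induction x using A.hom_induction with
  | h n x hx => rw [A.leibniz n x y hx, A.sign_of_mem hx, smul_mul_assoc]
  | ha x z hx hz => rw [add_mul, map_add, hx, hz, map_add, map_add, add_mul, add_mul]; abel

/-- The differential of `A` applied to the coefficients of polynomials in `t`. -/
noncomputable def pd : A.carrier[X] →ₗ[k] A.carrier[X] := polyMap A.d

theorem pd_psign (p : A.carrier[X]) : A.pd (A.psign p) = -A.psign (A.pd p) := by
  ext i
  rw [Polynomial.coeff_neg, A.coeff_psign, pd, coeff_polyMap, coeff_polyMap, A.coeff_psign,
    A.d_sign]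

theorem pd_mul (p q : A.carrier[X]) :
    A.pd (p * q) = A.pd p * q + A.psign p * A.pd q := by
  ext i
  simp only [pd, coeff_polyMap, Polynomial.coeff_mul, Polynomial.coeff_add, A.coeff_psign,
    map_sum, A.d_mul, Finset.sum_add_distrib]

theorem pd_pd (p : A.carrier[X]) : A.pd (A.pd p) = 0 := by
  ext i
  simp only [pd, coeff_polyMap, A.d_d, Polynomial.coeff_zero]

theorem pd_derivative (p : A.carrier[X]) :
    A.pd (Polynomial.derivative p) = Polynomial.derivative (A.pd p) := by
  ext i
  rw [Polynomial.coeff_derivative, pd, coeff_polyMap, coeff_polyMap, Polynomial.coeff_derivative,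
    ← Nat.cast_succ, ← nsmul_eq_mul', ← nsmul_eq_mul', map_nsmul]

theorem psign_derivative (p : A.carrier[X]) :
    A.psign (Polynomial.derivative p) = Polynomial.derivative (A.psign p) := by
  ext i
  rw [Polynomial.coeff_derivative, A.coeff_psign, Polynomial.coeff_derivative, A.coeff_psign,
    ← Nat.cast_succ, ← nsmul_eq_mul', ← nsmul_eq_mul', map_nsmul]

theorem pd_mem {S T : Submodule k A.carrier} (h : ∀ x ∈ S, A.d x ∈ T) (p : A.carrier[X])
    (hp : p ∈ polySub S) : A.pd p ∈ polySub T := fun i => by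
  rw [pd, coeff_polyMap]
  exact h _ (hp i)

/-- The differential of `A ⊗ Λ(t, dt)`: `d (a t^i) = (d a) t^i + (-1)^n i a t^(i-1) dt` for `a` of
degree `n`, and `d (a t^i dt) = (d a) t^i dt`. -/
noncomputable def pathD : A.PathCarrier →ₗ[k] A.PathCarrier :=
  LinearMap.prod (A.pd ∘ₗ LinearMap.fst k A.carrier[X] A.carrier[X])
    (A.pd ∘ₗ LinearMap.snd k A.carrier[X] A.carrier[X] +
      A.psign.toLinearMap ∘ₗ (Polynomial.derivative (R := A.carrier)).restrictScalars k ∘ₗ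
        LinearMap.fst k A.carrier[X] A.carrier[X])

@[simp] theorem fst_pathD (x : A.PathCarrier) : (A.pathD x).1 = A.pd x.1 := rfl
@[simp] theorem snd_pathD (x : A.PathCarrier) :
    (A.pathD x).2 = A.pd x.2 + A.psign (Polynomial.derivative x.1) := rfl

theorem pathD_mem {S S' T T' : ℕ → Submodule k A.carrier} {n : ℕ}
    (h1 : ∀ x ∈ S n, A.d x ∈ S' (n + 1)) (h2 : ∀ m, m + 1 = n → ∀ x ∈ T m, A.d x ∈ T' (m + 1))
    (hS : S n ≤ A.gr n) (hST : S n ≤ T' n) (x : A.PathCarrier) (hx : x ∈ A.pathSub S T n) :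
    A.pathD x ∈ A.pathSub S' T' (n + 1) := by
  refine ⟨A.pd_mem h1 _ hx.1, ?_⟩
  change A.pd x.2 + A.psign (Polynomial.derivative x.1) ∈ polySub (T' n)
  refine add_mem ?_ ?_
  · cases n with
    | zero => rw [polySub_bot hx.2, map_zero]; exact zero_mem _
    | succ n => exact A.pd_mem (h2 n rfl) _ hx.2
  · rw [A.psign_of_mem (polySub_mono hS (polySub_derivative _ hx.1))]
    exact Submodule.smul_mem _ _ (polySub_mono hST (polySub_derivative _ hx.1))

theorem exists_W_polySub (n : ℕ) (p : A.carrier[X]) (hp : p ∈ polySub (A.gr n)) :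
    ∃ w, p ∈ polySub (A.W w n) := by
  have key : ∀ s : Finset ℕ, ∃ w, ∀ i ∈ s, p.coeff i ∈ A.W w n := by
    intro s
    induction s using Finset.induction_on with
    | empty => exact ⟨0, by simp⟩
    | insert i s _ ih =>
      obtain ⟨w, hw⟩ := ih
      obtain ⟨v, hv⟩ := A.W_exhaustive n _ (hp i)
      refine ⟨max v w, fun j hj => ?_⟩
      rcases Finset.mem_insert.1 hj with rfl | hj
      · exact A.W_mono n (le_max_left v w) hv
      · exact A.W_mono n (le_max_right v w) (hw j hj)
  obtain ⟨w, hw⟩ := key p.support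
  refine ⟨w, fun i => ?_⟩
  by_cases hi : i ∈ p.support
  · exact hw i hi
  · rw [Polynomial.notMem_support_iff.1 hi]
    exact zero_mem _

/-- The `r`-path `P_r(A) = A ⊗ Λ(t, dt)` with
`W_p P_r(A) = (W_p A ⊗ Λ(t)) ⊕ (W_{p+r} A ⊗ Λ(t) dt)`. -/
noncomputable def path (r : ℕ) (A : FDGA.{u} k) : FDGA.{u} k where
  toGCAlg := A.toGCAlg.path
  d := A.pathD
  d_gr n := A.pathD_mem (A.d_gr n) (fun m _ => A.d_gr m) le_rfl le_rfl
  d_d x := by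
    refine GCAlg.PathCarrier.ext' ?_ ?_
    · exact A.pd_pd _
    · change A.pd (A.pd x.2 + A.psign (Polynomial.derivative x.1)) +
        A.psign (Polynomial.derivative (A.pd x.1)) = 0
      rw [map_add, A.pd_pd, A.pd_psign, A.pd_derivative]
      simp
  leibniz n x y hx := by
    have hs : (-1 : k) ^ n • x.1 = A.psign x.1 := (A.psign_of_mem hx.1).symm
    have hs' : (-1 : k) ^ n • x.2 = -A.psign x.2 := by
      cases n with
      | zero =>
        have h0 : x.2 = 0 := polySub_bot hx.2
        simp [h0]
      | succ n =>
        have h0 : x.2 ∈ polySub (A.gr n) := hx.2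
        rw [A.psign_of_mem h0, pow_succ]
        simp
    refine GCAlg.PathCarrier.ext' ?_ ?_
    · change A.pd (x.1 * y.1) = A.pd x.1 * y.1 + (-1 : k) ^ n • (x.1 * A.pd y.1)
      rw [A.pd_mul, ← smul_mul_assoc, hs]
    · change A.pd (x.1 * y.2 + x.2 * A.psign y.1) +
          A.psign (Polynomial.derivative (x.1 * y.1)) =
        (A.pd x.1 * y.2 + (A.pd x.2 + A.psign (Polynomial.derivative x.1)) * A.psign y.1) +
        (-1 : k) ^ n • (x.1 * (A.pd y.2 + A.psign (Polynomial.derivative y.1)) +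
          x.2 * A.psign (A.pd y.1))
      rw [smul_add, ← smul_mul_assoc, ← smul_mul_assoc, hs, hs', map_add, A.pd_mul, A.pd_mul,
        A.pd_psign, Polynomial.derivative_mul, map_add, map_mul, map_mul]
      simp only [mul_add, add_mul, mul_neg, neg_mul]
      abel
  W p := A.pathSub (A.W p) (A.W (p + r))
  W_le p n := Submodule.prod_mono (polySub_mono (A.W_le p n))
    (by cases n with
      | zero => exact le_rfl
      | succ n => exact polySub_mono (A.W_le _ n))
  W_mono n p q h := Submodule.prod_mono (polySub_mono (A.W_mono n h))
    (by cases n with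
      | zero => exact le_rfl
      | succ n => exact polySub_mono (A.W_mono n (by simpa using h)))
  W_exhaustive n x hx := by
    obtain ⟨p, hp⟩ := A.exists_W_polySub n x.1 hx.1
    cases n with
    | zero => exact ⟨p, hp, hx.2⟩
    | succ n =>
      obtain ⟨q, hq⟩ := A.exists_W_polySub n x.2 hx.2
      exact ⟨max p q, polySub_mono (A.W_mono _ (le_max_left p q)) hp,
        polySub_mono (A.W_mono n (by omega)) hq⟩
  one_W := by
    refine ⟨fun i => ?_, zero_mem _⟩
    change (1 : A.carrier[X]).coeff i ∈ A.W 0 0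
    rw [Polynomial.coeff_one]
    split_ifs
    exacts [A.one_W, zero_mem _]
  mul_W p q n m x y hx hy := A.mul_mem_pathSub
    (fun _ hx _ hy => A.mul_W _ _ _ _ _ _ hx hy)
    (fun _ _ _ hx _ hy => by
      have := A.mul_W _ _ _ _ _ _ hx hy
      rwa [← add_assoc] at this)
    (fun _ _ _ hx _ hy => by
      have := A.mul_W _ _ _ _ _ _ hx hy
      rwa [add_right_comm] at this) (A.W_le q m) hx hy
  d_W p n := A.pathD_mem (A.d_W p n) (fun m _ => A.d_W _ m) (A.W_le p n)
    (A.W_mono n (by simp))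

/-- Evaluation of forms `δ^c : P_r(A) → A`, with `t ↦ c` and `dt ↦ 0`. -/
noncomputable def evalAt {r : ℕ} {A : FDGA.{u} k} (c : k) (x : (A.path r).carrier) : A.carrier :=
  Polynomial.eval (algebraMap k A.carrier c) (show A.PathCarrier from x).1

end FDGA

/-- An `r`-homotopy from `f` to `g`: a morphism of filtered dga's `h : A → P_r(B)` with
`δ^0 h = f` and `δ^1 h = g`. -/
structure RHomotopy {k : Type} [Field k] (r : ℕ) {A B : FDGA.{u} k} (f g : FDGAHom A B) where
  h : FDGAHom A (B.path r)
  h_zero : ∀ x, FDGA.evalAt 0 (h.toFun x) = f.toFun x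
  h_one : ∀ x, FDGA.evalAt 1 (h.toFun x) = g.toFun x

/-! ## Hodge structures -/

/-- Complex conjugation on `ℂ ⊗ V`. -/
noncomputable def conjTensor (V : Type*) [AddCommGroup V] [Module ℚ V] :
    (ℂ ⊗[ℚ] V) →ₛₗ[starRingEnd ℂ] (ℂ ⊗[ℚ] V) where
  toFun := LinearMap.rTensor V (starRingEnd ℂ).toRatAlgHom.toLinearMap
  map_add' := map_add _
  map_smul' c x := by
    induction x using TensorProduct.induction_on with
    | zero => simp
    | tmul z v => simp [TensorProduct.smul_tmul']
    | add x y hx hy => simp only [smul_add, map_add, hx, hy]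

/-- The complex conjugate of a subspace of `ℂ ⊗ V`. -/
noncomputable def conjSub {V : Type*} [AddCommGroup V] [Module ℚ V]
    (S : Submodule ℂ (ℂ ⊗[ℚ] V)) : Submodule ℂ (ℂ ⊗[ℚ] V) :=
  S.comap (conjTensor V)

/-- `F` is the Hodge filtration of a pure Hodge structure of weight `w` on `V`: a finite decreasing
filtration of `V ⊗ ℂ` that is `w`-opposed to its complex conjugate. -/
structure IsPureHodge (V : Type*) [AddCommGroup V] [Module ℚ V]
    (F : ℤ → Submodule ℂ (ℂ ⊗[ℚ] V)) (w : ℤ) : Prop where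
  anti : Antitone F
  exists_top : ∃ a, F a = ⊤
  exists_bot : ∃ b, F b = ⊥
  isCompl : ∀ q, IsCompl (F q) (conjSub (F (w + 1 - q)))

/-- The graded piece `Gr_w^W V`. -/
abbrev GrW {V : Type*} [AddCommGroup V] [Module ℚ V] (W : ℤ → Submodule ℚ V) (w : ℤ) : Type _ :=
  ↥(W w) ⧸ (W (w - 1)).submoduleOf (W w)

/-- The filtration induced by `F` on `Gr_w^W V ⊗ ℂ`. -/
noncomputable def grF {V : Type*} [AddCommGroup V] [Module ℚ V] (W : ℤ → Submodule ℚ V)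
    (F : ℤ → Submodule ℂ (ℂ ⊗[ℚ] V)) (w q : ℤ) : Submodule ℂ (ℂ ⊗[ℚ] GrW W w) :=
  ((F q).comap ((W w).subtype.baseChange ℂ)).map
    (((W (w - 1)).submoduleOf (W w)).mkQ.baseChange ℂ)

/-- `(V, W, F)` is a finite-dimensional mixed Hodge structure over `ℚ`. -/
structure IsFiniteMHS (V : Type*) [AddCommGroup V] [Module ℚ V] (W : ℤ → Submodule ℚ V)
    (F : ℤ → Submodule ℂ (ℂ ⊗[ℚ] V)) : Prop where
  finite : Module.Finite ℚ V
  W_mono : Monotone W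
  W_bot : ∃ a, W a = ⊥
  W_top : ∃ b, W b = ⊤
  F_anti : Antitone F
  F_top : ∃ a, F a = ⊤
  F_bot : ∃ b, F b = ⊥
  pure : ∀ w, IsPureHodge (GrW W w) (grF W F w) w

/-- `(V, W, F)` is a mixed Hodge structure over `ℚ`, of possibly infinite dimension: `V` is the
directed union of the finite-dimensional subspaces on which `W` and `F` induce finite-dimensional
mixed Hodge structures. For finite-dimensional `V` this is the usual notion. -/
structure IsMHS (V : Type*) [AddCommGroup V] [Module ℚ V] (W : ℤ → Submodule ℚ V)
    (F : ℤ → Submodule ℂ (ℂ ⊗[ℚ] V)) : Prop where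
  W_mono : Monotone W
  F_anti : Antitone F
  exists_le : ∀ T : Submodule ℚ V, Module.Finite ℚ T → ∃ U : Submodule ℚ V, T ≤ U ∧
    IsFiniteMHS U (fun p => (W p).comap U.subtype)
      (fun q => (F q).comap (U.subtype.baseChange ℂ))

/-! ## Mixed Hodge diagrams -/

/-- A multiplicative decreasing filtration `F` by subcomplexes, with `1 ∈ F^0`, of a dga over `ℂ`;
`F q n` is the piece `F^q A^n`. -/
structure HodgeFil (A : FDGA.{u} ℂ) where
  F : ℤ → ℕ → Submodule ℂ A.carrier
  F_le : ∀ q n, F q n ≤ A.gr n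
  F_anti : ∀ n, Antitone fun q => F q n
  one_F : (1 : A.carrier) ∈ F 0 0
  mul_F : ∀ (p q : ℤ) (n m : ℕ) (x y : A.carrier), x ∈ F p n → y ∈ F q m →
    x * y ∈ F (p + q) (n + m)
  d_F : ∀ (q : ℤ) (n : ℕ) (x : A.carrier), x ∈ F q n → A.d x ∈ F q (n + 1)

/-- The filtration induced by `F` on `E_1^{-p,n+p}(A) = H^n(Gr_p^W A)`. -/
noncomputable def HodgeFil.onE1 {A : FDGA.{u} ℂ} (F : HodgeFil A) (p : ℤ) (n : ℕ) (q : ℤ) :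
    Submodule ℂ (A.E 1 p n) :=
  ((F.F q n).comap (A.Z 1 p n).subtype).map ((A.bd 1 p n).submoduleOf (A.Z 1 p n)).mkQ

/-- The vertices of the zig-zag `0 → 1 ← 2 → ⋯ ← s` with `s = 2 m + 2`: `left` is `0`, `right`
is `s`, `even i` is `2 i + 2` and `odd i` is `2 i + 1`. -/
inductive ZVertex (m : ℕ) : Type
  | left
  | even (i : Fin m)
  | odd (i : Fin (m + 1))
  | right

/-- The arrows of the zig-zag: `(i, false)` is `2 i → 2 i + 1` and `(i, true)` is
`2 i + 2 → 2 i + 1`. -/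
abbrev ZArrow (m : ℕ) : Type := Fin (m + 1) × Bool

/-- The vertex `2 i`. -/
def ZVertex.two {m : ℕ} : Fin (m + 2) → ZVertex m :=
  Fin.cons ZVertex.left (Fin.snoc ZVertex.even ZVertex.right)

def ZArrow.src {m : ℕ} : ZArrow m → ZVertex m
  | (i, false) => ZVertex.two i.castSucc
  | (i, true) => ZVertex.two i.succ

def ZArrow.tgt {m : ℕ} (u : ZArrow m) : ZVertex m := ZVertex.odd u.1

/-- The objects at the vertices: `A_0 = A_ℚ ⊗ ℂ` and `A_s = A_ℂ`. -/
noncomputable def nodeOf {m : ℕ} (Q : FDGA.{u} ℚ) (even : Fin m → FDGA.{u} ℂ)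
    (odd : Fin (m + 1) → FDGA.{u} ℂ) (C : FDGA.{u} ℂ) : ZVertex m → FDGA.{u} ℂ
  | .left => Q.baseChange
  | .even i => even i
  | .odd i => odd i
  | .right => C

/-- The data underlying a mixed Hodge diagram: a filtered dga `(A_ℚ, W)`, a bifiltered dga
`(A_ℂ, W, F)` and a string of filtered morphisms `φ_u : A_i → A_j` from `A_0 = A_ℚ ⊗ ℂ` to
`A_s = A_ℂ`. -/
structure HodgeDiagram (m : ℕ) where
  Q : FDGA.{u} ℚ
  C : FDGA.{u} ℂ
  F : HodgeFil C
  even : Fin m → FDGA.{u} ℂ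
  odd : Fin (m + 1) → FDGA.{u} ℂ
  φ : ∀ u : ZArrow m, FDGAHom (nodeOf Q even odd C u.src) (nodeOf Q even odd C u.tgt)

namespace HodgeDiagram

variable {m : ℕ}

noncomputable abbrev node (A : HodgeDiagram.{u} m) : ZVertex m → FDGA.{u} ℂ :=
  nodeOf A.Q A.even A.odd A.C

/-- The axioms of a mixed Hodge diagram. -/
structure IsMixedHodge (A : HodgeDiagram.{u} m) : Prop where
  /-- the comparison morphisms are `E_1`-quasi-isomorphisms -/
  comparison : ∀ u, (A.φ u).IsEQuasiIso 1
  regular_Q : A.Q.IsRegular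
  regular : ∀ v, (A.node v).IsRegular
  biregular : ∀ n, (∃ a, A.F.F a n = A.C.gr n) ∧ ∃ b, A.F.F b n = ⊥
  finite : ∀ n, Module.Finite ℚ (A.Q.H n)
  /-- the differential of `Gr_p^W A_ℂ` is strictly compatible with `F` -/
  strict : ∀ (p q : ℤ) (n : ℕ) (x z : A.C.carrier), x ∈ A.C.W p n →
    z ∈ A.F.F q (n + 1) → z ∈ A.C.W p (n + 1) → A.C.d x - z ∈ A.C.W (p - 1) (n + 1) →
    ∃ y ∈ A.F.F q n, y ∈ A.C.W p n ∧ A.C.d y - z ∈ A.C.W (p - 1) (n + 1)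
  /-- the comparison morphisms identify `H^n(Gr_p^W A_ℚ) ⊗ ℂ` with `H^n(Gr_p^W A_ℂ)`, and the
  filtration induced by `F` on the latter defines a pure Hodge structure of weight `p + n` -/
  pure : ∀ (p : ℤ) (n : ℕ), ∃ e : ∀ v, (ℂ ⊗[ℚ] A.Q.E 1 p n) ≃ₗ[ℂ] (A.node v).E 1 p n,
    (∀ x : A.Q.Z 1 p n, e .left (1 ⊗ₜ Submodule.Quotient.mk x) =
      Submodule.Quotient.mk ⟨A.Q.toBC x, A.Q.toBC_mem_Z 1 p n x x.2⟩) ∧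
    (∀ u x, (A.φ u).mapE 1 p n (e u.src x) = e u.tgt x) ∧
    IsPureHodge (A.Q.E 1 p n) (fun q => (A.F.onE1 p n q).comap (e .right).toLinearMap) (p + n)

end HodgeDiagram

theorem FDGA.algebraMap_mem_cocycles {k : Type} [Field k] (A : FDGA.{u} k) (c : k) :
    algebraMap k A.carrier c ∈ A.cocycles 0 := by
  have h1 : (1 : A.carrier) ∈ A.gr 0 := SetLike.GradedOne.one_mem
  have h : A.d 1 = 0 := by
    have := A.leibniz 0 1 1 h1
    simpa using this
  rw [Algebra.algebraMap_eq_smul_one]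
  exact Submodule.smul_mem _ _ ⟨h1, h⟩

/-- `A` is `0`-connected: the unit map induces an isomorphism `ℚ ≅ H^0(A_ℚ)`. -/
def HodgeDiagram.IsZeroConnected {m : ℕ} (A : HodgeDiagram.{u} m) : Prop :=
  Function.Bijective fun c : ℚ =>
    (Submodule.Quotient.mk ⟨algebraMap ℚ A.Q.carrier c, A.Q.algebraMap_mem_cocycles c⟩ : A.Q.H 0)

/-- The components of a pre-morphism at the vertices: `f_0 = f_ℚ ⊗ ℂ` and `f_s = f_ℂ`. -/
noncomputable def nodeMapOf {m : ℕ} {A B : HodgeDiagram.{u} m} (fQ : FDGAHom A.Q B.Q)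
    (fC : FDGAHom A.C B.C) (even : ∀ i, FDGAHom (A.even i) (B.even i))
    (odd : ∀ i, FDGAHom (A.odd i) (B.odd i)) : ∀ v, FDGAHom (A.node v) (B.node v)
  | .left => fQ.baseChange
  | .even i => even i
  | .odd i => odd i
  | .right => fC

/-- Pre-morphisms of mixed Hodge diagrams. -/
structure PreMorphism {m : ℕ} (A B : HodgeDiagram.{u} m) where
  fQ : FDGAHom A.Q B.Q
  fC : FDGAHom A.C B.C
  map_F : ∀ q n x, x ∈ A.F.F q n → fC.toFun x ∈ B.F.F q n
  even : ∀ i, FDGAHom (A.even i) (B.even i)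
  odd : ∀ i, FDGAHom (A.odd i) (B.odd i)

noncomputable abbrev PreMorphism.node {m : ℕ} {A B : HodgeDiagram.{u} m} (f : PreMorphism A B) :
    ∀ v, FDGAHom (A.node v) (B.node v) :=
  nodeMapOf f.fQ f.fC f.even f.odd

/-- A pre-morphism is a quasi-isomorphism if all its components are. -/
def PreMorphism.IsQuasiIso {m : ℕ} {A B : HodgeDiagram.{u} m} (f : PreMorphism A B) : Prop :=
  f.fQ.IsQuasiIso ∧ f.fC.IsQuasiIso ∧ ∀ v, (f.node v).IsQuasiIso

/-- Ho-morphisms: pre-morphisms together with `1`-homotopies from `f_j φ_u^A` to `φ_u^B f_i` for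
all `u : i → j`. -/
structure HoMorphism {m : ℕ} (A B : HodgeDiagram.{u} m) extends PreMorphism A B where
  htpy : ∀ u : ZArrow m, RHomotopy 1
    ((toPreMorphism.node u.tgt).comp (A.φ u)) ((B.φ u).comp (toPreMorphism.node u.src))

/-! ## Mixed Hodge dga's -/

/-- A mixed Hodge dga: a filtered dga `(A, W)` over `ℚ` with a filtration `F` of `A ⊗ ℂ` such that
every `(A^n, Dec W, F)` is a mixed Hodge structure and `d` and the products are morphisms of mixed
Hodge structures. (Compatibility of `d` and the products with `F` is part of `HodgeFil`, that with
`Dec W` follows from the axioms of a filtered dga.) -/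
structure MHDga where
  Q : FDGA.{u} ℚ
  F : HodgeFil Q.baseChange
  mhs : ∀ n, IsMHS (Q.gr n) (fun p => (Q.Dec p n).comap (Q.gr n).subtype)
    (fun q => (F.F q n).comap ((Q.gr n).subtype.baseChange ℂ))

/-- Morphisms of mixed Hodge dga's. -/
structure MHHom (A B : MHDga.{u}) where
  f : FDGAHom A.Q B.Q
  map_F : ∀ q n x, x ∈ A.F.F q n → f.baseChange.toFun x ∈ B.F.F q n

namespace MHDga

/-- The identity of `A ⊗ ℂ`, seen as a morphism to the object at a vertex of the constant
diagram. -/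
noncomputable def toNode {m : ℕ} (C : FDGA.{u} ℚ) :
    ∀ v : ZVertex m, FDGAHom C.baseChange
      (nodeOf C (fun _ => C.baseChange) (fun _ => C.baseChange) C.baseChange v)
  | .left => FDGAHom.id _
  | .even _ => FDGAHom.id _
  | .odd _ => FDGAHom.id _
  | .right => FDGAHom.id _

/-- The identity of `A ⊗ ℂ`, seen as a morphism from the object at a vertex of the constant
diagram. -/
noncomputable def fromNode {m : ℕ} (C : FDGA.{u} ℚ) :
    ∀ v : ZVertex m, FDGAHom
      (nodeOf C (fun _ => C.baseChange) (fun _ => C.baseChange) C.baseChange v) C.baseChange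
  | .left => FDGAHom.id _
  | .even _ => FDGAHom.id _
  | .odd _ => FDGAHom.id _
  | .right => FDGAHom.id _

/-- A mixed Hodge dga as a diagram in which all comparison morphisms are identities. -/
noncomputable def toDiagram (M : MHDga.{u}) (m : ℕ) : HodgeDiagram.{u} m where
  Q := M.Q
  C := M.Q.baseChange
  F := M.F
  even _ := M.Q.baseChange
  odd _ := M.Q.baseChange
  φ u := (toNode M.Q u.tgt).comp (fromNode M.Q u.src)

/-- The base field `ℚ` with the trivial mixed Hodge structure. -/
structure IsBase (M : MHDga.{u}) : Prop where
  bijective : Function.Bijective (algebraMap ℚ M.Q.carrier)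
  W_top : ∀ p : ℤ, 0 ≤ p → M.Q.W p 0 = ⊤
  W_bot : ∀ p : ℤ, p < 0 → M.Q.W p 0 = ⊥
  F_top : ∀ q : ℤ, q ≤ 0 → M.F.F q 0 = ⊤
  F_bot : ∀ q : ℤ, 0 < q → M.F.F q 0 = ⊥

end MHDga

/-- `B = A ⊗ Λ(V)` as a graded algebra, with `V` in degree `n`: `B` is the free graded commutative
algebra over `A` on the space `V` placed in degree `n`. -/
def IsFreeExtension {k : Type} [Field k] {A B : GCAlg.{u} k} (ι : GCHom A B) {V : Type u}
    [AddCommGroup V] [Module k V] (i : V →ₗ[k] B.carrier) (n : ℕ) : Prop :=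
  (∀ v, i v ∈ B.gr n) ∧
  ∀ (C : GCAlg.{u} k) (f : GCHom A C) (g : V →ₗ[k] C.carrier), (∀ v, g v ∈ C.gr n) →
    ∃! h : GCHom B C, (∀ a, h.toFun (ι.toFun a) = f.toFun a) ∧ ∀ v, h.toFun (i v) = g v

/-- The filtration `WB` is the multiplicative extension of the filtration `WA` of `A` and of the
filtration `WV` of the space `V` in degree `n`, i.e. the least multiplicative filtration that
contains their images. -/
def IsMultExtension {k : Type} [Field k] {A B : GCAlg.{u} k} (ι : GCHom A B)
    (WA : ℤ → ℕ → Submodule k A.carrier) {V : Type u} [AddCommGroup V] [Module k V]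
    (i : V →ₗ[k] B.carrier) (n : ℕ) (WV : ℤ → Submodule k V)
    (WB : ℤ → ℕ → Submodule k B.carrier) : Prop :=
  IsLeast {S : ℤ → ℕ → Submodule k B.carrier |
    (∀ p m, ∀ a ∈ WA p m, ι.toFun a ∈ S p m) ∧ (∀ p, ∀ v ∈ WV p, i v ∈ S p n) ∧
    ∀ p q m l, ∀ x ∈ S p m, ∀ y ∈ S q l, x * y ∈ S (p + q) (m + l)} WB

/-- A mixed Hodge extension `B = A ⊗_ξ Λ(V)` of `A` of degree `n`, with inclusion `ι : A → B`.
As a filtered dga over `ℚ`, `B` is the multiplicative extension of `A` by `(V, W)` along the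
inclusion `i`, with `d v = ξ v`. The filtration `F` of `B ⊗ ℂ` is the multiplicative extension of
the filtrations `F` of `A ⊗ ℂ` and `V ⊗ ℂ` along a complex filtered inclusion `j` of `V ⊗ ℂ` that
agrees with `i` modulo `A ⊗ ℂ`, so that `(V, Dec W, F)` is a quotient, but not necessarily a direct
summand, of the mixed Hodge structure on the generators. -/
structure MHExtension (A B : MHDga.{u}) (ι : MHHom A B) (n : ℕ) where
  V : Type u
  [acg : AddCommGroup V]
  [mod : Module ℚ V]
  WV : ℤ → Submodule ℚ V
  FV : ℤ → Submodule ℂ (ℂ ⊗[ℚ] V)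
  /-- `Dec W_p V = W_{p-n} V`, as `V` is of degree `n` -/
  mhs : IsMHS V (fun p => WV (p - n)) FV
  ξ : V →ₗ[ℚ] A.Q.carrier
  ξ_gr : ∀ v, ξ v ∈ A.Q.gr (n + 1)
  d_ξ : ∀ v, A.Q.d (ξ v) = 0
  ξ_W : ∀ p, ∀ v ∈ WV p, ξ v ∈ A.Q.W (p - 1) (n + 1)
  i : V →ₗ[ℚ] B.Q.carrier
  free : IsFreeExtension ι.f.toGCHom i n
  d_i : ∀ v, B.Q.d (i v) = ι.f.toFun (ξ v)
  W_ext : IsMultExtension ι.f.toGCHom A.Q.W i n WV B.Q.W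
  j : (ℂ ⊗[ℚ] V) →ₗ[ℂ] B.Q.baseChange.carrier
  j_W : ∀ p, ∀ x ∈ (WV p).baseChange ℂ, ∃ a ∈ A.Q.baseChange.W p n,
    j x - ι.f.baseChange.toFun a = i.baseChange ℂ x
  ξ_F : ∀ q, ∀ x ∈ FV q, ∃ a ∈ A.F.F q (n + 1), B.Q.baseChange.d (j x) = ι.f.baseChange.toFun a
  F_ext : IsMultExtension ι.f.baseChange.toGCHom A.F.F j n FV B.F.F

/-- The part of degree `n` of `A^+ · A^+`, where `A^+` is the part of positive degree. -/
def GCAlg.decomposables {k : Type} [Field k] (A : GCAlg.{u} k) (n : ℕ) : Submodule k A.carrier :=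
  Submodule.span k {z | ∃ i j : ℕ, 1 ≤ i ∧ 1 ≤ j ∧ i + j = n ∧
    ∃ x ∈ A.gr i, ∃ y ∈ A.gr j, z = x * y}

/-- The extension is minimal: it is of positive degree and `ξ(V) ⊆ A^+ · A^+`. -/
def MHExtension.IsMinimal {A B : MHDga.{u}} {ι : MHHom A B} {n : ℕ} (e : MHExtension A B ι n) :
    Prop :=
  1 ≤ n ∧ ∀ v : e.V, e.ξ v ∈ A.Q.toGCAlg.decomposables (n + 1)

/-- `M` is minimal: it is the colimit (increasing union, with the union filtrations) of a sequence
of minimal mixed Hodge extensions starting from `ℚ`. -/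
def MHDga.IsMinimal (M : MHDga.{u}) : Prop :=
  ∃ (S : ℕ → MHDga.{u}) (deg : ℕ → ℕ) (ι : ∀ k, MHHom (S k) (S (k + 1)))
    (j : ∀ k, MHHom (S k) M),
    (S 0).IsBase ∧
    (∀ k, ∃ e : MHExtension (S k) (S (k + 1)) (ι k) (deg k), e.IsMinimal) ∧
    (∀ k x, (j (k + 1)).f.toFun ((ι k).f.toFun x) = (j k).f.toFun x) ∧
    (∀ k, Function.Injective (j k).f.toFun) ∧
    (∀ p n, ∀ x ∈ M.Q.W p n, ∃ k, ∃ y ∈ (S k).Q.W p n, (j k).f.toFun y = x) ∧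
    (∀ q n, ∀ x ∈ M.F.F q n, ∃ k, ∃ y ∈ (S k).F.F q n, (j k).f.baseChange.toFun y = x)

attribute [reducible] FDGA.baseChange nodeOf ZArrow.src ZArrow.tgt

noncomputable section
open LinearMap (range mulRight mulLeft snd fst inl ker_eq_bot)
open FDGA (evalAt baseChange_map_mem)
open Submodule (mem_bot mem_comap smul_mem mem_sup mem_sup_left mem_sup_right baseChange_mono baseChange_top baseChange_bot span span_le tmul_mem_baseChange_of_mem baseChange_eq_span comap_mono span_induction subset_span mkQ_surjective add_mem_sup mem_span_singleton)

notation:max f:max "°" => FDGA.baseChange f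
notation:max f:max "°" => FDGAHom.baseChange f
notation:max f:max "ˆ" => LinearMap.baseChange ℂ f
notation:max f:max "ˆ" => Submodule.baseChange ℂ f
notation:max f:max "ˡ" => AlgHom.toLinearMap (GCHom.toFun (FDGAHom.toGCHom f))
notation:max f:max "ˡ" => AlgHom.toLinearMap (GCHom.toFun f)

instance {k : Type} [Field k] : CoeSort (GCAlg.{u} k) (Type u) := ⟨GCAlg.carrier⟩
instance {k : Type} [Field k] : CoeSort (FDGA.{u} k) (Type u) := ⟨fun A => A.carrier⟩
instance {k : Type} [Field k] {A B : FDGA.{u} k} : CoeFun (FDGAHom A B) (fun _ => A → B) :=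
  ⟨fun f => f.toFun⟩

/-! ## Subspaces and extension of scalars -/

section BaseChange

variable {M N : Type*} [AddCommGroup M] [Module ℚ M] [AddCommGroup N] [Module ℚ N]

/-- The contraction of `ℂ ⊗ M` with a linear form on `ℂ`. -/
def coef (φ : ℂ →ₗ[ℚ] ℚ) : (ℂ ⊗[ℚ] M) →ₗ[ℚ] M :=
  (TensorProduct.lid ℚ M).toLinearMap ∘ₗ LinearMap.rTensor M φ

@[simp] theorem coef_tmul (φ : ℂ →ₗ[ℚ] ℚ) (z : ℂ) (m : M) : coef φ (z ⊗ₜ m) = φ z • m := by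
  simp [coef]

theorem coef_baseChange (f : M →ₗ[ℚ] N) (φ : ℂ →ₗ[ℚ] ℚ) (x : ℂ ⊗[ℚ] M) :
    coef φ (fˆ x) = f (coef φ x) := by
  induction x using TensorProduct.induction_on with
  | zero => simp
  | tmul z m => simp
  | add x y hx hy => simp [hx, hy]

theorem exists_sum_coef (x : ℂ ⊗[ℚ] M) :
    ∃ (s : Finset ℂ) (φ : ℂ → (ℂ →ₗ[ℚ] ℚ)), x = ∑ z ∈ s, z ⊗ₜ coef (φ z) x := by
  classical
  let b := Module.Basis.ofVectorSpace ℚ ℂ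
  let e := TensorProduct.equivFinsuppOfBasisLeft (N := M) b
  have hc : ∀ i, e x i = coef (b.coord i) x := fun i => by
    have := TensorProduct.equivFinsuppOfBasisLeft_apply b x i
    exact this
  have hx : x = (e x).sum fun i n => b i ⊗ₜ n := by
    conv_lhs => rw [← e.symm_apply_apply x]
    exact TensorProduct.equivFinsuppOfBasisLeft_symm_apply b (e x)
  have hinj : Function.Injective b := b.injective
  refine ⟨(e x).support.image b, fun z => if h : ∃ i, b i = z then b.coord h.choose else 0, ?_⟩
  rw [Finset.sum_image fun i _ j _ h => hinj h]
  conv_lhs => rw [hx]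
  refine Finset.sum_congr rfl fun i _ => ?_
  have h : ∃ j, b j = b i := ⟨i, rfl⟩
  have hd : (if h : ∃ j, b j = b i then b.coord h.choose else 0) = b.coord i := by
    rw [dif_pos h, hinj h.choose_spec]
  change b i ⊗ₜ e x i = b i ⊗ₜ coef (if h : ∃ j, b j = b i then b.coord h.choose else 0) x
  rw [hd, ← hc]

theorem mem_baseChange_iff {U : Submodule ℚ M} {x : ℂ ⊗[ℚ] M} : x ∈ Uˆ ↔ ∀ φ, coef φ x ∈ U := by
  constructor
  · intro hx φ
    obtain ⟨y, rfl⟩ := Submodule.toBaseChange_surjective' ℂ _ hx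
    induction y using TensorProduct.induction_on with
    | zero => simp
    | tmul z m => simpa using U.smul_mem _ m.2
    | add x y ihx ihy =>
      simp only [map_add, Submodule.coe_add]
      exact U.add_mem (ihx (Subtype.prop _)) (ihy (Subtype.prop _))
  · intro h
    obtain ⟨s, φ, hx⟩ := exists_sum_coef x
    rw [hx]
    exact sum_mem fun z _ => tmul_mem_baseChange_of_mem z (h _)

theorem baseChange_inf (U V : Submodule ℚ M) : (U ⊓ V)ˆ = Uˆ ⊓ Vˆ := by
  ext x
  simp only [Submodule.mem_inf, mem_baseChange_iff, forall_and]

theorem baseChange_comap (f : M →ₗ[ℚ] N) (U : Submodule ℚ N) : (U.comap f)ˆ = (Uˆ).comap (fˆ) := by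
  ext x
  simp only [mem_comap, mem_baseChange_iff, coef_baseChange]

theorem baseChange_ker (f : M →ₗ[ℚ] N) : (LinearMap.ker f)ˆ = LinearMap.ker (fˆ) := by
  rw [← Submodule.comap_bot, baseChange_comap, baseChange_bot, Submodule.comap_bot]

theorem baseChange_map (f : M →ₗ[ℚ] N) (U : Submodule ℚ M) : (U.map f)ˆ = (Uˆ).map (fˆ) := by
  apply le_antisymm
  · rw [baseChange_eq_span, span_le]
    rintro _ ⟨_, ⟨u, hu, rfl⟩, rfl⟩
    exact ⟨1 ⊗ₜ u, tmul_mem_baseChange_of_mem _ hu, by simp⟩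
  · rw [Submodule.map_le_iff_le_comap, baseChange_eq_span, span_le]
    rintro _ ⟨u, hu, rfl⟩
    have := tmul_mem_baseChange_of_mem (A := ℂ) 1 (Submodule.mem_map_of_mem (f := f) hu)
    simpa using this

theorem baseChange_sup (U V : Submodule ℚ M) : (U ⊔ V)ˆ = Uˆ ⊔ Vˆ := by
  apply le_antisymm
  · rw [baseChange_eq_span, span_le]
    rintro _ ⟨x, hx, rfl⟩
    obtain ⟨y, hy, z, hz, rfl⟩ := mem_sup.1 hx
    simp only [TensorProduct.mk_apply, TensorProduct.tmul_add]
    exact add_mem_sup (tmul_mem_baseChange_of_mem _ hy) (tmul_mem_baseChange_of_mem _ hz)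
  · exact sup_le (baseChange_mono ℂ le_sup_left) (baseChange_mono ℂ le_sup_right)

theorem tmul_one_mem_baseChange {U : Submodule ℚ M} {x : M} : (1 : ℂ) ⊗ₜ[ℚ] x ∈ Uˆ ↔ x ∈ U := by
  refine ⟨fun h => ?_, tmul_mem_baseChange_of_mem 1⟩
  obtain ⟨φ, hφ⟩ := LinearMap.exists_leftInverse_of_injective (Algebra.linearMap ℚ ℂ)
    (LinearMap.ker_eq_bot.2 (algebraMap ℚ ℂ).injective)
  have h1 : φ 1 = 1 := by simpa using LinearMap.congr_fun hφ 1
  simpa [h1] using mem_baseChange_iff.1 h φ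

theorem baseChange_le_baseChange {U V : Submodule ℚ M} : Uˆ ≤ Vˆ ↔ U ≤ V :=
  ⟨fun h _ hx => tmul_one_mem_baseChange.1 (h (tmul_one_mem_baseChange.2 hx)), baseChange_mono ℂ⟩

theorem baseChange_le_iff {U : Submodule ℚ M} {S : Submodule ℂ (ℂ ⊗[ℚ] M)} :
    Uˆ ≤ S ↔ ∀ x ∈ U, (1 : ℂ) ⊗ₜ[ℚ] x ∈ S := by
  rw [baseChange_eq_span, span_le]
  exact ⟨fun h x hx => h ⟨x, hx, rfl⟩, by rintro h _ ⟨x, hx, rfl⟩; exact h x hx⟩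

@[simp] theorem conjTensor_tmul (z : ℂ) (m : M) :
    conjTensor M (z ⊗ₜ m) = (starRingEnd ℂ z) ⊗ₜ m := rfl

theorem conjTensor_conjTensor (x : ℂ ⊗[ℚ] M) : conjTensor M (conjTensor M x) = x := by
  induction x using TensorProduct.induction_on with
  | zero => simp
  | tmul z m => simp
  | add x y hx hy => simp [hx, hy]

theorem conjTensor_baseChange (f : M →ₗ[ℚ] N) (x : ℂ ⊗[ℚ] M) :
    conjTensor N (fˆ x) = fˆ (conjTensor M x) := by
  induction x using TensorProduct.induction_on with
  | zero => simp
  | tmul z m => simp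
  | add x y hx hy => simp [hx, hy]

theorem conjTensor_mem {U : Submodule ℚ M} {x : ℂ ⊗[ℚ] M} (hx : x ∈ Uˆ) : conjTensor M x ∈ Uˆ := by
  obtain ⟨y, rfl⟩ := Submodule.toBaseChange_surjective' ℂ _ hx
  induction y using TensorProduct.induction_on with
  | zero => simp
  | tmul z m => exact tmul_mem_baseChange_of_mem _ m.2
  | add x y ihx ihy =>
    simp only [map_add, Submodule.coe_add]
    exact add_mem (ihx (Subtype.prop _)) (ihy (Subtype.prop _))

theorem conjTensor_mul {A : Type*} [Ring A] [Algebra ℚ A] (x y : ℂ ⊗[ℚ] A) :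
    conjTensor A (x * y) = conjTensor A x * conjTensor A y := by
  induction x using TensorProduct.induction_on with
  | zero => simp
  | tmul z a =>
    induction y using TensorProduct.induction_on with
    | zero => simp
    | tmul w b => simp
    | add x y hx hy => rw [mul_add, map_add, hx, hy, map_add, mul_add]
  | add x z hx hz => rw [add_mul, map_add, hx, hz, map_add, add_mul]

theorem conjTensor_one {A : Type*} [Ring A] [Algebra ℚ A] : conjTensor A (1 : ℂ ⊗[ℚ] A) = 1 := by
  simp [Algebra.TensorProduct.one_def]

end BaseChange

/-! ## Families of subspaces that are independent modulo a subspace -/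

section Graded

variable {k X Γ : Type*} [Field k] [AddCommGroup X] [Module k X]

/-- The sum of the members of a family whose indices satisfy `P`. -/
def part (J : Γ → Submodule k X) (P : Γ → Prop) : Submodule k X := ⨆ γ, ⨆ _ : P γ, J γ

theorem le_part {J : Γ → Submodule k X} {P : Γ → Prop} {γ : Γ} (h : P γ) : J γ ≤ part J P :=
  le_iSup₂_of_le γ h le_rfl

theorem part_le {J : Γ → Submodule k X} {P : Γ → Prop} {S : Submodule k X}
    (h : ∀ γ, P γ → J γ ≤ S) : part J P ≤ S := iSup₂_le h

theorem part_mono {J J' : Γ → Submodule k X} {P P' : Γ → Prop} (hJ : ∀ γ, J γ ≤ J' γ)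
    (h : ∀ γ, P γ → P' γ) : part J P ≤ part J' P' :=
  part_le fun γ hγ => (hJ γ).trans (le_part (h γ hγ))

theorem mem_part {J : Γ → Submodule k X} {P : Γ → Prop} {x : X} : x ∈ part J P ↔
    ∃ f : Γ →₀ X, (∀ γ, f γ ∈ J γ) ∧ (∀ γ, ¬ P γ → f γ = 0) ∧ f.sum (fun _ x => x) = x := by
  classical
  rw [part, Submodule.mem_iSup_iff_exists_finsupp]
  constructor
  · rintro ⟨f, hf, rfl⟩
    refine ⟨f, fun γ => (iSup_le (fun _ => le_rfl) : (⨆ (_ : P γ), J γ) ≤ J γ) (hf γ), fun γ hγ => ?_, rfl⟩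
    simpa [hγ] using hf γ
  · rintro ⟨f, hf, hP, rfl⟩
    refine ⟨f, fun γ => ?_, rfl⟩
    by_cases hγ : P γ
    · simpa [hγ] using hf γ
    · simp [hP γ hγ]

/-- The family `J` is independent modulo `B`. -/
def GInd (B : Submodule k X) (J : Γ → Submodule k X) : Prop :=
  ∀ f : Γ →₀ X, (∀ γ, f γ ∈ J γ) → f.sum (fun _ x => x) ∈ B → ∀ γ, f γ ∈ B

theorem GInd.inter {B : Submodule k X} {J : Γ → Submodule k X} {P P' : Γ → Prop} {x y : X}
    (hJ : GInd B J) (hx : x ∈ part J P) (hy : y ∈ part J P') (h : x - y ∈ B) :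
    x ∈ part J (fun γ => P γ ∧ P' γ) ⊔ B := by
  classical
  obtain ⟨f, hf, hP, rfl⟩ := mem_part.1 hx
  obtain ⟨g, hg, hQ, rfl⟩ := mem_part.1 hy
  have hfg := hJ (f - g) (fun γ => sub_mem (hf γ) (hg γ))
    (by rwa [Finsupp.sum_sub_index fun _ _ _ => rfl])
  refine sum_mem fun γ _ => ?_
  change f γ ∈ _
  by_cases h1 : P γ
  · by_cases h2 : P' γ
    · exact mem_sup_left (le_part (P := fun γ => P γ ∧ P' γ) ⟨h1, h2⟩ (hf γ))
    · exact mem_sup_right (by simpa [hQ γ h2] using hfg γ)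
  · rw [hP γ h1]; exact zero_mem _

end Graded

/-! ## Relative mixed Hodge structures on complex vector spaces with a conjugation -/

/-- A mixed Hodge structure on `T / B` for subspaces `B ≤ T` of a complex vector space with a
conjugation `c`, the filtrations being given by subspaces between `B` and `T`. -/
structure CMHS {X : Type*} [AddCommGroup X] [Module ℂ X] (c : X →ₛₗ[starRingEnd ℂ] X)
    (B T : Submodule ℂ X) (W F : ℤ → Submodule ℂ X) : Prop where
  cc : ∀ x, c (c x) = x
  W_mono : Monotone W
  W_bot : ∃ a, W a = B
  W_top : ∃ b, W b = T
  B_le_W : ∀ k, B ≤ W k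
  W_le : ∀ k, W k ≤ T
  c_W : ∀ k x, x ∈ W k → c x ∈ W k
  F_anti : Antitone F
  F_top : ∃ a, F a = T
  F_bot : ∃ b, F b = B
  B_le_F : ∀ k, B ≤ F k
  F_le : ∀ k, F k ≤ T
  split : ∀ k p x, x ∈ W k → ∃ f ∈ F p ⊓ W k, ∃ g ∈ F (k + 1 - p) ⊓ W k, x - f - c g ∈ W (k - 1)
  disj : ∀ k p x y, x ∈ F p ⊓ W k → y ∈ F (k + 1 - p) ⊓ W k → x - c y ∈ W (k - 1) → x ∈ W (k - 1)

namespace CMHS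

variable {X : Type*} [AddCommGroup X] [Module ℂ X] {c : X →ₛₗ[starRingEnd ℂ] X}
  {B T : Submodule ℂ X} {W F : ℤ → Submodule ℂ X}

def cj (c : X →ₛₗ[starRingEnd ℂ] X) (S : Submodule ℂ X) : Submodule ℂ X := S.comap c

theorem mem_cj {S : Submodule ℂ X} {x : X} : x ∈ cj c S ↔ c x ∈ S := Iff.rfl

/-- The auxiliary filtration in the definition of Deligne's bigrading. -/
def aux (c : X →ₛₗ[starRingEnd ℂ] X) (W F : ℤ → Submodule ℂ X) (q k : ℤ) : Submodule ℂ X :=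
  (cj c (F q) ⊓ W k) ⊔ ⨆ j : ℕ, cj c (F (q - 1 - j)) ⊓ W (k - 2 - j)

/-- Deligne's bigrading `I^{p,q}`. -/
def I (c : X →ₛₗ[starRingEnd ℂ] X) (W F : ℤ → Submodule ℂ X) (p q : ℤ) : Submodule ℂ X :=
  F p ⊓ W (p + q) ⊓ aux c W F q (p + q)

def Iu (c : X →ₛₗ[starRingEnd ℂ] X) (W F : ℤ → Submodule ℂ X) (γ : ℤ × ℤ) : Submodule ℂ X :=
  I c W F γ.1 γ.2

theorem I_le_F (p q : ℤ) : I c W F p q ≤ F p := fun _ hx => hx.1.1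
theorem I_le_W (p q : ℤ) : I c W F p q ≤ W (p + q) := fun _ hx => hx.1.2

theorem cj_mono (h : CMHS c B T W F) {q q' : ℤ} (hq : q ≤ q') : cj c (F q') ≤ cj c (F q) :=
  fun _ hx => h.F_anti hq hx

theorem B_le_cj (h : CMHS c B T W F) (q : ℤ) : B ≤ cj c (F q) := fun x hx => by
  obtain ⟨a, ha⟩ := h.W_bot
  refine h.B_le_F q ?_
  rw [← ha] at hx ⊢
  exact h.c_W a x hx

theorem B_le_I (h : CMHS c B T W F) (p q : ℤ) : B ≤ I c W F p q :=
  le_inf (le_inf (h.B_le_F p) (h.B_le_W _)) (le_sup_of_le_left (le_inf (h.B_le_cj q) (h.B_le_W _)))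

theorem aux_le (h : CMHS c B T W F) (q k : ℤ) (m : ℕ) :
    aux c W F q k ≤ (cj c (F (q - m))) ⊔ W (k - 2 - m) := by
  refine sup_le (le_sup_of_le_left fun x hx => h.cj_mono (by omega) hx.1) (iSup_le fun j => ?_)
  rcases lt_or_ge j m with hj | hj
  · exact le_sup_of_le_left fun x hx => h.cj_mono (by omega) hx.1
  · exact le_sup_of_le_right fun x hx => h.W_mono (by omega) hx.2

theorem disj' (h : CMHS c B T W F) {k p q : ℤ} (hq : k + 1 ≤ p + q) {x y : X}
    (hx : x ∈ F p) (hxW : x ∈ W k) (hy : y ∈ cj c (F q)) (hxy : x - y ∈ W (k - 1)) :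
    x ∈ W (k - 1) := by
  have hyW : y ∈ W k := by
    have := sub_mem hxW (h.W_mono (by omega : k - 1 ≤ k) hxy)
    simpa using this
  refine h.disj k p x (c y) ⟨hx, hxW⟩ ⟨h.F_anti (by omega) hy, h.c_W k y hyW⟩ ?_
  rwa [h.cc]

theorem mem_B_of_forall (h : CMHS c B T W F) {k : ℤ} {x : X} (hx : x ∈ W k)
    (hP : ∀ l ≤ k, x ∈ W l → x ∈ W (l - 1)) : x ∈ B := by
  obtain ⟨a, ha⟩ := h.W_bot
  have key : ∀ m : ℕ, x ∈ W (k - m) := by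
    intro m
    induction m with
    | zero => simpa using hx
    | succ m ih => have := hP _ (by omega) ih; rwa [Nat.cast_succ, ← sub_sub]
  rw [← ha]
  exact h.W_mono (by omega : k - ((k - a).toNat : ℤ) ≤ a) (key _)

theorem I_inf_W (h : CMHS c B T W F) {p q k : ℤ} (hk : k < p + q) {x : X} (hx : x ∈ I c W F p q)
    (hxW : x ∈ W k) : x ∈ B := by
  refine h.mem_B_of_forall hxW fun l hl hxl => ?_
  obtain ⟨y, hy, w, hw, hyw⟩ := mem_sup.1 (h.aux_le q (p + q) (p + q - 1 - l).toNat hx.2)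
  refine h.disj' (p := p) (q := q - (p + q - 1 - l).toNat) (y := y) (by omega) hx.1.1 hxl hy ?_
  rw [← hyw, add_sub_cancel_left]
  exact h.W_mono (by omega) hw

theorem W_le_aux (h : CMHS c B T W F) (p q : ℤ) (x : X) (hx : x ∈ W (p + q - 1)) :
    ∃ u ∈ F p ⊓ W (p + q - 1), x - u ∈ aux c W F q (p + q) := by
  obtain ⟨a, ha⟩ := h.W_bot
  have key : ∀ m : ℕ, ∀ x ∈ W (a + m), a + m ≤ p + q - 1 →
      ∃ u ∈ F p ⊓ W (p + q - 1), x - u ∈ aux c W F q (p + q) := by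
    intro m
    induction m with
    | zero =>
      intro x hx _
      refine ⟨0, zero_mem _, ?_⟩
      have hx : x ∈ B := by simpa [ha] using hx
      rw [sub_zero]
      exact mem_sup_left ⟨h.B_le_cj q hx, h.B_le_W _ hx⟩
    | succ m ih =>
      intro x hx hm
      obtain ⟨f, hf, g, hg, hw⟩ := h.split _ p x hx
      have hw' : x - f - c g ∈ W (a + m) := by convert hw using 2; push_cast; ring
      obtain ⟨u, hu, hr⟩ := ih _ hw' (by push_cast at hm; omega)
      refine ⟨f + u, add_mem ⟨hf.1, h.W_mono hm hf.2⟩ hu, ?_⟩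
      have : x - (f + u) = (x - f - c g - u) + c g := by abel
      rw [this]
      refine add_mem hr ?_
      have hg2 : c g ∈ W (a + ((m : ℕ) + 1 : ℕ)) := h.c_W _ _ hg.2
      have hg1 : c g ∈ cj c (F (a + ((m : ℕ) + 1 : ℕ) + 1 - p)) := by rw [mem_cj, h.cc]; exact hg.1
      push_cast at hg1 hg2 hm
      rcases eq_or_lt_of_le hm with he | hlt
      · exact mem_sup_left ⟨h.cj_mono (by omega) hg1, h.W_mono (by omega) hg2⟩
      · refine mem_sup_right (Submodule.mem_iSup_of_mem (p + q - 2 - (a + m + 1)).toNat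
          ⟨h.cj_mono (by omega) hg1, h.W_mono (by omega) hg2⟩)
  rcases le_total a (p + q - 1) with hle | hle
  · exact key (p + q - 1 - a).toNat x (h.W_mono (by omega) hx) (by omega)
  · have hx : x ∈ W a := h.W_mono hle hx
    rw [ha] at hx
    refine ⟨0, zero_mem _, ?_⟩
    rw [sub_zero]
    exact mem_sup_left ⟨h.B_le_cj q hx, h.B_le_W _ hx⟩

theorem exists_lift_I (h : CMHS c B T W F) {p q : ℤ} {x v : X} (hx : x ∈ F p ⊓ W (p + q))
    (hv : v ∈ cj c (F q)) (hxv : x - v ∈ W (p + q - 1)) :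
    ∃ i ∈ I c W F p q, x - i ∈ W (p + q - 1) := by
  obtain ⟨u, hu, hr⟩ := h.W_le_aux p q _ hxv
  have huW : u ∈ W (p + q) := h.W_mono (by omega) hu.2
  have hvW : v ∈ W (p + q) := by
    have := sub_mem hx.2 (h.W_mono (by omega : p + q - 1 ≤ p + q) hxv)
    simpa using this
  refine ⟨x - u, ⟨⟨sub_mem hx.1 hu.1, sub_mem hx.2 huW⟩, ?_⟩, by simpa using hu.2⟩
  have : x - u = (x - v - u) + v := by abel
  rw [this]
  exact add_mem hr (mem_sup_left ⟨hv, hvW⟩)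

theorem F_inf_W_le (h : CMHS c B T W F) (p k : ℤ) : F p ⊓ W k ≤
    part (Iu c W F) fun γ => p ≤ γ.1 ∧ γ.1 + γ.2 ≤ k := by
  obtain ⟨a, ha⟩ := h.W_bot
  obtain ⟨b, hb⟩ := h.F_bot
  have hB : ∀ p k, B ≤ part (Iu c W F) fun γ => p ≤ γ.1 ∧ γ.1 + γ.2 ≤ k :=
    fun p k => (h.B_le_I p (k - p)).trans
      (le_part (J := Iu c W F) (γ := (p, k - p)) ⟨le_rfl, by simp⟩)
  have mono : ∀ p p' k k', p' ≤ p → k ≤ k' → (part (Iu c W F) fun γ => p ≤ γ.1 ∧ γ.1 + γ.2 ≤ k) ≤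
      part (Iu c W F) fun γ => p' ≤ γ.1 ∧ γ.1 + γ.2 ≤ k' :=
    fun p p' k k' hp hk => part_mono (fun _ => le_rfl) fun γ hγ => ⟨hp.trans hγ.1, hγ.2.trans hk⟩
  have key : ∀ m n : ℕ, ∀ p k, b - m ≤ p → k ≤ a + n → F p ⊓ W k ≤
      part (Iu c W F) fun γ => p ≤ γ.1 ∧ γ.1 + γ.2 ≤ k := by
    intro m n
    induction n generalizing m with
    | zero => intro p k _ hk x hx; exact hB p k (ha ▸ h.W_mono (by simpa using hk) hx.2)
    | succ n ihn =>
      induction m with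
      | zero => intro p k hp _ x hx; exact hB p k (hb ▸ h.F_anti (by simpa using hp) hx.1)
      | succ m ihm =>
        intro p k hp hk x hx
        obtain ⟨f, hf, g, hg, hw⟩ := h.split k (p + 1) x hx.2
        have hfp : f ∈ F p := h.F_anti (by omega) hf.1
        obtain ⟨q, rfl⟩ : ∃ q, k = p + q := ⟨k - p, by ring⟩
        obtain ⟨i, hi, hxi⟩ := h.exists_lift_I (p := p) (q := q) (x := x - f) (v := c g)
          ⟨sub_mem hx.1 hfp, sub_mem hx.2 hf.2⟩
          (by rw [mem_cj, h.cc]; exact h.F_anti (by omega) hg.1) hw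
        have h1 := ihm (p + 1) (p + q) (by push_cast at hp; omega) hk hf
        have h2 := ihn (m + 1) p (p + q - 1) hp (by push_cast at hk; omega)
          ⟨sub_mem (sub_mem hx.1 hfp) hi.1.1, hxi⟩
        have : x = f + i + (x - f - i) := by abel
        rw [this]
        refine add_mem (add_mem (mono _ _ _ _ (by omega) le_rfl h1) ?_)
          (mono _ _ _ _ le_rfl (by omega) h2)
        exact le_part (J := Iu c W F) (γ := (p, q)) ⟨le_rfl, le_rfl⟩ hi
  exact key (b - p).toNat (k - a).toNat p k (by omega) (by omega)

theorem F_inf_W_eq (h : CMHS c B T W F) (p k : ℤ) : F p ⊓ W k =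
    part (Iu c W F) fun γ => p ≤ γ.1 ∧ γ.1 + γ.2 ≤ k :=
  le_antisymm (h.F_inf_W_le p k) (part_le fun _ hγ => le_inf
    ((I_le_F _ _).trans (h.F_anti hγ.1)) ((I_le_W _ _).trans (h.W_mono hγ.2)))

theorem W_eq (h : CMHS c B T W F) (k : ℤ) : W k = part (Iu c W F) fun γ => γ.1 + γ.2 ≤ k := by
  obtain ⟨a, ha⟩ := h.F_top
  refine le_antisymm (fun x hx => ?_) (part_le fun _ hγ => (I_le_W _ _).trans (h.W_mono hγ))
  exact part_mono (fun _ => le_rfl) (fun γ hγ => hγ.2) (h.F_inf_W_le a k ⟨ha ▸ h.W_le k hx, hx⟩)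

theorem F_eq (h : CMHS c B T W F) (p : ℤ) : F p = part (Iu c W F) fun γ => p ≤ γ.1 := by
  obtain ⟨b, hb⟩ := h.W_top
  refine le_antisymm (fun x hx => ?_) (part_le fun _ hγ => (I_le_F _ _).trans (h.F_anti hγ))
  exact part_mono (fun _ => le_rfl) (fun γ hγ => hγ.1) (h.F_inf_W_le p b ⟨hx, hb ▸ h.F_le p hx⟩)

theorem T_eq (h : CMHS c B T W F) : T = part (Iu c W F) fun _ => True := by
  obtain ⟨b, hb⟩ := h.W_top
  refine le_antisymm ?_ (part_le fun γ _ => (I_le_F _ _).trans (h.F_le _))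
  rw [← hb, h.W_eq]
  exact part_mono (fun _ => le_rfl) fun _ _ => trivial

theorem gind (h : CMHS c B T W F) : GInd B (Iu c W F) := by
  classical
  have key : ∀ n : ℕ, ∀ f : ℤ × ℤ →₀ X, f.support.card = n → (∀ γ, f γ ∈ Iu c W F γ) →
      f.sum (fun _ x => x) ∈ B → ∀ γ, f γ ∈ B := by
    intro n
    induction n with
    | zero => intro f hn _ _ γ; rw [Finset.card_eq_zero, Finsupp.support_eq_empty] at hn; simp [hn]
    | succ n ih =>
      intro f hn hf hB
      have hne : f.support.Nonempty := Finset.card_pos.1 (by omega)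
      obtain ⟨γ1, h1, hmax⟩ := f.support.exists_max_image (fun γ => γ.1 + γ.2) hne
      set k := γ1.1 + γ1.2 with hk
      obtain ⟨γ0, h0, hmin⟩ := (f.support.filter fun γ => γ.1 + γ.2 = k).exists_min_image
        (fun γ => γ.1) ⟨γ1, Finset.mem_filter.2 ⟨h1, rfl⟩⟩
      rw [Finset.mem_filter] at h0
      have hB0 : f γ0 ∈ B := by
        refine h.I_inf_W (p := γ0.1) (q := γ0.2) (k := k - 1) (by omega) (hf γ0) ?_
        obtain ⟨v, hv, w, hw, hvw⟩ := mem_sup.1 (h.aux_le γ0.2 (γ0.1 + γ0.2) 0 (hf γ0).2)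
        set P : ℤ × ℤ → Prop := fun γ => γ.1 + γ.2 = k ∧ γ ≠ γ0
        set s := f.support.filter P
        have hsplit : f γ0 + ∑ γ ∈ s, f γ ∈ W (k - 1) := by
          have hsum : f.sum (fun _ x => x) = f γ0 + ∑ γ ∈ s, f γ +
              ∑ γ ∈ f.support.filter (fun γ => γ.1 + γ.2 ≠ k), f γ := by
            rw [Finsupp.sum, ← Finset.sum_filter_add_sum_filter_not f.support
              (fun γ => γ.1 + γ.2 = k)]
            congr 1
            rw [← Finset.add_sum_erase _ _ (Finset.mem_filter.2 h0)]
            congr 2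
            ext γ
            simp only [s, P, Finset.mem_erase, Finset.mem_filter]
            tauto
          have hlow : ∑ γ ∈ f.support.filter (fun γ => γ.1 + γ.2 ≠ k), f γ ∈ W (k - 1) := by
            refine sum_mem fun γ hγ => ?_
            rw [Finset.mem_filter] at hγ
            have := hmax γ hγ.1
            exact h.W_mono (by omega) (I_le_W _ _ (hf γ))
          rw [hsum] at hB
          have := sub_mem (h.B_le_W (k - 1) hB) hlow
          rwa [add_sub_cancel_right] at this
        have hsF : ∑ γ ∈ s, f γ ∈ F (γ0.1 + 1) := by
          refine sum_mem fun γ hγ => ?_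
          rw [Finset.mem_filter] at hγ
          have h2 := hmin γ (Finset.mem_filter.2 ⟨hγ.1, hγ.2.1⟩)
          have h3 : γ.1 ≠ γ0.1 := fun he => hγ.2.2 (Prod.ext he (by have := hγ.2.1; omega))
          exact h.F_anti (by omega) (I_le_F _ _ (hf γ))
        have hsW : ∑ γ ∈ s, f γ ∈ W k := by
          refine sum_mem fun γ hγ => ?_
          rw [Finset.mem_filter] at hγ
          exact h.W_mono hγ.2.1.le (I_le_W _ _ (hf γ))
        have hres := h.disj' (k := k) (p := γ0.1 + 1) (q := γ0.2) (x := ∑ γ ∈ s, f γ) (y := -v)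
          (by omega) hsF hsW (neg_mem (by simpa using hv)) (by
            have : ∑ γ ∈ s, f γ - -v = (f γ0 + ∑ γ ∈ s, f γ) - w := by rw [← hvw]; abel
            rw [this]
            exact sub_mem hsplit (h.W_mono (by omega) hw))
        simpa using sub_mem hsplit hres
      intro γ
      by_cases hγ : γ = γ0
      · rw [hγ]; exact hB0
      · have := ih (f.erase γ0) (by rw [Finsupp.support_erase, Finset.card_erase_of_mem h0.1]; omega)
          (fun δ => by
            by_cases hδ : δ = γ0
            · rw [hδ, Finsupp.erase_same]; exact zero_mem _
            · rw [Finsupp.erase_ne hδ]; exact hf δ)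
          (by
            have hs := Finsupp.add_sum_erase f γ0 (fun _ x => x) h0.1
            rw [← hs] at hB
            simpa using sub_mem hB hB0) γ
        rwa [Finsupp.erase_ne hγ] at this
  intro f
  exact key _ f rfl

theorem c_I (h : CMHS c B T W F) {p q : ℤ} {x : X} (hx : x ∈ I c W F p q) :
    ∃ y ∈ I c W F q p, c x - y ∈ W (p + q - 1) := by
  obtain ⟨v, hv, w, hw, hvw⟩ := mem_sup.1 (h.aux_le q (p + q) 0 hx.2)
  have hv' : c v ∈ F q := by have := mem_cj.1 hv; rwa [Nat.cast_zero, sub_zero] at this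
  have hwW : w ∈ W (p + q - 1) := h.W_mono (by omega) hw
  have hvW : v ∈ W (p + q) := by
    have := sub_mem hx.1.2 (h.W_mono (by omega : p + q - 1 ≤ p + q) hwW)
    rwa [← hvw, add_sub_cancel_right] at this
  have hcx : c x ∈ cj c (F p) := by rw [mem_cj, h.cc]; exact hx.1.1
  obtain ⟨y, hy, hyw⟩ := h.exists_lift_I (p := q) (q := p) (x := c v) (v := c x)
    ⟨hv', by rw [add_comm]; exact h.c_W _ _ hvW⟩ hcx (by
      rw [← map_sub, add_comm q p]
      refine h.c_W _ _ ?_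
      rw [← hvw]; simpa using hwW)
  refine ⟨y, hy, ?_⟩
  have : c x - y = c w + (c v - y) := by rw [← hvw, map_add]; abel
  rw [this, add_comm q p] at *
  exact add_mem (h.c_W _ _ hwW) hyw

/-- A bigraded family of subspaces with the properties of Deligne's bigrading defines a mixed Hodge
structure. -/
theorem of_graded (hcc : ∀ x, c (c x) = x) {J : ℤ × ℤ → Submodule ℂ X}
    (hW : ∀ k, W k = part J (fun γ => γ.1 + γ.2 ≤ k) ⊔ B)
    (hF : ∀ p, F p = part J (fun γ => p ≤ γ.1) ⊔ B)
    (hc : ∀ γ, ∀ x ∈ J γ, ∃ y ∈ J γ.swap, c x - y ∈ W (γ.1 + γ.2 - 1))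
    (hcB : ∀ x ∈ B, c x ∈ B)
    (hJ : GInd B J) (hW1 : ∃ a, W a = B) (hW2 : ∃ b, W b = T) (hF1 : ∃ a, F a = T)
    (hF2 : ∃ b, F b = B) (hT : ∀ γ, J γ ≤ T) (hBT : B ≤ T) : CMHS c B T W F := by
  have W_mono : Monotone W := fun k l hkl => by
    rw [hW, hW]
    exact sup_le_sup_right (part_mono (fun _ => le_rfl) fun γ hγ => le_trans hγ hkl) _
  have F_anti : Antitone F := fun k l hkl => by
    rw [hF, hF]
    exact sup_le_sup_right (part_mono (fun _ => le_rfl) fun γ hγ => le_trans hkl hγ) _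
  have hBW : ∀ k, B ≤ W k := fun k => by rw [hW]; exact le_sup_right
  have hBF : ∀ k, B ≤ F k := fun k => by rw [hF]; exact le_sup_right
  have hJW : ∀ γ k, γ.1 + γ.2 ≤ k → J γ ≤ W k := fun γ k h => by
    rw [hW]; exact le_sup_of_le_left (le_part (P := fun γ : ℤ × ℤ => γ.1 + γ.2 ≤ k) h)
  have hJF : ∀ γ k, k ≤ γ.1 → J γ ≤ F k := fun γ k h => by
    rw [hF]; exact le_sup_of_le_left (le_part (P := fun γ : ℤ × ℤ => k ≤ γ.1) h)
  have c_W : ∀ k x, x ∈ W k → c x ∈ W k := by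
    intro k x hx
    have hle : W k ≤ (W k).comap c := by
      conv_lhs => rw [hW]
      refine sup_le (part_le fun γ hγ x hx => ?_) fun x hx => hBW k (hcB x hx)
      obtain ⟨y, hy, hxy⟩ := hc γ x hx
      have : c x = y + (c x - y) := by abel
      rw [mem_comap, this]
      exact add_mem (hJW _ _ (by simpa [add_comm] using hγ) hy) (W_mono (by omega) hxy)
    exact hle hx
  refine ⟨hcc, W_mono, hW1, hW2, hBW, fun k => by rw [hW]; exact sup_le (part_le fun γ _ => hT γ) hBT,
    c_W, F_anti, hF1, hF2, hBF, fun k => by rw [hF]; exact sup_le (part_le fun γ _ => hT γ) hBT,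
    ?_, ?_⟩
  · intro k p x hx
    have hle : W k ≤ ((F p ⊓ W k) ⊔ cj c (F (k + 1 - p) ⊓ W k)) ⊔ W (k - 1) := by
      conv_lhs => rw [hW]
      refine sup_le (part_le fun γ hγ x hx => ?_) ((hBW _).trans le_sup_right)
      rcases lt_or_eq_of_le hγ with hlt | heq
      · exact mem_sup_right (hJW _ _ (by omega) hx)
      rcases le_or_gt p γ.1 with hp | hp
      · exact mem_sup_left (mem_sup_left ⟨hJF _ _ hp hx, hJW _ _ hγ hx⟩)
      obtain ⟨y, hy, hxy⟩ := hc γ x hx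
      have := c_W _ _ hxy
      rw [map_sub, hcc, heq] at this
      rw [← add_sub_cancel (c y) x]
      refine add_mem_sup (mem_sup_right ?_) this
      rw [mem_cj, hcc]
      exact ⟨hJF _ _ (by simp; omega) hy, hJW _ _ (by simp; omega) hy⟩
    obtain ⟨y, hy, w, hw, rfl⟩ := mem_sup.1 (hle hx)
    obtain ⟨f, hf, g, hg, rfl⟩ := mem_sup.1 hy
    exact ⟨f, hf, c g, hg, by rwa [hcc, sub_sub, add_sub_cancel_left]⟩
  · intro k p x y hx hy hxy
    -- modulo lower weights `x` and `c y` lie in the spans of complementary sets of types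
    have e1 : ∀ p, F p ⊓ W k ≤ part J (fun γ => p ≤ γ.1 ∧ γ.1 + γ.2 = k) ⊔ W (k - 1) := by
      rintro p x ⟨h1, h2⟩
      rw [hF] at h1
      rw [hW] at h2
      obtain ⟨x1, hx1, b1, hb1, rfl⟩ := mem_sup.1 h1
      obtain ⟨x2, hx2, b2, hb2, he⟩ := mem_sup.1 h2
      refine add_mem (sup_le (part_le fun γ hγ x hx => ?_) ((hBW _).trans le_sup_right)
        (hJ.inter hx1 hx2 (by
          rw [sub_eq_sub_iff_add_eq_add.2 (he.symm.trans (add_comm _ _))]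
          exact sub_mem hb2 hb1))) (mem_sup_right (hBW _ hb1))
      rcases lt_or_eq_of_le hγ.2 with hlt | heq
      · exact mem_sup_right (hJW _ _ (by omega) hx)
      · exact mem_sup_left
          (le_part (P := fun γ : ℤ × ℤ => p ≤ γ.1 ∧ γ.1 + γ.2 = k) ⟨hγ.1, heq⟩ hx)
    obtain ⟨x1, hx1, x2, hx2, rfl⟩ := mem_sup.1 (e1 p hx)
    obtain ⟨y1, hy1, y2, hy2, rfl⟩ := mem_sup.1 (e1 _ hy)
    have hcy : part J (fun γ => k + 1 - p ≤ γ.1 ∧ γ.1 + γ.2 = k) ≤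
        cj c (part J (fun γ => γ.1 < p ∧ γ.1 + γ.2 = k) ⊔ W (k - 1)) := part_le fun γ hγ x hx => by
      obtain ⟨z, hz, h⟩ := hc γ x hx
      rw [mem_cj, ← add_sub_cancel z (c x)]
      exact add_mem_sup (le_part (P := fun γ : ℤ × ℤ => γ.1 < p ∧ γ.1 + γ.2 = k)
        ⟨by simp; omega, by simp; omega⟩ hz) (by rwa [hγ.2] at h)
    obtain ⟨z, hz, w, hw, hyz⟩ := mem_sup.1 (hcy hy1)
    refine add_mem ?_ hx2
    have hxz : x1 - z ∈ W (k - 1) := by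
      have h1 : x1 - z = (x1 + x2 - c (y1 + y2)) - x2 + c y2 + w := by rw [map_add, ← hyz]; abel
      rw [h1]
      exact add_mem (add_mem (sub_mem hxy hx2) (c_W _ _ hy2)) hw
    rw [hW] at hxz
    obtain ⟨l, hl, b, hb, hlb⟩ := mem_sup.1 hxz
    have := hJ.inter hx1 (y := z + l) (P' := fun γ => γ.1 < p ∨ γ.1 + γ.2 ≤ k - 1)
      (add_mem (part_mono (fun _ => le_rfl) (fun γ h => .inl h.1) hz)
        (part_mono (fun _ => le_rfl) (fun γ h => .inr h) hl))
      (by rwa [← sub_sub, ← hlb, add_sub_cancel_left])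
    exact (sup_le (part_le fun γ hγ => by omega) (hBW _) : _ ≤ W (k - 1)) this

end CMHS

namespace CMHS

section Functoriality

variable {X X' : Type*} [AddCommGroup X] [Module ℂ X] {c : X →ₛₗ[starRingEnd ℂ] X}
  {B T : Submodule ℂ X} {W F : ℤ → Submodule ℂ X}
  [AddCommGroup X'] [Module ℂ X'] {c' : X' →ₛₗ[starRingEnd ℂ] X'}
  {B' T' : Submodule ℂ X'} {W' F' : ℤ → Submodule ℂ X'}

/-- A linear map compatible with conjugations and filtrations. -/
structure Mor (c : X →ₛₗ[starRingEnd ℂ] X) (W F : ℤ → Submodule ℂ X)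
    (c' : X' →ₛₗ[starRingEnd ℂ] X') (W' F' : ℤ → Submodule ℂ X') (f : X →ₗ[ℂ] X') : Prop where
  map_c : ∀ x, f (c x) = c' (f x)
  map_W : ∀ k x, x ∈ W k → f x ∈ W' k
  map_F : ∀ k x, x ∈ F k → f x ∈ F' k

variable {f : X →ₗ[ℂ] X'}

theorem Mor.map_I (m : Mor c W F c' W' F' f) (p q : ℤ) (x : X) (hx : x ∈ I c W F p q) :
    f x ∈ I c' W' F' p q := by
  refine ⟨⟨m.map_F _ _ hx.1.1, m.map_W _ _ hx.1.2⟩, ?_⟩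
  have hle : ∀ q k, cj c (F q) ⊓ W k ≤ (cj c' (F' q) ⊓ W' k).comap f := fun q k x hx =>
    ⟨by change c' (f x) ∈ F' q; rw [← m.map_c]; exact m.map_F _ _ hx.1, m.map_W _ _ hx.2⟩
  have : aux c W F q (p + q) ≤ (aux c' W' F' q (p + q)).comap f :=
    sup_le ((hle _ _).trans (comap_mono le_sup_left))
      (iSup_le fun j => (hle _ _).trans (comap_mono (le_sup_of_le_right
        (le_iSup (fun j : ℕ => cj c' (F' (q - 1 - j)) ⊓ W' (p + q - 2 - j)) j))))
  exact this hx.2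

theorem Mor.map_T (m : Mor c W F c' W' F' f) (h : CMHS c B T W F) (h' : CMHS c' B' T' W' F')
    {x : X} (hx : x ∈ T) : f x ∈ T' := by
  obtain ⟨b, hb⟩ := h.W_top
  rw [← hb] at hx
  exact h'.W_le b (m.map_W b x hx)

theorem exists_finsupp (h : CMHS c B T W F) {x : X} (hx : x ∈ T) :
    ∃ t : ℤ × ℤ →₀ X, (∀ γ, t γ ∈ Iu c W F γ) ∧ t.sum (fun _ x => x) = x := by
  rw [h.T_eq] at hx
  obtain ⟨t, h1, -, h2⟩ := mem_part.1 hx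
  exact ⟨t, h1, h2⟩

theorem gind_sub (h : CMHS c B T W F) {f t : ℤ × ℤ →₀ X} (hf : ∀ γ, f γ ∈ Iu c W F γ)
    (ht : ∀ γ, t γ ∈ Iu c W F γ) (hft : f.sum (fun _ x => x) - t.sum (fun _ x => x) ∈ B) (γ : ℤ × ℤ) :
    f γ - t γ ∈ B :=
  h.gind (f - t) (fun γ => sub_mem (hf γ) (ht γ))
    (by rwa [Finsupp.sum_sub_index (fun _ _ _ => rfl)]) γ

/-- Strictness of morphisms, with respect to any set of types. -/
theorem Mor.strict (m : Mor c W F c' W' F' f) (h' : CMHS c' B' T' W' F')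
    (P : ℤ × ℤ → Prop) {t : ℤ × ℤ →₀ X} (ht : ∀ γ, t γ ∈ Iu c W F γ)
    (hft : f (t.sum fun _ x => x) ∈ part (Iu c' W' F') P ⊔ B') :
    ∀ γ, ¬ P γ → f (t γ) ∈ B' := by
  classical
  intro γ hγ
  obtain ⟨y, hy, b, hb, hyb⟩ := mem_sup.1 hft
  obtain ⟨g, hg, hgP, hgx⟩ := mem_part.1 hy
  have := h'.gind_sub (f := t.mapRange f f.map_zero)
    (fun γ => by rw [Finsupp.mapRange_apply]; exact m.map_I _ _ _ (ht γ)) hg (by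
      have : (t.sum fun _ b => f b) = f (t.sum fun _ x => x) := by simp [Finsupp.sum, map_sum]
      rw [hgx, Finsupp.sum_mapRange_index (fun _ => rfl), this, ← hyb]
      simpa using hb) γ
  simpa [hgP γ hγ] using this

theorem Mor.exists_strict (m : Mor c W F c' W' F' f) (h : CMHS c B T W F)
    (h' : CMHS c' B' T' W' F') (P : ℤ × ℤ → Prop) {x : X} (hx : x ∈ T)
    (hfx : f x ∈ part (Iu c' W' F') P ⊔ B') : ∃ y ∈ part (Iu c W F) P, f x - f y ∈ B' := by
  classical
  obtain ⟨t, ht, rfl⟩ := h.exists_finsupp hx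
  have h1 := m.strict h' P ht hfx
  refine ⟨(t.filter P).sum fun _ x => x, mem_part.2 ⟨t.filter P, fun γ => ?_, fun γ hγ => ?_, rfl⟩, ?_⟩
  · by_cases hγ : P γ
    · rw [Finsupp.filter_apply_pos _ _ hγ]; exact ht γ
    · rw [Finsupp.filter_apply_neg _ _ hγ]; exact zero_mem _
  · exact Finsupp.filter_apply_neg _ _ hγ
  · rw [← map_sub]
    have : (t.sum fun _ x => x) - (t.filter P).sum (fun _ x => x) =
        (t.filter fun γ => ¬ P γ).sum fun _ x => x := by
      rw [sub_eq_iff_eq_add']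
      conv_lhs => rw [← Finsupp.filter_add_filter_not t P]
      rw [Finsupp.sum_add_index' (fun _ => rfl) (fun _ _ _ => rfl)]
    rw [this, Finsupp.sum, map_sum]
    refine sum_mem fun γ hγ => ?_
    rw [Finsupp.support_filter, Finset.mem_filter] at hγ
    rw [Finsupp.filter_apply_pos (fun γ => ¬ P γ) t hγ.2]
    exact h1 γ hγ.2

theorem Mor.exists_strict_I (m : Mor c W F c' W' F' f) (h : CMHS c B T W F)
    (h' : CMHS c' B' T' W' F') {γ : ℤ × ℤ} {x : X} (hx : x ∈ T) (hfx : f x ∈ Iu c' W' F' γ) :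
    ∃ y ∈ Iu c W F γ, f x - f y ∈ B' := by
  obtain ⟨y, hy, h1⟩ := m.exists_strict h h' (· = γ) hx
    (mem_sup_left (le_part (J := Iu c' W' F') (P := (· = γ)) rfl hfx))
  exact ⟨y, part_le (fun _ e => e ▸ le_rfl) hy, h1⟩

theorem Mor.exists_strict_FW (m : Mor c W F c' W' F' f) (h : CMHS c B T W F)
    (h' : CMHS c' B' T' W' F') {p k : ℤ} {x : X} (hx : x ∈ T) (hfF : f x ∈ F' p)
    (hfW : f x ∈ W' k) : ∃ y ∈ F p ⊓ W k, f x - f y ∈ B' := by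
  obtain ⟨y, hy, h1⟩ := m.exists_strict h h' (fun γ => p ≤ γ.1 ∧ γ.1 + γ.2 ≤ k) hx
    (mem_sup_left (h'.F_inf_W_le p k ⟨hfF, hfW⟩))
  exact ⟨y, by rwa [h.F_inf_W_eq], h1⟩

theorem Mor.exists_strict_W (m : Mor c W F c' W' F' f) (h : CMHS c B T W F)
    (h' : CMHS c' B' T' W' F') {k : ℤ} {x : X} (hx : x ∈ T)
    (hfW : f x ∈ W' k) : ∃ y ∈ W k, f x - f y ∈ B' := by
  obtain ⟨a, ha⟩ := h'.F_top
  obtain ⟨y, hy, h1⟩ := m.exists_strict_FW h h' (p := a) hx (ha ▸ m.map_T h h' hx) hfW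
  exact ⟨y, hy.2, h1⟩

/-- A subspace that is the sum of its intersections with the pieces of Deligne's bigrading. -/
def Bigr (c : X →ₛₗ[starRingEnd ℂ] X) (W F : ℤ → Submodule ℂ X) (U : Submodule ℂ X) : Prop :=
  ∀ x ∈ U, ∃ t : ℤ × ℤ →₀ X, (∀ γ, t γ ∈ Iu c W F γ ⊓ U) ∧ t.sum (fun _ x => x) = x

theorem Mor.bigr_ker (m : Mor c W F c' W' F' f) (h : CMHS c B T W F)
    (h' : CMHS c' B' T' W' F') : Bigr c W F (T ⊓ B'.comap f) := by
  rintro x ⟨hx, hfx⟩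
  obtain ⟨t, ht, rfl⟩ := h.exists_finsupp hx
  have h1 := m.strict h' (fun _ => False) ht (mem_sup_right hfx)
  exact ⟨t, fun γ => ⟨ht γ, h.F_le _ (I_le_F _ _ (ht γ)), h1 γ not_false⟩, rfl⟩

theorem Mor.bigr_map (m : Mor c W F c' W' F' f) {U : Submodule ℂ X}
    (hU : Bigr c W F U) (h' : CMHS c' B' T' W' F') : Bigr c' W' F' (U.map f ⊔ B') := by
  classical
  intro x hx
  obtain ⟨y, ⟨z, hz, rfl⟩, b, hb, rfl⟩ := mem_sup.1 hx
  obtain ⟨t, ht, rfl⟩ := hU z hz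
  refine ⟨t.mapRange f f.map_zero + Finsupp.single 0 b, fun γ => ?_, ?_⟩
  · rw [Finsupp.add_apply, Finsupp.mapRange_apply]
    refine add_mem ⟨m.map_I _ _ _ (ht γ).1, mem_sup_left ⟨_, (ht γ).2, rfl⟩⟩ ?_
    rw [Finsupp.single_apply]
    split_ifs with h0
    · exact ⟨h'.B_le_I _ _ hb, mem_sup_right hb⟩
    · exact zero_mem _
  · rw [Finsupp.sum_add_index' (fun _ => rfl) (fun _ _ _ => rfl),
      Finsupp.sum_mapRange_index (fun _ => rfl), Finsupp.sum_single_index rfl]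
    simp [Finsupp.sum, map_sum]

theorem bigr_T (h : CMHS c B T W F) : Bigr c W F T := fun x hx => by
  obtain ⟨t, ht, rfl⟩ := h.exists_finsupp hx
  exact ⟨t, fun γ => ⟨ht γ, h.F_le _ (I_le_F _ _ (ht γ))⟩, rfl⟩

theorem inf_eq_of_bigr (h : CMHS c B T W F) {U : Submodule ℂ X} (hU : Bigr c W F U)
    (hBU : B ≤ U) {P : ℤ × ℤ → Prop} :
    part (Iu c W F) P ⊓ U ≤ part (fun γ => Iu c W F γ ⊓ U) P ⊔ B := by
  classical
  rintro x ⟨hP, hxU⟩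
  obtain ⟨f, hf, hfP, hfx⟩ := mem_part.1 hP
  obtain ⟨t, ht, htx⟩ := hU x hxU
  have h1 := h.gind_sub hf (fun γ => (ht γ).1) (by rw [hfx, htx, sub_self]; exact zero_mem _)
  rw [← hfx]
  refine sum_mem fun γ _ => ?_
  change f γ ∈ _
  by_cases hγ : P γ
  · refine mem_sup_left (le_part (J := fun γ => Iu c W F γ ⊓ U) hγ ⟨hf γ, ?_⟩)
    have := add_mem (hBU (h1 γ)) (ht γ).2
    simpa using this
  · rw [hfP γ hγ]; exact zero_mem _

theorem sub (h : CMHS c B T W F) {U : Submodule ℂ X} (hU : Bigr c W F U) (hBU : B ≤ U)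
    (hUT : U ≤ T) (hcU : ∀ x ∈ U, c x ∈ U) :
    CMHS c B U (fun k => W k ⊓ U) (fun p => F p ⊓ U) := by
  have hle : ∀ P, part (Iu c W F) P ⊓ U = part (fun γ => Iu c W F γ ⊓ U) P ⊔ B ⊓ part (Iu c W F) P := by
    intro P
    refine le_antisymm ?_ (sup_le (part_le fun γ hγ => le_inf
      (inf_le_left.trans (le_part hγ)) inf_le_right) fun x hx => ⟨hx.2, hBU hx.1⟩)
    rintro x ⟨h1, h2⟩
    obtain ⟨y, hy, b, hb, rfl⟩ := mem_sup.1 (h.inf_eq_of_bigr hU hBU ⟨h1, h2⟩)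
    refine add_mem_sup hy ⟨hb, ?_⟩
    have := sub_mem h1 (part_mono (fun _ => inf_le_left) (fun _ h => h) hy)
    simpa using this
  have hne : ∀ P, (∃ γ, P γ) → B ⊓ part (Iu c W F) P = B := fun P ⟨γ, hγ⟩ =>
    inf_eq_left.2 ((h.B_le_I γ.1 γ.2).trans (le_part (J := Iu c W F) hγ))
  refine of_graded h.cc (J := fun γ => Iu c W F γ ⊓ U) (fun k => ?_) (fun p => ?_) (fun γ x hx => ?_)
    (fun x hx => ?_) (fun f hf hB γ => h.gind f (fun γ => (hf γ).1) hB γ) ?_ ?_ ?_ ?_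
    (fun γ => inf_le_right) hBU
  · rw [h.W_eq, hle, hne _ ⟨(k, 0), by simp⟩]
  · rw [h.F_eq, hle, hne _ ⟨(p, 0), by simp⟩]
  · obtain ⟨y, hy, hxy⟩ := h.c_I hx.1
    have hcx := hcU x hx.2
    obtain ⟨t, ht, htx⟩ := hU _ hcx
    have hd : (t.sum fun _ x => x) - y ∈ W (γ.1 + γ.2 - 1) := htx ▸ hxy
    refine ⟨t γ.swap, ht _, ?_⟩
    classical
    rw [← htx]
    have hmem : (t.sum fun _ x => x) - y = (t - Finsupp.single γ.swap y).sum fun _ x => x := by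
      rw [Finsupp.sum_sub_index (fun _ _ _ => rfl), Finsupp.sum_single_index rfl]
    obtain ⟨g, hg, hgP, hgx⟩ := mem_part.1 (h.W_eq _ ▸ hd)
    have h1 := h.gind_sub (f := t - Finsupp.single γ.swap y) (fun δ => by
      refine sub_mem (ht δ).1 ?_
      rw [Finsupp.single_apply]
      split_ifs with hδ
      · rw [← hδ]; exact hy
      · exact zero_mem _) hg (by rw [hgx, hmem, sub_self]; exact zero_mem _)
    refine ⟨?_, sub_mem (htx ▸ hcx) (ht _).2⟩
    have h2 := h1 γ.swap
    have h3 : g γ.swap = 0 := hgP _ (by simp; omega)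
    simp only [Finsupp.sub_apply, Finsupp.single_eq_same, h3, sub_zero] at h2
    have : (t.sum fun _ x => x) - t γ.swap = ((t.sum fun _ x => x) - y) - (t γ.swap - y) := by abel
    rw [this]
    exact sub_mem hd (h.B_le_W _ h2)
  · obtain ⟨a, ha⟩ := h.W_bot; rw [← ha] at hx ⊢; exact h.c_W _ _ hx
  · exact h.W_bot.imp fun _ e => by rw [e]; exact inf_eq_left.2 hBU
  · exact h.W_top.imp fun _ e => by rw [e]; exact inf_eq_right.2 hUT
  · exact h.F_top.imp fun _ e => by rw [e]; exact inf_eq_right.2 hUT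
  · exact h.F_bot.imp fun _ e => by rw [e]; exact inf_eq_left.2 hBU

theorem quot (h : CMHS c B T W F) {U : Submodule ℂ X} (hU : Bigr c W F U) (hBU : B ≤ U)
    (hUT : U ≤ T) (hcU : ∀ x ∈ U, c x ∈ U) :
    CMHS c U T (fun k => W k ⊔ U) (fun p => F p ⊔ U) := by
  classical
  refine of_graded h.cc (J := Iu c W F) (fun k => by rw [h.W_eq]) (fun p => by rw [h.F_eq])
    (fun γ x hx => ?_) hcU (fun f hf hs γ => ?_) ?_ ?_ ?_ ?_
    (fun γ => (I_le_F _ _).trans (h.F_le _)) hUT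
  · obtain ⟨y, hy, hxy⟩ := h.c_I hx; exact ⟨y, hy, mem_sup_left hxy⟩
  · obtain ⟨t, ht, htx⟩ := hU _ hs
    have h1 := h.gind_sub hf (fun γ => (ht γ).1) (by rw [htx, sub_self]; exact zero_mem _)
    have := add_mem (hBU (h1 γ)) (ht γ).2
    simpa using this
  · exact h.W_bot.imp fun _ e => by rw [e]; exact sup_eq_right.2 hBU
  · exact h.W_top.imp fun _ e => by rw [e]; exact sup_eq_left.2 hUT
  · exact h.F_top.imp fun _ e => by rw [e]; exact sup_eq_left.2 hUT
  · exact h.F_bot.imp fun _ e => by rw [e]; exact sup_eq_right.2 hBU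

theorem bigr_sub (h : CMHS c B T W F) {U U' : Submodule ℂ X} (hU' : Bigr c W F U')
    (hU : CMHS c B U (fun k => W k ⊓ U) (fun p => F p ⊓ U)) (hle : U' ≤ U) :
    Bigr c (fun k => W k ⊓ U) (fun p => F p ⊓ U) U' := by
  classical
  intro x hx
  obtain ⟨t, ht, htx⟩ := hU' x hx
  obtain ⟨s, hs, hsx⟩ := hU.exists_finsupp (hle hx)
  have m : Mor c (fun k => W k ⊓ U) (fun p => F p ⊓ U) c W F LinearMap.id :=
    ⟨fun _ => rfl, fun _ _ h => h.1, fun _ _ h => h.1⟩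
  have h1 := h.gind_sub (fun γ => m.map_I _ _ _ (hs γ)) (fun γ => (ht γ).1)
    (by rw [htx, hsx, sub_self]; exact zero_mem _)
  refine ⟨t, fun γ => ⟨?_, (ht γ).2⟩, htx⟩
  rw [← sub_sub_cancel (s γ) (t γ)]
  exact sub_mem (hs γ) (hU.B_le_I _ _ (h1 γ))

theorem prod (h : CMHS c ⊥ T W F) (h' : CMHS c' ⊥ T' W' F') (a : X' →ₗ[ℂ] X)
    (ha : ∀ k x, x ∈ W' k → a x ∈ W k)
    {C : (X × X') →ₛₗ[starRingEnd ℂ] (X × X')} (hC : ∀ x, C x = (c x.1, c' x.2)) :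
    CMHS C ⊥ (T.prod T') (fun k => (W k).prod (W' k))
      (fun p => (F p).comap (fst ℂ X X' - a ∘ₗ snd ℂ X X') ⊓
        (F' p).comap (snd ℂ X X')) := by
  have haT : ∀ x ∈ T', a x ∈ T := fun x hx => by
    obtain ⟨b, hb⟩ := h'.W_top
    rw [← hb] at hx
    exact h.W_le b (ha b x hx)
  refine ⟨fun x => by rw [hC, hC, h.cc, h'.cc], fun k l hkl =>
    Submodule.prod_mono (h.W_mono hkl) (h'.W_mono hkl), ?_, ?_, fun _ => bot_le,
    fun k => Submodule.prod_mono (h.W_le k) (h'.W_le k), fun k x hx => ?_, fun p q hpq x hx =>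
    ⟨h.F_anti hpq hx.1, h'.F_anti hpq hx.2⟩, ?_, ?_, fun _ => bot_le, fun p x hx => ?_, ?_, ?_⟩
  · obtain ⟨b, hb⟩ := h.W_bot
    obtain ⟨b', hb'⟩ := h'.W_bot
    refine ⟨min b b', le_antisymm (fun x hx => ?_) bot_le⟩
    have h1 := h.W_mono (min_le_left b b') hx.1
    have h2 := h'.W_mono (min_le_right b b') hx.2
    rw [hb] at h1
    rw [hb'] at h2
    exact Prod.ext h1 h2
  · obtain ⟨b, hb⟩ := h.W_top
    obtain ⟨b', hb'⟩ := h'.W_top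
    refine ⟨max b b', le_antisymm (Submodule.prod_mono (h.W_le _) (h'.W_le _)) ?_⟩
    refine Submodule.prod_mono ?_ ?_
    · rw [← hb]; exact h.W_mono (le_max_left _ _)
    · rw [← hb']; exact h'.W_mono (le_max_right _ _)
  · rw [hC]; exact ⟨h.c_W _ _ hx.1, h'.c_W _ _ hx.2⟩
  · obtain ⟨b, hb⟩ := h.F_top
    obtain ⟨b', hb'⟩ := h'.F_top
    refine ⟨min b b', le_antisymm (fun x hx => ?_) fun x hx => ⟨?_, ?_⟩⟩
    · have h1 := h.F_le _ hx.1
      have h2 := h'.F_le _ hx.2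
      refine ⟨?_, h2⟩
      have := add_mem h1 (haT _ h2)
      simpa using this
    · refine h.F_anti (min_le_left b b') ?_; rw [hb]; exact sub_mem hx.1 (haT _ hx.2)
    · refine h'.F_anti (min_le_right b b') ?_; rw [hb']; exact hx.2
  · obtain ⟨b, hb⟩ := h.F_bot
    obtain ⟨b', hb'⟩ := h'.F_bot
    refine ⟨max b b', le_antisymm (fun x hx => ?_) bot_le⟩
    have h1 := h.F_anti (le_max_left b b') hx.1
    have h2 := h'.F_anti (le_max_right b b') hx.2
    rw [hb] at h1
    rw [hb'] at h2
    have h2' : x.2 = 0 := h2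
    have h1' : x.1 - a x.2 = 0 := h1
    rw [h2', map_zero, sub_zero] at h1'
    exact Prod.ext h1' h2'
  · have h1 := h.F_le _ hx.1
    have h2 := h'.F_le _ hx.2
    refine ⟨?_, h2⟩
    have := add_mem h1 (haT _ h2)
    simpa using this
  · rintro k p ⟨x, v⟩ ⟨hx, hv⟩
    obtain ⟨f, hf, g, hg, hl⟩ := h'.split k p v hv
    have hx' : x - a f - c (a g) ∈ W k := sub_mem (sub_mem hx (ha _ _ hf.2))
      (h.c_W _ _ (ha _ _ hg.2))
    obtain ⟨f', hf', g', hg', hl'⟩ := h.split k p _ hx'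
    refine ⟨(a f + f', f), ⟨⟨by simpa using hf'.1, hf.1⟩, add_mem (ha _ _ hf.2) hf'.2, hf.2⟩,
      (a g + g', g), ⟨⟨by simpa using hg'.1, hg.1⟩, add_mem (ha _ _ hg.2) hg'.2, hg.2⟩, ?_, ?_⟩
    · rw [hC]; change _ ∈ W (k - 1); convert hl' using 1; simp only [Prod.fst_sub, map_add]; abel
    · rw [hC]; exact hl
  · rintro k p ⟨x, v⟩ ⟨y, w⟩ ⟨⟨hx1, hx2⟩, hx3, hx4⟩ ⟨⟨hy1, hy2⟩, hy3, hy4⟩ ⟨hd1, hd2⟩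
    rw [hC] at hd1 hd2
    simp only [Prod.fst_sub, Prod.snd_sub] at hd1 hd2
    have hv := h'.disj k p v w ⟨hx2, hx4⟩ ⟨hy2, hy4⟩ hd2
    have hw : w ∈ W' (k - 1) := by have := h'.c_W _ _ (sub_mem hv hd2); simpa [h'.cc] using this
    refine ⟨?_, hv⟩
    have := h.disj k p (x - a v) (y - a w) ⟨hx1, sub_mem hx3 (ha _ _ hx4)⟩
      ⟨hy1, sub_mem hy3 (ha _ _ hy4)⟩ (by
        have : x - a v - c (y - a w) = (x - c y) - a v + c (a w) := by rw [map_sub]; abel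
        rw [this]
        exact add_mem (sub_mem hd1 (ha _ _ hv)) (h.c_W _ _ (ha _ _ hw)))
    have := add_mem this (ha _ _ hv)
    simpa using this

/-- Transport of a mixed Hodge structure on `T / B` to a space `V`, presented as a quotient of a
space `Y` identified with `T`. -/
theorem transport {Y V : Type*} [AddCommGroup Y] [Module ℂ Y] [AddCommGroup V] [Module ℂ V]
    {cY : Y → Y} {cV : V →ₛₗ[starRingEnd ℂ] V} (h : CMHS c B T W F) (ι : Y →ₗ[ℂ] X)
    (π : Y →ₗ[ℂ] V) (hι : ∀ y, ι (cY y) = c (ι y)) (hπ : ∀ y, π (cY y) = cV (π y))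
    (hcV : ∀ v, cV (cV v) = v) {T' : Submodule ℂ V} (hT' : (T.comap ι).map π = T')
    (hT : T ≤ range ι) (hker : ∀ y, ι y ∈ B ↔ π y = 0) :
    CMHS cV ⊥ T' (fun k => ((W k).comap ι).map π) (fun p => ((F p).comap ι).map π) := by
  have hmem : ∀ S : Submodule ℂ X, B ≤ S → ∀ y, π y ∈ (S.comap ι).map π ↔ ι y ∈ S := by
    intro S hS y
    refine ⟨fun ⟨z, hz, hzy⟩ => ?_, fun hy => ⟨y, hy, rfl⟩⟩
    have : ι (z - y) ∈ B := (hker _).2 (by rw [map_sub, hzy, sub_self])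
    have h2 := sub_mem hz (hS this)
    simpa using h2
  have hbot : (B.comap ι).map π = ⊥ := by
    refine le_antisymm ?_ bot_le
    rintro _ ⟨y, hy, rfl⟩
    exact (hker y).1 hy
  subst hT'
  refine ⟨hcV, fun k l hkl => Submodule.map_mono (comap_mono (h.W_mono hkl)), ?_, ?_,
    fun _ => bot_le, fun k => Submodule.map_mono (comap_mono (h.W_le k)), ?_,
    fun k l hkl => Submodule.map_mono (comap_mono (h.F_anti hkl)), ?_, ?_,
    fun _ => bot_le, fun k => Submodule.map_mono (comap_mono (h.F_le k)), ?_, ?_⟩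
  · exact h.W_bot.imp fun _ e => by rw [e, hbot]
  · exact h.W_top.imp fun _ e => by rw [e]
  · rintro k _ ⟨y, hy, rfl⟩
    exact ⟨cY y, by rw [SetLike.mem_coe, mem_comap, hι]; exact h.c_W _ _ hy, hπ y⟩
  · exact h.F_top.imp fun _ e => by rw [e]
  · exact h.F_bot.imp fun _ e => by rw [e, hbot]
  · rintro k p _ ⟨y, hy, rfl⟩
    obtain ⟨f, hf, g, hg, hl⟩ := h.split k p _ hy
    obtain ⟨f', rfl⟩ : f ∈ range ι := hT (h.F_le _ hf.1)
    obtain ⟨g', rfl⟩ : g ∈ range ι := hT (h.F_le _ hg.1)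
    refine ⟨π f', ⟨⟨f', hf.1, rfl⟩, f', hf.2, rfl⟩, π g', ⟨⟨g', hg.1, rfl⟩, g', hg.2, rfl⟩,
      y - f' - cY g', ?_, by rw [map_sub, map_sub, hπ]⟩
    rw [SetLike.mem_coe, mem_comap, map_sub, map_sub, hι]
    exact hl
  · rintro k p _ _ ⟨⟨x, hx, rfl⟩, hx'⟩ ⟨⟨y, hy, rfl⟩, hy'⟩ hxy
    rw [← hπ, ← map_sub] at hxy
    rw [SetLike.mem_coe, hmem _ (h.B_le_W _)] at hx' hy'
    rw [hmem _ (h.B_le_W _), map_sub, hι] at hxy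
    rw [hmem _ (h.B_le_W _)]
    exact h.disj k p _ _ ⟨hx, hx'⟩ ⟨hy, hy'⟩ hxy

theorem map_injective (h : CMHS c ⊥ T W F) {f : X →ₗ[ℂ] X'} (hf : Function.Injective f)
    (hfc : ∀ x, f (c x) = c' (f x)) (hcc : ∀ x, c' (c' x) = x) :
    CMHS c' ⊥ (T.map f) (fun k => (W k).map f) (fun p => (F p).map f) := by
  simpa only [Submodule.comap_id] using h.transport LinearMap.id f (fun _ => rfl) hfc hcc
    (by rw [Submodule.comap_id]) (by simp) fun y => (map_eq_zero_iff f hf).symm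

end Functoriality

end CMHS

section Subquotient

variable {V : Type*} [AddCommGroup V] [Module ℚ V] (T B : Submodule ℚ V)

theorem range_subtype_baseChange : range (T.subtypeˆ) = Tˆ := by
  rw [LinearMap.range_eq_map, ← baseChange_top, ← baseChange_map, Submodule.map_top,
    Submodule.range_subtype]

theorem subtype_baseChange_mem_iff (y : ℂ ⊗[ℚ] T) :
    T.subtypeˆ y ∈ Bˆ ↔ (B.submoduleOf T).mkQˆ y = 0 := by
  rw [← LinearMap.mem_ker, ← baseChange_ker, Submodule.ker_mkQ, Submodule.submoduleOf,
    ← mem_comap, baseChange_comap]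

theorem mkQ_baseChange_surjective (U : Submodule ℚ V) : Function.Surjective (U.mkQˆ) := by
  rw [← LinearMap.range_eq_top, LinearMap.range_eq_map, ← baseChange_top,
    ← baseChange_map, Submodule.map_top, Submodule.range_mkQ, baseChange_top]

theorem subtype_baseChange_injective : Function.Injective (T.subtypeˆ) := by
  rw [← ker_eq_bot, ← baseChange_ker, Submodule.ker_subtype, baseChange_bot]

end Subquotient

namespace CMHS

section Rational

variable {V : Type*} [AddCommGroup V] [Module ℚ V] {W : ℤ → Submodule ℚ V}
  {F : ℤ → Submodule ℂ (ℂ ⊗[ℚ] V)}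

theorem isFiniteMHS [Module.Finite ℚ V]
    (h : CMHS (conjTensor V) ⊥ ⊤ (fun k => (W k)ˆ) F) : IsFiniteMHS V W F := by
  have hbc : ∀ {S S' : Submodule ℚ V}, Sˆ = S'ˆ → S = S' := fun h =>
    le_antisymm (baseChange_le_baseChange.1 h.le) (baseChange_le_baseChange.1 h.ge)
  refine ⟨inferInstance, fun k l hkl => baseChange_le_baseChange.1 (h.W_mono hkl), ?_, ?_,
    h.F_anti, h.F_top, h.F_bot, fun w => ?_⟩
  · obtain ⟨a, ha⟩ := h.W_bot; exact ⟨a, hbc (by rw [ha, baseChange_bot])⟩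
  · obtain ⟨a, ha⟩ := h.W_top; exact ⟨a, hbc (by rw [ha, baseChange_top])⟩
  have hr := range_subtype_baseChange (W w)
  have hk := subtype_baseChange_mem_iff (W w) (W (w - 1))
  have hs := mkQ_baseChange_surjective ((W (w - 1)).submoduleOf (W w))
  refine ⟨fun p q hpq => Submodule.map_mono (comap_mono (h.F_anti hpq)), ?_, ?_, ?_⟩
  · obtain ⟨a, ha⟩ := h.F_top
    refine ⟨a, ?_⟩
    rw [grF, ha, Submodule.comap_top, Submodule.map_top, LinearMap.range_eq_top.2 hs]
  · obtain ⟨a, ha⟩ := h.F_bot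
    refine ⟨a, ?_⟩
    rw [grF, ha, ← LinearMap.ker, LinearMap.ker_eq_bot.2 (subtype_baseChange_injective _),
      Submodule.map_bot]
  · intro q
    rw [isCompl_iff, disjoint_iff, codisjoint_iff]
    constructor
    · refine le_antisymm ?_ bot_le
      rintro _ ⟨⟨x, hx, rfl⟩, y, hy, hxy⟩
      rw [mem_bot, ← hk]
      refine h.disj w q _ ((W w).subtypeˆ y) ⟨hx, hr ▸ ⟨x, rfl⟩⟩ ⟨hy, hr ▸ ⟨y, rfl⟩⟩ ?_
      rw [conjTensor_baseChange, ← map_sub, hk, map_sub, ← conjTensor_baseChange, hxy,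
        conjTensor_conjTensor, sub_self]
    · refine le_antisymm le_top fun v _ => ?_
      obtain ⟨x, rfl⟩ := hs v
      obtain ⟨f, hf, g, hg, hl⟩ := h.split w q ((W w).subtypeˆ x) (hr ▸ ⟨x, rfl⟩)
      obtain ⟨f', rfl⟩ : f ∈ range ((W w).subtypeˆ) := hr ▸ hf.2
      obtain ⟨g', rfl⟩ : g ∈ range ((W w).subtypeˆ) := hr ▸ hg.2
      rw [conjTensor_baseChange, ← map_sub, ← map_sub, hk, map_sub, map_sub, sub_sub,
        sub_eq_zero] at hl
      rw [hl]
      refine add_mem_sup ⟨f', hf.1, rfl⟩ ?_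
      refine ⟨g', hg.1, ?_⟩
      rw [← conjTensor_baseChange]
      exact (conjTensor_conjTensor _).symm

theorem restrict {U : Submodule ℚ V} (h : CMHS (conjTensor V) ⊥ (Uˆ)
    (fun k => (W k)ˆ ⊓ Uˆ) (fun q => F q ⊓ Uˆ)) :
    CMHS (conjTensor U) ⊥ ⊤ (fun k => ((W k).comap U.subtype)ˆ)
      (fun q => (F q).comap (U.subtypeˆ)) := by
  have := h.transport (cY := conjTensor U) (U.subtypeˆ) LinearMap.id
    (fun y => (conjTensor_baseChange _ _).symm) (fun y => rfl) conjTensor_conjTensor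
    (top_le_iff.1 fun y _ => ⟨y, (range_subtype_baseChange U).le ⟨y, rfl⟩, rfl⟩)
    (range_subtype_baseChange U).ge (fun y => by
      rw [mem_bot, ← LinearMap.map_zero (U.subtypeˆ), (subtype_baseChange_injective U).eq_iff]; rfl)
  have hU : ∀ S : Submodule ℂ (ℂ ⊗[ℚ] V), Submodule.map LinearMap.id
      (Submodule.comap (U.subtypeˆ) (S ⊓ Uˆ)) =
      S.comap (U.subtypeˆ) := by
    intro S
    rw [Submodule.map_id, Submodule.comap_inf, inf_eq_left, ← range_subtype_baseChange]
    exact fun y _ => ⟨y, rfl⟩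
  simpa only [hU, baseChange_comap] using this

theorem subquotient {T B : Submodule ℚ V} (h : CMHS (conjTensor V) (Bˆ) (Tˆ) (fun k => (W k)ˆ) F) :
    CMHS (conjTensor (↥T ⧸ B.submoduleOf T)) ⊥ ⊤
      (fun k => (((W k).comap T.subtype).map (B.submoduleOf T).mkQ)ˆ)
      (fun q => ((F q).comap (T.subtypeˆ)).map ((B.submoduleOf T).mkQˆ)) := by
  have := h.transport (cY := conjTensor T) (T.subtypeˆ) ((B.submoduleOf T).mkQˆ)
    (fun y => (conjTensor_baseChange _ _).symm) (fun y => (conjTensor_baseChange _ _).symm)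
    conjTensor_conjTensor (top_le_iff.1 fun v _ => by
      obtain ⟨y, hy⟩ := mkQ_baseChange_surjective _ v
      exact ⟨y, (range_subtype_baseChange T).le ⟨y, rfl⟩, hy⟩) (range_subtype_baseChange T).ge
    (subtype_baseChange_mem_iff T B)
  simpa only [baseChange_map, baseChange_comap] using this

end Rational

section Basis

open Module

/-- A basis adapted to Deligne's bigrading. -/
theorem exists_typed_basis {X : Type*} [AddCommGroup X] [Module ℂ X] [Module.Finite ℂ X]
    {c : X →ₛₗ[starRingEnd ℂ] X} {W F : ℤ → Submodule ℂ X} (h : CMHS c ⊥ ⊤ W F) :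
    ∃ (b : Basis (Fin (finrank ℂ X)) ℂ X) (τ : Fin (finrank ℂ X) → ℤ × ℤ),
      (∀ i, b i ∈ Iu c W F (τ i)) ∧
      ∀ P : ℤ × ℤ → Prop, part (Iu c W F) P = span ℂ (b '' {i | P (τ i)}) := by
  classical
  have hind : iSupIndep (Iu c W F) := by
    rw [iSupIndep_iff_finsetSum_eq_zero_imp_eq_zero]
    intro s v hv hs γ hγ
    have := h.gind (Finsupp.onFinset s (fun γ => if γ ∈ s then v γ else 0)
      (fun γ hγ => by by_contra hc; simp [hc] at hγ)) (fun γ => by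
        rw [Finsupp.onFinset_apply]
        split_ifs with hc
        · exact hv _ hc
        · exact zero_mem _) (by
        rw [Finsupp.onFinset_sum _ (fun _ => rfl), Finset.sum_congr rfl fun γ hγ => if_pos hγ, hs]
        exact zero_mem _) γ
    simpa [hγ] using this
  have htop : iSup (Iu c W F) = ⊤ := by
    refine le_antisymm le_top ?_
    conv_lhs => rw [h.T_eq]
    exact part_le fun γ _ => le_iSup _ γ
  have hint := DirectSum.isInternal_submodule_of_iSupIndep_of_iSup_eq_top hind htop
  set b0 := hint.collectedBasis fun γ => Basis.ofVectorSpace ℂ (Iu c W F γ)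
  have : Finite ((γ : ℤ × ℤ) × Basis.ofVectorSpaceIndex ℂ (Iu c W F γ)) :=
    Module.Finite.finite_basis b0
  have := Fintype.ofFinite ((γ : ℤ × ℤ) × Basis.ofVectorSpaceIndex ℂ (Iu c W F γ))
  set e := Fintype.equivFinOfCardEq (finrank_eq_card_basis b0).symm
  have hb : ∀ i, (b0.reindex e) i ∈ Iu c W F (e.symm i).1 := fun i => by
    rw [Basis.reindex_apply]
    exact hint.collectedBasis_mem _ _
  refine ⟨b0.reindex e, fun i => (e.symm i).1, hb, fun P => le_antisymm ?_ ?_⟩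
  · refine part_le fun γ hγ x hx => ?_
    set b := b0.reindex e
    set g : ℤ × ℤ →₀ X := ∑ i, Finsupp.single (e.symm i).1 (b.repr x i • b i)
    have hg : ∀ δ, g δ = ∑ i, if (e.symm i).1 = δ then b.repr x i • b i else 0 := fun δ => by
      simp only [g, Finsupp.finsetSum_apply, Finsupp.single_apply]
    have hgs : (g.sum fun _ x => x) = x := by
      have : (g.sum fun _ x => x) = Finsupp.lsum ℂ (fun _ => (LinearMap.id : X →ₗ[ℂ] X)) g := rfl
      rw [this, map_sum]
      simp [b.sum_repr x]
    have h1 := h.gind (g - Finsupp.single γ x) (fun δ => by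
      refine sub_mem ?_ ?_
      · rw [hg]
        refine sum_mem fun i _ => ?_
        split_ifs with hi
        · rw [← hi]; exact smul_mem _ _ (hb i)
        · exact zero_mem _
      · rw [Finsupp.single_apply]
        split_ifs with hδ
        · rw [← hδ]; exact hx
        · exact zero_mem _) (by
      rw [Finsupp.sum_sub_index (fun _ _ _ => rfl), hgs, Finsupp.sum_single_index rfl, sub_self]
      exact zero_mem _) γ
    rw [mem_bot, Finsupp.sub_apply, Finsupp.single_eq_same, sub_eq_zero] at h1
    rw [← h1, hg]
    refine sum_mem fun i _ => ?_
    split_ifs with hi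
    · exact smul_mem _ _ (subset_span ⟨i, by simpa [hi] using hγ, rfl⟩)
    · exact zero_mem _
  · rw [span_le]; rintro _ ⟨i, hi, rfl⟩; exact le_part (J := Iu c W F) (P := P) hi (hb i)

/-- A basis adapted to a finite filtration. -/
theorem exists_adapted_basis {k V : Type*} [Field k] [AddCommGroup V] [Module k V]
    [Module.Finite k V] {W : ℤ → Submodule k V} (hW : Monotone W) (h1 : ∃ a, W a = ⊥)
    (h2 : ∃ a, W a = ⊤) :
    ∃ (b : Basis (Fin (finrank k V)) k V) (w : Fin (finrank k V) → ℤ),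
      (∀ i, b i ∈ W (w i)) ∧ ∀ l, W l = span k (b '' {i | w i ≤ l}) := by
  classical
  obtain ⟨a, ha⟩ := h1
  have key : ∀ m : ℕ, ∃ s : Set V, LinearIndepOn k id s ∧ s ⊆ W (a + m) ∧
      ∀ l ≤ a + (m : ℤ), W l ≤ span k (s ∩ W l) := by
    intro m
    induction m with
    | zero =>
      refine ⟨∅, linearIndepOn_empty k id, Set.empty_subset _, fun l hl => ?_⟩
      have : W l ≤ W a := hW (by simpa using hl)
      rw [ha] at this
      exact this.trans bot_le
    | succ m ih =>
      obtain ⟨s, hs, hsW, hl⟩ := ih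
      obtain ⟨b, hbW, hsb, hspan, hb⟩ := exists_linearIndepOn_id_extension hs
        (hsW.trans (hW (by push_cast; omega) : W (a + m) ≤ W (a + (m + 1 : ℕ))))
      refine ⟨b, hb, hbW, fun l hlm => ?_⟩
      rcases lt_or_eq_of_le hlm with h | h
      · exact (hl l (by push_cast at h; omega)).trans
          (Submodule.span_mono (Set.inter_subset_inter_left _ hsb))
      · rw [h, Set.inter_eq_left.2 hbW]; exact hspan
  obtain ⟨t, ht⟩ := h2
  obtain ⟨s, hs, -, hl⟩ := key (t - a).toNat
  have hl' : ∀ l, W l = span k (s ∩ W l) := by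
    intro l
    refine le_antisymm ?_ (span_le.2 Set.inter_subset_right)
    rcases le_total l (a + ((t - a).toNat : ℤ)) with h | h
    · exact hl l h
    · have e1 : W t ≤ W l := hW (by omega)
      have e2 := hl _ le_rfl
      have e3 : W (a + ((t - a).toNat : ℤ)) = ⊤ := le_antisymm le_top (ht ▸ hW (by omega))
      rw [e3] at e2
      exact le_top.trans (e2.trans (Submodule.span_mono fun x hx => ⟨hx.1, e1 (ht ▸ trivial)⟩))
  have hspan : ⊤ ≤ span k (Set.range ((↑) : s → V)) := by
    rw [Subtype.range_coe, ← ht, hl' t]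
    exact Submodule.span_mono Set.inter_subset_left
  set b0 : Basis s k V := Basis.mk hs.linearIndependent hspan
  have : Finite s := Module.Finite.finite_basis b0
  have := Fintype.ofFinite s
  set e := Fintype.equivFinOfCardEq (finrank_eq_card_basis b0).symm
  have hex : ∀ x : s, ∃ l, (x : V) ∈ W l ∧ ∀ l', (x : V) ∈ W l' → l ≤ l' := by
    intro x
    refine Int.exists_least_of_bdd (P := fun l => (x : V) ∈ W l) ⟨a, fun l hx => ?_⟩
      ⟨t, ht ▸ trivial⟩
    by_contra hlt
    have : (x : V) ∈ W a := hW (by omega) hx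
    rw [ha, mem_bot] at this
    exact hs.ne_zero x.2 this
  choose w hw1 hw2 using hex
  refine ⟨b0.reindex e, fun i => w (e.symm i), fun i => ?_, fun l => ?_⟩
  · rw [Basis.reindex_apply, Basis.mk_apply]; exact hw1 _
  · rw [hl' l]
    congr 1
    ext x
    constructor
    · rintro ⟨hx, hxl⟩; exact ⟨e ⟨x, hx⟩, by simpa using hw2 ⟨x, hx⟩ l hxl, by simp [b0]⟩
    · rintro ⟨i, hi, rfl⟩
      rw [Basis.reindex_apply, Basis.mk_apply]
      exact ⟨(e.symm i).2, hW hi (hw1 _)⟩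

end Basis

end CMHS

/-! ## The zig-zag -/

namespace ZVertex

variable {m : ℕ}

@[simp] theorem two_last : (two (Fin.last (m + 1)) : ZVertex m) = right := by
  rw [two, ← Fin.succ_last, Fin.cons_succ, Fin.snoc_last]

theorem two_even (i : Fin m) : (two i.castSucc.succ : ZVertex m) = even i := by
  rw [two, Fin.cons_succ, Fin.snoc_castSucc]

theorem two_ne_odd (i : Fin (m + 2)) (j : Fin (m + 1)) : (two i : ZVertex m) ≠ odd j := by
  induction i using Fin.cases with
  | zero => exact fun h => nomatch (h : left = odd j)
  | succ i =>
    induction i using Fin.lastCases with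
    | last => rw [Fin.succ_last, two_last]; simp
    | cast i => rw [two_even]; simp

theorem two_injective : Function.Injective (two : Fin (m + 2) → ZVertex m) := by
  refine Fin.cons_injective_iff.2 ⟨?_, Fin.snoc_injective_iff.2 ⟨fun _ _ h => by cases h; rfl, ?_⟩⟩
  · rintro ⟨i, h⟩; induction i using Fin.lastCases <;> simp at h
  · rintro ⟨i, h⟩
    cases h

theorem eq_two_or_odd (v : ZVertex m) : (∃ j, two j = v) ∨ ∃ i, odd i = v := by
  cases v with
  | left => exact .inl ⟨0, rfl⟩
  | even i => exact .inl ⟨_, two_even i⟩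
  | odd i => exact .inr ⟨i, rfl⟩
  | right => exact .inl ⟨_, two_last⟩

theorem zigzag_induction {P : ZVertex m → Prop} (h0 : P left)
    (h : ∀ u : ZArrow m, P u.src ↔ P u.tgt) : ∀ v, P v := by
  have key : ∀ i : Fin (m + 2), P (two i) := by
    intro i
    induction i using Fin.induction with
    | zero => exact h0
    | succ i ih => exact (h (i, true)).2 ((h (i, false)).1 ih)
  intro v
  cases v with
  | left => exact h0
  | even i => rw [← two_even]; exact key _
  | odd i => exact (h (i, false)).1 (key _)
  | right => rw [← two_last]; exact key _

section Family

variable {X : ZVertex m → Type*} {R : ∀ u : ZArrow m, X u.src → X u.tgt → Prop}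

theorem exists_family_of_two (y : ∀ j, X (two j))
    (hy : ∀ i, ∃ b : X (odd i), R (i, false) (y i.castSucc) b ∧ R (i, true) (y i.succ) b) :
    ∃ z : ∀ v, X v, (∀ j, z (two j) = y j) ∧ ∀ u : ZArrow m, R u (z u.src) (z u.tgt) := by
  choose b hb using hy
  have : ∀ v, ∃ t : X v, (∀ j (h : two j = v), t = h ▸ y j) ∧ ∀ i (h : odd i = v), t = h ▸ b i := by
    intro v
    obtain ⟨j, rfl⟩ | ⟨i, rfl⟩ := eq_two_or_odd v
    · exact ⟨y j, fun j' h => by obtain rfl := two_injective h; rfl,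
        fun i h => (two_ne_odd _ _ h.symm).elim⟩
    · exact ⟨b i, fun j h => (two_ne_odd _ _ h).elim, fun i' h => by cases h; rfl⟩
  choose z h1 h2 using this
  have e1 : ∀ j, z (two j) = y j := fun j => h1 _ j rfl
  have e2 : ∀ i, z (odd i) = b i := fun i => h2 _ i rfl
  refine ⟨z, e1, ?_⟩
  rintro ⟨i, _ | _⟩
  · change R (i, false) (z (two _)) (z (odd i)); rw [e1, e2]; exact (hb i).1
  · change R (i, true) (z (two _)) (z (odd i)); rw [e1, e2]; exact (hb i).2

theorem exists_family_left (fw : ∀ u a, ∃ b, R u a b) (bw : ∀ u b, ∃ a, R u a b) (x : X left) :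
    ∃ z : ∀ v, X v, z left = x ∧ ∀ u : ZArrow m, R u (z u.src) (z u.tgt) := by
  have h : ∀ i a, ∃ a', ∃ b, R (i, false) a b ∧ R (i, true) a' b := fun i a => by
    obtain ⟨b, hb⟩ := fw (i, false) a
    obtain ⟨a', ha⟩ := bw (i, true) b
    exact ⟨a', b, hb, ha⟩
  choose f hf using h
  obtain ⟨z, h1, h2⟩ := exists_family_of_two (R := R)
    (Fin.induction (motive := fun j => X (two j)) x f) fun i => hf i _
  exact ⟨z, h1 0, h2⟩

theorem exists_family_right (fw : ∀ u a, ∃ b, R u a b) (bw : ∀ u b, ∃ a, R u a b) :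
    ∀ x : X right, ∃ z : ∀ v, X v, z right = x ∧ ∀ u : ZArrow m, R u (z u.src) (z u.tgt) := by
  have h : ∀ i a', ∃ a, ∃ b, R (i, false) a b ∧ R (i, true) a' b := fun i a' => by
    obtain ⟨b, hb⟩ := fw (i, true) a'
    obtain ⟨a, ha⟩ := bw (i, false) b
    exact ⟨a, b, ha, hb⟩
  choose f hf using h
  rw [← two_last]
  intro x
  obtain ⟨z, h1, h2⟩ := exists_family_of_two (R := R)
    (Fin.reverseInduction (motive := fun j => X (two j)) x f) fun i => by
      rw [Fin.reverseInduction_castSucc]; exact hf i _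
  exact ⟨z, (h1 _).trans (Fin.reverseInduction_last ..), h2⟩

end Family

end ZVertex

/-! ## Pure Hodge structures -/

namespace IsPureHodge

variable {V : Type*} [AddCommGroup V] [Module ℚ V] {F : ℤ → Submodule ℂ (ℂ ⊗[ℚ] V)} {w : ℤ}

theorem eq_zero (h : IsPureHodge V F w) {p q : ℤ} (hpq : w + 1 ≤ p + q) {x y : ℂ ⊗[ℚ] V}
    (hx : x ∈ F p) (hy : y ∈ F q) (hxy : x = conjTensor V y) : x = 0 := by
  have := (h.isCompl p).disjoint
  rw [Submodule.disjoint_def] at this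
  refine this x hx ?_
  change conjTensor V x ∈ F (w + 1 - p)
  rw [hxy, conjTensor_conjTensor]
  exact h.anti (by omega) hy

theorem exists_split (h : IsPureHodge V F w) (p : ℤ) (x : ℂ ⊗[ℚ] V) :
    ∃ f ∈ F p, ∃ g ∈ F (w + 1 - p), x = f + conjTensor V g := by
  have hx : x ∈ F p ⊔ conjSub (F (w + 1 - p)) := by rw [(h.isCompl p).sup_eq_top]; trivial
  obtain ⟨f, hf, g, hg, rfl⟩ := mem_sup.1 hx
  exact ⟨f, hf, conjTensor V g, hg, by rw [conjTensor_conjTensor]⟩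

variable {V' : Type*} [AddCommGroup V'] [Module ℚ V'] {F' : ℤ → Submodule ℂ (ℂ ⊗[ℚ] V')} {w' : ℤ}

theorem exists_strict (h : IsPureHodge V F w) (h' : IsPureHodge V' F' w)
    {f : (ℂ ⊗[ℚ] V) →ₗ[ℂ] (ℂ ⊗[ℚ] V')} (hc : ∀ x, f (conjTensor V x) = conjTensor V' (f x))
    (hF : ∀ p, ∀ x ∈ F p, f x ∈ F' p) {p : ℤ} {x : ℂ ⊗[ℚ] V} (hx : f x ∈ F' p) :
    ∃ y ∈ F p, f y = f x := by
  obtain ⟨a, ha, b, hb, rfl⟩ := h.exists_split p x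
  refine ⟨a, ha, ?_⟩
  rw [map_add, hc] at hx ⊢
  have := h'.eq_zero (p := p) (q := w + 1 - p) (by omega)
    (by simpa using sub_mem hx (hF p a ha)) (hF _ b hb) rfl
  rw [this, add_zero]

theorem mem_range (h : IsPureHodge V F w) (h' : IsPureHodge V' F' w)
    {f : (ℂ ⊗[ℚ] V) →ₗ[ℂ] (ℂ ⊗[ℚ] V')} (hc : ∀ x, f (conjTensor V x) = conjTensor V' (f x))
    (hF : ∀ p, ∀ x ∈ F p, f x ∈ F' p) {p q : ℤ} (hpq : w + 1 ≤ p + q) {x y : ℂ ⊗[ℚ] V'}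
    (hx : x ∈ F' p) (hy : y ∈ F' q) (hxy : x - conjTensor V' y ∈ range f) :
    x ∈ range f := by
  obtain ⟨t, ht⟩ := hxy
  obtain ⟨a, ha, b, hb, rfl⟩ := h.exists_split p t
  rw [map_add, hc] at ht
  have := h'.eq_zero (p := p) (q := w + 1 - p) (x := x - f a)
    (y := f b + y) (by omega) (sub_mem hx (hF _ _ ha))
    (add_mem (hF _ _ hb) (h'.anti (by omega) hy)) (by
      rw [map_add, sub_eq_iff_eq_add, add_right_comm, add_comm _ (f a), ht, sub_add_cancel])
  exact ⟨a, (sub_eq_zero.1 this).symm⟩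

theorem exists_split_ker (h : IsPureHodge V F w) (h' : IsPureHodge V' F' w)
    {f : (ℂ ⊗[ℚ] V) →ₗ[ℂ] (ℂ ⊗[ℚ] V')} (hc : ∀ x, f (conjTensor V x) = conjTensor V' (f x))
    (hF : ∀ p, ∀ x ∈ F p, f x ∈ F' p) {x : ℂ ⊗[ℚ] V} (hx : f x = 0) (p : ℤ) :
    ∃ a ∈ F p, ∃ b ∈ F (w + 1 - p), f a = 0 ∧ f b = 0 ∧ x = a + conjTensor V b := by
  obtain ⟨a, ha, b, hb, rfl⟩ := h.exists_split p x
  rw [map_add, hc] at hx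
  have h1 := h'.eq_zero (p := p) (q := w + 1 - p) (x := f a) (y := - f b) (by omega)
    (hF _ _ ha) (neg_mem (hF _ _ hb)) (by rw [map_neg]; exact eq_neg_of_add_eq_zero_left hx)
  refine ⟨a, ha, b, hb, h1, ?_, rfl⟩
  rw [h1, zero_add] at hx
  have := congrArg (conjTensor V') hx
  rwa [conjTensor_conjTensor, map_zero] at this

/-- A relation from the kernel of a morphism of pure Hodge structures to the cokernel of a morphism
of pure Hodge structures of smaller weight vanishes if it is compatible with the conjugations and
the Hodge filtrations. -/
theorem relation_eq_zero (h : IsPureHodge V F w)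
    {V1 : Type*} [AddCommGroup V1] [Module ℚ V1] {F1 : ℤ → Submodule ℂ (ℂ ⊗[ℚ] V1)}
    (h1 : IsPureHodge V1 F1 w)
    {g : (ℂ ⊗[ℚ] V) →ₗ[ℂ] (ℂ ⊗[ℚ] V1)} (hgc : ∀ x, g (conjTensor V x) = conjTensor V1 (g x))
    (hgF : ∀ p, ∀ x ∈ F p, g x ∈ F1 p)
    (h' : IsPureHodge V' F' w')
    {V2 : Type*} [AddCommGroup V2] [Module ℚ V2] {F2 : ℤ → Submodule ℂ (ℂ ⊗[ℚ] V2)}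
    (h2 : IsPureHodge V2 F2 w')
    {f : (ℂ ⊗[ℚ] V2) →ₗ[ℂ] (ℂ ⊗[ℚ] V')} (hc : ∀ x, f (conjTensor V2 x) = conjTensor V' (f x))
    (hF : ∀ p, ∀ x ∈ F2 p, f x ∈ F' p)
    (hw : w' < w) {Γ : (ℂ ⊗[ℚ] V) → (ℂ ⊗[ℚ] V') → Prop}
    (hadd : ∀ x y x' y', Γ x y → Γ x' y' → Γ (x + x') (y + y'))
    (hneg : ∀ x y, Γ x y → Γ (-x) (-y))
    (hconj : ∀ x y, Γ x y → Γ (conjTensor V x) (conjTensor V' y))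
    (hzero : ∀ y, Γ 0 y → y ∈ range f)
    (hlift : ∀ p x, x ∈ F p → g x = 0 → ∃ y ∈ F' p, Γ x y)
    {x : ℂ ⊗[ℚ] V} {y : ℂ ⊗[ℚ] V'} (hxy : Γ x y) (hx : g x = 0) : y ∈ range f := by
  have hsub : ∀ x y y', Γ x y → Γ x y' → y - y' ∈ range f := fun x y y' h1 h2 =>
    hzero _ (by simpa [sub_eq_add_neg] using hadd _ _ _ _ h1 (hneg _ _ h2))
  have hsplit : ∀ p, ∀ x ∈ F p, x ∈ conjSub (F (w - p)) → g x = 0 →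
      ∀ y, Γ x y → y ∈ range f := by
    intro p x hx hxc hgx y hxy
    obtain ⟨y1, hy1, hxy1⟩ := hlift p x hx hgx
    obtain ⟨y2, hy2, hxy2⟩ := hlift (w - p) (conjTensor V x) hxc (by rw [hgc, hgx, map_zero])
    have hxy2' := hconj _ _ hxy2
    rw [conjTensor_conjTensor] at hxy2'
    have := h2.mem_range h' hc hF (p := p) (q := w - p) (by omega) hy1 hy2 (hsub _ _ _ hxy1 hxy2')
    have h3 := add_mem (hsub _ _ _ hxy hxy1) this
    simpa using h3
  obtain ⟨a, ha⟩ := h.exists_top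
  obtain ⟨b, hb⟩ := h.exists_bot
  have key : ∀ k : ℕ, ∀ p, b - p ≤ k → ∀ x ∈ F p, g x = 0 → ∀ y, Γ x y → y ∈ range f := by
    intro k
    induction k with
    | zero =>
      intro p hp x hx _ y hxy
      have : x ∈ F b := h.anti (by push_cast at hp; omega) hx
      rw [hb, mem_bot] at this
      exact hzero y (this ▸ hxy)
    | succ k ih =>
      intro p hp x hx hgx y hxy
      obtain ⟨s, hs, t, ht, hgs, hgt, hst⟩ := h.exists_split_ker h1 hgc hgF hgx (p + 1)
      obtain ⟨y1, -, hy1⟩ := hlift _ _ hs hgs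
      have e1 := ih (p + 1) (by push_cast at hp; omega) s hs hgs y1 hy1
      have hxs : Γ (x - s) (y - y1) := by
        simpa [sub_eq_add_neg] using hadd _ _ _ _ hxy (hneg _ _ hy1)
      have hxs' : x - s = conjTensor V t := by rw [hst, add_sub_cancel_left]
      have e2 := hsplit p (x - s) (sub_mem hx (h.anti (by omega) hs)) (by
        change conjTensor V (x - s) ∈ F (w - p)
        rw [hxs', conjTensor_conjTensor]
        have : w + 1 - (p + 1) = w - p := by ring
        rwa [this] at ht) (by rw [map_sub, hgx, hgs, sub_zero]) _ hxs
      have := add_mem e2 e1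
      simpa using this
  exact key (b - a).toNat a (by omega) x (ha ▸ trivial) hx y hxy

end IsPureHodge

section Shift

variable {k X Y : Type*} [Field k] [AddCommGroup X] [Module k X] [AddCommGroup Y] [Module k Y]

theorem shiftDeg_mono {S T : ℕ → Submodule k X} (h : ∀ n, S n ≤ T n) (n : ℕ) :
    shiftDeg S n ≤ shiftDeg T n := by
  cases n with
  | zero => exact le_rfl
  | succ n => exact h n

end Shift

namespace FDGA

variable {k : Type} [Field k] (K : FDGA.{u} k)

theorem Z_zero (p : ℤ) (n : ℕ) : K.Z 0 p n = K.W p n :=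
  inf_eq_left.2 fun x hx => by rw [mem_comap, sub_zero]; exact K.d_W p n x hx

theorem bd_one (p : ℤ) (n : ℕ) : K.bd 1 p n = K.W (p - 1) n ⊔ (shiftDeg (K.W p) n).map K.d := by
  rw [bd]
  have h : (1 : ℤ) - 1 = 0 := rfl
  rw [h, Z_zero, add_sub_cancel_right]
  congr 2
  exact congrArg (fun f => shiftDeg f n) (funext fun n => K.Z_zero p n)

theorem bd_two (p : ℤ) (n : ℕ) :
    K.bd 2 p n = K.Z 1 (p - 1) n ⊔ (shiftDeg (K.Z 1 (p + 1)) n).map K.d := by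
  rw [bd]
  have h : (2 : ℤ) - 1 = 1 := rfl
  have h' : p + 2 - 1 = p + 1 := by ring
  rw [h, h']

theorem shiftDeg_W_le (p : ℤ) (n : ℕ) : shiftDeg (K.W p) n ≤ shiftDeg K.gr n :=
  shiftDeg_mono (K.W_le p) n

theorem coboundaries_le (n : ℕ) : K.coboundaries n ≤ K.cocycles n := by
  rintro _ ⟨x, hx, rfl⟩
  refine ⟨?_, K.d_d x⟩
  cases n with
  | zero => have : x = 0 := hx; rw [this, map_zero]; exact zero_mem _
  | succ n => exact K.d_gr n x hx

theorem d_shiftDeg_W {p : ℤ} {n : ℕ} {x : K} (hx : x ∈ shiftDeg (K.W p) n) : K.d x ∈ K.W p n := by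
  cases n with
  | zero => have : x = 0 := hx; rw [this, map_zero]; exact zero_mem _
  | succ n => exact K.d_W p n x hx

end FDGA

namespace FDGAHom

variable {k : Type} [Field k] {A B : FDGA.{u} k} (f : FDGAHom A B)

theorem IsEQuasiIso.exists_lift {f : FDGAHom A B} (hf : f.IsEQuasiIso 1) {p : ℤ} {n : ℕ}
    {x : B} (hx : x ∈ B.W p n) (hdx : B.d x ∈ B.W (p - 2) (n + 1)) :
    ∃ y ∈ A.W p n, A.d y ∈ A.W (p - 2) (n + 1) ∧ ∃ u ∈ B.Z 1 (p - 1) n,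
      ∃ c ∈ shiftDeg (B.Z 1 (p + 1)) n, f y = x + u + B.d c := by
  obtain ⟨z, hz⟩ := (hf p n).2 (Submodule.Quotient.mk ⟨x, hx, hdx⟩)
  obtain ⟨⟨y, hy⟩, rfl⟩ := Submodule.Quotient.mk_surjective _ z
  have h1 := (Submodule.Quotient.eq _).1 hz
  have h2 : f y - x ∈ B.bd 2 p n := h1
  rw [B.bd_two] at h2
  obtain ⟨u, hu, _, ⟨c, hc, rfl⟩, huc⟩ := mem_sup.1 h2
  exact ⟨y, hy.1, hy.2, u, hu, c, hc, by rw [add_assoc, huc]; abel⟩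

theorem IsEQuasiIso.exists_primitive {f : FDGAHom A B} (hf : f.IsEQuasiIso 1) {p : ℤ} {n : ℕ}
    {x : A} (hx : x ∈ A.W p n) (hdx : A.d x ∈ A.W (p - 2) (n + 1))
    (hfx : f x ∈ B.bd 2 p n) :
    ∃ u ∈ A.Z 1 (p - 1) n, ∃ c ∈ shiftDeg (A.Z 1 (p + 1)) n, x = u + A.d c := by
  have h1 : f.mapE (1 + 1) p n (Submodule.Quotient.mk ⟨x, hx, hdx⟩) = f.mapE (1 + 1) p n 0 := by
    rw [map_zero]
    exact (Submodule.Quotient.mk_eq_zero _).2 hfx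
  have h2 := (hf p n).1 h1
  have h3 : x ∈ A.bd 2 p n := (Submodule.Quotient.mk_eq_zero ((A.bd 2 p n).submoduleOf _)).1 h2
  rw [A.bd_two] at h3
  obtain ⟨u, hu, _, ⟨c, hc, rfl⟩, huc⟩ := mem_sup.1 h3
  exact ⟨u, hu, c, hc, huc.symm⟩

end FDGAHom

namespace HodgeDiagram

variable {m : ℕ} {A : HodgeDiagram.{u} m}

namespace IsMixedHodge

variable (hA : A.IsMixedHodge)

/-- The comparison isomorphisms of the `E_1`-terms. -/
def e (p : ℤ) (n : ℕ) (v : ZVertex m) :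
    (ℂ ⊗[ℚ] A.Q.E 1 p n) ≃ₗ[ℂ] (A.node v).E 1 p n := (hA.pure p n).choose v

/-- The Hodge filtration on the `E_1`-term. -/
def G (p : ℤ) (n : ℕ) (q : ℤ) : Submodule ℂ (ℂ ⊗[ℚ] A.Q.E 1 p n) :=
  (A.F.onE1 p n q).comap (hA.e p n .right).toLinearMap

theorem pureG (p : ℤ) (n : ℕ) : IsPureHodge (A.Q.E 1 p n) (hA.G p n) (p + n) :=
  (hA.pure p n).choose_spec.2.2

/-- The element `x` of `W_p` represents the class `ε` of the `E_1`-term. -/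
def Sym (p : ℤ) (n : ℕ) (v : ZVertex m) (x : A.node v) (ε : ℂ ⊗[ℚ] A.Q.E 1 p n) : Prop :=
  ∃ hx : x ∈ (A.node v).Z 1 p n, hA.e p n v ε = Submodule.Quotient.mk ⟨x, hx⟩

variable {hA} {p : ℤ} {n : ℕ} {v : ZVertex m}

theorem exists_sym {x : A.node v} (hx : x ∈ (A.node v).Z 1 p n) : ∃ ε, hA.Sym p n v x ε :=
  ⟨(hA.e p n v).symm (Submodule.Quotient.mk ⟨x, hx⟩), hx, by simp⟩

theorem exists_of_sym (v : ZVertex m) (ε : ℂ ⊗[ℚ] A.Q.E 1 p n) : ∃ x, hA.Sym p n v x ε := by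
  obtain ⟨⟨x, hx⟩, h⟩ := Submodule.Quotient.mk_surjective _ (hA.e p n v ε)
  exact ⟨x, hx, h.symm⟩

theorem Sym.add {x y : A.node v} {ε η} (hx : hA.Sym p n v x ε) (hy : hA.Sym p n v y η) :
    hA.Sym p n v (x + y) (ε + η) := by
  obtain ⟨hx, h1⟩ := hx
  obtain ⟨hy, h2⟩ := hy
  exact ⟨add_mem hx hy, by rw [map_add, h1, h2]; rfl⟩

theorem Sym.smul {x : A.node v} {ε} (c : ℂ) (hx : hA.Sym p n v x ε) :
    hA.Sym p n v (c • x) (c • ε) := by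
  obtain ⟨hx, h1⟩ := hx
  exact ⟨smul_mem _ c hx, by rw [map_smul, h1]; rfl⟩

theorem Sym.neg {x : A.node v} {ε} (hx : hA.Sym p n v x ε) : hA.Sym p n v (-x) (-ε) := by
  simpa using hx.smul (-1)

theorem Sym.sub {x y : A.node v} {ε η} (hx : hA.Sym p n v x ε) (hy : hA.Sym p n v y η) :
    hA.Sym p n v (x - y) (ε - η) := by
  simpa [sub_eq_add_neg] using hx.add hy.neg

theorem Sym.unique {x : A.node v} {ε η} (hx : hA.Sym p n v x ε)
    (hy : hA.Sym p n v x η) : ε = η := by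
  obtain ⟨hx, h1⟩ := hx
  obtain ⟨hy, h2⟩ := hy
  exact (hA.e p n v).injective (h1.trans h2.symm)

theorem sym_zero_iff {x : A.node v} (hx : x ∈ (A.node v).Z 1 p n) :
    hA.Sym p n v x 0 ↔ ∃ u ∈ (A.node v).W (p - 1) n, ∃ c ∈ shiftDeg ((A.node v).W p) n,
      x = u + (A.node v).d c := by
  have h1 : hA.Sym p n v x 0 ↔ x ∈ (A.node v).bd 1 p n := by
    refine ⟨fun ⟨h, h'⟩ => ?_, fun h => ⟨hx, ?_⟩⟩
    · rw [map_zero] at h'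
      exact (Submodule.Quotient.mk_eq_zero (((A.node v).bd 1 p n).submoduleOf _)).1 h'.symm
    · rw [map_zero]
      exact ((Submodule.Quotient.mk_eq_zero (((A.node v).bd 1 p n).submoduleOf _)).2 h).symm
  rw [h1, FDGA.bd_one, mem_sup]
  constructor
  · rintro ⟨u, hu, _, ⟨c, hc, rfl⟩, h⟩; exact ⟨u, hu, c, hc, h.symm⟩
  · rintro ⟨u, hu, c, hc, h⟩; exact ⟨u, hu, _, ⟨c, hc, rfl⟩, h.symm⟩

theorem W_le_Z {K : FDGA.{u} ℂ} {p : ℤ} {n : ℕ} : K.W (p - 1) n ≤ K.Z 1 p n := fun x hx =>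
  ⟨K.W_mono n (by omega : p - 1 ≤ p) hx, K.d_W _ _ _ hx⟩

theorem sym_zero_of_mem {x : A.node v} (hx : x ∈ (A.node v).W (p - 1) n) : hA.Sym p n v x 0 :=
  (sym_zero_iff (W_le_Z hx)).2 ⟨x, hx, 0, zero_mem _, by simp⟩

theorem sym_zero_of_d {c : A.node v} (hc : c ∈ shiftDeg ((A.node v).W p) n) :
    hA.Sym p n v ((A.node v).d c) 0 :=
  (sym_zero_iff ⟨FDGA.d_shiftDeg_W _ hc, by
    change _ ∈ Submodule.comap _ _; rw [mem_comap, FDGA.d_d]; exact zero_mem _⟩).2 ⟨0, zero_mem _, c, hc, by simp⟩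

theorem Sym.congr {x y : A.node v} {ε} (hx : hA.Sym p n v x ε)
    (hxy : y - x ∈ (A.node v).W (p - 1) n) : hA.Sym p n v y ε := by
  simpa using hx.add (sym_zero_of_mem hxy)

theorem Sym.eq_of_sub_mem {x y : A.node v} {ε η} (hx : hA.Sym p n v x ε)
    (hy : hA.Sym p n v y η) (hxy : x - y ∈ (A.node v).W (p - 1) n) : ε = η :=
  hx.unique (hy.congr hxy)

theorem Sym.map {u : ZArrow m} {x : A.node u.src} {ε} (hx : hA.Sym p n u.src x ε) :
    hA.Sym p n u.tgt (A.φ u x) ε := by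
  obtain ⟨hx, h⟩ := hx
  refine ⟨(A.φ u).map_Z _ _ _ _ hx, ?_⟩
  have := (hA.pure p n).choose_spec.2.1 u ε
  change (A.φ u).mapE 1 p n (hA.e p n u.src ε) = hA.e p n u.tgt ε at this
  rw [← this, h]
  rfl

theorem mem_G_iff {q : ℤ} {ε : ℂ ⊗[ℚ] A.Q.E 1 p n} :
    ε ∈ hA.G p n q ↔ ∃ x ∈ A.F.F q n, hA.Sym p n .right x ε := by
  constructor
  · rintro ⟨⟨x, hx⟩, hxF, h⟩; exact ⟨x, hxF, hx, h.symm⟩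
  · rintro ⟨x, hxF, hx, h⟩; exact ⟨⟨x, hx⟩, hxF, h.symm⟩

theorem sym_toBC {x : A.Q} (hx : x ∈ A.Q.Z 1 p n) :
    hA.Sym p n .left (A.Q.toBC x) (1 ⊗ₜ Submodule.Quotient.mk ⟨x, hx⟩) :=
  ⟨A.Q.toBC_mem_Z 1 p n x hx, (hA.pure p n).choose_spec.1 ⟨x, hx⟩⟩

theorem baseChange_Z (K : FDGA.{u} ℚ) (r p : ℤ) (n : ℕ) : K°.Z r p n = (K.Z r p n)ˆ := by
  change _ = (K.W p n ⊓ (K.W (p - r) (n + 1)).comap K.d)ˆ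
  rw [baseChange_inf, baseChange_comap]
  rfl

theorem left_induction {P : (ℂ ⊗[ℚ] A.Q) → (ℂ ⊗[ℚ] A.Q.E 1 p n) → Prop}
    (h1 : ∀ x (hx : x ∈ A.Q.Z 1 p n), P (1 ⊗ₜ x) (1 ⊗ₜ Submodule.Quotient.mk ⟨x, hx⟩))
    (h2 : ∀ x y ε η, P x ε → P y η → P (x + y) (ε + η))
    (h3 : ∀ (c : ℂ) x ε, P x ε → P (c • x) (c • ε))
    {x : ℂ ⊗[ℚ] A.Q} {ε} (hx : hA.Sym p n .left x ε) : P x ε := by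
  have hxZ : x ∈ (A.Q.Z 1 p n)ˆ := by rw [← baseChange_Z]; exact hx.1
  rw [baseChange_eq_span] at hxZ
  have key : ∀ x ∈ span ℂ ((Submodule.map (TensorProduct.mk ℚ ℂ A.Q 1)
      (A.Q.Z 1 p n) : Submodule ℚ _) : Set (ℂ ⊗[ℚ] A.Q)),
      ∃ ε, hA.Sym p n .left x ε ∧ P x ε := by
    intro x hx
    induction hx using span_induction with
    | mem x hx => obtain ⟨a, ha, rfl⟩ := hx; exact ⟨_, sym_toBC ha, h1 a ha⟩
    | zero => refine ⟨0, sym_zero_of_mem (zero_mem _), ?_⟩; simpa using h3 0 _ _ (h1 0 (zero_mem _))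
    | add x y _ _ hx hy =>
      obtain ⟨ε, hε, hP⟩ := hx
      obtain ⟨η, hη, hQ⟩ := hy
      exact ⟨_, hε.add hη, h2 _ _ _ _ hP hQ⟩
    | smul c x _ hx => obtain ⟨ε, hε, hP⟩ := hx; exact ⟨_, hε.smul c, h3 _ _ _ hP⟩
  obtain ⟨η, hη, hP⟩ := key x hxZ
  exact hx.unique hη ▸ hP

theorem Sym.conj {x : A.node .left} {ε} (hx : hA.Sym p n .left x ε) :
    hA.Sym p n .left (conjTensor A.Q x) (conjTensor _ ε) := by
  refine left_induction (P := fun x ε => hA.Sym p n .left (conjTensor A.Q x)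
    (conjTensor _ ε)) (fun x hx => ?_) (fun x y ε η hx hy => ?_) (fun c x ε hx => ?_) hx
  · rw [conjTensor_tmul, conjTensor_tmul, map_one]; exact sym_toBC hx
  · rw [map_add, map_add]; exact hx.add hy
  · rw [LinearMap.map_smulₛₗ, LinearMap.map_smulₛₗ]; exact hx.smul _

variable (A) in
/-- The differential of the `E_1`-term over `ℚ`. -/
def dE (p : ℤ) (n : ℕ) : A.Q.E 1 p n →ₗ[ℚ] A.Q.E 1 (p - 1) (n + 1) :=
  Submodule.mapQ _ _ (A.Q.d.restrict (p := A.Q.Z 1 p n) (q := A.Q.Z 1 (p - 1) (n + 1))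
    fun x hx => ⟨hx.2, by change _ ∈ Submodule.comap _ _; rw [mem_comap, FDGA.d_d]; exact zero_mem _⟩) (by
  rintro ⟨x, hx⟩ hxb
  have hxb : x ∈ A.Q.bd 1 p n := hxb
  change A.Q.d x ∈ A.Q.bd 1 (p - 1) (n + 1)
  rw [FDGA.bd_one] at hxb ⊢
  obtain ⟨u, hu, _, ⟨c, hc, rfl⟩, rfl⟩ := mem_sup.1 hxb
  rw [map_add, A.Q.d_d, add_zero]
  exact mem_sup_right ⟨u, hu, rfl⟩)

variable (A) in
/-- The differential of the `E_1`-term. -/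
def D (p : ℤ) (n : ℕ) :
    (ℂ ⊗[ℚ] A.Q.E 1 p n) →ₗ[ℂ] (ℂ ⊗[ℚ] A.Q.E 1 (p - 1) (n + 1)) := (dE A p n)ˆ

theorem D_conj (x : ℂ ⊗[ℚ] A.Q.E 1 p n) : D A p n (conjTensor _ x) = conjTensor _ (D A p n x) :=
  (conjTensor_baseChange _ x).symm

theorem Sym.d {x : A.node v} {ε} (hx : hA.Sym p n v x ε) :
    hA.Sym (p - 1) (n + 1) v ((A.node v).d x) (D A p n ε) := by
  revert x ε
  refine ZVertex.zigzag_induction (P := fun v => ∀ {x : A.node v} {ε},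
    hA.Sym p n v x ε → hA.Sym (p - 1) (n + 1) v ((A.node v).d x) (D A p n ε)) ?_ ?_ v
  · intro x ε hx
    refine left_induction (P := fun x ε => hA.Sym (p - 1) (n + 1) .left ((A.node .left).d x)
      (D A p n ε)) (fun x hx => ?_) (fun x y ε η hx hy => ?_) (fun c x ε hx => ?_) hx
    · have h : A.Q.d x ∈ A.Q.Z 1 (p - 1) (n + 1) :=
        ⟨hx.2, by change _ ∈ Submodule.comap _ _; rw [mem_comap, FDGA.d_d]; exact zero_mem _⟩
      exact sym_toBC h
    · rw [map_add, map_add]; exact hx.add hy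
    · rw [map_smul, map_smul]; exact hx.smul _
  · intro u
    constructor
    · intro h x ε hx
      obtain ⟨y, hy⟩ := exists_of_sym (hA := hA) u.src ε
      have h1 := (h hy).map
      rw [(A.φ u).map_d] at h1
      have h2 := hx.sub hy.map
      rw [sub_self, sym_zero_iff h2.1] at h2
      obtain ⟨w, hw, c, hc, hwc⟩ := h2
      have h3 := h1.add (sym_zero_of_d (hA := hA) (p := p - 1) (n := n + 1) (c := w) hw)
      rw [add_zero] at h3
      convert h3 using 1
      have : x = A.φ u y + w + (A.node u.tgt).d c := by rw [add_assoc, ← hwc]; abel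
      rw [this, map_add, map_add, FDGA.d_d, add_zero]
    · intro h x ε hx
      have hd : (A.node u.src).d x ∈ (A.node u.src).Z 1 (p - 1) (n + 1) :=
        ⟨hx.1.2, by change _ ∈ Submodule.comap _ _; rw [mem_comap, FDGA.d_d]; exact zero_mem _⟩
      obtain ⟨η, hη⟩ := exists_sym (hA := hA) hd
      have h1 := hη.map
      rw [(A.φ u).map_d] at h1
      rwa [← h1.unique (h hx.map)]

theorem D_G (q : ℤ) (ε : ℂ ⊗[ℚ] A.Q.E 1 p n) (h : ε ∈ hA.G p n q) :
    D A p n ε ∈ hA.G (p - 1) (n + 1) q := by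
  obtain ⟨x, hx, hs⟩ := mem_G_iff.1 h
  exact mem_G_iff.2 ⟨_, A.F.d_F _ _ _ hx, hs.d⟩

end IsMixedHodge

end HodgeDiagram

namespace HodgeDiagram

namespace IsMixedHodge

variable {m : ℕ} {A : HodgeDiagram.{u} m} {hA : A.IsMixedHodge} {n : ℕ} {v : ZVertex m}

/-! ### Degeneration of the weight spectral sequence -/

theorem pureG' (hA : A.IsMixedHodge) (p : ℤ) (n : ℕ) :
    IsPureHodge (A.Q.E 1 (p - 1) (n + 1)) (hA.G (p - 1) (n + 1)) (p + n) := by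
  have := hA.pureG (p - 1) (n + 1)
  convert this using 1
  push_cast
  ring

theorem strict_right (hA : A.IsMixedHodge) {q a : ℤ} {y z : A.C} (hy : y ∈ A.C.W q n)
    (hzF : z ∈ A.F.F a (n + 1)) (hz : z ∈ A.C.W (q - 1) (n + 1))
    (hd : z - A.C.d y ∈ A.C.W (q - 2) (n + 1)) :
    ∃ y' ∈ A.F.F a n, y' ∈ A.C.W q n ∧ z - A.C.d y' ∈ A.C.W (q - 2) (n + 1) := by
  have hq : q - 1 - 1 = q - 2 := by ring
  have hdy : A.C.d y ∈ A.C.W (q - 1) (n + 1) := by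
    have := sub_mem hz (A.C.W_mono _ (by omega : q - 2 ≤ q - 1) hd)
    rwa [sub_sub_cancel] at this
  obtain ⟨ε, hε⟩ := exists_sym (hA := hA) (v := .right) (p := q) (n := n) (x := y) ⟨hy, hdy⟩
  have hz' : hA.Sym (q - 1) (n + 1) .right z (D A q n ε) := hε.d.congr (by rw [hq]; exact hd)
  obtain ⟨ε', hε'G, hε'⟩ := (hA.pureG q n).exists_strict (hA.pureG' q n) (D_conj (A := A)) D_G
    (mem_G_iff.2 ⟨z, hzF, hz'⟩)
  obtain ⟨f, hfF, hf⟩ := mem_G_iff.1 hε'G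
  have h0 := hz'.sub hf.d
  rw [hε', sub_self, sym_zero_iff h0.1] at h0
  obtain ⟨u, hu, c, hc, huc⟩ := h0
  obtain ⟨y3, hy3F, hy3, hy3d⟩ := hA.strict (q - 1) a n c (z - A.C.d f) hc
    (sub_mem hzF (A.F.d_F _ _ _ hfF)) (sub_mem hz hf.1.2) (by
      have : A.C.d c - (z - A.C.d f) = -u := by
        change z - A.C.d f = u + A.C.d c at huc
        rw [huc]; abel
      rw [this]
      exact neg_mem hu)
  refine ⟨f + y3, add_mem hfF hy3F, add_mem hf.1.1 (A.C.W_mono _ (by omega : q - 1 ≤ q) hy3), ?_⟩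
  have : z - A.C.d (f + y3) = -(A.C.d y3 - (z - A.C.d f)) := by rw [map_add]; abel
  rw [this, ← hq]
  exact neg_mem hy3d

variable (A) in
/-- The differential of the `r`-th term of the spectral sequence vanishes. -/
def Degen (r : ℕ) : Prop := ∀ (v : ZVertex m) (q : ℤ) (n : ℕ) (x : A.node v),
  x ∈ (A.node v).W (q - 1 + r) n → (A.node v).d x ∈ (A.node v).W (q - 1) (n + 1) →
  ∃ y ∈ (A.node v).W q n, (A.node v).d x - (A.node v).d y ∈ (A.node v).W (q - 2) (n + 1)

theorem exists_adjust {r : ℕ} (hr : 2 ≤ r) (h : ∀ j, 2 ≤ j → j < r → Degen A j) {p : ℤ}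
    {x : A.node v} (hx : x ∈ (A.node v).W p n)
    (hdx : (A.node v).d x ∈ (A.node v).W (p - 2) (n + 1)) :
    ∃ u ∈ (A.node v).W (p - 1) n, (A.node v).d (x - u) ∈ (A.node v).W (p - r) (n + 1) := by
  induction r, hr using Nat.le_induction with
  | base => exact ⟨0, zero_mem _, by simpa using hdx⟩
  | succ j hj ih =>
    obtain ⟨u, hu, hux⟩ := ih fun i h1 h2 => h i h1 (by omega)
    have hxu : x - u ∈ (A.node v).W p n := sub_mem hx ((A.node v).W_mono n (by omega : p - 1 ≤ p) hu)
    obtain ⟨y, hy, hyd⟩ := h j hj (by omega) v (p - j + 1) n (x - u)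
      ((A.node v).W_mono n (by omega : p ≤ p - j + 1 - 1 + j) hxu)
      ((A.node v).W_mono _ (by omega : p - j ≤ p - j + 1 - 1) hux)
    refine ⟨u + y, add_mem hu ((A.node v).W_mono n (by omega) hy), ?_⟩
    rw [← sub_sub, map_sub]
    exact (A.node v).W_mono _ (by push_cast; omega) hyd

theorem mem_range_D {r : ℕ} (hr : 2 ≤ r) (h : ∀ j, 2 ≤ j → j < r → Degen A j) {q : ℤ}
    {x : A.node v} {η} (hx : x ∈ (A.node v).W (q - 1 + r - 1) n)
    (hη : hA.Sym (q - 1) (n + 1) v ((A.node v).d x) η) : η ∈ range (D A q n) := by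
  have hdx : (A.node v).d x ∈ (A.node v).W (q - 1) (n + 1) := hη.1.1
  have : ∃ y ∈ (A.node v).W q n, (A.node v).d x - (A.node v).d y ∈ (A.node v).W (q - 2) (n + 1) := by
    rcases Nat.lt_or_eq_of_le hr with h2 | h2
    · exact h (r - 1) (by omega) (by omega) v q n x
        ((A.node v).W_mono n (by push_cast [Nat.cast_sub (by omega : 1 ≤ r)]; omega) hx) hdx
    · refine ⟨x, (A.node v).W_mono n (by rw [← h2]; push_cast; omega) hx, by simp⟩
  obtain ⟨y, hy, hyx⟩ := this
  have hdy : (A.node v).d y ∈ (A.node v).W (q - 1) (n + 1) := by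
    have := sub_mem hdx ((A.node v).W_mono _ (by omega : q - 2 ≤ q - 1) hyx)
    rwa [sub_sub_cancel] at this
  obtain ⟨ε, hε⟩ := exists_sym (hA := hA) (v := v) (p := q) (n := n) (x := y) ⟨hy, hdy⟩
  exact ⟨ε, (hη.eq_of_sub_mem hε.d ((A.node v).W_mono _ (by omega) hyx)).symm⟩

variable (hA) in
/-- The relation given by the differential of the `r`-th term, `p = q - 1 + r`. -/
def Rel (p q : ℤ) (n : ℕ) (v : ZVertex m) (ε : ℂ ⊗[ℚ] A.Q.E 1 p n)
    (η : ℂ ⊗[ℚ] A.Q.E 1 (q - 1) (n + 1)) : Prop :=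
  ∃ x η', hA.Sym p n v x ε ∧ hA.Sym (q - 1) (n + 1) v ((A.node v).d x) η' ∧
    η - η' ∈ range (D A q n)

theorem d_mem_Z {K : FDGA.{u} ℂ} {x : K} {p : ℤ} {n : ℕ} (h : K.d x ∈ K.W p n) :
    K.d x ∈ K.Z 1 p n :=
  ⟨h, by change K.d (K.d x) ∈ K.W (p - 1) (n + 1); rw [K.d_d]; exact zero_mem _⟩

theorem exists_lift_boundary (hA : A.IsMixedHodge) (u : ZArrow m) {p : ℤ} {n : ℕ}
    {c : A.node u.tgt} (hc : c ∈ shiftDeg ((A.node u.tgt).Z 1 (p + 1)) n) :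
    ∃ c' ∈ shiftDeg ((A.node u.src).Z 1 (p + 1)) n, ∃ w ∈ shiftDeg ((A.node u.tgt).W p) n,
      A.φ u ((A.node u.src).d c') = (A.node u.tgt).d c + (A.node u.tgt).d w := by
  cases n with
  | zero => have : c = 0 := hc; exact ⟨0, zero_mem _, 0, zero_mem _, by simp [this]⟩
  | succ k =>
    obtain ⟨ε, hε⟩ := exists_sym (hA := hA) (v := u.tgt) (p := p + 1) (n := k) hc
    obtain ⟨c', hc'⟩ := exists_of_sym (hA := hA) u.src ε
    have h0 := hc'.map.sub hε
    rw [sub_self, sym_zero_iff h0.1] at h0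
    obtain ⟨w, hw, t, -, hwt⟩ := h0
    rw [add_sub_cancel_right] at hw
    refine ⟨c', hc'.1, w, hw, ?_⟩
    rw [(A.φ u).map_d, ← map_add]
    have : A.φ u c' = c + w + (A.node u.tgt).d t := by rw [add_assoc, ← hwt]; abel
    rw [this, map_add _ _ ((A.node u.tgt).d t), FDGA.d_d, add_zero]

theorem rel_iff {r : ℕ} (hr : 2 ≤ r) (h : ∀ j, 2 ≤ j → j < r → Degen A j) {p q : ℤ}
    (hp : p = q - 1 + r) (u : ZArrow m) (ε η) :
    hA.Rel p q n u.src ε η ↔ hA.Rel p q n u.tgt ε η := by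
  constructor
  · rintro ⟨x, η', h1, h2, h3⟩
    refine ⟨A.φ u x, η', h1.map, ?_, h3⟩
    have := h2.map
    rwa [(A.φ u).map_d] at this
  · rintro ⟨x, η', h1, h2, h3⟩
    obtain ⟨y, hy, hdy, u1, hu1, c, hc, hyx⟩ := (hA.comparison u).exists_lift h1.1.1
      ((A.node u.tgt).W_mono _ (by omega : q - 1 ≤ p - 2) h2.1.1)
    obtain ⟨u2, hu2, hyu⟩ := exists_adjust hr h hy hdy
    obtain ⟨c', hc', w, hw, hcw⟩ := exists_lift_boundary hA u hc
    set x' := y - u2 - (A.node u.src).d c' with hx'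
    have hdx' : (A.node u.src).d x' ∈ (A.node u.src).W (q - 1) (n + 1) := by
      rw [hx', map_sub _ (y - u2), FDGA.d_d, sub_zero]
      exact (A.node u.src).W_mono _ (by omega) hyu
    have hx'W : x' ∈ (A.node u.src).W p n := by
      refine sub_mem (sub_mem hy ((A.node u.src).W_mono n (by omega : p - 1 ≤ p) hu2)) ?_
      cases n with
      | zero => have : c' = 0 := hc'; rw [this, map_zero]; exact zero_mem _
      | succ k => have := hc'.2; exact (A.node u.src).W_mono _ (by omega : p + 1 - 1 ≤ p) this
    obtain ⟨ε1, hε1⟩ := exists_sym (hA := hA) (v := u.src) (p := p) (n := n) (x := x')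
      ⟨hx'W, (A.node u.src).W_mono _ (by omega : q - 1 ≤ p - 1) hdx'⟩
    have e1 : A.φ u x' = x + (u1 - A.φ u u2) - (A.node u.tgt).d w := by
      rw [hx', map_sub, map_sub, hyx, hcw]; abel
    have hu3 : u1 - A.φ u u2 ∈ (A.node u.tgt).W (p - 1) n := sub_mem hu1.1 ((A.φ u).map_W _ _ _ hu2)
    have h4 : ε1 = ε := by
      have := (h1.add (sym_zero_of_mem (hA := hA) hu3)).sub (sym_zero_of_d (hA := hA) hw)
      rw [add_zero, sub_zero, ← e1] at this
      exact hε1.map.unique this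
    obtain ⟨η1, hη1⟩ := exists_sym (hA := hA) (v := u.src) (p := q - 1) (n := n + 1) (d_mem_Z hdx')
    refine ⟨x', η1, h4 ▸ hε1, hη1, ?_⟩
    have h5 := hη1.map.sub h2
    have h6 := mem_range_D hr h (x := u1 - A.φ u u2) (q := q) (η := η1 - η')
      (hA := hA) (hp ▸ hu3) (by
        convert h5 using 1
        rw [(A.φ u).map_d, e1, map_sub _ (x + _), FDGA.d_d, sub_zero, map_add _ x]
        abel)
    have := sub_mem h3 h6
    rwa [sub_sub_sub_cancel_right] at this

theorem exists_lift_F {r : ℕ} (hr : 2 ≤ r) (h : ∀ j, 2 ≤ j → j < r → Degen A j) {p a : ℤ}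
    {ε : ℂ ⊗[ℚ] A.Q.E 1 p n} (hε : ε ∈ hA.G p n a) (hD : D A p n ε = 0) :
    ∃ f ∈ A.F.F a n, hA.Sym p n .right f ε ∧ A.C.d f ∈ A.C.W (p - r) (n + 1) := by
  induction r, hr using Nat.le_induction with
  | base =>
    obtain ⟨f, hf, hs⟩ := mem_G_iff.1 hε
    have h0 := hs.d
    rw [hD, sym_zero_iff h0.1] at h0
    obtain ⟨u, hu, c, hc, huc⟩ := h0
    obtain ⟨y, hyF, hy, hyd⟩ := hA.strict (p - 1) a n c (A.C.d f) hc (A.F.d_F _ _ _ hf) hs.1.2 (by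
      have : A.C.d c - A.C.d f = -u := by change A.C.d f = u + A.C.d c at huc; rw [huc]; abel
      rw [this]
      exact neg_mem hu)
    refine ⟨f - y, sub_mem hf hyF, hs.congr (by rw [sub_sub_cancel_left]; exact neg_mem hy), ?_⟩
    have h2 := neg_mem (A.C.W_mono _ (by push_cast; omega : p - 1 - 1 ≤ p - ((2 : ℕ) : ℤ)) hyd)
    rw [neg_sub] at h2
    rw [map_sub]
    exact h2
  | succ j hj ih =>
    obtain ⟨f, hf, hs, hfd⟩ := ih fun i h1 h2 => h i h1 (by omega)
    obtain ⟨y, hy, hyd⟩ := h j hj (by omega) .right (p - j + 1) n f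
      (A.C.W_mono n (by omega : p ≤ p - j + 1 - 1 + j) hs.1.1)
      (A.C.W_mono _ (by omega : p - j ≤ p - j + 1 - 1) hfd)
    obtain ⟨y', hy'F, hy', hyd'⟩ := hA.strict_right hy (A.F.d_F _ _ _ hf)
      (A.C.W_mono _ (by omega : p - j ≤ p - j + 1 - 1) hfd) hyd
    refine ⟨f - y', sub_mem hf hy'F, hs.congr ?_, ?_⟩
    · rw [sub_sub_cancel_left]; exact neg_mem (A.C.W_mono _ (by omega) hy')
    · rw [map_sub]; exact A.C.W_mono _ (by push_cast; omega) hyd'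

theorem degen (hA : A.IsMixedHodge) (r : ℕ) (hr : 2 ≤ r) : Degen A r := by
  induction r using Nat.strong_induction_on with
  | _ r ih =>
  have h : ∀ j, 2 ≤ j → j < r → Degen A j := fun j h1 h2 => ih j h2 h1
  intro v q n x hx hdx
  obtain ⟨p, hp⟩ : ∃ p, p = q - 1 + (r : ℤ) := ⟨_, rfl⟩
  rw [← hp] at hx
  have hrel : ∀ v w ε η, hA.Rel p q n v ε η → hA.Rel p q n w ε η := by
    have key : ∀ v ε η, hA.Rel p q n v ε η ↔ hA.Rel p q n .left ε η :=
      ZVertex.zigzag_induction (fun ε η => Iff.rfl) fun u =>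
        ⟨fun h' ε η => (rel_iff hr h hp u ε η).symm.trans (h' ε η),
          fun h' ε η => (rel_iff hr h hp u ε η).trans (h' ε η)⟩
    exact fun v w ε η h' => (key w ε η).2 ((key v ε η).1 h')
  obtain ⟨ε, hε⟩ := exists_sym (hA := hA) (v := v) (p := p) (n := n) (x := x)
    ⟨hx, (A.node v).W_mono _ (by omega : q - 1 ≤ p - 1) hdx⟩
  obtain ⟨η, hη⟩ := exists_sym (hA := hA) (v := v) (p := q - 1) (n := n + 1) (d_mem_Z hdx)
  have hD : D A p n ε = 0 := hε.d.unique
    (sym_zero_of_mem ((A.node v).W_mono _ (by omega : q - 1 ≤ p - 1 - 1) hdx))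
  have hΓ : hA.Rel p q n .left ε η := hrel v _ _ _ ⟨x, η, hε, hη, by simp⟩
  have hmem : η ∈ range (D A q n) := by
    refine (hA.pureG p n).relation_eq_zero (hA.pureG' p n) (D_conj (A := A)) D_G (hA.pureG' q n)
      (hA.pureG q n) (D_conj (A := A)) D_G (by omega) (Γ := hA.Rel p q n .left) ?_ ?_ ?_ ?_ ?_ hΓ hD
    · rintro x y x' y' ⟨a, b, h1, h2, h3⟩ ⟨a', b', h1', h2', h3'⟩
      refine ⟨a + a', b + b', h1.add h1', ?_, ?_⟩
      · rw [map_add]; exact h2.add h2'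
      · rw [add_sub_add_comm]; exact add_mem h3 h3'
    · rintro x y ⟨a, b, h1, h2, h3⟩
      refine ⟨-a, -b, h1.neg, ?_, ?_⟩
      · rw [map_neg]; exact h2.neg
      · rw [← neg_sub']; exact neg_mem h3
    · rintro x y ⟨a, b, h1, h2, t, h3⟩
      refine ⟨conjTensor _ a, conjTensor _ b, h1.conj, ?_, conjTensor _ t, ?_⟩
      · have := h2.conj
        change hA.Sym (q - 1) (n + 1) .left (conjTensor _ (A.Q.dˆ a)) _ at this
        rwa [conjTensor_baseChange] at this
      · rw [D_conj, h3, map_sub]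
    · rintro y ⟨a, b, h1, h2, h3⟩
      obtain ⟨s, hs, c, hc, hsc⟩ := (sym_zero_iff h1.1).1 h1
      have := mem_range_D hr h (x := s) (q := q) (η := b) (hA := hA) (v := .left) (n := n)
        (hp ▸ hs) (by rw [hsc, map_add _ s, FDGA.d_d, add_zero] at h2; exact h2)
      have := add_mem h3 this
      rwa [sub_add_cancel] at this
    · intro a x hx hgx
      obtain ⟨f, hf, hs, hfd⟩ := exists_lift_F hr h hx hgx
      have hfd' : A.C.d f ∈ A.C.W (q - 1) (n + 1) := A.C.W_mono _ (by omega) hfd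
      obtain ⟨η', hη'⟩ := exists_sym (hA := hA) (v := .right) (p := q - 1) (n := n + 1)
        (d_mem_Z hfd')
      exact ⟨η', mem_G_iff.2 ⟨_, A.F.d_F _ _ _ hf, hη'⟩, hrel .right _ _ _
        ⟨f, η', hs, hη', by simp⟩⟩
  obtain ⟨ε', rfl⟩ := hmem
  obtain ⟨y, hy⟩ := exists_of_sym (hA := hA) v ε'
  have h0 := hη.sub hy.d
  rw [sub_self, sym_zero_iff h0.1] at h0
  obtain ⟨w, hw, c, hc, hwc⟩ := h0
  refine ⟨y + c, add_mem hy.1.1 ((A.node v).W_mono n (by omega : q - 1 ≤ q) hc), ?_⟩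
  rw [map_add, ← sub_sub, hwc, add_sub_cancel_right]
  exact (A.node v).W_mono _ (by omega) hw

end IsMixedHodge

end HodgeDiagram

namespace HodgeDiagram

namespace IsMixedHodge

variable {m : ℕ} {A : HodgeDiagram.{u} m} {n : ℕ} {v : ZVertex m}

/-! ### Strictness of the differential and of the comparison morphisms -/

theorem exists_step (hA : A.IsMixedHodge) {q : ℤ} {x : A.node v} (hx : x ∈ (A.node v).gr n)
    (hdx : (A.node v).d x ∈ (A.node v).W (q - 1) (n + 1)) :
    ∃ y ∈ (A.node v).W q n, (A.node v).d x - (A.node v).d y ∈ (A.node v).W (q - 2) (n + 1) := by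
  obtain ⟨P, hP⟩ := (A.node v).W_exhaustive n x hx
  exact hA.degen ((P - q).toNat + 2) (by omega) v q n x
    ((A.node v).W_mono n (by push_cast; omega) hP) hdx

theorem exact_W (hA : A.IsMixedHodge) {p : ℤ} {z : A.node v}
    (hz : z ∈ (A.node v).coboundaries n) (hzW : z ∈ (A.node v).W p n) :
    ∃ c ∈ shiftDeg ((A.node v).W (p + 1)) n, (A.node v).d c = z := by
  cases n with
  | zero => obtain ⟨c, hc, rfl⟩ := hz; exact ⟨c, hc, rfl⟩
  | succ n =>
    obtain ⟨x, hx, rfl⟩ := hz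
    have key : ∀ k : ℕ, ∃ y ∈ (A.node v).W (p + 1) n,
        (A.node v).d x - (A.node v).d y ∈ (A.node v).W (p - k) (n + 1) := by
      intro k
      induction k with
      | zero => exact ⟨0, zero_mem _, by simpa using hzW⟩
      | succ k ih =>
        obtain ⟨y, hy, hyd⟩ := ih
        have hxy : x - y ∈ (A.node v).gr n := sub_mem hx ((A.node v).W_le _ _ hy)
        obtain ⟨y', hy', hyd'⟩ := hA.exists_step (q := p - k + 1) hxy
          (by rw [map_sub]; exact (A.node v).W_mono _ (by omega) hyd)
        refine ⟨y + y', add_mem hy ((A.node v).W_mono n (by omega) hy'), ?_⟩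
        rw [map_add, ← sub_sub, ← map_sub]
        exact (A.node v).W_mono _ (by push_cast; omega) hyd'
    obtain ⟨b, hb⟩ := hA.regular v (n + 1)
    obtain ⟨y, hy, hyd⟩ := key (p - b).toNat
    have : (A.node v).d x - (A.node v).d y ∈ (A.node v).W b (n + 1) :=
      (A.node v).W_mono _ (by omega) hyd
    rw [hb, mem_bot, sub_eq_zero] at this
    exact ⟨y, hy, this.symm⟩

theorem exact_W_F (hA : A.IsMixedHodge) {p a : ℤ} {z : A.C}
    (hz : z ∈ A.C.coboundaries (n + 1)) (hzW : z ∈ A.C.W p (n + 1)) (hzF : z ∈ A.F.F a (n + 1)) :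
    ∃ c ∈ A.C.W (p + 1) n, c ∈ A.F.F a n ∧ A.C.d c = z := by
  obtain ⟨x, hx, rfl⟩ := hz
  have key : ∀ k : ℕ, ∃ y ∈ A.C.W (p + 1) n, y ∈ A.F.F a n ∧
      A.C.d x - A.C.d y ∈ A.C.W (p - k) (n + 1) := by
    intro k
    induction k with
    | zero => exact ⟨0, zero_mem _, zero_mem _, by simpa using hzW⟩
    | succ k ih =>
      obtain ⟨y, hy, hyF, hyd⟩ := ih
      have hxy : x - y ∈ A.C.gr n := sub_mem hx (A.C.W_le _ _ hy)
      have h1 : A.C.d x - A.C.d y ∈ A.C.W (p - k + 1 - 1) (n + 1) := A.C.W_mono _ (by omega) hyd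
      obtain ⟨y1, hy1, hyd1⟩ := hA.exists_step (v := .right) (q := p - k + 1) hxy
        (by rw [map_sub]; exact h1)
      rw [map_sub] at hyd1
      obtain ⟨y', hyF', hy', hyd'⟩ := hA.strict_right hy1 (sub_mem hzF (A.F.d_F _ _ _ hyF)) h1 hyd1
      refine ⟨y + y', add_mem hy (A.C.W_mono n (by omega) hy'), add_mem hyF hyF', ?_⟩
      rw [map_add, ← sub_sub]
      exact A.C.W_mono _ (by push_cast; omega) hyd'
  obtain ⟨b, hb⟩ := hA.regular .right (n + 1)
  obtain ⟨y, hy, hyF, hyd⟩ := key (p - b).toNat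
  have : A.C.d x - A.C.d y ∈ A.C.W b (n + 1) := A.C.W_mono _ (by omega) hyd
  change _ ∈ (A.node .right).W b (n + 1) at this
  rw [hb, mem_bot, sub_eq_zero] at this
  exact ⟨y, hy, hyF, this.symm⟩

theorem exists_rep (hA : A.IsMixedHodge) {p a : ℤ} {z z' : A.C} (hz : z ∈ A.F.F a n)
    (hzz' : z - z' ∈ A.C.coboundaries n) (hz' : z' ∈ A.C.W p n) :
    ∃ f ∈ A.F.F a n, f ∈ A.C.W p n ∧ z - f ∈ A.C.coboundaries n := by
  cases n with
  | zero =>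
    obtain ⟨c, hc, hcz⟩ := hzz'
    have h0 : c = 0 := hc
    rw [h0, map_zero, eq_comm, sub_eq_zero] at hcz
    exact ⟨z, hz, hcz ▸ hz', by simp⟩
  | succ n =>
    obtain ⟨P, hP⟩ := A.C.W_exhaustive _ z (A.F.F_le _ _ hz)
    have key : ∀ k : ℕ, ∃ b ∈ A.F.F a n, z - A.C.d b ∈ A.C.W (max p (P - k)) (n + 1) := by
      intro k
      induction k with
      | zero => exact ⟨0, zero_mem _, by rw [map_zero, sub_zero]; exact A.C.W_mono _ (by simp) hP⟩
      | succ k ih =>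
        obtain ⟨b, hb, hbz⟩ := ih
        by_cases hp : P - k ≤ p
        · exact ⟨b, hb, A.C.W_mono _ (by omega) hbz⟩
        obtain ⟨x, hx, hxz⟩ := hzz'
        have hbz' : z - A.C.d b ∈ A.C.W (P - k + 1 - 1) (n + 1) := A.C.W_mono _ (by omega) hbz
        have hxb : x - b ∈ A.C.gr n := sub_mem hx (A.F.F_le _ _ hb)
        have e1 : A.C.d (x - b) = z - A.C.d b - z' := by rw [map_sub, hxz]; abel
        obtain ⟨y, hy, hyd⟩ := hA.exists_step (v := .right) (q := P - k + 1) hxb (by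
          rw [e1]
          exact sub_mem hbz' (A.C.W_mono _ (by omega) hz'))
        rw [e1] at hyd
        obtain ⟨y', hyF', hy', hyd'⟩ := hA.strict_right hy (sub_mem hz (A.F.d_F _ _ _ hb)) hbz' (by
            have := add_mem hyd (A.C.W_mono _ (by omega : p ≤ P - k + 1 - 2) hz')
            convert this using 1
            abel)
        refine ⟨b + y', add_mem hb hyF', ?_⟩
        rw [map_add, ← sub_sub]
        exact A.C.W_mono _ (by push_cast; omega) hyd'
    obtain ⟨b, hb, hbz⟩ := key (P - p).toNat
    exact ⟨z - A.C.d b, sub_mem hz (A.F.d_F _ _ _ hb), A.C.W_mono _ (by omega) hbz,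
      b, A.F.F_le _ _ hb, by abel⟩

theorem exists_cocycle_adjust (hA : A.IsMixedHodge) {p : ℤ} {x : A.node v}
    (hx : x ∈ (A.node v).W p n) (hdx : (A.node v).d x ∈ (A.node v).W (p - 2) (n + 1)) :
    ∃ u ∈ (A.node v).W (p - 1) n, (A.node v).d (x - u) = 0 := by
  obtain ⟨b, hb⟩ := hA.regular v (n + 1)
  obtain ⟨u, hu, hud⟩ := exists_adjust (r := (p - b).toNat + 2) (by omega)
    (fun j h1 _ => hA.degen j h1) hx hdx
  refine ⟨u, hu, ?_⟩
  have : (A.node v).d (x - u) ∈ (A.node v).W b (n + 1) :=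
    (A.node v).W_mono _ (by push_cast; omega) hud
  rwa [hb, mem_bot] at this

theorem exists_lift_cocycle (hA : A.IsMixedHodge) (u : ZArrow m) {p : ℤ}
    {z : A.node u.tgt} (hz : z ∈ (A.node u.tgt).W p n) (hdz : (A.node u.tgt).d z = 0) :
    ∃ y ∈ (A.node u.src).W p n, (A.node u.src).d y = 0 ∧
      A.φ u y - z ∈ (A.node u.tgt).coboundaries n := by
  have key : ∀ k : ℕ, ∃ y ∈ (A.node u.src).W p n, (A.node u.src).d y = 0 ∧
      ∃ t ∈ (A.node u.tgt).coboundaries n, A.φ u y - z - t ∈ (A.node u.tgt).W (p - k) n := by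
    intro k
    induction k with
    | zero => exact ⟨0, zero_mem _, map_zero _, 0, zero_mem _, by simpa using hz⟩
    | succ k ih =>
      obtain ⟨y, hy, hdy, t, ht, hw⟩ := ih
      set w := A.φ u y - z - t with hwdef
      have hdw : (A.node u.tgt).d w = 0 := by
        rw [hwdef, map_sub, map_sub, ← (A.φ u).map_d, hdy, hdz, map_zero,
          show (A.node u.tgt).d t = 0 from ((A.node u.tgt).coboundaries_le n ht).2]
        simp
      obtain ⟨y1, hy1, hdy1, u1, hu1, c1, hc1, e1⟩ := (hA.comparison u).exists_lift hw (by
        rw [hdw]; exact zero_mem _)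
      obtain ⟨u2, hu2, hd2⟩ := hA.exists_cocycle_adjust hy1 hdy1
      refine ⟨y - (y1 - u2), sub_mem hy ((A.node u.src).W_mono n (by omega : p - k ≤ p)
        (sub_mem hy1 ((A.node u.src).W_mono n (by omega) hu2))), by rw [map_sub, hdy, hd2, sub_zero],
        t - (A.node u.tgt).d c1, sub_mem ht ⟨c1, ?_, rfl⟩, ?_⟩
      · exact shiftDeg_mono (S := (A.node u.tgt).Z 1 (p - k + 1)) (fun n x hx => (A.node u.tgt).W_le _ _ hx.1) n hc1
      · have : A.φ u (y - (y1 - u2)) - z - (t - (A.node u.tgt).d c1) = A.φ u u2 - u1 := by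
          rw [map_sub, map_sub, e1, hwdef]; abel
        rw [this]
        exact (A.node u.tgt).W_mono n (by push_cast; omega)
          (sub_mem ((A.φ u).map_W _ _ _ hu2) hu1.1)
  obtain ⟨b, hb⟩ := hA.regular u.tgt n
  obtain ⟨y, hy, hdy, t, ht, hw⟩ := key (p - b).toNat
  have : A.φ u y - z - t ∈ (A.node u.tgt).W b n := (A.node u.tgt).W_mono n (by omega) hw
  rw [hb, mem_bot, sub_eq_zero] at this
  exact ⟨y, hy, hdy, this ▸ ht⟩

theorem exact_of_map (hA : A.IsMixedHodge) (u : ZArrow m) {z : A.node u.src}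
    (hz : z ∈ (A.node u.src).cocycles n)
    (hφ : A.φ u z ∈ (A.node u.tgt).coboundaries n) :
    z ∈ (A.node u.src).coboundaries n := by
  obtain ⟨p, hp⟩ := (A.node u.src).W_exhaustive n z hz.1
  have key : ∀ k : ℕ, ∃ t ∈ (A.node u.src).coboundaries n, z - t ∈ (A.node u.src).W (p - k) n := by
    intro k
    induction k with
    | zero => exact ⟨0, zero_mem _, by simpa using hp⟩
    | succ k ih =>
      obtain ⟨t, ht, hw⟩ := ih
      have hdw : (A.node u.src).d (z - t) = 0 := by
        rw [map_sub, show (A.node u.src).d z = 0 from hz.2,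
          show (A.node u.src).d t = 0 from ((A.node u.src).coboundaries_le n ht).2, sub_zero]
      have hφw : A.φ u (z - t) ∈ (A.node u.tgt).coboundaries n := by
        rw [map_sub]
        exact sub_mem hφ ((A.φ u).map_coboundaries n t ht)
      have hφW := (A.φ u).map_W _ _ _ hw
      obtain ⟨c, hc, hcw⟩ := hA.exact_W hφw hφW
      obtain ⟨u1, hu1, c1, hc1, e1⟩ := (hA.comparison u).exists_primitive hw
        (by rw [hdw]; exact zero_mem _) (by
          rw [FDGA.bd_two]
          refine mem_sup_right ⟨c, ?_, hcw⟩
          cases n with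
          | zero => exact hc
          | succ n =>
            refine ⟨hc, ?_⟩
            change (A.node u.tgt).d c ∈ (A.node u.tgt).W (p - k + 1 - 1) (n + 1)
            rw [hcw, add_sub_cancel_right]
            exact hφW)
      refine ⟨t + (A.node u.src).d c1, add_mem ht ⟨c1, ?_, rfl⟩, ?_⟩
      · exact shiftDeg_mono (S := (A.node u.src).Z 1 (p - k + 1)) (fun n x hx => (A.node u.src).W_le _ _ hx.1) n hc1
      · rw [← sub_sub, e1, add_sub_cancel_right]
        exact (A.node u.src).W_mono n (by push_cast; omega) hu1.1
  obtain ⟨b, hb⟩ := hA.regular u.src n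
  obtain ⟨t, ht, hw⟩ := key (p - b).toNat
  have : z - t ∈ (A.node u.src).W b n := (A.node u.src).W_mono n (by omega) hw
  rw [hb, mem_bot, sub_eq_zero] at this
  exact this ▸ ht

theorem exists_rel_lift (hA : A.IsMixedHodge) (u : ZArrow m) {w : ℤ} {c : A.node u.src}
    (hc : c ∈ (A.node u.src).W (w - 1) (n + 1)) (hdc : (A.node u.src).d c = 0)
    {T : A.node u.tgt} (hT : T ∈ (A.node u.tgt).W w n)
    (hdT : (A.node u.tgt).d T = A.φ u c) :
    ∃ α ∈ (A.node u.src).W w n, (A.node u.src).d α = c ∧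
      A.φ u α - T ∈ (A.node u.tgt).coboundaries n := by
  have h1 : c ∈ (A.node u.src).coboundaries (n + 1) :=
    hA.exact_of_map u ⟨(A.node u.src).W_le _ _ hc, hdc⟩ ⟨T, (A.node u.tgt).W_le _ _ hT, hdT⟩
  obtain ⟨α, hα, hdα⟩ := hA.exact_W h1 hc
  have hα : α ∈ (A.node u.src).W w n := by
    have : α ∈ (A.node u.src).W (w - 1 + 1) n := hα
    rwa [sub_add_cancel] at this
  obtain ⟨y, hy, hdy, hyT⟩ := hA.exists_lift_cocycle u (z := T - A.φ u α)
    (sub_mem hT ((A.φ u).map_W _ _ _ hα)) (by rw [map_sub, hdT, ← (A.φ u).map_d, hdα, sub_self])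
  refine ⟨α + y, add_mem hα hy, by rw [map_add, hdα, hdy, add_zero], ?_⟩
  convert hyT using 1
  rw [map_add]; abel

/-! ### Coherent families of cocycles -/

variable (A) in
/-- A family of cocycles at the nodes whose classes correspond to each other. -/
structure Coh (n : ℕ) (z : ∀ v, A.node v) : Prop where
  cocycle : ∀ v, z v ∈ (A.node v).cocycles n
  compat : ∀ u, A.φ u (z u.src) - z u.tgt ∈ (A.node u.tgt).coboundaries n

theorem Coh.add {z z' : ∀ v, (A.node v)} (h : Coh A n z) (h' : Coh A n z') :
    Coh A n (fun v => z v + z' v) :=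
  ⟨fun v => add_mem (h.cocycle v) (h'.cocycle v), fun u => by
    rw [map_add, add_sub_add_comm]; exact add_mem (h.compat u) (h'.compat u)⟩

theorem Coh.smul {z : ∀ v, (A.node v)} (c : ℂ) (h : Coh A n z) : Coh A n (fun v => c • z v) :=
  ⟨fun v => smul_mem _ c (h.cocycle v), fun u => by
    rw [map_smul, ← smul_sub]; exact smul_mem _ c (h.compat u)⟩

theorem Coh.sub {z z' : ∀ v, (A.node v)} (h : Coh A n z) (h' : Coh A n z') :
    Coh A n (fun v => z v - z' v) :=
  ⟨fun v => sub_mem (h.cocycle v) (h'.cocycle v), fun u => by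
    rw [map_sub, sub_sub_sub_comm]; exact sub_mem (h.compat u) (h'.compat u)⟩

theorem Coh.exact (hA : A.IsMixedHodge) {z : ∀ v, (A.node v)} (h : Coh A n z)
    {v : ZVertex m} (hv : z v ∈ (A.node v).coboundaries n) (w : ZVertex m) :
    z w ∈ (A.node w).coboundaries n := by
  have key : ∀ v, z v ∈ (A.node v).coboundaries n ↔ z .left ∈ (A.node .left).coboundaries n := by
    refine ZVertex.zigzag_induction Iff.rfl fun u => ?_
    have : z u.src ∈ (A.node u.src).coboundaries n ↔ z u.tgt ∈ (A.node u.tgt).coboundaries n := by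
      constructor
      · intro h1
        have := sub_mem ((A.φ u).map_coboundaries n _ h1) (h.compat u)
        rwa [sub_sub_cancel] at this
      · intro h1
        refine hA.exact_of_map u (h.cocycle _) ?_
        have := add_mem (h.compat u) h1
        rwa [sub_add_cancel] at this
    rw [this]
  exact (key w).2 ((key v).1 hv)

variable (A) in
/-- The cocycles in `W_p` at a node. -/
abbrev Cyc (p : ℤ) (n : ℕ) (v : ZVertex m) := ↥((A.node v).W p n ⊓ LinearMap.ker (A.node v).d)

variable (A) in
/-- The relation of being cohomologous along a comparison morphism, for cocycles in `W_p`. -/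
def cohRel (p : ℤ) (n : ℕ) (u : ZArrow m) (a : Cyc A p n u.src) (b : Cyc A p n u.tgt) : Prop :=
  A.φ u a.1 - b.1 ∈ (A.node u.tgt).coboundaries n

theorem exists_cohRel_tgt {p : ℤ} (u a) : ∃ b, cohRel A p n u a b :=
  ⟨⟨A.φ u a.1, (A.φ u).map_W _ _ _ a.2.1, by
    have : (A.node _).d a.1 = 0 := a.2.2
    change (A.node _).d _ = 0; rw [← (A.φ u).map_d, this, map_zero]⟩, by
    rw [cohRel, sub_self]; exact zero_mem _⟩

theorem exists_cohRel_src (hA : A.IsMixedHodge) {p : ℤ} (u b) : ∃ a, cohRel A p n u a b := by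
  obtain ⟨y, hy, hdy, h⟩ := hA.exists_lift_cocycle u b.2.1 b.2.2
  exact ⟨⟨y, hy, hdy⟩, h⟩

theorem exists_coh_left (hA : A.IsMixedHodge) {p : ℤ} {x : A.node .left}
    (hx : x ∈ (A.node .left).W p n) (hdx : (A.node .left).d x = 0) :
    ∃ z, Coh A n z ∧ z .left = x ∧ ∀ v, z v ∈ (A.node v).W p n := by
  obtain ⟨z, hz, hR⟩ := ZVertex.exists_family_left (X := Cyc A p n) (R := cohRel A p n) exists_cohRel_tgt
    hA.exists_cohRel_src ⟨x, hx, hdx⟩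
  exact ⟨fun v => (z v).1, ⟨fun v => ⟨(A.node v).W_le _ _ (z v).2.1, (z v).2.2⟩, hR⟩,
    congrArg Subtype.val hz, fun v => (z v).2.1⟩

theorem exists_coh_right (hA : A.IsMixedHodge) {p : ℤ} {x : A.node .right}
    (hx : x ∈ (A.node .right).W p n) (hdx : (A.node .right).d x = 0) :
    ∃ z, Coh A n z ∧ z .right = x ∧ ∀ v, z v ∈ (A.node v).W p n := by
  obtain ⟨z, hz, hR⟩ := ZVertex.exists_family_right (X := Cyc A p n) (R := cohRel A p n) exists_cohRel_tgt
    hA.exists_cohRel_src ⟨x, hx, hdx⟩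
  exact ⟨fun v => (z v).1, ⟨fun v => ⟨(A.node v).W_le _ _ (z v).2.1, (z v).2.2⟩, hR⟩,
    congrArg Subtype.val hz, fun v => (z v).2.1⟩

end IsMixedHodge

end HodgeDiagram

namespace FDGA

variable (K : FDGA.{u} ℚ) (n : ℕ)

theorem baseChange_cocycles : K°.cocycles n = (K.cocycles n)ˆ := by
  change _ = (K.gr n ⊓ LinearMap.ker K.d)ˆ
  rw [baseChange_inf, baseChange_ker]
  rfl

theorem baseChange_shiftDeg {X : Type*} [AddCommGroup X] [Module ℚ X] (S : ℕ → Submodule ℚ X) :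
    shiftDeg (fun n => (S n)ˆ) n = (shiftDeg S n)ˆ := by
  cases n with
  | zero => exact (baseChange_bot (R := ℚ) (M := X) (A := ℂ)).symm
  | succ n => rfl

theorem baseChange_coboundaries : K°.coboundaries n = (K.coboundaries n)ˆ := by
  change (shiftDeg (fun n => (K.gr n)ˆ) n).map (K.dˆ) = _
  rw [baseChange_shiftDeg, FDGA.coboundaries, baseChange_map]

end FDGA

open FDGA (baseChange_cocycles baseChange_coboundaries)

namespace HodgeDiagram

variable {m : ℕ}

/-- The weight filtration of the mixed Hodge structure on `H^n(A_ℚ)`, lifted to cocycles. -/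
def HW (A : HodgeDiagram.{u} m) (n : ℕ) (k : ℤ) : Submodule ℂ (ℂ ⊗[ℚ] A.Q) :=
  ((A.Q.cocycles n ⊓ A.Q.W (k - n) n) ⊔ A.Q.coboundaries n)ˆ

/-- The Hodge filtration of the mixed Hodge structure on `H^n(A_ℚ)`, lifted to cocycles. -/
def HF (A : HodgeDiagram.{u} m) (n : ℕ) (q : ℤ) : Submodule ℂ (ℂ ⊗[ℚ] A.Q) where
  carrier := {x | ∃ z, IsMixedHodge.Coh A n z ∧ x - z .left ∈ (A.node .left).coboundaries n ∧
    z .right ∈ A.F.F q n}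
  add_mem' := by
    rintro x y ⟨z, h1, h2, h3⟩ ⟨z', h1', h2', h3'⟩
    exact ⟨_, h1.add h1', by rw [add_sub_add_comm]; exact add_mem h2 h2', add_mem h3 h3'⟩
  zero_mem' := ⟨fun _ => 0, ⟨fun _ => zero_mem _, fun u => by
    rw [map_zero, sub_zero]; exact zero_mem _⟩, by rw [sub_zero]; exact zero_mem _, zero_mem _⟩
  smul_mem' := by
    rintro c x ⟨z, h1, h2, h3⟩
    exact ⟨_, h1.smul c, by rw [← smul_sub]; exact smul_mem _ c h2,
      smul_mem _ c h3⟩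

theorem mem_HW {A : HodgeDiagram.{u} m} {n : ℕ} {k : ℤ} {x : ℂ ⊗[ℚ] A.Q} :
    x ∈ A.HW n k ↔ ∃ y ∈ (A.node .left).cocycles n, y ∈ (A.node .left).W (k - n) n ∧
      x - y ∈ (A.node .left).coboundaries n := by
  have h1 : A.HW n k = ((A.node .left).cocycles n ⊓ (A.node .left).W (k - n) n) ⊔
      (A.node .left).coboundaries n := by
    change _ = (A.Q°.cocycles n ⊓ (A.Q.W (k - n) n)ˆ) ⊔ A.Q°.coboundaries n
    rw [baseChange_cocycles, baseChange_coboundaries, ← baseChange_inf, ← baseChange_sup]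
    rfl
  rw [h1, mem_sup]
  constructor
  · rintro ⟨y, hy, z, hz, rfl⟩; exact ⟨y, hy.1, hy.2, by rwa [add_sub_cancel_left]⟩
  · rintro ⟨y, hy, hyW, hz⟩; exact ⟨y, ⟨hy, hyW⟩, _, hz, by abel⟩

namespace IsMixedHodge

variable {A : HodgeDiagram.{u} m} {n : ℕ} {v : ZVertex m}

theorem exists_im (hA : A.IsMixedHodge) (w : ℤ) (n : ℕ) :
    ∃ (V : Type u) (_ : AddCommGroup V) (_ : Module ℚ V) (F : ℤ → Submodule ℂ (ℂ ⊗[ℚ] V))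
      (f : (ℂ ⊗[ℚ] V) →ₗ[ℂ] (ℂ ⊗[ℚ] A.Q.E 1 w n)), IsPureHodge V F (w + n) ∧
      (∀ x, f (conjTensor V x) = conjTensor _ (f x)) ∧ (∀ p, ∀ x ∈ F p, f x ∈ hA.G w n p) ∧
      ∀ v ε, ε ∈ range f ↔
        ∃ c ∈ shiftDeg ((A.node v).W (w + 1)) n, hA.Sym w n v ((A.node v).d c) ε := by
  cases n with
  | zero =>
    refine ⟨A.Q.E 1 w 0, inferInstance, inferInstance, hA.G w 0, 0, hA.pureG w 0, by simp,
      by simp, fun v ε => ?_⟩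
    constructor
    · rintro ⟨x, rfl⟩; exact ⟨0, zero_mem _, by rw [map_zero]; exact sym_zero_of_mem (zero_mem _)⟩
    · rintro ⟨c, hc, h⟩
      have h0 : c = 0 := hc
      rw [h0, map_zero] at h
      rw [h.unique (sym_zero_of_mem (zero_mem _))]
      exact zero_mem _
  | succ n =>
    obtain ⟨q, rfl⟩ : ∃ q, w = q - 1 := ⟨w + 1, by omega⟩
    refine ⟨A.Q.E 1 q n, inferInstance, inferInstance, hA.G q n, D A q n, ?_, D_conj (A := A),
      D_G, fun v ε => ?_⟩
    · have := hA.pureG q n; convert this using 1; push_cast; ring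
    · constructor
      · rintro ⟨η, rfl⟩
        obtain ⟨c, hc⟩ := exists_of_sym (hA := hA) v η
        refine ⟨c, (A.node v).W_mono n (by omega) hc.1.1, hc.d⟩
      · rintro ⟨c, hc, h⟩
        have hc : c ∈ (A.node v).W q n := (A.node v).W_mono n (by omega : q - 1 + 1 ≤ q) hc
        obtain ⟨η, hη⟩ := exists_sym (hA := hA) (v := v) (p := q) (n := n) (x := c) ⟨hc, h.1.1⟩
        exact ⟨η, hη.d.unique h⟩

/-- The class in the `E_1`-term of a coherent family is well defined modulo boundaries. -/
theorem Coh.exists_sym_sub (hA : A.IsMixedHodge) {w : ℤ} {z : ∀ v, (A.node v)}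
    (h : Coh A n z) (hz : ∀ v, z v ∈ (A.node v).W w n) {v v' : ZVertex m} {ε ε'}
    (hε : hA.Sym w n v (z v) ε) (hε' : hA.Sym w n v' (z v') ε') :
    ∃ c ∈ shiftDeg ((A.node v').W (w + 1)) n, hA.Sym w n v' ((A.node v').d c) (ε - ε') := by
  obtain ⟨V, _, _, F, f, -, -, -, hf⟩ := hA.exists_im w n
  have hS : ∀ v, ∃ ε, hA.Sym w n v (z v) ε := fun v => exists_sym ⟨hz v, by
    change (A.node v).d (z v) ∈ (A.node v).W (w - 1) (n + 1)
    rw [show (A.node v).d (z v) = 0 from (h.cocycle v).2]; exact zero_mem _⟩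
  choose s hs using hS
  have hu : ∀ u : ZArrow m, s u.src - s u.tgt ∈ range f := fun u => by
    have h1 := (hs u.src).map.sub (hs u.tgt)
    obtain ⟨c, hc, hd⟩ := hA.exact_W (v := u.tgt) (p := w) (h.compat u)
      (sub_mem ((A.φ u).map_W _ _ _ (hz _)) (hz _))
    rw [← hd] at h1
    exact (hf _ _).2 ⟨c, hc, h1⟩
  have key : ∀ v, s v - s .left ∈ range f := by
    refine ZVertex.zigzag_induction (by simp) fun u => ?_
    constructor
    · intro h1
      have := sub_mem h1 (hu u)
      have h2 : s u.src - s .left - (s u.src - s u.tgt) = s u.tgt - s .left := by abel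
      rwa [h2] at this
    · intro h1; have := add_mem (hu u) h1; rwa [sub_add_sub_cancel] at this
  have := sub_mem (key v) (key v')
  rw [sub_sub_sub_cancel_right, (hs v).unique hε, (hs v').unique hε'] at this
  exact (hf _ _).1 this

theorem mem_HW_of_sym (hA : A.IsMixedHodge) {k w : ℤ} (hk : k - n = w) {x : A.node .left}
    (hx : x ∈ (A.node .left).cocycles n) {ε} (hs : hA.Sym w n .left x ε)
    {c : A.node .left} (hc : c ∈ shiftDeg ((A.node .left).W (w + 1)) n)
    (hsc : hA.Sym w n .left ((A.node .left).d c) ε) : x ∈ A.HW n (k - 1) := by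
  have h1 := hs.sub hsc
  rw [sub_self, sym_zero_iff h1.1] at h1
  obtain ⟨u, hu, c', hc', huc⟩ := h1
  have hcob : (A.node .left).d c + (A.node .left).d c' ∈ (A.node .left).coboundaries n :=
    add_mem ⟨c, FDGA.shiftDeg_W_le _ _ _ hc, rfl⟩ ⟨c', FDGA.shiftDeg_W_le _ _ _ hc', rfl⟩
  have hu' : u = x - ((A.node .left).d c + (A.node .left).d c') := by
    rw [sub_eq_iff_eq_add] at huc
    rw [huc]; abel
  refine mem_HW.2 ⟨u, ?_, (A.node .left).W_mono n (by omega) hu, ?_⟩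
  · rw [hu']; exact sub_mem hx ((A.node .left).coboundaries_le n hcob)
  · rw [hu', sub_sub_cancel]; exact hcob

theorem exists_coh_F (hA : A.IsMixedHodge) {w p : ℤ} {ε} (hε : ε ∈ hA.G w n p)
    (hD : D A w n ε = 0) : ∃ z, Coh A n z ∧ (∀ v, z v ∈ (A.node v).W w n) ∧
      z .right ∈ A.F.F p n ∧ hA.Sym w n .right (z .right) ε := by
  obtain ⟨b, hb⟩ := hA.regular .right (n + 1)
  obtain ⟨f, hf, hs, hfd⟩ := exists_lift_F (r := (w - b).toNat + 2) (by omega)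
    (fun j h1 _ => hA.degen j h1) hε hD
  have h0 : (A.node .right).d f = 0 := by
    have : (A.node .right).d f ∈ (A.node .right).W b (n + 1) :=
      (A.node .right).W_mono _ (by push_cast; omega) hfd
    rwa [hb, mem_bot] at this
  obtain ⟨z, hz, hzr, hzW⟩ := hA.exists_coh_right (x := f) hs.1.1 h0
  exact ⟨z, hz, hzW, by rw [hzr]; exact hf, by rw [hzr]; exact hs⟩

theorem sym_of_cocycle (hA : A.IsMixedHodge) {w : ℤ} {x : A.node v}
    (hx : x ∈ (A.node v).cocycles n) (hxW : x ∈ (A.node v).W w n) : ∃ ε, hA.Sym w n v x ε :=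
  exists_sym ⟨hxW, by
    change (A.node v).d x ∈ (A.node v).W (w - 1) (n + 1)
    rw [show (A.node v).d x = 0 from hx.2]; exact zero_mem _⟩

theorem conj_coboundaries {x : A.node .left} (hx : x ∈ (A.node .left).coboundaries n) :
    conjTensor A.Q x ∈ (A.node .left).coboundaries n := by
  change x ∈ A.Q°.coboundaries n at hx
  change _ ∈ A.Q°.coboundaries n
  rw [baseChange_coboundaries] at hx ⊢
  exact conjTensor_mem hx

theorem conj_cocycles {x : A.node .left} (hx : x ∈ (A.node .left).cocycles n) :
    conjTensor A.Q x ∈ (A.node .left).cocycles n := by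
  change x ∈ A.Q°.cocycles n at hx
  change _ ∈ A.Q°.cocycles n
  rw [baseChange_cocycles] at hx ⊢
  exact conjTensor_mem hx

theorem exists_coh_F_W (hA : A.IsMixedHodge) {k w p : ℤ} (hk : k - n = w)
    {x : A.node .left} (hx : x ∈ A.HF n p) (hxW : x ∈ A.HW n k) :
    ∃ z, Coh A n z ∧ (∀ v, z v ∈ (A.node v).W w n) ∧ z .right ∈ A.F.F p n ∧
      x - z .left ∈ (A.node .left).coboundaries n := by
  subst hk
  obtain ⟨z, hz, hzx, hzF⟩ := hx
  obtain ⟨y, hy, hyW, hxy⟩ := mem_HW.1 hxW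
  obtain ⟨y', hy', rfl, hyW'⟩ := hA.exists_coh_left hyW hy.2
  have h1 := (hz.sub hy').exact hA (v := .left) (by
    have := sub_mem hxy hzx
    rwa [sub_sub_sub_cancel_left] at this) .right
  obtain ⟨f, hfF, hfW, hzf⟩ := hA.exists_rep hzF h1 (hyW' .right)
  obtain ⟨f', hf', hfr, hfW'⟩ := hA.exists_coh_right (x := f) hfW (by
    have h2 : f = z .right - (z .right - f) := by abel
    rw [h2, map_sub, show (A.node .right).d (z .right) = 0 from (hz.cocycle _).2,
      show (A.node .right).d (z .right - f) = 0 from ((A.node .right).coboundaries_le n hzf).2,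
      sub_zero])
  refine ⟨f', hf', hfW', by rw [hfr]; exact hfF, ?_⟩
  have h3 := (hz.sub hf').exact hA (v := .right) (by rw [hfr]; exact hzf) .left
  have := add_mem hzx h3
  rwa [sub_add_sub_cancel] at this

theorem coboundaries_le_HF {q : ℤ} {x : A.node .left} (hx : x ∈ (A.node .left).coboundaries n) :
    x ∈ A.HF n q :=
  ⟨fun _ => 0, ⟨fun _ => zero_mem _, fun u => by rw [map_zero, sub_zero]; exact zero_mem _⟩,
    by rw [sub_zero]; exact hx, zero_mem _⟩

theorem HF_le_cocycles {q : ℤ} {x : A.node .left} (hx : x ∈ A.HF n q) :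
    x ∈ (A.node .left).cocycles n := by
  obtain ⟨z, hz, hzx, -⟩ := hx
  have := add_mem ((A.node .left).coboundaries_le n hzx) (hz.cocycle .left)
  rwa [sub_add_cancel] at this

/-- The mixed Hodge structure on the cohomology of a mixed Hodge diagram. -/
theorem cmhs (hA : A.IsMixedHodge) (n : ℕ) : CMHS (conjTensor A.Q)
    ((A.Q.coboundaries n)ˆ) ((A.Q.cocycles n)ˆ) (A.HW n) (A.HF n) where
  cc := conjTensor_conjTensor
  W_mono k l h := baseChange_mono ℂ
    (sup_le_sup_right (inf_le_inf_left _ (A.Q.W_mono n (by omega))) _)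
  W_bot := by
    obtain ⟨b, hb⟩ := hA.regular_Q n
    exact ⟨b + n, by rw [HW, add_sub_cancel_right, hb, inf_bot_eq, bot_sup_eq]⟩
  W_top := by
    have key : ∃ b, A.Q.cocycles n ≤ (A.Q.cocycles n ⊓ A.Q.W b n) ⊔ A.Q.coboundaries n := by
      obtain ⟨s, hs⟩ := (hA.finite n).fg_top
      have h1 : ∀ s : Finset (A.Q.H n), ∃ b, ∀ x ∈ s, ∃ y ∈ A.Q.W b n, ∃ hy : y ∈ A.Q.cocycles n,
          x = Submodule.Quotient.mk ⟨y, hy⟩ := by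
        classical
        intro s
        induction s using Finset.induction_on with
        | empty => exact ⟨0, by simp⟩
        | insert a s _ ih =>
          obtain ⟨b, hb⟩ := ih
          obtain ⟨⟨y, hy⟩, rfl⟩ := Submodule.Quotient.mk_surjective _ a
          obtain ⟨b', hb'⟩ := A.Q.W_exhaustive n y hy.1
          refine ⟨max b b', fun x hx => ?_⟩
          rcases Finset.mem_insert.1 hx with rfl | hx
          · exact ⟨y, A.Q.W_mono n (le_max_right _ _) hb', hy, rfl⟩
          · obtain ⟨z, hz, h⟩ := hb x hx; exact ⟨z, A.Q.W_mono n (le_max_left _ _) hz, h⟩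
      obtain ⟨b, hb⟩ := h1 s
      refine ⟨b, fun x hx => ?_⟩
      have h2 : (Submodule.Quotient.mk ⟨x, hx⟩ : A.Q.H n) ∈ span ℚ (s : Set _) := by
        rw [hs]; trivial
      have h3 : span ℚ (s : Set (A.Q.H n)) ≤
          ((A.Q.cocycles n ⊓ A.Q.W b n).submoduleOf (A.Q.cocycles n)).map (Submodule.mkQ _) := by
        rw [span_le]
        intro y hy
        obtain ⟨z, hz, hz', rfl⟩ := hb y hy
        exact ⟨⟨z, hz'⟩, ⟨hz', hz⟩, rfl⟩
      obtain ⟨⟨y, hy⟩, hyW, hyx⟩ := h3 h2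
      have h4 : y - x ∈ A.Q.coboundaries n := (Submodule.Quotient.eq ((A.Q.coboundaries n).submoduleOf _)).1 hyx
      exact mem_sup.2 ⟨y, hyW, x - y, by rw [← neg_sub]; exact neg_mem h4, by abel⟩
    obtain ⟨b, hb⟩ := key
    refine ⟨b + n, le_antisymm ?_ ?_⟩
    · exact baseChange_mono ℂ (sup_le inf_le_left (A.Q.coboundaries_le n))
    · rw [HW, add_sub_cancel_right]; exact baseChange_mono ℂ hb
  B_le_W k := baseChange_mono ℂ le_sup_right
  W_le k := baseChange_mono ℂ (sup_le inf_le_left (A.Q.coboundaries_le n))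
  c_W k x hx := conjTensor_mem hx
  F_anti p q h x := by rintro ⟨z, h1, h2, h3⟩; exact ⟨z, h1, h2, A.F.F_anti n h h3⟩
  F_top := by
    obtain ⟨⟨a, ha⟩, -⟩ := hA.biregular n
    refine ⟨a, le_antisymm (fun x hx => ?_) fun x hx => ?_⟩
    · rw [← baseChange_cocycles]; exact HF_le_cocycles hx
    · rw [← baseChange_cocycles] at hx
      obtain ⟨p, hp⟩ := (A.node .left).W_exhaustive n x hx.1
      obtain ⟨z, hz, rfl, -⟩ := hA.exists_coh_left hp hx.2
      exact ⟨z, hz, by rw [sub_self]; exact zero_mem _, by rw [ha]; exact (hz.cocycle .right).1⟩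
  F_bot := by
    obtain ⟨-, b, hb⟩ := hA.biregular n
    refine ⟨b, le_antisymm (fun x hx => ?_) fun x hx => ?_⟩
    · obtain ⟨z, h1, h2, h3⟩ := hx
      rw [hb] at h3
      have h3 : z .right = 0 := h3
      have := add_mem h2 (h1.exact hA (v := .right) (by rw [h3]; exact zero_mem _) .left)
      rw [sub_add_cancel] at this
      rwa [← baseChange_coboundaries]
    · rw [← baseChange_coboundaries] at hx
      exact coboundaries_le_HF hx
  B_le_F q x hx := by
    rw [← baseChange_coboundaries] at hx
    exact coboundaries_le_HF hx
  F_le q x hx := by rw [← baseChange_cocycles]; exact HF_le_cocycles hx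
  split k p x hx := by
    obtain ⟨w, hw⟩ : ∃ w, k - n = w := ⟨_, rfl⟩
    obtain ⟨z, hz, hzW, hxz⟩ := mem_HW.1 hx
    rw [hw] at hzW
    obtain ⟨ε, hε⟩ := hA.sym_of_cocycle hz hzW
    have hD : D A w n ε = 0 := hε.d.unique (by
      rw [show (A.node .left).d z = 0 from hz.2]; exact sym_zero_of_mem (zero_mem _))
    obtain ⟨a, ha, b, hb, hDa, hDb, rfl⟩ := (hA.pureG w n).exists_split_ker
      (hA.pureG' w n) (D_conj (A := A)) D_G hD p
    obtain ⟨f, hf, hfW, hfF, hfs⟩ := hA.exists_coh_F ha hDa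
    obtain ⟨g, hg, hgW, hgF, hgs⟩ := hA.exists_coh_F hb hDb
    have hkw : w + n + 1 - p = k + 1 - p := by omega
    rw [hkw] at hgF
    have mem : ∀ {f : ∀ v, (A.node v)} {q : ℤ}, Coh A n f → (∀ v, f v ∈ (A.node v).W w n) →
        f .right ∈ A.F.F q n → f .left ∈ A.HF n q ⊓ A.HW n k := fun {f q} h1 h2 h3 =>
      ⟨⟨f, h1, by rw [sub_self]; exact zero_mem _, h3⟩,
        mem_HW.2 ⟨f .left, h1.cocycle _, by rw [hw]; exact h2 _, by rw [sub_self]; exact zero_mem _⟩⟩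
    refine ⟨f .left, mem hf hfW hfF, g .left, mem hg hgW hgF, ?_⟩
    obtain ⟨a', ha'⟩ := hA.sym_of_cocycle (hf.cocycle .left) (hfW _)
    obtain ⟨b', hb'⟩ := hA.sym_of_cocycle (hg.cocycle .left) (hgW _)
    obtain ⟨V, _, _, FV, φ, -, hφc, -, hφ⟩ := hA.exists_im w n
    have h1 := (hφ .left _).2 (hf.exists_sym_sub hA hfW hfs ha')
    have h2 := (hφ .left _).2 (hg.exists_sym_sub hA hgW hgs hb')
    have h3 : conjTensor _ (b - b') ∈ range φ := by
      obtain ⟨t, ht⟩ := h2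
      exact ⟨conjTensor _ t, by rw [hφc, ht]⟩
    have h4 := add_mem h1 h3
    rw [map_sub] at h4
    obtain ⟨c, hc, hcs⟩ := (hφ .left _).1 h4
    have h5 := mem_HW_of_sym hA hw (x := z - f .left - conjTensor _ (g .left))
      (sub_mem (sub_mem hz (hf.cocycle _)) (conj_cocycles (hg.cocycle _)))
      ((hε.sub ha').sub hb'.conj) hc (by convert hcs using 1; abel)
    have h6 : x - z ∈ A.HW n (k - 1) :=
      mem_HW.2 ⟨0, zero_mem _, zero_mem _, by rw [sub_zero]; exact hxz⟩
    have h7 := add_mem h6 h5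
    convert h7 using 1
    abel
  disj k p x y hx hy hxy := by
    obtain ⟨w, hw⟩ : ∃ w, k - n = w := ⟨_, rfl⟩
    obtain ⟨f, hf, hfW, hfF, hxf⟩ := hA.exists_coh_F_W hw hx.1 hx.2
    obtain ⟨g, hg, hgW, hgF, hyg⟩ := hA.exists_coh_F_W hw hy.1 hy.2
    obtain ⟨a, ha⟩ := hA.sym_of_cocycle (hf.cocycle .right) (hfW _)
    obtain ⟨b, hb⟩ := hA.sym_of_cocycle (hg.cocycle .right) (hgW _)
    obtain ⟨a', ha'⟩ := hA.sym_of_cocycle (hf.cocycle .left) (hfW _)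
    obtain ⟨b', hb'⟩ := hA.sym_of_cocycle (hg.cocycle .left) (hgW _)
    obtain ⟨V, _, _, FV, φ, hV, hφc, hφF, hφ⟩ := hA.exists_im w n
    have h1 := (hφ .left _).2 (hf.exists_sym_sub hA hfW ha ha')
    have h2 := (hφ .left _).2 (hg.exists_sym_sub hA hgW hb hb')
    have h3 : conjTensor _ (b - b') ∈ range φ := by
      obtain ⟨t, ht⟩ := h2
      exact ⟨conjTensor _ t, by rw [hφc, ht]⟩
    obtain ⟨s, hs, hsW, hxs⟩ := mem_HW.1 hxy
    have h4 : a' - conjTensor _ b' ∈ range φ := by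
      have hcob : f .left - conjTensor _ (g .left) - s ∈ (A.node .left).coboundaries n := by
        have h := add_mem (sub_mem hxs hxf) (conj_coboundaries hyg)
        convert h using 1
        rw [map_sub]
        abel
      obtain ⟨c, hc, hcd⟩ := hA.exact_W hcob (sub_mem (sub_mem (hfW _) (conjTensor_mem (hgW .left)))
        ((A.node .left).W_mono n (by omega) hsW))
      refine (hφ .left _).2 ⟨c, hc, ?_⟩
      rw [hcd]
      exact (ha'.sub hb'.conj).congr (by
        rw [sub_sub_cancel_left]
        exact neg_mem ((A.node .left).W_mono n (by omega) hsW))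
    have h5 : a - conjTensor _ b ∈ range φ := by
      have := add_mem (sub_mem h1 h3) h4
      rw [map_sub] at this
      convert this using 1
      abel
    have h6 := hV.mem_range (hA.pureG w n) hφc hφF (p := p) (q := k + 1 - p) (by omega)
      (mem_G_iff.2 ⟨_, hfF, ha⟩) (mem_G_iff.2 ⟨_, hgF, hb⟩) h5
    have h7 := sub_mem h6 h1
    rw [sub_sub_cancel] at h7
    obtain ⟨c, hc, hcs⟩ := (hφ .left _).1 h7
    have h8 := mem_HW_of_sym hA hw (hf.cocycle _) ha' hc hcs
    have h9 : x - f .left ∈ A.HW n (k - 1) :=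
      mem_HW.2 ⟨0, zero_mem _, zero_mem _, by rw [sub_zero]; exact hxf⟩
    have := add_mem h9 h8
    rwa [sub_add_cancel] at this

theorem exact_Q (hA : A.IsMixedHodge) {p : ℤ} {z : A.Q} (hz : z ∈ A.Q.coboundaries n)
    (hzW : z ∈ A.Q.W p n) : ∃ c ∈ shiftDeg (A.Q.W (p + 1)) n, A.Q.d c = z := by
  have h1 : (1 : ℂ) ⊗ₜ[ℚ] z ∈ A.Q°.coboundaries n := by
    rw [baseChange_coboundaries, tmul_one_mem_baseChange]
    exact hz
  obtain ⟨c, hc, hcd⟩ := hA.exact_W (v := .left) h1 (tmul_one_mem_baseChange.2 hzW)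
  have h2 : (1 : ℂ) ⊗ₜ[ℚ] z ∈ ((shiftDeg (A.Q.W (p + 1)) n).map A.Q.d)ˆ := by
    rw [baseChange_map, ← FDGA.baseChange_shiftDeg]
    exact ⟨c, hc, hcd⟩
  exact tmul_one_mem_baseChange.1 h2

end IsMixedHodge

end HodgeDiagram

/-! ## Free extensions by one generator -/

/-- The family `T` shifted by `a` degrees. -/
def shiftBy {k X : Type*} [Field k] [AddCommGroup X] [Module k X] (T : ℕ → Submodule k X)
    (a m : ℕ) : Submodule k X := if a ≤ m then T (m - a) else ⊥

theorem shiftBy_add {k X : Type*} [Field k] [AddCommGroup X] [Module k X]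
    (T : ℕ → Submodule k X) (a i : ℕ) : shiftBy T a (i + a) = T i := by
  simp [shiftBy]

theorem exists_of_mem_shiftBy {k X : Type*} [Field k] [AddCommGroup X] [Module k X]
    {T : ℕ → Submodule k X} {a m : ℕ} {x : X} (hx : x ∈ shiftBy T a m) :
    x = 0 ∨ ∃ i, i + a = m ∧ x ∈ T i := by
  unfold shiftBy at hx
  split_ifs at hx with h
  · exact .inr ⟨m - a, by omega, hx⟩
  · exact .inl hx

/-- A graded algebra `S ⊗ Λ(y)` for a generator `y` of degree `n`, with the coordinates `κ j` of
elements with respect to the powers of `y`, and the derivation that sends `y` to `ξ`. -/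
structure OneGen {k : Type} [Field k] (S : FDGA.{u} k) (n : ℕ) (ξ : S) where
  carrier : Type u
  [ring : Ring carrier]
  [algebra : Algebra k carrier]
  ι : S →ₐ[k] carrier
  y : carrier
  κ : ℕ → carrier →ₗ[k] S
  inj : ∀ b, (∀ j, κ j b = 0) → b = 0
  fin : ∀ b, ∃ N, ∀ j, N ≤ j → κ j b = 0
  κ_self : ∀ j s, Even n ∨ j ≤ 1 → κ j (ι s * y ^ j) = s
  κ_ne : ∀ j l s, j ≠ l → κ j (ι s * y ^ l) = 0
  κ_zero : ∀ j b, ¬ (Even n ∨ j ≤ 1) → κ j b = 0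
  swap : ∀ m s, s ∈ S.gr m → y * ι s = (-1 : k) ^ (n * m) • (ι s * y)
  d : carrier →ₗ[k] carrier
  d_d : ∀ x, d (d x) = 0
  d_ι : ∀ s, d (ι s) = ι (S.d s)
  d_y : d y = ι ξ
  leib : ∀ m x z, (∀ j, κ j x ∈ shiftBy S.gr (n * j) m) →
    d (x * z) = d x * z + (-1 : k) ^ m • (x * d z)
  lift : ∀ (C : Type u) [Ring C] [Algebra k C] (f : S →ₐ[k] C) (c : C),
    (∀ m s, s ∈ S.gr m → c * f s = (-1 : k) ^ (n * m) • (f s * c)) → (¬ Even n → c * c = 0) →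
    ∃ h : carrier →ₐ[k] C, (∀ s, h (ι s) = f s) ∧ h y = c

instance {k : Type} [Field k] {S : FDGA.{u} k} {n : ℕ} {ξ : S} :
    CoeSort (OneGen S n ξ) (Type u) := ⟨OneGen.carrier⟩

attribute [instance] OneGen.ring OneGen.algebra

namespace OneGen

variable {k : Type} [Field k] {S : FDGA.{u} k} {n : ℕ} {ξ : S} (E : OneGen S n ξ)

theorem pow_eq_zero {j : ℕ} (hj : ¬ (Even n ∨ j ≤ 1)) : E.y ^ j = 0 := by
  refine E.inj _ fun l => ?_
  by_cases h : l = j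
  · exact E.κ_zero _ _ (h ▸ hj)
  · have := E.κ_ne l j 1 h; rwa [map_one, one_mul] at this

theorem κ_mul (j l : ℕ) (b : E) :
    E.κ l (E.ι (E.κ j b) * E.y ^ j) = if l = j then E.κ j b else 0 := by
  split_ifs with h
  · subst h
    by_cases hl : Even n ∨ l ≤ 1
    · exact E.κ_self _ _ hl
    · rw [E.κ_zero _ _ hl, E.κ_zero _ _ hl]
  · exact E.κ_ne _ _ _ h

theorem eq_sum (b : E) : ∃ N, b = ∑ j ∈ Finset.range N, E.ι (E.κ j b) * E.y ^ j := by
  obtain ⟨N, hN⟩ := E.fin b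
  refine ⟨N, sub_eq_zero.1 (E.inj _ fun l => ?_)⟩
  rw [map_sub, map_sum, sub_eq_zero]
  simp only [κ_mul]
  rw [Finset.sum_ite_eq]
  split_ifs with h
  · rfl
  · exact hN l (by simpa using h)

/-- The elements whose coordinate at `y ^ j`, times `y ^ j`, is of degree `m` with respect to the
family `T j`. -/
def sub (T : ℕ → ℕ → Submodule k S) (m : ℕ) : Submodule k E :=
  ⨅ j, (shiftBy (T j) (n * j) m).comap (E.κ j)

variable {E}

theorem mem_sub {T : ℕ → ℕ → Submodule k S} {m : ℕ} {b : E} :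
    b ∈ E.sub T m ↔ ∀ j, E.κ j b ∈ shiftBy (T j) (n * j) m := by
  simp [sub]

theorem gen_mem {T : ℕ → ℕ → Submodule k S} {i j : ℕ} {s : S} (hs : s ∈ T j i) :
    E.ι s * E.y ^ j ∈ E.sub T (i + n * j) := by
  rw [mem_sub]
  intro l
  by_cases h : l = j
  · subst h
    by_cases hl : Even n ∨ l ≤ 1
    · rw [E.κ_self _ _ hl, shiftBy_add]; exact hs
    · rw [E.κ_zero _ _ hl]; exact zero_mem _
  · rw [E.κ_ne _ _ _ h]; exact zero_mem _

theorem sub_le {T : ℕ → ℕ → Submodule k S} {m : ℕ} {U : Submodule k E}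
    (h : ∀ i j s, i + n * j = m → s ∈ T j i → E.ι s * E.y ^ j ∈ U) : E.sub T m ≤ U := by
  intro b hb
  rw [mem_sub] at hb
  obtain ⟨N, hN⟩ := E.eq_sum b
  rw [hN]
  refine sum_mem fun j _ => ?_
  rcases exists_of_mem_shiftBy (hb j) with h0 | ⟨i, hi, hs⟩
  · rw [h0, map_zero, zero_mul]; exact zero_mem _
  · exact h i j _ hi hs

theorem pow_swap (j m : ℕ) (s : S) (hs : s ∈ S.gr m) :
    E.y ^ j * E.ι s = (-1 : k) ^ (n * j * m) • (E.ι s * E.y ^ j) := by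
  induction j with
  | zero => simp
  | succ j ih =>
    rw [pow_succ', mul_assoc, ih, mul_smul_comm, ← mul_assoc, E.swap m s hs, smul_mul_assoc,
      smul_smul, mul_assoc (E.ι s), ← pow_add, show n * j * m + n * m = n * (j + 1) * m by ring]

theorem gen_mul_gen {j i' j' : ℕ} {s t : S} (ht : t ∈ S.gr i') :
    (E.ι s * E.y ^ j) * (E.ι t * E.y ^ j') =
      (-1 : k) ^ (n * j * i') • (E.ι (s * t) * E.y ^ (j + j')) := by
  rw [mul_assoc, ← mul_assoc (E.y ^ j), pow_swap _ _ _ ht, smul_mul_assoc, mul_smul_comm, map_mul,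
    pow_add]
  simp only [mul_assoc]

theorem mul_mem_sub {T T' T'' : ℕ → ℕ → Submodule k S} (hT' : ∀ j i, T' j i ≤ S.gr i)
    (h : ∀ j j' i i' s t, s ∈ T j i → t ∈ T' j' i' → s * t ∈ T'' (j + j') (i + i')) {m m' : ℕ}
    {x z : E} (hx : x ∈ E.sub T m) (hz : z ∈ E.sub T' m') :
    x * z ∈ E.sub T'' (m + m') := by
  have h1 : E.sub T m ≤ (E.sub T'' (m + m')).comap (mulRight k z) := by
    refine sub_le fun i j s hi hs => ?_
    have h2 : E.sub T' m' ≤ (E.sub T'' (m + m')).comap (mulLeft k (E.ι s * E.y ^ j)) := by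
      refine sub_le fun i' j' t hi' ht => ?_
      change E.ι s * E.y ^ j * (E.ι t * E.y ^ j') ∈ E.sub T'' (m + m')
      rw [gen_mul_gen (hT' _ _ ht)]
      refine smul_mem _ _ ?_
      have := gen_mem (E := E) (T := T'') (h _ _ _ _ _ _ hs ht)
      convert this using 1
      rw [← hi, ← hi']; ring_nf
    exact h2 hz
  exact h1 hx

theorem sub_indep {G : Type*} {T : G → ℕ → ℕ → Submodule k S} {m : ℕ}
    (h : ∀ j, iSupIndep fun g => shiftBy (T g j) (n * j) m) :
    iSupIndep fun g => E.sub (T g) m := by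
  rw [iSupIndep_iff_finsetSum_eq_zero_imp_eq_zero]
  intro s x hx hsum g hg
  refine E.inj _ fun j => ?_
  have := (iSupIndep_iff_finsetSum_eq_zero_imp_eq_zero _).1 (h j) s (fun g => E.κ j (x g))
    (fun g hg => mem_sub.1 (hx g hg) j) (by rw [← map_sum, hsum, map_zero])
  exact this g hg

theorem sub_mono {T T' : ℕ → ℕ → Submodule k S} (h : ∀ j i, T j i ≤ T' j i) (m : ℕ) :
    E.sub T m ≤ E.sub T' m := sub_le fun _ _ _ hi hs => hi ▸ gen_mem (h _ _ hs)

theorem sub_le_of_mul {G : Type*} [AddCommGroup G] {T : G → ℕ → Submodule k S} {τ : G}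
    {U : G → ℕ → Submodule k E} (hU : ∀ g i s, s ∈ T g i → E.ι s ∈ U g i)
    (hy : E.y ∈ U τ n)
    (hmul : ∀ g g' i i' x z, x ∈ U g i → z ∈ U g' i' → x * z ∈ U (g + g') (i + i')) (g : G)
    (m : ℕ) : E.sub (fun j => T (g - j • τ)) m ≤ U g m := by
  refine sub_le fun i j s hi hs => ?_
  have key : ∀ j : ℕ, ∀ g i, s ∈ T g i → E.ι s * E.y ^ j ∈ U (g + j • τ) (i + n * j) := by
    intro j g i hs
    induction j with
    | zero => simpa using hU g i s hs
    | succ j ih =>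
      rw [pow_succ, ← mul_assoc, succ_nsmul, ← add_assoc, mul_add, mul_one, ← add_assoc]
      exact hmul _ _ _ _ _ _ ih hy
  have := key j _ _ hs
  rwa [sub_add_cancel, hi] at this

theorem ι_mem {T : ℕ → ℕ → Submodule k S} {i : ℕ} {s : S} (hs : s ∈ T 0 i) : E.ι s ∈ E.sub T i := by
  simpa using gen_mem (E := E) (T := T) (j := 0) hs

theorem y_mem {T : ℕ → ℕ → Submodule k S} (h1 : (1 : S) ∈ T 1 0) : E.y ∈ E.sub T n := by
  simpa using gen_mem (E := E) (T := T) (j := 1) h1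

theorem gr_iSup : ⨆ m, E.sub (fun _ => S.gr) m = ⊤ := by
  rw [eq_top_iff]
  intro b _
  obtain ⟨N, hN⟩ := E.eq_sum b
  rw [hN]
  refine sum_mem fun j _ => ?_
  induction E.κ j b using S.hom_induction with
  | h i s hs => exact Submodule.mem_iSup_of_mem (i + n * j) (gen_mem hs)
  | ha x z hx hz => rw [map_add, add_mul]; exact add_mem hx hz

theorem shiftBy_indep {X G : Type*} [AddCommGroup X] [Module k X] {T : G → ℕ → Submodule k X}
    (h : ∀ i, iSupIndep fun g => T g i) (a m : ℕ) :
    iSupIndep fun g => shiftBy (T g) a m := by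
  unfold shiftBy
  split_ifs with h'
  · exact h _
  · exact fun i => disjoint_bot_left

theorem gr_indep : iSupIndep fun m => E.sub (fun _ => S.gr) m := by
  rw [iSupIndep_iff_finsetSum_eq_zero_imp_eq_zero]
  intro s x hx hsum g hg
  refine E.inj _ fun j => ?_
  have hind := (iSupIndep_iff_finsetSum_eq_zero_imp_eq_zero _).1
    (DirectSum.Decomposition.isInternal S.gr).submodule_iSupIndep
    ((s.filter (n * j ≤ ·)).image (· - n * j)) (fun i => E.κ j (x (i + n * j)))
  rcases exists_of_mem_shiftBy (mem_sub.1 (hx g hg) j) with h0 | ⟨i, rfl, -⟩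
  · exact h0
  refine hind (fun i hi => ?_) ?_ i ?_
  · obtain ⟨l, hl, rfl⟩ := Finset.mem_image.1 hi
    rw [Finset.mem_filter] at hl
    rw [Nat.sub_add_cancel hl.2]
    have := mem_sub.1 (hx l hl.1) j
    rw [shiftBy, if_pos hl.2] at this
    exact this
  · rw [Finset.sum_image (by
      intro a ha b hb hab
      have ha := (Finset.mem_filter.1 ha).2
      have hb := (Finset.mem_filter.1 hb).2
      simp only at hab
      omega)]
    have h1 : ∀ l ∈ s.filter (n * j ≤ ·), E.κ j (x (l - n * j + n * j)) = E.κ j (x l) :=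
      fun l hl => by rw [Nat.sub_add_cancel (Finset.mem_filter.1 hl).2]
    rw [Finset.sum_congr rfl h1, Finset.sum_filter_of_ne, ← map_sum, hsum, map_zero]
    intro l hl hne
    by_contra hlt
    have := mem_sub.1 (hx l hl) j
    rw [shiftBy, if_neg hlt] at this
    exact hne this
  · exact Finset.mem_image.2 ⟨i + n * j, Finset.mem_filter.2 ⟨hg, by omega⟩, by omega⟩

theorem one_mem_sub {T : ℕ → ℕ → Submodule k S} (h1 : (1 : S) ∈ T 0 0) : (1 : E) ∈ E.sub T 0 := by
  rw [← map_one E.ι]; exact ι_mem h1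

variable (E)

/-- The graded algebra underlying a one-generator extension. -/
@[reducible] def gcalg : GCAlg.{u} k where
  carrier := E
  gr := E.sub fun _ => S.gr
  graded :=
    { one_mem := one_mem_sub SetLike.GradedOne.one_mem
      mul_mem := fun _ _ _ _ hx hz => mul_mem_sub (fun _ _ => le_rfl)
        (fun _ _ _ _ _ _ hs ht => SetLike.GradedMul.mul_mem hs ht) hx hz
      toDecomposition := (DirectSum.isInternal_submodule_of_iSupIndep_of_iSup_eq_top
        E.gr_indep E.gr_iSup).chooseDecomposition }
  comm {m m' x z} hx hz := by
    have h1 : E.sub (fun _ => S.gr) m ≤ LinearMap.ker (mulRight k z -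
        (-1 : k) ^ (m * m') • mulLeft k z) := by
      refine sub_le fun i j s hi hs => ?_
      have h2 : E.sub (fun _ => S.gr) m' ≤ LinearMap.ker (mulLeft k (E.ι s * E.y ^ j) -
          (-1 : k) ^ (m * m') • mulRight k (E.ι s * E.y ^ j)) := by
        refine sub_le fun i' j' t hi' ht => ?_
        change E.ι s * E.y ^ j * (E.ι t * E.y ^ j') -
          (-1 : k) ^ (m * m') • (E.ι t * E.y ^ j' * (E.ι s * E.y ^ j)) = 0
        rw [gen_mul_gen ht, gen_mul_gen hs, S.comm hs ht, map_smul,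
          smul_mul_assoc, smul_smul, smul_smul, add_comm j' j, ← pow_add, ← pow_add, ← hi, ← hi',
          sub_eq_zero]
        by_cases hn : Even n ∨ j + j' ≤ 1
        · congr 1
          have key : ∀ a b : ℕ, Even (a + b) → (-1 : k) ^ a = (-1 : k) ^ b := fun a b h => by
            rcases Nat.even_or_odd a with ha | ha
            · rw [ha.neg_one_pow, ((Nat.even_add.1 h).1 ha).neg_one_pow]
            · rw [ha.neg_one_pow, (Nat.not_even_iff_odd.1 fun hb =>
                (Nat.not_even_iff_odd.2 ha) ((Nat.even_add.1 h).2 hb)).neg_one_pow]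
          refine key _ _ ?_
          have e : n * j * i' + i * i' + ((i + n * j) * (i' + n * j') + n * j' * i) =
            2 * (n * j * i' + i * i' + n * j' * i) + n * n * (j * j') := by ring
          rw [e]
          refine (even_two_mul _).add ?_
          rcases hn with hn | hn
          · exact (hn.mul_right _).mul_right _
          · have : j * j' = 0 := by
              rcases Nat.eq_zero_or_pos j with h | h
              · simp [h]
              · have : j' = 0 := by omega
                simp [this]
            rw [this]
            simp
        · rw [E.pow_eq_zero hn, mul_zero, smul_zero, smul_zero]
      exact h2 hz
    exact sub_eq_zero.1 (h1 hx)

end OneGen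

namespace OneGen

variable {k : Type} [Field k] {S : FDGA.{u} k} {n : ℕ} {ξ : S} {E : OneGen S n ξ}

theorem mul_mem_fam {G : Type*} [AddCommGroup G] (T T' T'' : G → ℕ → Submodule k S) {τ : G}
    (hT' : ∀ g i, T' g i ≤ S.gr i)
    (hmul : ∀ g g' i i' s t, s ∈ T g i → t ∈ T' g' i' → s * t ∈ T'' (g + g') (i + i'))
    {g g' : G} {m m' : ℕ} {x z : E} (hx : x ∈ E.sub (fun j => T (g - j • τ)) m)
    (hz : z ∈ E.sub (fun j => T' (g' - j • τ)) m') :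
    x * z ∈ E.sub (fun j => T'' (g + g' - j • τ)) (m + m') := by
  refine mul_mem_sub (T'' := fun j => T'' (g + g' - j • τ)) (fun j i => hT' _ i)
    (fun j j' i i' s t hs ht => ?_) hx hz
  have e : g - j • τ + (g' - j' • τ) = g + g' - (j + j') • τ := by rw [add_smul]; abel
  have := hmul _ _ _ _ _ _ hs ht
  rwa [e] at this

theorem d_mem_sub {G : Type*} [AddCommGroup G] (T T' : G → ℕ → Submodule k S) {τ : G}
    (hT : ∀ g i, T g i ≤ S.gr i) (hT' : ∀ g i, T' g i ≤ S.gr i) (h1 : (1 : S) ∈ T 0 0)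
    (hmul : ∀ g g' i i' s t, s ∈ T g i → t ∈ T g' i' → s * t ∈ T (g + g') (i + i'))
    (hmul' : ∀ g g' i i' s t, s ∈ T g i → t ∈ T' g' i' → s * t ∈ T' (g + g') (i + i'))
    (hmul'' : ∀ g g' i i' s t, s ∈ T' g i → t ∈ T g' i' → s * t ∈ T' (g + g') (i + i'))
    (hd : ∀ g i s, s ∈ T g i → S.d s ∈ T' g (i + 1)) (hξ : ξ ∈ T' τ (n + 1)) {g : G} {m : ℕ}
    {x : E} (hx : x ∈ E.sub (fun j => T (g - j • τ)) m) :
    E.d x ∈ E.sub (fun j => T' (g - j • τ)) (m + 1) := by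
  have key := sub_le_of_mul (E := E) (T := T) (τ := τ)
    (U := fun g m => E.sub (fun j => T (g - j • τ)) m ⊓
      (E.sub (fun j => T' (g - j • τ)) (m + 1)).comap E.d) ?_ ?_ ?_ g m
  · exact (key hx).2
  · intro g i s hs
    refine ⟨ι_mem (by simpa using hs), ?_⟩
    change E.d (E.ι s) ∈ E.sub (fun j => T' (g - j • τ)) (i + 1)
    rw [E.d_ι]
    exact ι_mem (by simpa using hd _ _ _ hs)
  · refine ⟨y_mem (by simpa using h1), ?_⟩
    change E.d E.y ∈ E.sub (fun j => T' (τ - j • τ)) (n + 1)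
    rw [E.d_y]
    exact ι_mem (by simpa using hξ)
  · rintro g g' i i' x z ⟨hx, hdx⟩ ⟨hz, hdz⟩
    refine ⟨mul_mem_fam T T T hT hmul hx hz, ?_⟩
    change E.d (x * z) ∈ E.sub (fun j => T' (g + g' - j • τ)) (i + i' + 1)
    rw [E.leib i x z (mem_sub.1 (sub_mono (fun _ _ => hT _ _) i hx))]
    refine add_mem ?_ (smul_mem _ _ ?_)
    · rw [add_right_comm]; exact mul_mem_fam T' T T' hT hmul'' hdx hz
    · rw [add_assoc]; exact mul_mem_fam T T' T' hT' hmul' hx hdz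

variable (E)

/-- The filtered dga underlying a one-generator extension, the generator being of weight `w`. -/
@[reducible] def fdga {w : ℤ} (hξ : ξ ∈ S.W w (n + 1)) : FDGA.{u} k where
  toGCAlg := E.gcalg
  d := E.d
  d_gr m x hx := by
    have := d_mem_sub (E := E) (G := ℤ) (fun _ => S.gr) (fun _ => S.gr) (τ := 0)
      (fun _ _ => le_rfl) (fun _ _ => le_rfl) SetLike.GradedOne.one_mem
      (fun _ _ _ _ _ _ hs ht => SetLike.GradedMul.mul_mem hs ht)
      (fun _ _ _ _ _ _ hs ht => SetLike.GradedMul.mul_mem hs ht)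
      (fun _ _ _ _ _ _ hs ht => SetLike.GradedMul.mul_mem hs ht)
      (fun _ i s hs => S.d_gr i s hs) (S.W_le _ _ hξ) (g := 0) (m := m) (x := x) hx
    exact this
  d_d := E.d_d
  leibniz m x z hx := E.leib m x z (mem_sub.1 hx)
  W p m := E.sub (fun j => S.W (p - j • w)) m
  W_le p m := sub_mono (fun _ _ => S.W_le _ _) m
  W_mono m p q h := sub_mono (fun _ i => S.W_mono i (by omega)) m
  W_exhaustive m x hx := by
    have hdir : Directed (· ≤ ·) fun p : ℤ => E.sub (fun j => S.W (p - j • w)) m :=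
      Monotone.directed_le fun p q h => sub_mono (fun _ i => S.W_mono i (by omega)) m
    refine (Submodule.mem_iSup_of_directed _ hdir).1 ?_
    refine sub_le (U := ⨆ p : ℤ, E.sub (fun j => S.W (p - j • w)) m) (fun i j s hi hs => ?_) hx
    obtain ⟨q, hq⟩ := S.W_exhaustive i s hs
    refine Submodule.mem_iSup_of_mem (q + j • w) ?_
    rw [← hi]
    exact gen_mem (by rwa [add_sub_cancel_right])
  one_W := one_mem_sub (by simpa using S.one_W)
  mul_W p q m l x z hx hz := mul_mem_fam S.W S.W S.W S.W_le
    (fun _ _ _ _ _ _ hs ht => S.mul_W _ _ _ _ _ _ hs ht) hx hz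
  d_W p m x hx := d_mem_sub S.W S.W S.W_le S.W_le S.one_W
    (fun _ _ _ _ _ _ hs ht => S.mul_W _ _ _ _ _ _ hs ht)
    (fun _ _ _ _ _ _ hs ht => S.mul_W _ _ _ _ _ _ hs ht)
    (fun _ _ _ _ _ _ hs ht => S.mul_W _ _ _ _ _ _ hs ht) (S.d_W) hξ hx

def incl {w : ℤ} (hξ : ξ ∈ S.W w (n + 1)) : FDGAHom S (E.fdga hξ) where
  toFun := E.ι
  map_gr _ _ hx := ι_mem (T := fun _ => S.gr) hx
  map_d s := (E.d_ι s).symm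
  map_W p _ _ hx := ι_mem (T := fun j => S.W (p - j • w)) (by simpa using hx)

end OneGen

/-! ### Generators of even degree -/

section Even

variable {k : Type} [Field k] (S : FDGA.{u} k) {n : ℕ} {ξ : S}

theorem GCAlg.mul_self_eq_zero [CharZero k] (S : GCAlg.{u} k) {n : ℕ} {x : S} (hn : ¬ Even n)
    (hx : x ∈ S.gr n) : x * x = 0 := by
  have h := S.comm hx hx
  rw [((Nat.not_even_iff_odd.1 hn).mul (Nat.not_even_iff_odd.1 hn)).neg_one_pow, neg_one_smul] at h
  have h2 : (2 : k) • (x * x) = 0 := by rw [two_smul]; nth_rewrite 1 [h]; exact neg_add_cancel _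
  exact (smul_eq_zero.1 h2).resolve_left two_ne_zero

theorem GCAlg.mul_eq_of_even (S : GCAlg.{u} k) {n : ℕ} {ξ : S} (hn : Even n)
    (hξ : ξ ∈ S.gr n) (s : S) : ξ * s = s * ξ := by
  induction s using S.hom_induction with
  | h m s hs => rw [S.comm hξ hs, (hn.mul_right m).neg_one_pow, one_smul]
  | ha x y hx hy => rw [mul_add, add_mul, hx, hy]

theorem GCAlg.mul_eq_of_odd (S : GCAlg.{u} k) {n : ℕ} {ξ : S} (hn : ¬ Even n)
    (hξ : ξ ∈ S.gr n) (s : S) : ξ * s = S.sign s * ξ := by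
  induction s using S.hom_induction with
  | h m s hs =>
    rw [S.comm hξ hs, S.sign_of_mem hs, smul_mul_assoc, pow_mul,
      (Nat.not_even_iff_odd.1 hn).neg_one_pow]
  | ha x y hx hy => rw [mul_add, map_add, add_mul, hx, hy]

open Polynomial in
/-- The differential of `S[y]` for `y` of even degree. -/
def evenD (ξ : S) : S[X] →ₗ[k] S[X] :=
  S.pd + mulRight k (C ξ) ∘ₗ S.psign.toLinearMap ∘ₗ
    (Polynomial.derivative (R := S)).restrictScalars k

open Polynomial in
theorem evenD_apply (p : S[X]) : evenD S ξ p = S.pd p + S.psign (derivative p) * C ξ := rfl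

open Polynomial in
theorem C_mul_eq (hn : Even n) (hξ : ξ ∈ S.gr (n + 1)) (p : S[X]) : C ξ * p = S.psign p * C ξ := by
  ext i
  rw [coeff_C_mul, coeff_mul_C, S.coeff_psign,
    S.mul_eq_of_odd (by rw [Nat.even_add_one]; exact not_not.2 hn) hξ]

open Polynomial in
theorem pd_C (s : S) : S.pd (C s) = C (S.d s) := by
  ext i
  rw [FDGA.pd, coeff_polyMap, coeff_C, coeff_C]
  split_ifs <;> simp

open Polynomial in
/-- `S ⊗ Λ(y)` for `y` of even degree. -/
def evenGen [CharZero k] (hn : Even n) (hξ : ξ ∈ S.gr (n + 1)) (hdξ : S.d ξ = 0) :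
    OneGen S n ξ where
  carrier := S[X]
  ι := CAlgHom
  y := X
  κ j := (lcoeff S j).restrictScalars k
  inj b h := Polynomial.ext h
  fin b := ⟨b.natDegree + 1, fun j hj => coeff_eq_zero_of_natDegree_lt hj⟩
  κ_self j s _ := by change (C s * X ^ j).coeff j = s; simp
  κ_ne j l s h := by
    change (C s * X ^ l).coeff j = 0
    rw [coeff_C_mul, coeff_X_pow, if_neg h, mul_zero]
  κ_zero j b h := absurd (.inl hn) h
  swap m s _ := by rw [(hn.mul_right m).neg_one_pow, one_smul]; exact X_mul
  d := evenD S ξ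
  d_d p := by
    have hn' : ¬ Even (n + 1) := by rw [Nat.even_add_one]; exact not_not.2 hn
    have h0 : ∀ q : S[X], S.psign (q * C ξ) * C ξ = 0 := fun q => by
      rw [← C_mul_eq S hn hξ, ← mul_assoc, C_mul_eq S hn hξ, mul_assoc, ← C_mul,
        S.mul_self_eq_zero hn' hξ, C_0, mul_zero]
    rw [evenD_apply, evenD_apply, map_add, S.pd_pd, S.pd_mul, S.pd_psign, pd_C, hdξ, C_0,
      mul_zero, map_add (derivative (R := S)), ← S.pd_derivative, derivative_mul,
      derivative_C, mul_zero, map_add, add_mul]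
    simp only [add_zero, zero_add, h0, neg_mul, neg_add_cancel]
  d_ι s := by
    change evenD S ξ (C s) = C (S.d s)
    rw [evenD_apply, pd_C, derivative_C, map_zero, zero_mul, add_zero]
  d_y := by
    change evenD S ξ X = C ξ
    have : S.pd (X : S[X]) = 0 := by
      ext i
      rw [FDGA.pd, coeff_polyMap, coeff_X]
      have h1 : S.d 1 = 0 := by simpa using (S.algebraMap_mem_cocycles 1).2
      split_ifs <;> simp [h1]
    rw [evenD_apply, this, derivative_X, map_one, one_mul, zero_add]
  leib m x z hx := by
    have hs : (-1 : k) ^ m • x = S.psign x := by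
      ext i
      rw [coeff_smul, S.coeff_psign]
      rcases exists_of_mem_shiftBy (hx i) with h | ⟨j, hj, h⟩
      · have h : x.coeff i = 0 := h; rw [h, map_zero, smul_zero]
      · have h : x.coeff i ∈ S.gr j := h
        rw [S.sign_of_mem h, ← hj, pow_add, (hn.mul_right i).neg_one_pow, mul_one]
    rw [← smul_mul_assoc, hs]
    simp only [evenD_apply, S.pd_mul, derivative_mul, map_add, map_mul, add_mul, mul_add]
    rw [mul_assoc (S.psign (derivative x)), ← C_mul_eq S hn hξ z]
    simp only [mul_assoc]
    abel
  lift C _ _ f c hc _ := by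
    refine ⟨{ eval₂RingHom' (f : S →+* C) c fun s => ?_ with
      commutes' := fun r => ?_ }, fun s => ?_, ?_⟩
    · induction s using S.hom_induction with
      | h m s hs =>
        have := hc m s hs
        rw [(hn.mul_right m).neg_one_pow, one_smul] at this
        exact this.symm
      | ha x y hx hy => change Commute (f (x + y)) c; rw [map_add]; exact Commute.add_left hx hy
    · change eval₂ (f : S →+* C) c (algebraMap k S[X] r) = _
      rw [Polynomial.algebraMap_apply, eval₂_C]
      exact f.commutes r
    · exact eval₂_C _ _
    · exact eval₂_X _ _

end Even

section

/-! ### Generators of odd degree -/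

section Odd

variable {k : Type} [Field k]

/-- `S ⊗ Λ(y)` for `y` of odd degree; the pair `(a, b)` stands for `a + b y`. -/
def OddExt (S : GCAlg.{u} k) : Type u := S × S

namespace OddExt

variable {S : GCAlg.{u} k}

instance : AddCommGroup (OddExt S) := inferInstanceAs (AddCommGroup (S × S))

instance : Module k (OddExt S) := inferInstanceAs (Module k (S × S))

@[ext] theorem ext' {x y : OddExt S} (h : x.1 = y.1) (h' : x.2 = y.2) : x = y := Prod.ext h h'

instance : Mul (OddExt S) := ⟨fun x y => (x.1 * y.1, x.1 * y.2 + x.2 * S.sign y.1)⟩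

instance : One (OddExt S) := ⟨((1 : S), (0 : S))⟩

@[simp] theorem fst_mul (x y : OddExt S) : (x * y).1 = x.1 * y.1 := rfl
@[simp] theorem snd_mul (x y : OddExt S) : (x * y).2 = x.1 * y.2 + x.2 * S.sign y.1 := rfl
@[simp] theorem fst_one : (1 : OddExt S).1 = 1 := rfl
@[simp] theorem snd_one : (1 : OddExt S).2 = 0 := rfl
@[simp] theorem fst_add (x y : OddExt S) : (x + y).1 = x.1 + y.1 := rfl
@[simp] theorem snd_add (x y : OddExt S) : (x + y).2 = x.2 + y.2 := rfl
@[simp] theorem fst_zero : (0 : OddExt S).1 = 0 := rfl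
@[simp] theorem snd_zero : (0 : OddExt S).2 = 0 := rfl
@[simp] theorem fst_smul (c : k) (x : OddExt S) : (c • x).1 = c • x.1 := rfl
@[simp] theorem snd_smul (c : k) (x : OddExt S) : (c • x).2 = c • x.2 := rfl

instance : Ring (OddExt S) :=
  { (inferInstance : AddCommGroup (OddExt S)), (inferInstance : Mul (OddExt S)),
    (inferInstance : One (OddExt S)) with
    left_distrib := fun x y z => by ext1 <;> simp [mul_add]; abel
    right_distrib := fun x y z => by ext1 <;> simp [add_mul]; abel
    zero_mul := fun x => by ext1 <;> simp
    mul_zero := fun x => by ext1 <;> simp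
    mul_assoc := fun x y z => by ext1 <;> simp [mul_add, add_mul, mul_assoc, add_assoc]
    one_mul := fun x => by ext1 <;> simp
    mul_one := fun x => by ext1 <;> simp }

instance : Algebra k (OddExt S) :=
  Algebra.ofModule (fun c x y => by ext1 <;> simp [smul_add])
    (fun c x y => by ext1 <;> simp [smul_add])

variable (S) in
def ι : S →ₐ[k] OddExt S := AlgHom.ofLinearMap (inl k S S) rfl fun x y => by
    apply ext'
    · rfl
    · change (0 : S) = x * 0 + 0 * _; simp

def y : OddExt S := ((0 : S), (1 : S))

@[simp] theorem fst_ι (s : S) : (ι S s).1 = s := rfl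
@[simp] theorem snd_ι (s : S) : (ι S s).2 = 0 := rfl
@[simp] theorem fst_y : (y : OddExt S).1 = 0 := rfl
@[simp] theorem snd_y : (y : OddExt S).2 = 1 := rfl

variable (S) in
/-- The coordinates with respect to `1` and the generator. -/
def κ : ℕ → OddExt S →ₗ[k] S
  | 0 => fst k S S
  | 1 => snd k S S
  | _ + 2 => 0

@[simp] theorem κ_zero_apply (x : OddExt S) : κ S 0 x = x.1 := rfl
@[simp] theorem κ_one_apply (x : OddExt S) : κ S 1 x = x.2 := rfl

theorem y_sq : (y : OddExt S) * y = 0 := by ext1 <;> simp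

end OddExt

variable (S : FDGA.{u} k) {n : ℕ} {ξ : S}

/-- The differential of `S ⊗ Λ(y)` for `y` of odd degree. -/
def oddD (ξ : S) : OddExt S.toGCAlg →ₗ[k] OddExt S.toGCAlg :=
  LinearMap.prod (S.d ∘ₗ fst k S S +
    mulRight k ξ ∘ₗ S.sign.toLinearMap ∘ₗ snd k S S)
    (S.d ∘ₗ snd k S S)

@[simp] theorem fst_oddD (x : OddExt S.toGCAlg) : (oddD S ξ x).1 = S.d x.1 + S.sign x.2 * ξ := rfl
@[simp] theorem snd_oddD (x : OddExt S.toGCAlg) : (oddD S ξ x).2 = S.d x.2 := rfl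

/-- `S ⊗ Λ(y)` for `y` of odd degree. -/
def oddGen (hn : ¬ Even n) (hξ : ξ ∈ S.gr (n + 1)) (hdξ : S.d ξ = 0) :
    OneGen S n ξ where
  carrier := OddExt S.toGCAlg
  ι := OddExt.ι S.toGCAlg
  y := OddExt.y
  κ := OddExt.κ S.toGCAlg
  inj b h := OddExt.ext' (h 0) (h 1)
  fin b := ⟨2, fun j hj => by obtain ⟨i, rfl⟩ := Nat.exists_eq_add_of_le' hj; rfl⟩
  κ_self j s h := by have h := h.resolve_left hn; interval_cases j <;> simp
  κ_ne j l s h := by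
    match j, l, h with
    | _ + 2, _, _ => rfl
    | 0, 1, _ => simp
    | 1, 0, _ => simp
    | 0, l + 2, _ => rw [pow_add, pow_two, OddExt.y_sq, mul_zero, mul_zero, map_zero]
    | 1, l + 2, _ => rw [pow_add, pow_two, OddExt.y_sq, mul_zero, mul_zero, map_zero]
  κ_zero j b h := by obtain ⟨i, rfl⟩ : ∃ i, j = i + 2 := ⟨j - 2, by omega⟩; rfl
  swap m s hs := by
    ext1
    · simp
    · simp [S.sign_of_mem hs, pow_mul, (Nat.not_even_iff_odd.1 hn).neg_one_pow]
  d := oddD S ξ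
  d_d x := by
    ext1
    · simp only [fst_oddD, snd_oddD, map_add, S.d_d, S.d_mul, S.d_sign, S.sign_sign, hdξ, mul_zero,
        neg_mul, zero_add, add_zero, neg_add_cancel, OddExt.fst_zero]
    · simp [S.d_d]
  d_ι s := by ext1 <;> simp
  d_y := by
    ext1
    · simp
    · simpa using (S.algebraMap_mem_cocycles 1).2
  leib m x z hx := by
    have hn' : Even (n + 1) := Nat.even_add_one.2 hn
    have e1 : (-1 : k) ^ m • x.1 = S.sign x.1 := by
      rcases exists_of_mem_shiftBy (hx 0) with h | ⟨j, hj, h⟩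
      · have h : x.1 = 0 := h; rw [h, map_zero, smul_zero]
      · have h : x.1 ∈ S.gr j := h; rw [S.sign_of_mem h, ← hj, mul_zero, add_zero]
    have e2 : (-1 : k) ^ m • x.2 = -S.sign x.2 := by
      rcases exists_of_mem_shiftBy (hx 1) with h | ⟨j, hj, h⟩
      · have h : x.2 = 0 := h; rw [h, map_zero, smul_zero, neg_zero]
      · have h : x.2 ∈ S.gr j := h
        rw [S.sign_of_mem h, ← hj, pow_add, mul_one, (Nat.not_even_iff_odd.1 hn).neg_one_pow,
          mul_neg_one, neg_smul]
    have e3 : S.sign ξ = ξ := by rw [S.sign_of_mem hξ, hn'.neg_one_pow, one_smul]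
    have e4 := S.mul_eq_of_even hn' hξ
    ext1
    · simp only [fst_oddD, OddExt.fst_mul, OddExt.snd_mul, OddExt.fst_add, OddExt.fst_smul,
        ← smul_mul_assoc, e1, S.d_mul, map_add, map_mul, S.sign_sign, add_mul, mul_add]
      rw [mul_assoc (S.sign x.2) ξ, e4]
      simp only [mul_assoc]
      abel
    · change S.d (x.1 * z.2 + x.2 * S.sign z.1) = (S.d x.1 + S.sign x.2 * ξ) * z.2 +
        S.d x.2 * S.sign z.1 + (-1 : k) ^ m • (x.1 * S.d z.2 +
          x.2 * S.sign (S.d z.1 + S.sign z.2 * ξ))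
      rw [smul_add, ← smul_mul_assoc, ← smul_mul_assoc, e1, e2, map_add, S.d_mul, S.d_mul, S.d_sign,
        map_add, map_mul, S.sign_sign, e3, add_mul, mul_add, mul_assoc (S.sign x.2) ξ, e4]
      simp only [neg_mul, mul_neg]
      abel
  lift C _ _ f c hc hcc := by
    have hc : ∀ s, c * f s = f (S.sign s) * c := fun s => by
      induction s using S.hom_induction with
      | h m s hs =>
        rw [hc m s hs, S.sign_of_mem hs, map_smul, smul_mul_assoc, pow_mul,
          (Nat.not_even_iff_odd.1 hn).neg_one_pow]
      | ha x y hx hy => rw [map_add, mul_add, hx, hy, map_add, map_add, add_mul]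
    refine ⟨AlgHom.ofLinearMap (f.toLinearMap ∘ₗ fst k S S +
      mulRight k c ∘ₗ f.toLinearMap ∘ₗ snd k S S) ?_ ?_,
      fun s => ?_, ?_⟩
    · change f 1 + f 0 * c = 1; simp
    · intro x z
      change f (x.1 * z.1) + f (x.1 * z.2 + x.2 * S.sign z.1) * c =
        (f x.1 + f x.2 * c) * (f z.1 + f z.2 * c)
      have e : f x.2 * c * (f z.2 * c) = 0 := by
        rw [mul_assoc, ← mul_assoc c, hc, mul_assoc (f _) c, hcc hn, mul_zero, mul_zero]
      rw [add_mul, mul_add, mul_add, e, add_zero, mul_assoc (f x.2), hc]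
      simp only [map_mul, map_add, add_mul, mul_assoc]
      abel
    · change f s + f 0 * c = f s; simp
    · change f 0 + f 1 * c = c; simp

end Odd

theorem exists_oneGen {k : Type} [Field k] [CharZero k] (S : FDGA.{u} k) {n : ℕ} {ξ : S}
    (hξ : ξ ∈ S.gr (n + 1)) (hdξ : S.d ξ = 0) : Nonempty (OneGen S n ξ) := by
  by_cases hn : Even n
  · exact ⟨evenGen S hn hξ hdξ⟩
  · exact ⟨oddGen S hn hξ hdξ⟩

end

instance {k : Type} [Field k] {A B : GCAlg.{u} k} : CoeFun (GCHom A B) (fun _ => A → B) :=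
  ⟨fun f => f.toFun⟩

/-! ## Free extensions by several generators -/

/-- A multiplicative bigrading of a filtered dga that splits the weight filtration and is preserved
by the differential. -/
structure Bigrading {k : Type} [Field k] (S : FDGA.{u} k) (J : ℤ × ℤ → ℕ → Submodule k S) :
    Prop where
  indep : ∀ i, iSupIndep fun γ => J γ i
  W_le : ∀ p i, S.W p i ≤ part (fun γ => J γ i) fun γ => γ.1 + γ.2 ≤ p + i
  le_W : ∀ γ i, J γ i ≤ S.W (γ.1 + γ.2 - i) i
  one : (1 : S) ∈ J 0 0
  mul : ∀ γ γ' i i' s t, s ∈ J γ i → t ∈ J γ' i' → s * t ∈ J (γ + γ') (i + i')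
  d : ∀ γ i s, s ∈ J γ i → S.d s ∈ J γ (i + 1)

theorem Bigrading.le_gr {k : Type} [Field k] {S : FDGA.{u} k}
    {J : ℤ × ℤ → ℕ → Submodule k S} (h : Bigrading S J) (γ : ℤ × ℤ) (i : ℕ) :
    J γ i ≤ S.gr i := (h.le_W γ i).trans (S.W_le _ _)

namespace OneGen

variable {k : Type} [Field k] {S : FDGA.{u} k} {n : ℕ} {ξ : S} (E : OneGen S n ξ)

theorem bigrading {J : ℤ × ℤ → ℕ → Submodule k S} (h : Bigrading S J) {τ : ℤ × ℤ} {w : ℤ}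
    (hw : w = τ.1 + τ.2 - n) (hξ : ξ ∈ S.W w (n + 1)) (hξJ : ξ ∈ J τ (n + 1)) :
    Bigrading (E.fdga hξ) fun γ => E.sub fun j => J (γ - j • τ) where
  indep i := sub_indep fun j => shiftBy_indep (T := fun γ => J (γ - j • τ))
    (fun i => (h.indep i).comp (f := fun γ => γ - j • τ) (sub_left_injective)) _ _
  W_le p m := by
    refine sub_le fun i j s hi hs => ?_
    have h1 : part (fun γ => J γ i) (fun γ => γ.1 + γ.2 ≤ p - j • w + i) ≤
        (part (fun γ => E.sub (fun j => J (γ - j • τ)) m) fun γ => γ.1 + γ.2 ≤ p + m).comap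
          (mulRight k (E.y ^ j) ∘ₗ E.ι.toLinearMap) := by
      refine part_le fun γ hγ s hs => ?_
      refine le_part (J := fun γ => E.sub (fun j => J (γ - j • τ)) m) (γ := γ + j • τ) ?_ ?_
      · rw [hw] at hγ
        simp only [Prod.fst_add, Prod.snd_add, Prod.smul_fst, Prod.smul_snd] at hγ ⊢
        simp only [nsmul_eq_mul] at hγ ⊢
        rw [← hi]
        push_cast
        linarith
      · rw [← hi]
        exact gen_mem (T := fun j' => J (γ + j • τ - j' • τ)) (by rwa [add_sub_cancel_right])
    exact h1 (h.W_le _ _ hs)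
  le_W γ m := by
    refine sub_le fun i j s hi hs => ?_
    have e : γ.1 + γ.2 - ((i + n * j : ℕ) : ℤ) - j • w =
        (γ - j • τ).1 + (γ - j • τ).2 - (i : ℤ) := by
      simp only [Prod.fst_sub, Prod.snd_sub, Prod.smul_fst, Prod.smul_snd, hw]
      simp only [nsmul_eq_mul]
      push_cast
      ring
    have hs' : s ∈ S.W (γ.1 + γ.2 - ((i + n * j : ℕ) : ℤ) - j • w) i := by
      rw [e]
      exact h.le_W _ _ hs
    rw [← hi]
    exact gen_mem (T := fun l => S.W (γ.1 + γ.2 - ((i + n * j : ℕ) : ℤ) - l • w)) hs'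
  one := one_mem_sub (T := fun j => J (0 - j • τ)) (by simpa using h.one)
  mul γ γ' i i' s t hs ht := (mul_mem_fam (E := E) J J J h.le_gr h.mul hs ht :
      (show E from s) * (show E from t) ∈ E.sub (fun j => J (γ + γ' - j • τ)) (i + i'))
  d γ i s hs := (d_mem_sub (E := E) J J h.le_gr h.le_gr h.one h.mul h.mul h.mul h.d hξJ hs :
      E.d (show E from s) ∈ E.sub (fun j => J (γ - j • τ)) (i + 1))

theorem finite_gr (hn : 1 ≤ n) (h : ∀ i, Module.Finite k (S.gr i)) (m : ℕ) :
    Module.Finite k (E.sub (fun _ => S.gr) m) := by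
  have h1 : E.sub (fun _ => S.gr) m ≤ (Finset.range (m + 1)).sup fun i =>
      (Finset.range (m + 1)).sup fun j =>
        (S.gr i).map (mulRight k (E.y ^ j) ∘ₗ E.ι.toLinearMap) := by
    refine sub_le fun i j s hi hs => ?_
    have hj : j ≤ n * j := Nat.le_mul_of_pos_left j hn
    have h2 := Finset.le_sup (f := fun j =>
      (S.gr i).map (mulRight k (E.y ^ j) ∘ₗ E.ι.toLinearMap))
      (Finset.mem_range.2 (by omega : j < m + 1))
    have h3 := Finset.le_sup (f := fun i => (Finset.range (m + 1)).sup fun j =>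
      (S.gr i).map (mulRight k (E.y ^ j) ∘ₗ E.ι.toLinearMap))
      (Finset.mem_range.2 (by omega : i < m + 1))
    exact h3 (h2 ⟨s, hs, rfl⟩)
  exact Submodule.finiteDimensional_of_le h1

end OneGen

/-- `B` is the free extension of `S` by generators `y a` of degree `n` and weight `w a` with
differentials `ξ a`. -/
structure FreeExt {k : Type} [Field k] (S : FDGA.{u} k) (n : ℕ) {α : Type} (ξ : α → S)
    (w : α → ℤ) (B : FDGA.{u} k) (ι : FDGAHom S B) (y : α → B) : Prop where
  y_W : ∀ a, y a ∈ B.W (w a) n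
  d_y : ∀ a, B.d (y a) = ι (ξ a)
  lift : ∀ (C : GCAlg.{u} k) (f : GCHom S.toGCAlg C) (c : α → C), (∀ a, c a ∈ C.gr n) →
    ∃ h : GCHom B.toGCAlg C, (∀ s, h (ι s) = f s) ∧ ∀ a, h (y a) = c a
  W_le : ∀ U : ℤ → ℕ → Submodule k B, (∀ p m s, s ∈ S.W p m → ι s ∈ U p m) →
    (∀ a, y a ∈ U (w a) n) →
    (∀ p q m l x z, x ∈ U p m → z ∈ U q l → x * z ∈ U (p + q) (m + l)) → ∀ p m, B.W p m ≤ U p m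
  finite : (∀ i, Module.Finite k (S.gr i)) → ∀ i, Module.Finite k (B.gr i)
  bigrading : ∀ (J : ℤ × ℤ → ℕ → Submodule k S) (τ : α → ℤ × ℤ), Bigrading S J →
    (∀ a, w a = (τ a).1 + (τ a).2 - n) → (∀ a, ξ a ∈ J (τ a) (n + 1)) →
    ∃ J' : ℤ × ℤ → ℕ → Submodule k B, Bigrading B J' ∧
      (∀ γ i s, s ∈ J γ i → ι s ∈ J' γ i) ∧ (∀ a, y a ∈ J' (τ a) n) ∧
      ∀ U : ℤ × ℤ → ℕ → Submodule k B, (∀ γ i s, s ∈ J γ i → ι s ∈ U γ i) → (∀ a, y a ∈ U (τ a) n) →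
        (∀ γ γ' i i' x z, x ∈ U γ i → z ∈ U γ' i' → x * z ∈ U (γ + γ') (i + i')) →
        ∀ γ i, J' γ i ≤ U γ i

namespace FreeExt

variable {k : Type} [Field k] {S B : FDGA.{u} k} {n : ℕ} {ι : FDGAHom S B}

theorem of_isEmpty {α : Type} [IsEmpty α] (S : FDGA.{u} k) (n : ℕ) (ξ : α → S)
    (w : α → ℤ) (y : α → S) : FreeExt S n ξ w S (FDGAHom.id S) y where
  y_W a := isEmptyElim a
  d_y a := isEmptyElim a
  lift _ f _ _ := ⟨f, fun _ => rfl, fun a => isEmptyElim a⟩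
  W_le _ h _ _ p m _ hx := h p m _ hx
  finite h := h
  bigrading J _ h _ _ := ⟨J, h, fun _ _ _ hs => hs, fun a => isEmptyElim a,
    fun _ h _ _ γ i _ hx => h γ i _ hx⟩

theorem option [CharZero k] (hn : 1 ≤ n) {α : Type} {ξ : Option α → S} {w : Option α → ℤ}
    {y : α → B} (h : FreeExt S n (fun a => ξ (some a)) (fun a => w (some a)) B ι y)
    (hξ : ξ none ∈ S.W (w none) (n + 1)) (hdξ : S.d (ξ none) = 0) :
    ∃ (B' : FDGA.{u} k) (ι' : FDGAHom S B') (y' : Option α → B'), FreeExt S n ξ w B' ι' y' := by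
  have hξ' := ι.map_W _ _ _ hξ
  obtain ⟨E⟩ := exists_oneGen B (B.W_le _ _ hξ') (by rw [← ι.map_d, hdξ, map_zero])
  refine ⟨E.fdga hξ', (E.incl hξ').comp ι, fun a => a.elim E.y fun a => E.ι (y a), ?_, ?_, ?_, ?_,
    ?_, ?_⟩
  · rintro (_ | a)
    · exact OneGen.y_mem (T := fun j => B.W (w none - j • w none)) (by simpa using B.one_W)
    · exact (E.incl hξ').map_W _ _ _ (h.y_W a)
  · rintro (_ | a)
    · exact E.d_y
    · exact (E.d_ι _).trans (congrArg E.ι (h.d_y a))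
  · intro C f c hc
    obtain ⟨h1, hs, ha⟩ := h.lift C f (fun a => c (some a)) fun a => hc _
    obtain ⟨h2, hs', hy'⟩ := E.lift C h1.toFun (c none)
      (fun m s hs => C.comm (hc none) (h1.map_gr m s hs)) fun hn => C.mul_self_eq_zero hn (hc none)
    refine ⟨⟨h2, fun m x hx => ?_⟩, fun s => (hs' _).trans (hs s), ?_⟩
    · have : E.sub (fun _ => B.gr) m ≤ (C.gr m).comap h2.toLinearMap := by
        refine OneGen.sub_le fun i j s hi hs => ?_
        change h2 (E.ι s * E.y ^ j) ∈ C.gr m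
        rw [map_mul, map_pow, hs', hy', ← hi, mul_comm n j]
        exact SetLike.GradedMul.mul_mem (h1.map_gr _ _ hs) (SetLike.pow_mem_graded j (hc none))
      exact this hx
    · rintro (_ | a)
      · exact hy'
      · exact (hs' _).trans (ha a)
  · intro U hS hy hmul p m
    exact OneGen.sub_le_of_mul (T := B.W) (fun p m s hs => h.W_le
      (fun p m => (U p m).comap E.ι.toLinearMap) hS (fun a => hy (some a))
      (fun p q m l x z hx hz => by
        change E.ι (x * z) ∈ U (p + q) (m + l)
        rw [map_mul]; exact hmul _ _ _ _ _ _ hx hz) p m hs) (hy none) hmul p m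
  · intro hS i; exact E.finite_gr hn (h.finite hS) i
  · intro J τ hJ hw hξJ
    obtain ⟨J1, h1, hι, hy, hle⟩ := h.bigrading J (fun a => τ (some a)) hJ (fun a => hw _)
      fun a => hξJ _
    refine ⟨_, E.bigrading h1 (hw none) hξ' (hι _ _ _ (hξJ none)), fun γ i s hs => ?_, ?_, ?_⟩
    · exact OneGen.ι_mem (by simpa using hι _ _ _ hs)
    · rintro (_ | a)
      · exact OneGen.y_mem (by simpa using h1.one)
      · exact OneGen.ι_mem (by simpa using hy a)
    · intro U hS hy hmul γ m
      exact OneGen.sub_le_of_mul (T := J1) (fun p m s hs => hle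
        (fun p m => (U p m).comap E.ι.toLinearMap) hS (fun a => hy (some a))
        (fun p q m l x z hx hz => by
          change E.ι (x * z) ∈ U (p + q) (m + l)
          rw [map_mul]; exact hmul _ _ _ _ _ _ hx hz) p m hs) (hy none) hmul γ m

theorem reindex {α β : Type} (e : β ≃ α) {ξ : α → S} {w : α → ℤ} {y : α → B}
    (h : FreeExt S n ξ w B ι y) : FreeExt S n (ξ ∘ e) (w ∘ e) B ι (y ∘ e) where
  y_W a := h.y_W _
  d_y a := h.d_y _
  lift C f c hc := by
    obtain ⟨h1, h2, h3⟩ := h.lift C f (c ∘ e.symm) fun a => hc _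
    exact ⟨h1, h2, fun a => by simp [h3]⟩
  W_le U hS hy := h.W_le U hS fun a => by simpa using hy (e.symm a)
  finite := h.finite
  bigrading J τ hJ hw hξ := by
    obtain ⟨J', h1, h2, h3, h4⟩ := h.bigrading J (τ ∘ e.symm) hJ
      (fun a => by simpa using hw (e.symm a)) fun a => by simpa using hξ (e.symm a)
    exact ⟨J', h1, h2, fun a => by simpa using h3 (e a),
      fun U hS hy => h4 U hS fun a => by simpa using hy (e.symm a)⟩

theorem exists_freeExt [CharZero k] (hn : 1 ≤ n) (α : Type) [Finite α] :
    ∀ (S : FDGA.{u} k) (ξ : α → S) (w : α → ℤ), (∀ a, ξ a ∈ S.W (w a) (n + 1)) →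
      (∀ a, S.d (ξ a) = 0) → ∃ (B : FDGA.{u} k) (ι : FDGAHom S B) (y : α → B),
        FreeExt S n ξ w B ι y := by
  induction α using Finite.induction_empty_option with
  | of_equiv e ih =>
    intro S ξ w hξ hdξ
    obtain ⟨B, ι, y, h⟩ := ih S (ξ ∘ e) (w ∘ e) (fun a => hξ _) fun a => hdξ _
    refine ⟨B, ι, y ∘ e.symm, ?_⟩
    have := h.reindex e.symm
    simpa [Function.comp_assoc] using this
  | h_empty => exact fun S ξ w _ _ => ⟨S, FDGAHom.id S, ξ, of_isEmpty S n ξ w ξ⟩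
  | h_option ih =>
    intro S ξ w hξ hdξ
    obtain ⟨B, ι, y, h⟩ := ih S (fun a => ξ (some a)) (fun a => w (some a)) (fun a => hξ _)
      fun a => hdξ _
    exact h.option hn (hξ none) (hdξ none)

end FreeExt

/-! ## Free extensions by filtered vector spaces -/

/-- A graded algebra over `ℂ` as a graded algebra over `ℚ`. -/
@[reducible] def GCAlg.restrictQ (D : GCAlg.{u} ℂ) : GCAlg.{u} ℚ :=
  let _ : Algebra ℚ D := Algebra.compHom D (algebraMap ℚ ℂ)
  have _ : IsScalarTower ℚ ℂ D := IsScalarTower.of_algebraMap_eq fun _ => rfl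
  { carrier := D
    gr := fun n => (D.gr n).restrictScalars ℚ
    graded :=
      { one_mem := SetLike.GradedOne.one_mem (A := D.gr)
        mul_mem := fun _ _ _ _ hx hy => SetLike.GradedMul.mul_mem (A := D.gr) hx hy
        toDecomposition := DirectSum.IsInternal.chooseDecomposition _
          (DirectSum.Decomposition.isInternal D.gr) }
    comm := fun {n m x y} hx hy => by
      rw [D.comm hx hy]
      rcases Nat.even_or_odd (n * m) with h | h
      · simp [h.neg_one_pow]
      · simp [h.neg_one_pow] }

theorem GCHom.ext_of_gr {k : Type} [Field k] {A B : GCAlg.{u} k} {f g : GCHom A B}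
    (h : ∀ m x, x ∈ A.gr m → f x = g x) : f = g := by
  refine GCHom.ext (AlgHom.ext fun x => ?_)
  induction x using A.hom_induction with
  | h m x hx => exact h m x hx
  | ha x y hx hy => rw [map_add, map_add, hx, hy]

theorem baseChange_hom_ext {M X : Type*} [AddCommGroup M] [Module ℚ M] [AddCommGroup X]
    [Module ℂ X] {f g : (ℂ ⊗[ℚ] M) →ₗ[ℂ] X} (h : ∀ m : M, f (1 ⊗ₜ m) = g (1 ⊗ₜ m)) : f = g := by
  refine LinearMap.ext fun x => ?_
  induction x using TensorProduct.induction_on with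
  | zero => rw [map_zero, map_zero]
  | tmul z m =>
    rw [show z ⊗ₜ[ℚ] m = z • ((1 : ℂ) ⊗ₜ[ℚ] m) by rw [TensorProduct.smul_tmul', smul_eq_mul, mul_one],
      map_smul, map_smul, h]
  | add x y hx hy => rw [map_add, map_add, hx, hy]

/-- `B` is the free extension of `S` by the filtered vector space `(V, WV)` in degree `n` with the
differential `ξ`. -/
structure IsFree {S B : FDGA.{u} ℚ} (ι : FDGAHom S B) (n : ℕ) {V : Type u} [AddCommGroup V]
    [Module ℚ V] (WV : ℤ → Submodule ℚ V) (ξ : V →ₗ[ℚ] S) (i : V →ₗ[ℚ] B) :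
    Prop where
  free : IsFreeExtension ι.toGCHom i n
  d_i : ∀ v, B.d (i v) = ι (ξ v)
  W_ext : IsMultExtension ι.toGCHom S.W i n WV B.W

namespace IsFree

variable {S B : FDGA.{u} ℚ} {ι : FDGAHom S B} {n : ℕ} {V : Type u} [AddCommGroup V]
  [Module ℚ V] {WV : ℤ → Submodule ℚ V} {ξ : V →ₗ[ℚ] S} {i : V →ₗ[ℚ] B}

theorem W_le (h : IsFree ι n WV ξ i) (U : ℤ → ℕ → Submodule ℚ B)
    (hS : ∀ p m s, s ∈ S.W p m → ι s ∈ U p m) (hi : ∀ p v, v ∈ WV p → i v ∈ U p n)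
    (hmul : ∀ p q m l x z, x ∈ U p m → z ∈ U q l → x * z ∈ U (p + q) (m + l)) (p : ℤ) (m : ℕ) :
    B.W p m ≤ U p m :=
  h.W_ext.2 ⟨hS, hi, fun p q m l x hx y hy => hmul p q m l x y hx hy⟩ p m

theorem gr_le (h : IsFree ι n WV ξ i) (U : ℕ → Submodule ℚ B)
    (hS : ∀ m s, s ∈ S.gr m → ι s ∈ U m) (hi : ∀ v, i v ∈ U n)
    (hmul : ∀ m l x z, x ∈ U m → z ∈ U l → x * z ∈ U (m + l)) (m : ℕ) : B.gr m ≤ U m := by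
  intro x hx
  obtain ⟨p, hp⟩ := B.W_exhaustive m x hx
  exact h.W_le (fun _ => U) (fun p m s hs => hS m s (S.W_le _ _ hs)) (fun _ v _ => hi v)
    (fun _ _ => hmul) p m hp

theorem hom_ext (h : IsFree ι n WV ξ i) {D : GCAlg.{u} ℚ} {f g : GCHom B.toGCAlg D}
    (hS : ∀ s, f (ι s) = g (ι s))
    (hi : ∀ v, f (i v) = g (i v)) : f = g := by
  obtain ⟨k, -, hk⟩ := h.free.2 D ⟨f.toFun.comp ι.toFun, fun n x hx => f.map_gr _ _ (ι.map_gr _ _ hx)⟩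
    (fˡ ∘ₗ i) fun v => f.map_gr _ _ (h.free.1 v)
  rw [hk f ⟨fun _ => rfl, fun _ => rfl⟩, hk g ⟨fun s => (hS s).symm, fun v => (hi v).symm⟩]

theorem hom_ext_C (h : IsFree ι n WV ξ i) {X : Type*} [Ring X] [Algebra ℂ X] {f g : B° →ₐ[ℂ] X}
    (hS : ∀ s, f (ι° s) = g (ι° s))
    (hi : ∀ v, f (iˆ v) = g (iˆ v)) : f = g := by
  have key : ∀ m x, x ∈ B.gr m → f ((1 : ℂ) ⊗ₜ x) = g ((1 : ℂ) ⊗ₜ x) := by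
    intro m x hx
    refine h.gr_le (fun _ =>
      { carrier := {x | f ((1 : ℂ) ⊗ₜ x) = g ((1 : ℂ) ⊗ₜ x)}
        add_mem' := fun {x y} hx hy => by
          change f ((1 : ℂ) ⊗ₜ (x + y)) = g ((1 : ℂ) ⊗ₜ (x + y))
          rw [TensorProduct.tmul_add, map_add, map_add]
          exact congrArg₂ (· + ·) hx hy
        zero_mem' := by
          change f ((1 : ℂ) ⊗ₜ 0) = g ((1 : ℂ) ⊗ₜ 0)
          rw [TensorProduct.tmul_zero, map_zero, map_zero]
        smul_mem' := fun q x hx => by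
          change f ((1 : ℂ) ⊗ₜ (q • x)) = g ((1 : ℂ) ⊗ₜ (q • x))
          have e : (1 : ℂ) ⊗ₜ[ℚ] (q • x) = (q : ℂ) • ((1 : ℂ) ⊗ₜ[ℚ] x) := by
            rw [← TensorProduct.smul_tmul, TensorProduct.smul_tmul', smul_eq_mul, mul_one,
              Algebra.smul_def, mul_one]
            rfl
          rw [e, map_smul, map_smul]
          exact congrArg (fun t => (q : ℂ) • t) hx }) ?_ ?_ ?_ m hx
    · exact fun m s _ => hS (1 ⊗ₜ s)
    · exact fun v => hi (1 ⊗ₜ v)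
    · intro m l x z hx hz
      have hx : f ((1 : ℂ) ⊗ₜ x) = g ((1 : ℂ) ⊗ₜ x) := hx
      have hz : f ((1 : ℂ) ⊗ₜ z) = g ((1 : ℂ) ⊗ₜ z) := hz
      change f ((1 : ℂ) ⊗ₜ (x * z)) = g ((1 : ℂ) ⊗ₜ (x * z))
      have e : (1 : ℂ) ⊗ₜ[ℚ] (x * z) = (1 ⊗ₜ x) * (1 ⊗ₜ z) := by
        rw [Algebra.TensorProduct.tmul_mul_tmul, one_mul]
      rw [e, map_mul, map_mul, hx, hz]
  have : f.toLinearMap = g.toLinearMap := baseChange_hom_ext fun x => by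
    induction x using B.hom_induction with
    | h m x hx => exact key m x hx
    | ha x y hx hy => rw [TensorProduct.tmul_add, map_add, map_add, hx, hy]
  exact AlgHom.ext fun x => LinearMap.congr_fun this x

/-- A homomorphism of graded algebras on a free extension is a morphism of filtered dga's if it is so
on the base and on the generators. -/
theorem compat (h : IsFree ι n WV ξ i) {K : Type} [Field K] {D : FDGA.{u} K} (σ : ℚ →+* K)
    (ψ : B →+* D) (hσ : ∀ q x, ψ (q • x) = σ q • ψ x)
    (hgr : ∀ m x, x ∈ B.gr m → ψ x ∈ D.gr m) (hdS : ∀ s, ψ (ι (S.d s)) = D.d (ψ (ι s)))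
    (hWS : ∀ p m s, s ∈ S.W p m → ψ (ι s) ∈ D.W p m)
    (hdi : ∀ v, D.d (ψ (i v)) = ψ (ι (ξ v))) (hWi : ∀ p v, v ∈ WV p → ψ (i v) ∈ D.W p n) :
    (∀ x, ψ (B.d x) = D.d (ψ x)) ∧ ∀ p m x, x ∈ B.W p m → ψ x ∈ D.W p m := by
  constructor
  · have key : ∀ m x, x ∈ B.gr m → ψ (B.d x) = D.d (ψ x) := by
      intro m x hx
      refine (h.gr_le (fun m =>
        { carrier := {x | x ∈ B.gr m ∧ ψ (B.d x) = D.d (ψ x)}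
          add_mem' := fun {x y} hx hy => ⟨add_mem hx.1 hy.1, by
            rw [map_add, map_add, hx.2, hy.2, map_add, map_add]⟩
          zero_mem' := ⟨zero_mem _, by simp⟩
          smul_mem' := fun q x hx => ⟨smul_mem _ q hx.1, by
            rw [map_smul, hσ, hx.2, hσ, map_smul]⟩ }) ?_ ?_ ?_ m hx).2
      · exact fun m s hs => ⟨ι.map_gr _ _ hs, by rw [← ι.map_d, hdS]⟩
      · exact fun v => ⟨h.free.1 v, by rw [h.d_i, hdi]⟩
      · rintro m l x z ⟨hx, hx'⟩ ⟨hz, hz'⟩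
        refine ⟨SetLike.GradedMul.mul_mem hx hz, ?_⟩
        rw [B.leibniz m x z hx, map_add, map_mul, hσ, map_mul, map_mul, hx', hz',
          D.leibniz m _ _ (hgr m x hx), map_pow, map_neg, map_one]
    intro x
    induction x using B.hom_induction with
    | h m x hx => exact key m x hx
    | ha x y hx hy => rw [map_add, map_add, hx, hy, map_add, map_add]
  · exact h.W_le (fun p m =>
      { carrier := {x | ψ x ∈ D.W p m}
        add_mem' := fun {x y} hx hy => by
          change ψ (x + y) ∈ D.W p m
          rw [map_add]; exact add_mem hx hy
        zero_mem' := by change ψ 0 ∈ D.W p m; rw [map_zero]; exact zero_mem _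
        smul_mem' := fun q x hx => by
          change ψ (q • x) ∈ D.W p m
          rw [hσ]; exact smul_mem _ _ hx }) hWS hWi
      fun p q m l x z hx hz => by
        change ψ (x * z) ∈ D.W (p + q) (m + l)
        rw [map_mul]; exact D.mul_W _ _ _ _ _ _ hx hz

theorem lift (h : IsFree ι n WV ξ i) {D : FDGA.{u} ℚ} (f : FDGAHom S D) (g : V →ₗ[ℚ] D)
    (hg : ∀ v, g v ∈ D.gr n) (hW : ∀ p v, v ∈ WV p → g v ∈ D.W p n)
    (hd : ∀ v, D.d (g v) = f (ξ v)) :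
    ∃ k : FDGAHom B D, (∀ s, k (ι s) = f s) ∧ ∀ v, k (i v) = g v := by
  obtain ⟨k, ⟨hk1, hk2⟩, -⟩ := h.free.2 D.toGCAlg f.toGCHom g hg
  obtain ⟨h1, h2⟩ := h.compat (RingHom.id ℚ) (k.toFun : B →+* D)
    (fun q x => map_smul k.toFun q x) k.map_gr
    (fun s => by
      change k _ = D.d (k _)
      exact (hk1 _).trans ((f.map_d s).trans (congrArg D.d (hk1 s).symm)))
    (fun p m s hs => by change k _ ∈ _; exact (hk1 s).symm ▸ f.map_W _ _ _ hs)
    (fun v => by change D.d (k _) = k _; rw [hk2, hd]; exact (hk1 _).symm)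
    (fun p v hv => by change k _ ∈ _; rw [hk2]; exact hW p v hv)
  exact ⟨⟨k, h1, h2⟩, hk1, hk2⟩

theorem lift_C (h : IsFree ι n WV ξ i) {D : FDGA.{u} ℂ} (f : FDGAHom S° D)
    (g : (ℂ ⊗[ℚ] V) →ₗ[ℂ] D) (hg : ∀ v, g v ∈ D.gr n)
    (hW : ∀ p v, v ∈ (WV p)ˆ → g v ∈ D.W p n)
    (hd : ∀ v, D.d (g v) = f (ξˆ v)) :
    ∃ k : FDGAHom B° D, (∀ s, k (ι° s) = f s) ∧ ∀ v, k (iˆ v) = g v := by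
  let _ : Algebra ℚ D := Algebra.compHom D (algebraMap ℚ ℂ)
  have _ : IsScalarTower ℚ ℂ D := IsScalarTower.of_algebraMap_eq fun _ => rfl
  obtain ⟨k, ⟨hk1, hk2⟩, -⟩ := h.free.2 D.toGCAlg.restrictQ
    ⟨(f.toFun.restrictScalars ℚ).comp Algebra.TensorProduct.includeRight,
      fun m x hx => f.map_gr m _ (tmul_one_mem_baseChange.2 hx)⟩
    ((g.restrictScalars ℚ) ∘ₗ TensorProduct.mk ℚ ℂ V 1) fun v => hg _
  have hk1 : ∀ s, k (ι s) = f (1 ⊗ₜ s) := hk1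
  have hk2 : ∀ v, k (i v) = g (1 ⊗ₜ v) := hk2
  obtain ⟨h1, h2⟩ := h.compat (D := D) (algebraMap ℚ ℂ) (k.toFun : B →+* D)
    (fun q x => map_smul k.toFun q x) k.map_gr
    (fun s => by change k _ = D.d (k _); rw [hk1, hk1]; exact f.map_d (1 ⊗ₜ s))
    (fun p m s hs => by
      change k _ ∈ D.W p m
      rw [hk1]
      exact f.map_W _ _ _ (tmul_one_mem_baseChange.2 hs))
    (fun v => by change D.d (k _) = k _; rw [hk1, hk2, hd]; rfl)
    (fun p v hv => by change k _ ∈ D.W p n; rw [hk2]; exact hW _ _ (tmul_one_mem_baseChange.2 hv))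
  let kC : ℂ ⊗[ℚ] B →ₐ[ℂ] D := Algebra.TensorProduct.lift (Algebra.ofId ℂ D) k.toFun
      fun x y => Algebra.commutes x _
  have hkC : ∀ x, kC (1 ⊗ₜ x) = k x := fun x =>
    (Algebra.TensorProduct.lift_tmul _ _ _ _ _).trans (by rw [map_one, one_mul])
  have mem : ∀ {T : Submodule ℚ B} {U : Submodule ℂ D},
      (∀ x ∈ T, k x ∈ U) → ∀ x ∈ Tˆ, kC x ∈ U := fun {T U} hTU => by
    have h3 : Tˆ ≤ U.comap kC.toLinearMap := baseChange_le_iff.2 fun x hx => by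
      change kC (1 ⊗ₜ x) ∈ U
      rw [hkC]
      exact hTU x hx
    exact h3
  have hd' : kC.toLinearMap ∘ₗ B°.d = D.d ∘ₗ kC.toLinearMap := baseChange_hom_ext fun x => by
      change kC (B.dˆ (1 ⊗ₜ x)) = D.d (kC (1 ⊗ₜ x))
      rw [LinearMap.baseChange_tmul, hkC, hkC]
      exact h1 x
  refine ⟨⟨⟨kC, fun m => mem fun x hx => k.map_gr m x hx⟩, LinearMap.congr_fun hd',
    fun p m => mem fun x hx => h2 p m x hx⟩, ?_, ?_⟩
  · refine LinearMap.congr_fun (baseChange_hom_ext (f := kC.toLinearMap ∘ₗ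
      ι°ˡ) (g := fˡ) fun s => ?_)
    change kC (1 ⊗ₜ ι.toFun s) = f (1 ⊗ₜ s)
    rw [hkC, hk1]
  · refine LinearMap.congr_fun (baseChange_hom_ext (f := kC.toLinearMap ∘ₗ iˆ) (g := g) fun v => ?_)
    change kC (iˆ (1 ⊗ₜ v)) = g (1 ⊗ₜ v)
    rw [LinearMap.baseChange_tmul, hkC, hk2]

end IsFree

theorem exists_isFree (S : FDGA.{u} ℚ) {n : ℕ} (hn : 1 ≤ n) {V : Type u} [AddCommGroup V]
    [Module ℚ V] [Module.Finite ℚ V] {WV : ℤ → Submodule ℚ V} (hWV : Monotone WV)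
    (h1 : ∃ a, WV a = ⊥) (h2 : ∃ a, WV a = ⊤) (ξ : V →ₗ[ℚ] S)
    (hξ : ∀ p v, v ∈ WV p → ξ v ∈ S.W p (n + 1)) (hdξ : ∀ v, S.d (ξ v) = 0) :
    ∃ (B : FDGA.{u} ℚ) (ι : FDGAHom S B) (i : V →ₗ[ℚ] B), IsFree ι n WV ξ i ∧
      ((∀ m, Module.Finite ℚ (S.gr m)) → ∀ m, Module.Finite ℚ (B.gr m)) := by
  obtain ⟨b, w, hb, hw⟩ := CMHS.exists_adapted_basis hWV h1 h2
  obtain ⟨B, ι, y, h⟩ := FreeExt.exists_freeExt hn _ S (fun a => ξ (b a)) w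
    (fun a => hξ _ _ (hb a)) fun a => hdξ _
  have hy : ∀ a, b.constr ℚ y (b a) = y a := fun a => b.constr_basis ℚ y a
  have hi : ∀ v, b.constr ℚ y v ∈ B.gr n := fun v => by
    have : (⊤ : Submodule ℚ V) ≤ (B.gr n).comap (b.constr ℚ y) := by
      rw [← b.span_eq, span_le]
      rintro _ ⟨a, rfl⟩
      change b.constr ℚ y (b a) ∈ B.gr n
      rw [hy]
      exact B.W_le _ _ (h.y_W a)
    exact this trivial
  refine ⟨B, ι, b.constr ℚ y, ⟨⟨hi, fun C f g hg => ?_⟩, fun v => ?_, ⟨?_, ?_, ?_⟩, ?_⟩, h.finite⟩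
  · obtain ⟨k, hk1, hk2⟩ := h.lift C f (fun a => g (b a)) fun a => hg _
    refine ⟨k, ⟨hk1, fun v => ?_⟩, fun k' hk' => GCHom.ext_of_gr fun m x hx => ?_⟩
    · have : kˡ ∘ₗ b.constr ℚ y = g := b.ext fun a => by
        change k (b.constr ℚ y (b a)) = g (b a)
        rw [hy, hk2]
      exact LinearMap.congr_fun this v
    · obtain ⟨p, hp⟩ := B.W_exhaustive m x hx
      have := h.W_le (fun _ _ => LinearMap.ker (k'ˡ - kˡ))
        (fun p m s _ => sub_eq_zero.2 ((hk'.1 s).trans (hk1 s).symm))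
        (fun a => sub_eq_zero.2 (by change k' (y a) = k (y a); rw [hk2, ← hk'.2, hy]))
        (fun p q m l x z hx hz => by
          have hx : k' x = k x := sub_eq_zero.1 hx
          have hz : k' z = k z := sub_eq_zero.1 hz
          exact sub_eq_zero.2 (by
            change k' (x * z) = k (x * z)
            rw [map_mul, map_mul, hx, hz])) p m hp
      exact sub_eq_zero.1 this
  · have : B.d ∘ₗ b.constr ℚ y = ιˡ ∘ₗ ξ := b.ext fun a => by
      change B.d (b.constr ℚ y (b a)) = ι (ξ (b a))
      rw [hy, h.d_y]
    exact LinearMap.congr_fun this v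
  · exact ι.map_W
  · intro p v hv
    have : WV p ≤ (B.W p n).comap (b.constr ℚ y) := by
      rw [hw, span_le]
      rintro _ ⟨a, ha, rfl⟩
      change b.constr ℚ y (b a) ∈ B.W p n
      rw [hy]
      exact B.W_mono n ha (h.y_W a)
    exact this hv
  · exact fun p q m l x hx z hz => B.mul_W p q m l x z hx hz
  · rintro U ⟨hS, hV, hmul⟩ p m
    exact h.W_le U hS (fun a => by rw [← hy]; exact hV _ _ (hb a))
      (fun p q m l x z hx hz => hmul _ _ _ _ x hx z hz) p m

/-! ## Finite-dimensional mixed Hodge structures on filtered dga's -/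

/-- A filtered dga of finite type with a Hodge filtration and strictly decreasing differential
whose homogeneous parts carry mixed Hodge structures for the shifted weight filtration. -/
structure IsMH (S : FDGA.{u} ℚ) (F : HodgeFil S°) : Prop where
  d_W : ∀ p n x, x ∈ S.W p n → S.d x ∈ S.W (p - 1) (n + 1)
  finite : ∀ n, Module.Finite ℚ (S.gr n)
  cmhs : ∀ i, CMHS (conjTensor S) ⊥ ((S.gr i)ˆ) (fun k => (S.W (k - i) i)ˆ) (fun q => F.F q i)

theorem GInd.iSupIndep {k X Γ : Type*} [Field k] [AddCommGroup X] [Module k X]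
    {J : Γ → Submodule k X} (h : GInd ⊥ J) : iSupIndep J := by
  classical
  rw [iSupIndep_iff_finsetSum_eq_zero_imp_eq_zero]
  intro s v hv hs γ hγ
  have h1 := h (Finsupp.onFinset s (fun γ => if γ ∈ s then v γ else 0) fun γ hγ => by
    by_contra h; simp [h] at hγ) (fun γ => by
      change (if γ ∈ s then v γ else 0) ∈ J γ
      split_ifs with h2
      · exact hv γ h2
      · exact zero_mem _) (by
      rw [Finsupp.onFinset_sum _ fun _ => rfl, mem_bot, ← hs]
      exact Finset.sum_congr rfl fun γ hγ => if_pos hγ) γ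
  change (if γ ∈ s then v γ else 0) ∈ (⊥ : Submodule k X) at h1
  rwa [if_pos hγ, mem_bot] at h1

theorem iSupIndep.gInd {k X Γ : Type*} [Field k] [AddCommGroup X] [Module k X]
    {J : Γ → Submodule k X} (h : iSupIndep J) : GInd ⊥ J := by
  classical
  rw [iSupIndep_iff_finsetSum_eq_zero_imp_eq_zero] at h
  intro f hf hs γ
  by_cases hγ : γ ∈ f.support
  · exact h f.support f (fun γ _ => hf γ) hs γ hγ
  · rw [Finsupp.notMem_support_iff.1 hγ]; exact zero_mem _

namespace IsMH

variable {S : FDGA.{u} ℚ} {F : HodgeFil S°}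

/-- Deligne's bigrading of the homogeneous parts. -/
def J (F : HodgeFil S°) (γ : ℤ × ℤ) (i : ℕ) : Submodule ℂ S° :=
  CMHS.Iu (conjTensor S) (fun k => (S.W (k - i) i)ˆ) (fun q => F.F q i) γ

theorem mor_d (h : IsMH S F) (i : ℕ) : CMHS.Mor (conjTensor S)
    (fun k => (S.W (k - i) i)ˆ) (fun q => F.F q i) (conjTensor S)
    (fun k => (S.W (k - (i + 1 : ℕ)) (i + 1))ˆ) (fun q => F.F q (i + 1))
    S°.d where
  map_c x := (conjTensor_baseChange S.d x).symm
  map_W k := baseChange_map_mem S.d fun x hx => by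
    have := h.d_W _ _ x hx
    rwa [show k - (i : ℤ) - 1 = k - (i + 1 : ℕ) by push_cast; ring] at this
  map_F k x := F.d_F k i x

theorem aux_mul {i i' : ℕ} {q k q' k' : ℤ} {x y : S°}
    (hx : x ∈ CMHS.aux (conjTensor S) (fun k => (S.W (k - i) i)ˆ) (fun q => F.F q i) q k)
    (hy : y ∈ CMHS.aux (conjTensor S) (fun k => (S.W (k - i') i')ˆ) (fun q => F.F q i') q' k') :
    x * y ∈ CMHS.aux (conjTensor S)
      (fun k => (S.W (k - (i + i' : ℕ)) (i + i'))ˆ) (fun q => F.F q (i + i'))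
      (q + q') (k + k') := by
  set R : ℤ → ℤ → ℕ → Submodule ℂ S° := fun q k i =>
    CMHS.cj (conjTensor S) (F.F q i) ⊓ (S.W (k - i) i)ˆ with hR
  have key : ∀ q k q' k' l l' x y, x ∈ R q k i → y ∈ R q' k' i' → q + q' = l → k + k' ≤ l' →
      x * y ∈ R l l' (i + i') := by
    intro q k q' k' l l' x y hx hy hl hl'
    refine ⟨?_, ?_⟩
    · change conjTensor S (x * y) ∈ F.F l (i + i')
      rw [conjTensor_mul, ← hl]
      exact F.mul_F _ _ _ _ _ _ hx.1 hy.1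
    · refine S°.W_mono (i + i') ?_ (S°.mul_W _ _ _ _ _ _ hx.2 hy.2); push_cast; linarith
  have ind : ∀ {i q k} {U : Submodule ℂ S°}, (∀ x ∈ R q k i, x ∈ U) →
      (∀ j : ℕ, ∀ x ∈ R (q - 1 - j) (k - 2 - j) i, x ∈ U) →
      CMHS.aux (conjTensor S) (fun k => (S.W (k - i) i)ˆ)
        (fun q => F.F q i) q k ≤ U := fun h1 h2 => sup_le h1 (iSup_le fun j => h2 j)
  generalize hA : CMHS.aux (conjTensor S)
    (fun k => (S.W (k - (i + i' : ℕ)) (i + i'))ˆ) (fun q => F.F q (i + i'))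
    (q + q') (k + k') = A
  have m1 : ∀ z ∈ R (q + q') (k + k') (i + i'), z ∈ A := fun z hz => hA ▸ mem_sup_left hz
  have m2 : ∀ j : ℕ, ∀ z ∈ R (q + q' - 1 - j) (k + k' - 2 - j) (i + i'), z ∈ A := fun j z hz =>
    hA ▸ mem_sup_right (le_iSup (fun j : ℕ => R (q + q' - 1 - j) (k + k' - 2 - j) (i + i')) j hz)
  have h1 : x ∈ A.comap (mulRight ℂ y) := ?_
  · exact h1
  refine ind (U := A.comap (mulRight ℂ y)) (fun x hx => ?_) (fun j x hx => ?_) hx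
  · refine ind (U := A.comap (mulLeft ℂ x)) (fun y hy => ?_) (fun j y hy => ?_) hy
    · exact m1 _ (key _ _ _ _ _ _ _ _ hx hy rfl le_rfl)
    · exact m2 j _ (key _ _ _ _ _ _ _ _ hx hy (by ring) (by linarith))
  · refine ind (U := A.comap (mulLeft ℂ x)) (fun y hy => ?_) (fun j' y hy => ?_) hy
    · exact m2 j _ (key _ _ _ _ _ _ _ _ hx hy (by ring) (by linarith))
    · exact m2 (j + j' + 1) _ (key _ _ _ _ _ _ _ _ hx hy (by push_cast; ring)
        (by push_cast; linarith))

theorem bigrading (h : IsMH S F) : Bigrading S° (J F) where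
  indep i := (h.cmhs i).gind.iSupIndep
  W_le p i x hx := by
    have := (h.cmhs i).W_eq (p + i)
    rw [add_sub_cancel_right] at this
    exact this.le hx
  le_W γ i := CMHS.I_le_W _ _
  one := by
    have h0 : (1 : S°) ∈ (S.W (0 + 0 - (0 : ℕ)) 0)ˆ := S°.one_W
    refine ⟨⟨F.one_F, h0⟩, mem_sup_left ⟨?_, h0⟩⟩
    change conjTensor S 1 ∈ F.F 0 0
    rw [conjTensor_one]
    exact F.one_F
  mul γ γ' i i' s t hs ht := by
    have e : γ.1 + γ.2 + (γ'.1 + γ'.2) = (γ + γ').1 + (γ + γ').2 := by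
      rw [Prod.fst_add, Prod.snd_add]; ring
    refine ⟨⟨F.mul_F _ _ _ _ _ _ hs.1.1 ht.1.1, ?_⟩, ?_⟩
    · refine S°.W_mono (i + i') ?_ (S°.mul_W _ _ _ _ _ _ hs.1.2 ht.1.2)
      rw [← e]
      push_cast
      linarith
    · have := aux_mul hs.2 ht.2; rwa [e] at this
  d γ i s hs := (h.mor_d i).map_I γ.1 γ.2 s hs

end IsMH

/-! ## The Hodge filtration of a free extension -/

namespace IsFree

variable {S B : FDGA.{u} ℚ} {ι : FDGAHom S B} {n : ℕ} {V : Type u} [AddCommGroup V]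
  [Module ℚ V] {WV : ℤ → Submodule ℚ V} {ξ : V →ₗ[ℚ] S} {i : V →ₗ[ℚ] B}

theorem d_W (h : IsFree ι n WV ξ i) (hS : ∀ p n x, x ∈ S.W p n → S.d x ∈ S.W (p - 1) (n + 1))
    (hξ : ∀ p v, v ∈ WV p → ξ v ∈ S.W (p - 1) (n + 1)) (p : ℤ) (m : ℕ) (x : B)
    (hx : x ∈ B.W p m) : B.d x ∈ B.W (p - 1) (m + 1) := by
  refine (h.W_le (fun p m => B.W p m ⊓ (B.W (p - 1) (m + 1)).comap B.d) ?_ ?_ ?_ p m hx).2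
  · refine fun p m s hs => ⟨ι.map_W _ _ _ hs, ?_⟩
    change B.d (ι s) ∈ B.W (p - 1) (m + 1)
    rw [← ι.map_d]
    exact ι.map_W _ _ _ (hS _ _ _ hs)
  · refine fun p v hv => ⟨h.W_ext.1.2.1 _ _ hv, ?_⟩
    change B.d (i v) ∈ B.W (p - 1) (n + 1)
    rw [h.d_i]
    exact ι.map_W _ _ _ (hξ _ _ hv)
  · rintro p q m l x z ⟨hx, hx'⟩ ⟨hz, hz'⟩
    refine ⟨B.mul_W _ _ _ _ _ _ hx hz, ?_⟩
    change B.d (x * z) ∈ B.W (p + q - 1) (m + l + 1)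
    rw [B.leibniz m x z (B.W_le _ _ hx)]
    have h1 := B.mul_W _ _ _ _ _ _ hx' hz
    have h2 := B.mul_W _ _ _ _ _ _ hx hz'
    rw [show p - 1 + q = p + q - 1 by ring, show m + 1 + l = m + l + 1 by ring] at h1
    rw [show p + (q - 1) = p + q - 1 by ring] at h2
    exact add_mem h1 (smul_mem _ _ h2)

def conjProd (M N : Type*) [AddCommGroup M] [Module ℚ M] [AddCommGroup N]
    [Module ℚ N] : ((ℂ ⊗[ℚ] M) × (ℂ ⊗[ℚ] N)) →ₛₗ[starRingEnd ℂ] ((ℂ ⊗[ℚ] M) × (ℂ ⊗[ℚ] N)) where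
  toFun x := (conjTensor M x.1, conjTensor N x.2)
  map_add' x y := by simp
  map_smul' c x := by simp

/-- A basis of the quotient of a twisted product lifts to Deligne's bigrading. -/
theorem _root_.CMHS.exists_twisted_basis {X Y : Type*} [AddCommGroup X] [Module ℂ X]
    [AddCommGroup Y] [Module ℂ Y] [Module.Finite ℂ Y] {c : X →ₛₗ[starRingEnd ℂ] X}
    {T : Submodule ℂ X} {W F : ℤ → Submodule ℂ X} {c' : Y →ₛₗ[starRingEnd ℂ] Y}
    {W' F' : ℤ → Submodule ℂ Y} (h : CMHS c ⊥ T W F) (h' : CMHS c' ⊥ ⊤ W' F') (a : Y →ₗ[ℂ] X)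
    {C : (X × Y) →ₛₗ[starRingEnd ℂ] (X × Y)} (hC : ∀ x, C x = (c x.1, c' x.2))
    {WE FE : ℤ → Submodule ℂ (X × Y)} (hWE : WE = fun k => (W k).prod (W' k))
    (hFE : FE = fun p => (F p).comap (fst ℂ X Y - a ∘ₗ snd ℂ X Y) ⊓
      (F' p).comap (snd ℂ X Y)) (hE : CMHS C ⊥ (T.prod ⊤) WE FE) :
    ∃ (b : Module.Basis (Fin (Module.finrank ℂ Y)) ℂ Y) (τ : Fin (Module.finrank ℂ Y) → ℤ × ℤ)
      (s : Fin (Module.finrank ℂ Y) → X),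
      (∀ P : ℤ × ℤ → Prop, part (CMHS.Iu c' W' F') P = span ℂ (b '' {i | P (τ i)})) ∧
      (∀ x, b x ∈ CMHS.Iu c' W' F' (τ x)) ∧ (∀ x, (s x, b x) ∈ CMHS.Iu C WE FE (τ x)) ∧
      ∀ γ, CMHS.Iu C WE FE γ ≤ (CMHS.Iu c W F γ).map (inl ℂ X Y) ⊔
        span ℂ ((fun x => (s x, b x)) '' {x | τ x = γ}) := by
  obtain ⟨b, τ, hb, hspan⟩ := h'.exists_typed_basis
  have msnd : CMHS.Mor C WE FE c' W' F' (snd ℂ X Y) :=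
    ⟨fun x => by rw [hC]; rfl, fun k x hx => by rw [hWE] at hx; exact hx.2,
      fun k x hx => by rw [hFE] at hx; exact hx.2⟩
  have mfst : CMHS.Mor c W F C WE FE (inl ℂ X Y) := by
    refine ⟨fun x => ?_, fun k x hx => ?_, fun k x hx => ?_⟩
    · rw [hC]; exact Prod.ext rfl (map_zero c').symm
    · rw [hWE]; exact ⟨hx, zero_mem _⟩
    · rw [hFE]; refine ⟨?_, zero_mem (F' k)⟩; change x - a 0 ∈ F k; rwa [map_zero, sub_zero]
  have hgen : ∀ x, ∃ s, (s, b x) ∈ CMHS.Iu C WE FE (τ x) := by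
    intro x
    obtain ⟨e, he, hx⟩ := msnd.exists_strict_I hE h' (x := (0, b x)) ⟨zero_mem T, trivial⟩ (hb x)
    have he' : e.2 = b x := (sub_eq_zero.1 ((mem_bot ℂ).1 hx)).symm
    exact ⟨e.1, by rw [← he']; exact he⟩
  choose s hs using hgen
  refine ⟨b, τ, s, hspan, hb, hs, fun γ e he => ?_⟩
  have h1 : e.2 ∈ (span ℂ ((fun x => (s x, b x)) '' {x | τ x = γ})).map (snd ℂ X Y) := by
    rw [Submodule.map_span, ← Set.image_comp]
    exact (hspan (· = γ)).le (le_part (J := CMHS.Iu c' W' F') (P := (· = γ)) rfl (msnd.map_I _ _ _ he))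
  obtain ⟨⟨t, v⟩, ht, hv⟩ := h1
  obtain rfl : v = e.2 := hv
  have e1 : inl ℂ X Y (e.1 - t) = e - (t, e.2) := Prod.ext rfl (sub_self _).symm
  have h3 : inl ℂ X Y (e.1 - t) ∈ CMHS.Iu C WE FE γ := by
    rw [e1]
    refine sub_mem he (span_le.2 ?_ ht)
    rintro _ ⟨x, hx, rfl⟩
    exact Eq.subst (motive := fun γ => (s x, b x) ∈ CMHS.Iu C WE FE γ) hx (hs x)
  have h4 : e.1 - t ∈ T := (hE.F_le _ (CMHS.I_le_F _ _ h3)).1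
  obtain ⟨t', hu, hu'⟩ := mfst.exists_strict_I h hE h4 h3
  have h5 : e.1 - t = t' := sub_eq_zero.1 (congrArg Prod.fst ((mem_bot ℂ).1 hu'))
  refine mem_sup.2 ⟨_, ⟨t', hu, rfl⟩, _, ht, ?_⟩
  rw [← h5, e1, sub_add_cancel]

open Module in
/-- A bigrading of the base and bigraded generators determine a bigrading of a free extension. -/
theorem exists_bigrading (h : IsFree ι n WV ξ i) (hn : 1 ≤ n)
    {J : ℤ × ℤ → ℕ → Submodule ℂ S°} (hJ : Bigrading S° J) {r : ℕ}
    (b : Basis (Fin r) ℂ (ℂ ⊗[ℚ] V)) (τ : Fin r → ℤ × ℤ) (s : Fin r → S°)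
    (hW : ∀ p, (WV p)ˆ = span ℂ (b '' {x | (τ x).1 + (τ x).2 ≤ p + n}))
    (hexh : ∃ l, WV l = ⊤)
    (hs : ∀ x, s x ∈ S°.W ((τ x).1 + (τ x).2 - n) n)
    (hJξ : ∀ x, S°.d (s x) + ξˆ (b x) ∈ J (τ x) (n + 1))
    (hdξ : ∀ v, S.d (ξ v) = 0) :
    ∃ JB : ℤ × ℤ → ℕ → Submodule ℂ B°, Bigrading B° JB ∧ (∀ γ m t, t ∈ J γ m → ι° t ∈ JB γ m) ∧
      (∀ x, ι° (s x) + iˆ (b x) ∈ JB (τ x) n) ∧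
      ∀ U : ℤ × ℤ → ℕ → Submodule ℂ B°, (∀ γ m t, t ∈ J γ m → ι° t ∈ U γ m) →
        (∀ x, ι° (s x) + iˆ (b x) ∈ U (τ x) n) →
        (∀ γ γ' m m' x z, x ∈ U γ m → z ∈ U γ' m' → x * z ∈ U (γ + γ') (m + m')) →
        ∀ γ m, JB γ m ≤ U γ m := by
  have hdd : ∀ x, S°.d (S°.d (s x) + ξˆ (b x)) = 0 := fun x => by
    have h1 : S°.d ∘ₗ ξˆ = 0 := baseChange_hom_ext fun v => by
      change S.dˆ (ξˆ (1 ⊗ₜ v)) = 0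
      rw [LinearMap.baseChange_tmul, LinearMap.baseChange_tmul, hdξ, TensorProduct.tmul_zero]
    rw [map_add, S°.d_d, zero_add]
    exact LinearMap.congr_fun h1 (b x)
  have hw : ∀ x, S°.d (s x) + ξˆ (b x) ∈ S°.W ((τ x).1 + (τ x).2 - n) (n + 1) := fun x =>
    S°.W_mono _ (by push_cast; linarith) (hJ.le_W _ _ (hJξ x))
  obtain ⟨M, ιM, y, hM⟩ := FreeExt.exists_freeExt hn _ S° _ _ hw hdd
  obtain ⟨J', hJ', hJι, hJy, hJle⟩ := hM.bigrading J τ hJ (fun _ => rfl) hJξ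
  -- comparison of the two models
  have hbW : ∀ x, b x ∈ (WV ((τ x).1 + (τ x).2 - n))ˆ := fun x => by
    rw [hW]
    exact subset_span ⟨x, by simp, rfl⟩
  have hiW : ∀ p v, v ∈ (WV p)ˆ → iˆ v ∈ B°.W p n := fun p =>
    baseChange_map_mem i fun v hv => h.W_ext.1.2.1 _ _ hv
  have hig : ∀ v, iˆ v ∈ B°.gr n := fun v =>
    baseChange_map_mem (S := ⊤) i (fun v _ => h.free.1 v) v (by rw [baseChange_top]; trivial)
  obtain ⟨θ, hθι, hθy⟩ := hM.lift B°.toGCAlg ι°.toGCHom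
    (fun x => ι° (s x) + iˆ (b x)) fun x => add_mem (ι°.map_gr _ _ (S°.W_le _ _ (hs x))) (hig _)
  let g : (ℂ ⊗[ℚ] V) →ₗ[ℂ] M := b.constr ℂ fun x => y x - ιM (s x)
  have hgb : ∀ x, g (b x) = y x - ιM (s x) := fun x => b.constr_basis ℂ _ x
  have hgW : ∀ p v, v ∈ (WV p)ˆ → g v ∈ M.W p n := by
    intro p v hv
    rw [hW] at hv
    refine span_le (p := (M.W p n).comap g).2 ?_ hv
    rintro _ ⟨x, hx : (τ x).1 + (τ x).2 ≤ p + n, rfl⟩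
    rw [SetLike.mem_coe, mem_comap, hgb]
    exact M.W_mono n (by linarith) (sub_mem (hM.y_W x) (ιM.map_W _ _ _ (hs x)))
  obtain ⟨θ', hθ'ι, hθ'i⟩ := h.lift_C ιM g (fun v => by
      obtain ⟨l, hl⟩ := hexh
      exact M.W_le l n (hgW l v (by rw [hl, baseChange_top]; trivial))) hgW (fun v => by
    have : M.d ∘ₗ g = ιMˡ ∘ₗ ξˆ := b.ext fun x => by
      change M.d (g (b x)) = ιM (ξˆ (b x))
      rw [hgb, map_sub, hM.d_y, ← ιM.map_d, ← map_sub]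
      exact congrArg ιM.toFun (add_sub_cancel_left _ _)
    exact LinearMap.congr_fun this v)
  have hθθ' : ∀ z, θ (θ' z) = z := by
    refine fun z => DFunLike.congr_fun (h.hom_ext_C (f := θ.toFun.comp θ'.toFun)
      (g := AlgHom.id ℂ B°) (fun t => ?_) fun v => ?_) z
    · exact (congrArg θ.toFun (hθ'ι t)).trans (hθι t)
    · have : θˡ ∘ₗ g = iˆ := b.ext fun x => by
        change θ (g (b x)) = iˆ (b x)
        rw [hgb, map_sub, hθy, hθι]
        exact add_sub_cancel_left _ _
      exact (congrArg θ.toFun (hθ'i v)).trans (LinearMap.congr_fun this v)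
  have hθ'y : ∀ x, θ' (ι° (s x) + iˆ (b x)) = y x := fun x => by
    rw [map_add, hθ'ι, hθ'i, hgb, add_sub_cancel]
  have hθ'θ : ∀ z, θ' (θ z) = z := by
    intro z
    induction z using M.hom_induction with
    | h m z hz =>
      obtain ⟨p, hp⟩ := M.W_exhaustive m z hz
      refine hM.W_le (fun _ _ => LinearMap.eqLocus (θ'.toFun.comp θ.toFun).toLinearMap
        LinearMap.id) (fun p m t _ => ?_) (fun x => ?_) (fun p q m l x z hx hz => ?_) p m hp
      · exact (congrArg θ'.toFun (hθι t)).trans (hθ'ι t)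
      · exact (congrArg θ'.toFun (hθy x)).trans (hθ'y x)
      · have hx : θ' (θ x) = x := hx
        have hz : θ' (θ z) = z := hz
        change θ' (θ (x * z)) = x * z
        rw [map_mul, map_mul, hx, hz]
    | ha x y hx hy => rw [map_add, map_add, hx, hy]
  have hθd : ∀ z, θ (M.d z) = B°.d (θ z) := fun z => by conv_lhs => rw [← hθ'θ z, ← θ'.map_d, hθθ']
  -- the bigrading
  let JB : ℤ × ℤ → ℕ → Submodule ℂ B° := fun γ m => (J' γ m).map θˡ
  have JB_W : ∀ γ m, JB γ m ≤ B°.W (γ.1 + γ.2 - m) m := by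
    intro γ m
    refine Submodule.map_le_iff_le_comap.2 (hJle (fun γ m =>
      (B°.W (γ.1 + γ.2 - m) m).comap θˡ) (fun γ m t ht => ?_)
      (fun x => ?_) (fun γ γ' m m' x z hx hz => ?_) γ m)
    · change θ (ιM t) ∈ B°.W _ _; rw [hθι]; exact ι°.map_W _ _ _ (hJ.le_W _ _ ht)
    · change θ (y x) ∈ B°.W _ _; rw [hθy]; exact add_mem (ι°.map_W _ _ _ (hs x)) (hiW _ _ (hbW x))
    · change θ (x * z) ∈ B°.W _ _
      rw [map_mul]
      refine B°.W_mono _ ?_ (B°.mul_W _ _ _ _ _ _ hx hz)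
      rw [Prod.fst_add, Prod.snd_add]
      push_cast
      linarith
  refine ⟨JB, ⟨?_, fun p m z hz => ?_, JB_W, ⟨1, hJ'.one, map_one θ.toFun⟩, ?_, ?_⟩,
    fun γ m t ht => ⟨ιM t, hJι _ _ _ ht, hθι t⟩, fun x => ⟨y x, hJy x, hθy x⟩,
    fun U hU1 hU2 hU3 γ m => ?_⟩
  · refine fun m => GInd.iSupIndep fun f hf hsum γ => ?_
    have h1 := (hJ'.indep m).gInd (f.mapRange θ'.toFun (map_zero _)) (fun γ => by
      rw [Finsupp.mapRange_apply]
      obtain ⟨x, hx, hxe⟩ := hf γ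
      have hxe : θ x = f γ := hxe
      rwa [← hxe, hθ'θ]) (by
      rw [Finsupp.sum_mapRange_index fun _ => rfl, mem_bot]
      rw [mem_bot] at hsum
      exact (map_finsuppSum θ'.toFun f _).symm.trans ((congrArg θ'.toFun hsum).trans (map_zero _))) γ
    rw [Finsupp.mapRange_apply, mem_bot] at h1
    rw [mem_bot, ← hθθ' (f γ), h1, map_zero]
  · have h1 := hJ'.W_le _ _ (θ'.map_W _ _ _ hz)
    rw [← hθθ' z]
    exact part_le (S := (part (fun γ => JB γ m) fun γ => γ.1 + γ.2 ≤ p + m).comap θˡ)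
      (fun γ hγ x hx => le_part (J := fun γ => JB γ m) hγ ⟨x, hx, rfl⟩) h1
  · rintro γ γ' m m' _ _ ⟨x, hx, rfl⟩ ⟨z, hz, rfl⟩
    exact ⟨x * z, hJ'.mul _ _ _ _ _ _ hx hz, map_mul θ.toFun _ _⟩
  · rintro γ m _ ⟨x, hx, rfl⟩; exact ⟨M.d x, hJ'.d _ _ _ hx, hθd x⟩
  · refine Submodule.map_le_iff_le_comap.2 (hJle (fun γ m =>
      (U γ m).comap θˡ) (fun γ m t ht => ?_) (fun x => ?_)
      (fun γ γ' m m' x z hx hz => ?_) γ m)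
    · change θ (ιM t) ∈ U γ m; rw [hθι]; exact hU1 _ _ _ ht
    · change θ (y x) ∈ U (τ x) n; rw [hθy]; exact hU2 x
    · change θ (x * z) ∈ U (γ + γ') (m + m'); rw [map_mul]; exact hU3 _ _ _ _ _ _ hx hz

/-- The Hodge filtration defined by a bigrading. -/
@[reducible] def _root_.Bigrading.hodgeFil {S : FDGA.{u} ℂ}
    {J : ℤ × ℤ → ℕ → Submodule ℂ S} (h : Bigrading S J) : HodgeFil S where
  F q m := part (fun γ => J γ m) fun γ => q ≤ γ.1
  F_le q m := part_le fun γ _ => h.le_gr γ m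
  F_anti m q q' hq := part_mono (fun _ => le_rfl) fun γ hγ => le_trans hq hγ
  one_F := le_part (J := fun γ => J γ 0) (P := fun γ => 0 ≤ γ.1) (γ := 0) le_rfl h.one
  mul_F p q m l x y hx hy := by
    let U := part (fun γ => J γ (m + l)) fun γ => p + q ≤ γ.1
    refine part_le (S := U.comap (mulRight ℂ y)) (fun γ hγ x hx => ?_) hx
    exact part_le (S := U.comap (mulLeft ℂ x)) (fun γ' hγ' y hy =>
      le_part (J := fun γ => J γ (m + l)) (P := fun γ => p + q ≤ γ.1)
        (γ := γ + γ') (add_le_add hγ hγ') (h.mul _ _ _ _ _ _ hx hy)) hy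
  d_F q m x hx := part_le (S := (part (fun γ => J γ (m + 1)) fun γ => q ≤ γ.1).comap S.d)
    (fun γ hγ x hx => le_part (J := fun γ => J γ (m + 1)) (P := fun γ => q ≤ γ.1) hγ
      (h.d _ _ _ hx)) hx

/-- A bigrading compatible with the conjugation defines mixed Hodge structures. -/
theorem _root_.Bigrading.cmhs [hfin : ∀ m, Module.Finite ℚ (B.gr m)]
    {J : ℤ × ℤ → ℕ → Submodule ℂ B°} (h : Bigrading B° J)
    (hc : ∀ γ m x, x ∈ J γ m → conjTensor B x ∈ J γ.swap m ⊔ B°.W (γ.1 + γ.2 - 1 - m) m) (m : ℕ) :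
    CMHS (conjTensor B) ⊥ ((B.gr m)ˆ) (fun k => (B.W (k - m) m)ˆ) (fun q => h.hodgeFil.F q m) := by
  have hT : (B.gr m)ˆ = part (fun γ => J γ m) fun _ => True := by
    refine le_antisymm (fun x hx => ?_) (part_le fun γ _ => h.le_gr γ m)
    obtain ⟨p, hp⟩ := B°.W_exhaustive m x hx
    exact part_mono (fun _ => le_rfl) (fun _ _ => trivial) (h.W_le p m hp)
  have hJfin : ∃ N : ℤ, ∀ γ, J γ m ≠ ⊥ → |γ.1| ≤ N ∧ |γ.2| ≤ N := by
    have hind : iSupIndep fun γ => (J γ m).submoduleOf ((B.gr m)ˆ) := by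
      refine GInd.iSupIndep fun f hf hs γ => ?_
      have h1 := (h.indep m).gInd (f.mapRange _ (map_zero (Submodule.subtype _)))
        (fun γ => hf γ) (by
        rw [Finsupp.sum_mapRange_index fun _ => rfl, mem_bot]
        rw [mem_bot] at hs
        exact (map_finsuppSum (Submodule.subtype _) f _).symm.trans
          ((congrArg _ hs).trans (map_zero _))) γ
      exact Subtype.ext h1
    have : Module.Finite ℂ ((B.gr m)ˆ) := by
      rw [← range_subtype_baseChange]
      exact Module.Finite.range _
    have hf := WellFoundedGT.finite_ne_bot_of_iSupIndep hind
    obtain ⟨N, hN⟩ := (hf.image fun γ => max |γ.1| |γ.2|).bddAbove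
    refine ⟨N, fun γ hγ => ?_⟩
    have h1 := hN ⟨γ, fun h2 => hγ ?_, rfl⟩
    · exact ⟨(le_max_left _ _).trans h1, (le_max_right _ _).trans h1⟩
    · have h3 : J γ m ≤ (B.gr m)ˆ := h.le_gr γ m
      rw [Submodule.submoduleOf, ← Submodule.disjoint_iff_comap_eq_bot] at h2
      exact le_bot_iff.1 (h2 h3 le_rfl)
  obtain ⟨N, hN⟩ := hJfin
  have hbot : ∀ P : ℤ × ℤ → Prop, (∀ γ, P γ → ¬ (|γ.1| ≤ N ∧ |γ.2| ≤ N)) →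
      part (fun γ => J γ m) P = ⊥ := fun P hP => le_bot_iff.1 (part_le fun γ hγ => by
    by_contra h1
    exact hP γ hγ (hN γ fun h2 => h1 h2.le))
  have htop : ∀ P : ℤ × ℤ → Prop, (∀ γ, |γ.1| ≤ N ∧ |γ.2| ≤ N → P γ) →
      part (fun γ => J γ m) P = (B.gr m)ˆ := fun P hP => by
    rw [hT]
    refine le_antisymm (part_mono (fun _ => le_rfl) fun _ _ => trivial) (part_le fun γ _ => ?_)
    by_cases h1 : J γ m = ⊥
    · exact h1.le.trans bot_le
    · exact le_part (J := fun γ => J γ m) (P := P) (hP γ (hN γ h1))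
  have hWk : ∀ k : ℤ, (B.W (k - m) m)ˆ = part (fun γ => J γ m) fun γ => γ.1 + γ.2 ≤ k := fun k => by
    refine le_antisymm ?_ (part_le fun γ hγ => (h.le_W γ m).trans (B°.W_mono m (by linarith)))
    have h1 := h.W_le (k - m) m
    rwa [sub_add_cancel] at h1
  refine CMHS.of_graded conjTensor_conjTensor (J := fun γ => J γ m)
    (fun k => by rw [hWk, sup_bot_eq]) (fun p => (sup_bot_eq _).symm) (fun γ x hx => ?_)
    (fun x hx => by rw [(mem_bot ℂ).1 hx, map_zero]; exact zero_mem _)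
    (h.indep m).gInd ⟨-2 * N - 1, ?_⟩ ⟨2 * N, ?_⟩ ⟨-N, ?_⟩ ⟨N + 1, ?_⟩
    (fun γ => h.le_gr γ m) bot_le
  · obtain ⟨y, hy, z, hz, e⟩ := mem_sup.1 (hc γ m x hx)
    exact ⟨y, hy, by rw [← e, add_sub_cancel_left]; exact hz⟩
  · rw [hWk]; exact hbot _ fun γ hγ h1 => by have := abs_le.1 h1.1; have := abs_le.1 h1.2; linarith
  · rw [hWk]; exact htop _ fun γ h1 => by have := abs_le.1 h1.1; have := abs_le.1 h1.2; linarith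
  · exact htop _ fun γ h1 => (abs_le.1 h1.1).1
  · exact hbot _ fun γ hγ h1 => by have := abs_le.1 h1.1; linarith

/-- A free extension of a mixed Hodge dga by a mixed Hodge structure is a mixed Hodge dga. -/
theorem exists_isMH [Module.Finite ℚ V] (h : IsFree ι n WV ξ i) (hn : 1 ≤ n)
    {F : HodgeFil S°} (hS : IsMH S F) (hfin : ∀ m, Module.Finite ℚ (B.gr m))
    (hξ : ∀ p v, v ∈ WV p → ξ v ∈ S.W (p - 1) (n + 1)) (hdξ : ∀ v, S.d (ξ v) = 0)
    {FV : ℤ → Submodule ℂ (ℂ ⊗[ℚ] V)}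
    (hV : CMHS (conjTensor V) ⊥ ⊤ (fun k => (WV (k - n))ˆ) FV)
    (a : (ℂ ⊗[ℚ] V) →ₗ[ℂ] S°)
    (ha : ∀ p x, x ∈ (WV p)ˆ → a x ∈ S°.W p n)
    (haF : ∀ q x, x ∈ FV q → ξˆ x + S°.d (a x) ∈ F.F q (n + 1)) :
    ∃ G : HodgeFil B°, IsMH B G ∧ IsMultExtension ι°.toGCHom F.F (iˆ + ι°ˡ ∘ₗ a) n FV G.F := by
  have hE := CMHS.prod (hS.cmhs n) hV a
    (fun k x hx => ha (k - n) x hx) (C := conjProd S V) fun _ => rfl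
  obtain ⟨WE, hWE⟩ : ∃ WE, WE = fun k : ℤ => ((S.W (k - n) n)ˆ).prod ((WV (k - n))ˆ) := ⟨_, rfl⟩
  obtain ⟨FE, hFE⟩ : ∃ FE, FE = fun p =>
    (F.F p n).comap (fst ℂ _ _ - a ∘ₗ snd ℂ _ _) ⊓
        (FV p).comap (snd ℂ _ _) := ⟨_, rfl⟩
  rw [← hWE, ← hFE] at hE
  obtain ⟨b, τ, s, hspan, hb, hs, hJE⟩ := (hS.cmhs n).exists_twisted_basis hV a
    (C := conjProd S V) (fun _ => rfl) hWE hFE hE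
  let dE : ((ℂ ⊗[ℚ] S) × (ℂ ⊗[ℚ] V)) →ₗ[ℂ] S° :=
    S°.d ∘ₗ fst ℂ _ _ + ξˆ ∘ₗ snd ℂ _ _
  have mdE : CMHS.Mor (conjProd S V) WE FE (conjTensor S)
      (fun k => (S.W (k - (n + 1 : ℕ)) (n + 1))ˆ) (fun q => F.F q (n + 1)) dE := by
    refine ⟨fun x => ?_, fun k x hx => ?_, fun k x hx => ?_⟩
    · change S°.d (conjTensor S x.1) + ξˆ (conjTensor V x.2) = conjTensor S (S°.d x.1 + ξˆ x.2)
      rw [map_add]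
      exact congrArg₂ (· + ·) (conjTensor_baseChange S.d _).symm (conjTensor_baseChange ξ _).symm
    · rw [hWE] at hx
      have e : k - (n : ℤ) - 1 = k - (n + 1 : ℕ) := by push_cast; ring
      refine add_mem ((hS.mor_d n).map_W k _ hx.1) ?_
      refine baseChange_map_mem ξ (fun v hv => ?_) _ hx.2
      rw [← e]
      exact hξ _ v hv
    · rw [hFE] at hx
      have h1 := add_mem (F.d_F _ _ _ hx.1) (haF _ _ hx.2)
      have e : S°.d (x.1 - a x.2) + (ξˆ x.2 + S°.d (a x.2)) = dE x := by
        change _ = S°.d x.1 + ξˆ x.2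
        rw [map_sub]; abel
      exact e ▸ h1
  have hsE : ∀ x, (s x, b x) ∈ WE ((τ x).1 + (τ x).2) := fun x => CMHS.I_le_W _ _ (hs x)
  have hsF : ∀ x, (s x, b x) ∈ FE (τ x).1 := fun x => CMHS.I_le_F _ _ (hs x)
  rw [hWE] at hsE
  rw [hFE] at hsF
  obtain ⟨JB, hJB, hJι, hJy, hJle⟩ := h.exists_bigrading hn hS.bigrading b τ s (fun p => by
      have h1 := hV.W_eq (p + n)
      rwa [add_sub_cancel_right, hspan] at h1) (by
      obtain ⟨l, hl⟩ := hV.W_top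
      exact ⟨l - n, top_le_iff.1 (baseChange_le_baseChange.1 (by
        rw [baseChange_top]; exact hl.ge))⟩)
    (fun x => (hsE x).1) (fun x => mdE.map_I _ _ _ (hs x)) hdξ
  have W_JB : ∀ p m, B°.W p m = part (fun γ => JB γ m) fun γ => γ.1 + γ.2 ≤ p + m :=
    fun p m => le_antisymm (hJB.W_le p m) (part_le fun γ hγ =>
      (hJB.le_W γ m).trans (B°.W_mono m (by linarith)))
  let L : ((ℂ ⊗[ℚ] S) × (ℂ ⊗[ℚ] V)) →ₗ[ℂ] B° :=
    ι°ˡ ∘ₗ fst ℂ _ _ + iˆ ∘ₗ snd ℂ _ _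
  have JB_L : ∀ γ, CMHS.Iu (conjProd S V) WE FE γ ≤ (JB γ n).comap L := by
    refine fun γ => (hJE γ).trans (sup_le (Submodule.map_le_iff_le_comap.2 fun t ht => ?_)
      (span_le.2 ?_))
    · change ι° t + iˆ 0 ∈ JB γ n; rw [map_zero, add_zero]; exact hJι _ _ _ ht
    · rintro _ ⟨x, hx, rfl⟩; have hx : τ x = γ := hx; exact hx ▸ hJy x
  have L_W : ∀ k x, x ∈ WE k → L x ∈ B°.W (k - n) n := fun k x hx => by
    rw [hWE] at hx
    exact add_mem (ι°.map_W _ _ _ hx.1)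
      (baseChange_map_mem i (fun v hv => h.W_ext.1.2.1 _ _ hv) _ hx.2)
  have JB_c : ∀ γ m x, x ∈ JB γ m → conjTensor B x ∈ JB γ.swap m ⊔ B°.W (γ.1 + γ.2 - 1 - m) m := by
    intro γ m
    refine hJle (fun γ m =>
      (JB γ.swap m ⊔ B°.W (γ.1 + γ.2 - 1 - m) m).comap (conjTensor B))
      (fun γ m t ht => ?_) (fun x => ?_) (fun γ γ' m m' x z hx hz => ?_) γ m
    · obtain ⟨t', ht', h1⟩ := (hS.cmhs m).c_I (p := γ.1) (q := γ.2) ht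
      have e : conjTensor B (ι° t) = ι° (conjTensor S t) := conjTensor_baseChange ιˡ t
      refine mem_sup.2 ⟨_, hJι _ _ _ ht', _, ι°.map_W _ _ _ h1, ?_⟩
      rw [e, ← map_add, add_sub_cancel]
    · obtain ⟨e', he', h1⟩ := hE.c_I (p := (τ x).1) (q := (τ x).2) (hs x)
      have e : conjTensor B (L (s x, b x)) = L (conjProd S V (s x, b x)) := by
        change conjTensor B (ι° (s x) + iˆ (b x)) =
          ι° (conjTensor S (s x)) + iˆ (conjTensor V (b x))
        rw [map_add]
        exact congrArg₂ (· + ·) (conjTensor_baseChange ιˡ _) (conjTensor_baseChange i _)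
      change conjTensor B (L (s x, b x)) ∈ JB (τ x).swap n ⊔ B°.W ((τ x).1 + (τ x).2 - 1 - n) n
      refine mem_sup.2 ⟨_, JB_L (τ x).swap he', _, L_W _ _ h1, ?_⟩
      rw [e, ← map_add, add_sub_cancel]
    · change conjTensor B (x * z) ∈
        JB (γ + γ').swap (m + m') ⊔ B°.W ((γ + γ').1 + (γ + γ').2 - 1 - (m + m' : ℕ)) (m + m')
      rw [conjTensor_mul]
      obtain ⟨x1, hx1, x2, hx2, hx⟩ := mem_sup.1 hx
      obtain ⟨z1, hz1, z2, hz2, hz⟩ := mem_sup.1 hz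
      rw [← hx, ← hz, add_mul, mul_add, add_assoc]
      have hx1' := hJB.le_W _ _ hx1
      have hz1' := hJB.le_W _ _ hz1
      refine add_mem_sup (hJB.mul _ _ _ _ _ _ hx1 hz1) (add_mem ?_ ?_)
      · refine B°.W_mono _ ?_ (B°.mul_W _ _ _ _ _ _ hx1' hz2)
        simp only [Prod.fst_add, Prod.snd_add, Prod.fst_swap, Prod.snd_swap]
        push_cast
        linarith
      · rw [hz]
        refine B°.W_mono _ ?_ (B°.mul_W _ _ _ _ _ _ hx2
          (show conjTensor B z ∈ B°.W (γ'.1 + γ'.2 - m') m' from ?_))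
        · simp only [Prod.fst_add, Prod.snd_add]; push_cast; linarith
        · rw [← hz]
          refine add_mem (B°.W_mono _ ?_ hz1') (B°.W_mono _ ?_ hz2)
          · simp only [Prod.fst_swap, Prod.snd_swap]; linarith
          · linarith
  have hιF : ∀ p m t, t ∈ F.F p m → ι° t ∈ hJB.hodgeFil.F p m := fun p m t ht => by
    exact (((hS.cmhs m).F_eq p).le.trans (part_le (S := (hJB.hodgeFil.F p m).comap ι°ˡ) fun γ hγ x hx =>
      le_part (J := fun γ => JB γ m) (P := fun γ => p ≤ γ.1) hγ (hJι _ _ _ hx))) ht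
  have hja : ∀ x, (iˆ + ι°ˡ ∘ₗ a) (b x) + ι° (s x - a (b x)) = ι° (s x) + iˆ (b x) := fun x => by
    change iˆ (b x) + ι° (a (b x)) + _ = _
    rw [map_sub]; abel
  refine ⟨hJB.hodgeFil, ⟨h.d_W hS.d_W hξ, hfin, fun m => hJB.cmhs JB_c m⟩, ⟨fun p m t ht => ?_, fun p v hv => ?_,
    fun p q m l x hx y hy => hJB.hodgeFil.mul_F p q m l x y hx hy⟩, fun U hU q m => part_le fun γ hγ => ?_⟩
  · exact hιF p m t ht
  · have h1 : FV p ≤ (hJB.hodgeFil.F p n).comap (iˆ + ι°ˡ ∘ₗ a) := by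
      rw [hV.F_eq, hspan, span_le]
      rintro _ ⟨x, hx, rfl⟩
      have h2 := hιF _ _ _ (F.F_anti n hx (hsF x).1)
      have h3 : ι° (s x) + iˆ (b x) ∈ hJB.hodgeFil.F p n :=
        le_part (J := fun γ => JB γ n) (P := fun γ => p ≤ γ.1) hx (hJy x)
      rw [← hja] at h3
      exact ((hJB.hodgeFil.F p n).add_mem_iff_left h2).1 h3
    exact h1 hv
  · have hU1 : ∀ p q m x, p ≤ q → x ∈ U q m → x ∈ U p m := fun p q m x hpq hx => by
      have h1 : (1 : B°) ∈ U (p - q) 0 := by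
        have := hU.1 (p - q) 0 1 (F.F_anti 0 (by linarith) F.one_F)
        rwa [map_one] at this
      have := hU.2.2 _ _ _ _ _ h1 _ hx
      rwa [one_mul, sub_add_cancel, zero_add] at this
    refine (hJle (fun γ m => U γ.1 m) (fun γ m t ht => hU.1 _ _ _ ht.1.1) (fun x => ?_)
      (fun γ γ' m m' x z hx hz => hU.2.2 _ _ _ _ _ hx _ hz) γ m).trans fun x hx => hU1 _ _ _ _ hγ hx
    have h1 := hU.2.1 _ _ (CMHS.I_le_F _ _ (hb x))
    have h2 := hU.1 _ _ _ (hsF x).1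
    exact hja x ▸ add_mem h1 h2

end IsFree

section

/-! ## Finite stages of a minimal model -/

theorem mem_of_eq {k X : Type*} [Semiring k] [AddCommMonoid X] [Module k X]
    {S : Submodule k X} {x y : X} (h : x = y) (hx : x ∈ S) : y ∈ S := h ▸ hx

def FDGA.evalHom {k : Type} [Field k] {r : ℕ} {A : FDGA.{u} k} (c : k) :
    (A.path r) →ₐ[k] A :=
  AlgHom.ofLinearMap
    { toFun := evalAt c
      map_add' := fun _ _ => Polynomial.eval_add
      map_smul' := fun q x => Polynomial.eval_smul q (x : A.PathCarrier).1 _ }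
    (Polynomial.eval_one (x := algebraMap k A c))
    fun x y => map_mul (Polynomial.eval₂RingHom' (RingHom.id A)
      (algebraMap k A c) fun a => (Algebra.commutes c a).symm)
        (x : A.PathCarrier).1 (y : A.PathCarrier).1

/-- A mixed Hodge dga of finite type with a ho-morphism to the diagram `A`. -/
structure State {m : ℕ} (A : HodgeDiagram.{u} m) where
  Q : FDGA.{u} ℚ
  F : HodgeFil Q°
  isMH : IsMH Q F
  conn : Q.gr 0 ≤ span ℚ {1}
  ρQ : FDGAHom Q A.Q
  ρ : ∀ v, FDGAHom Q° (A.node v)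
  ρ_left : ρ .left = ρQ°
  ρ_F : ∀ q n x, x ∈ F.F q n → ρ .right x ∈ A.F.F q n
  h : ∀ u : ZArrow m, FDGAHom Q° ((A.node u.tgt).path 1)
  h_zero : ∀ u x, evalAt 0 (h u x) = ρ u.tgt x
  h_one : ∀ u x, evalAt 1 (h u x) = A.φ u (ρ u.src x)

variable {m : ℕ} {A : HodgeDiagram.{u} m}

structure StateHom (S S' : State A) where
  f : FDGAHom S.Q S'.Q
  map_F : ∀ q n x, x ∈ S.F.F q n → f° x ∈ S'.F.F q n
  ρQ : ∀ x, S'.ρQ (f x) = S.ρQ x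
  ρ : ∀ v x, S'.ρ v (f° x) = S.ρ v x
  h : ∀ u x, S'.h u (f° x) = S.h u x

theorem FDGAHom.baseChange_comp {X Y Z : FDGA.{u} ℚ} (g : FDGAHom Y Z) (f : FDGAHom X Y) (x) :
    (g.comp f)° x = g° (f° x) :=
  LinearMap.congr_fun (baseChange_hom_ext (f := (g.comp f)°ˡ) (g := g°ˡ ∘ₗ f°ˡ) fun _ => rfl) x

theorem FDGAHom.baseChange_id {X : FDGA.{u} ℚ} (x) : (FDGAHom.id X)° x = x :=
  LinearMap.congr_fun (baseChange_hom_ext (f := (FDGAHom.id X)°ˡ)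
    (g := LinearMap.id) fun _ => rfl) x

theorem baseChange_apply_comp {X Y Z : Type*} [AddCommGroup X] [Module ℚ X] [AddCommGroup Y]
    [Module ℚ Y] [AddCommGroup Z] [Module ℚ Z] (g : Y →ₗ[ℚ] Z) (f : X →ₗ[ℚ] Y) (x) :
    (g ∘ₗ f)ˆ x = gˆ (fˆ x) := by
  rw [LinearMap.baseChange_comp]; rfl

namespace StateHom

@[reducible] def id (S : State A) : StateHom S S where
  f := FDGAHom.id S.Q
  map_F q n x hx := by rwa [FDGAHom.baseChange_id]
  ρQ _ := rfl
  ρ v x := by rw [FDGAHom.baseChange_id]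
  h u x := by rw [FDGAHom.baseChange_id]

@[reducible] def comp {S S' S'' : State A} (g : StateHom S' S'') (f : StateHom S S') :
    StateHom S S'' where
  f := g.f.comp f.f
  map_F q n x hx := by rw [FDGAHom.baseChange_comp]; exact g.map_F _ _ _ (f.map_F _ _ _ hx)
  ρQ x := (g.ρQ _).trans (f.ρQ x)
  ρ v x := by rw [FDGAHom.baseChange_comp, g.ρ, f.ρ]
  h u x := by rw [FDGAHom.baseChange_comp, g.h, f.h]

end StateHom

/-- A mixed Hodge structure to be attached to a stage in degree `n`. -/
structure Cell (S : State A) (n : ℕ) where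
  V : Type u
  [acg : AddCommGroup V]
  [mod : Module ℚ V]
  [fin : Module.Finite ℚ V]
  WV : ℤ → Submodule ℚ V
  FV : ℤ → Submodule ℂ (ℂ ⊗[ℚ] V)
  cmhs : CMHS (conjTensor V) ⊥ ⊤ (fun k => (WV (k - n))ˆ) FV
  pos : 1 ≤ n
  ξ : V →ₗ[ℚ] S.Q
  ξ_W : ∀ p v, v ∈ WV p → ξ v ∈ S.Q.W (p - 1) (n + 1)
  d_ξ : ∀ v, S.Q.d (ξ v) = 0
  ξ_dec : ∀ v, ξ v ∈ S.Q.toGCAlg.decomposables (n + 1)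
  a : (ℂ ⊗[ℚ] V) →ₗ[ℂ] S.Q°
  a_W : ∀ p x, x ∈ (WV p)ˆ → a x ∈ S.Q°.W p n
  a_F : ∀ q x, x ∈ FV q → ξˆ x + S.Q°.d (a x) ∈ S.F.F q (n + 1)
  αQ : V →ₗ[ℚ] A.Q
  αQ_W : ∀ p v, v ∈ WV p → αQ v ∈ A.Q.W p n
  αQ_d : ∀ v, A.Q.d (αQ v) = S.ρQ (ξ v)
  α : ∀ v, (ℂ ⊗[ℚ] V) →ₗ[ℂ] (A.node v)
  α_left : α .left = αQˆ
  α_W : ∀ v p x, x ∈ (WV p)ˆ → α v x ∈ (A.node v).W p n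
  α_d : ∀ v x, (A.node v).d (α v x) = S.ρ v (ξˆ x)
  α_F : ∀ q x, x ∈ FV q → α .right x + S.ρ .right (a x) ∈ A.F.F q n
  β : ∀ u : ZArrow m, (ℂ ⊗[ℚ] V) →ₗ[ℂ] ((A.node u.tgt).path 1)
  β_W : ∀ u p x, x ∈ (WV p)ˆ → β u x ∈ ((A.node u.tgt).path 1).W p n
  β_d : ∀ u x, ((A.node u.tgt).path 1).d (β u x) = S.h u (ξˆ x)
  β_zero : ∀ u x, evalAt 0 (β u x) = α u.tgt x
  β_one : ∀ u x, evalAt 1 (β u x) = A.φ u (α u.src x)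

attribute [instance] Cell.acg Cell.mod Cell.fin

theorem GCHom.map_decomposables {k : Type} [Field k] {X Y : GCAlg.{u} k} (f : GCHom X Y) (n : ℕ)
    (x : X) (hx : x ∈ X.decomposables n) : f x ∈ Y.decomposables n := by
  have h : X.decomposables n ≤ (Y.decomposables n).comap fˡ :=
    span_le.2 fun z ⟨i, j, hi, hj, hij, x, hx, y, hy, e⟩ => subset_span
      ⟨i, j, hi, hj, hij, _, f.map_gr _ _ hx, _, f.map_gr _ _ hy, by rw [e]; exact map_mul f.toFun _ _⟩
  exact h hx

namespace Cell

variable {S : State A} {n : ℕ}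

theorem exists_W (c : Cell S n) : ∃ l, c.WV l = ⊤ := by
  obtain ⟨l, hl⟩ := c.cmhs.W_top
  exact ⟨l - n, top_le_iff.1 (baseChange_le_baseChange.1 (by rw [baseChange_top]; exact hl.ge))⟩

theorem exists_W_C (c : Cell S n) : ∃ l, ∀ x, x ∈ (c.WV l)ˆ := by
  obtain ⟨l, hl⟩ := c.exists_W
  exact ⟨l, fun x => by rw [hl, baseChange_top]; trivial⟩

/-- The image of a cell under a morphism of stages. -/
@[reducible] def push (c : Cell S n) {X : State A} (g : StateHom S X) : Cell X n where
  V := c.V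
  WV := c.WV
  FV := c.FV
  cmhs := c.cmhs
  pos := c.pos
  ξ := g.fˡ ∘ₗ c.ξ
  ξ_W p v hv := g.f.map_W _ _ _ (c.ξ_W p v hv)
  d_ξ v := (g.f.map_d _).symm.trans ((congrArg g.f.toFun (c.d_ξ v)).trans (map_zero _))
  ξ_dec v := g.f.map_decomposables _ _ (c.ξ_dec v)
  a := g.f°ˡ ∘ₗ c.a
  a_W p x hx := g.f°.map_W _ _ _ (c.a_W p x hx)
  a_F q x hx := by
    have h := g.map_F _ _ _ (c.a_F q x hx)
    rw [map_add, g.f°.map_d] at h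
    rw [baseChange_apply_comp]
    exact h
  αQ := c.αQ
  αQ_W := c.αQ_W
  αQ_d v := (c.αQ_d v).trans (g.ρQ _).symm
  α := c.α
  α_left := c.α_left
  α_W := c.α_W
  α_d v x := by rw [c.α_d, ← g.ρ, baseChange_apply_comp]; rfl
  α_F q x hx := by have h := c.α_F q x hx; rw [← g.ρ] at h; exact h
  β := c.β
  β_W := c.β_W
  β_d u x := by rw [c.β_d, ← g.h, baseChange_apply_comp]; rfl
  β_zero := c.β_zero
  β_one := c.β_one

end Cell

/-- `S'` is obtained from `S` by attaching the cell `c`. -/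
structure IsStep {S S' : State A} {n : ℕ} (c : Cell S n) (f : StateHom S S')
    (i : c.V →ₗ[ℚ] S'.Q) : Prop where
  free : IsFree f.f n c.WV c.ξ i
  F_ext : IsMultExtension f.f°.toGCHom S.F.F (iˆ + f.f°ˡ ∘ₗ c.a) n c.FV S'.F.F
  ρQ : ∀ v, S'.ρQ (i v) = c.αQ v
  ρ : ∀ v x, S'.ρ v (iˆ x) = c.α v x
  h : ∀ u x, S'.h u (iˆ x) = c.β u x

theorem Cell.exists_isStep {S : State A} {n : ℕ} (c : Cell S n) :
    ∃ (S' : State A) (f : StateHom S S') (i : c.V →ₗ[ℚ] S'.Q), IsStep c f i := by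
  have hmono : Monotone c.WV := fun p q hpq => baseChange_le_baseChange.1 (by
    have := c.cmhs.W_mono (show p + (n : ℤ) ≤ q + n by linarith)
    simpa using this)
  have hbot : ∃ l, c.WV l = ⊥ := by
    obtain ⟨l, hl⟩ := c.cmhs.W_bot
    exact ⟨l - n, le_bot_iff.1 (baseChange_le_baseChange.1 (by rw [baseChange_bot]; exact hl.le))⟩
  obtain ⟨l, hl⟩ := c.exists_W
  obtain ⟨L, hL⟩ := c.exists_W_C
  obtain ⟨B, ι, i, hB, hfin⟩ := exists_isFree S.Q c.pos hmono hbot c.exists_W c.ξ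
    (fun p v hv => S.Q.W_mono _ (by linarith) (c.ξ_W p v hv)) c.d_ξ
  obtain ⟨G, hG, hF⟩ := hB.exists_isMH c.pos S.isMH (hfin S.isMH.finite) c.ξ_W c.d_ξ c.cmhs c.a
    c.a_W c.a_F
  obtain ⟨ρQ, hρQι, hρQi⟩ := hB.lift S.ρQ c.αQ
    (fun v => A.Q.W_le _ _ (c.αQ_W l v (hl ▸ trivial))) c.αQ_W c.αQ_d
  choose ρ hρι hρi using fun v => hB.lift_C (S.ρ v) (c.α v)
    (fun x => (A.node v).W_le _ _ (c.α_W v L x (hL x))) (c.α_W v) (c.α_d v)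
  choose h hhι hhi using fun u => hB.lift_C (S.h u) (c.β u)
    (fun x => ((A.node u.tgt).path 1).W_le _ _ (c.β_W u L x (hL x))) (c.β_W u) (c.β_d u)
  have hconn : B.gr 0 ≤ span ℚ {1} := by
    have hn := c.pos
    refine (hB.gr_le (fun j => if j = 0 then span ℚ {1} else ⊤) (fun j s hs => ?_)
      (fun v => ?_) (fun j j' x z hx hz => ?_) 0).trans (if_pos rfl).le
    · split_ifs with hj
      · subst hj
        obtain ⟨q, rfl⟩ := mem_span_singleton.1 (S.conn hs)
        rw [map_smul, map_one]
        exact smul_mem _ _ (Submodule.mem_span_singleton_self _)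
      · trivial
    · rw [if_neg (by omega)]; trivial
    · split_ifs with hj
      · rw [if_pos (by omega)] at hx hz
        obtain ⟨q, rfl⟩ := mem_span_singleton.1 hx
        rw [smul_mul_assoc, one_mul]
        exact smul_mem _ _ hz
      · trivial
  refine ⟨⟨B, G, hG, hconn, ρQ, ρ, ?_, ?_, h, fun u => ?_, fun u => ?_⟩,
    ⟨ι, hF.1.1, hρQι, hρι, hhι⟩, i, hB, hF, hρQi, hρi, hhi⟩
  · refine FDGAHom.ext (hB.hom_ext_C (f := (ρ .left).toFun) (g := ρQ°.toFun)
      (fun s => ?_) fun v => ?_)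
    · rw [hρι, S.ρ_left, ← FDGAHom.baseChange_comp]
      exact LinearMap.congr_fun (baseChange_hom_ext (f := S.ρQ°ˡ) (g := (ρQ.comp ι)°ˡ)
        fun s => congrArg (fun y => (1 : ℂ) ⊗ₜ[ℚ] y) (hρQι s).symm) s
    · rw [hρi, c.α_left]
      exact LinearMap.congr_fun (baseChange_hom_ext (f := c.αQˆ) (g := ρQ°ˡ ∘ₗ iˆ)
        fun v => congrArg (fun y => (1 : ℂ) ⊗ₜ[ℚ] y) (hρQi v).symm) v
  · refine fun q j => mem_lowerBounds.1 hF.2 (fun q j => (A.F.F q j).comap (ρ .right)ˡ)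
      ⟨fun p j s hs => ?_, fun p x hx => ?_, fun p q j l x hx y hy => ?_⟩ q j
    · change ρ .right (ι° s) ∈ A.F.F p j; rw [hρι]; exact S.ρ_F _ _ _ hs
    · change ρ .right (iˆ x + ι° (c.a x)) ∈ A.F.F p n; rw [map_add, hρi, hρι]; exact c.α_F p x hx
    · change ρ .right (x * y) ∈ A.F.F (p + q) (j + l)
      rw [map_mul]
      exact A.F.mul_F _ _ _ _ _ _ hx hy
  · refine DFunLike.congr_fun (hB.hom_ext_C (f := (FDGA.evalHom 0).comp (h u).toFun)
      (g := (ρ u.tgt).toFun) (fun s => ?_) fun v => ?_)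
    · exact (congrArg (evalAt 0) (hhι u s)).trans ((S.h_zero u s).trans (hρι _ s).symm)
    · exact (congrArg (evalAt 0) (hhi u v)).trans ((c.β_zero u v).trans (hρi _ v).symm)
  · refine DFunLike.congr_fun (hB.hom_ext_C (f := (FDGA.evalHom 1).comp (h u).toFun)
      (g := (A.φ u).toFun.comp (ρ u.src).toFun) (fun s => ?_) fun v => ?_)
    · exact (congrArg (evalAt 1) (hhι u s)).trans ((S.h_one u s).trans
        (congrArg (A.φ u).toFun (hρι _ s).symm))
    · exact (congrArg (evalAt 1) (hhi u v)).trans ((c.β_one u v).trans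
        (congrArg (A.φ u).toFun (hρi _ v).symm))

namespace IsStep

variable {S S' : State A} {n : ℕ} {c : Cell S n} {f : StateHom S S'} {i : c.V →ₗ[ℚ] S'.Q}

/-- Cells attached to the same stage can be attached one after the other in either order. -/
theorem exists_push (hc : IsStep c f i) {X : State A} {l : ℕ} {e : Cell S l} {g : StateHom S X}
    {j : e.V →ₗ[ℚ] X.Q} (he : IsStep e g j) :
    ∃ (X' : State A) (f' : StateHom X X') (i' : (c.push g).V →ₗ[ℚ] X'.Q)
      (g' : StateHom S' X'), IsStep (c.push g) f' i' ∧
      IsStep (e.push f) g' (f'.fˡ ∘ₗ j) ∧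
      ∀ x, g'.f (f.f x) = f'.f (g.f x) := by
  obtain ⟨X', f', i', hX⟩ := (c.push g).exists_isStep
  obtain ⟨g', hg1, hg2⟩ := hc.free.lift (f'.f.comp g.f) i' hX.free.free.1 hX.free.W_ext.1.2.1
    hX.free.d_i
  have hgC : ∀ x, g'° (f.f° x) = f'.f° (g.f° x) := fun x => by
    rw [← FDGAHom.baseChange_comp, ← FDGAHom.baseChange_comp,
      show g'.comp f.f = f'.f.comp g.f from FDGAHom.ext (AlgHom.ext hg1)]
  have hgi : ∀ v, g'° (iˆ v) = i'ˆ v := fun v => by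
    have : g'ˡ ∘ₗ i = i' := LinearMap.ext hg2
    rw [← this, baseChange_apply_comp]
    rfl
  have hca : ∀ v, g'°.toFun ((iˆ + f.f°ˡ ∘ₗ c.a) v) = (i'ˆ + f'.f°ˡ ∘ₗ (c.push g).a) v := fun v => by
    change g'° (iˆ v + f.f° (c.a v)) = i'ˆ v + f'.f° (g.f° (c.a v))
    rw [map_add, hgi, hgC]
  have hC : ∀ {Y : Type u} [Ring Y] [Algebra ℂ Y] (s : S'.Q° →ₐ[ℂ] Y)
      (t : X'.Q° →ₐ[ℂ] Y), (∀ x, t (f'.f°.toFun (g.f° x)) = s (f.f° x)) →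
      (∀ v, t (i'ˆ v) = s (iˆ v)) →
      ∀ x, t (g'° x) = s x := fun s t h1 h2 x =>
    DFunLike.congr_fun (hc.free.hom_ext_C (f := t.comp g'°.toFun) (g := s)
      (fun x => (congrArg t (hgC x)).trans (h1 x)) fun v => (congrArg t (hgi v)).trans (h2 v)) x
  let G : StateHom S' X' := ⟨g', ?_, ?_, fun v => hC _ _ ?_ ?_, fun u => hC _ _ ?_ ?_⟩
  · refine ⟨X', f', i', G, hX, ⟨⟨⟨?_, ?_⟩, ?_, ?_⟩, ?_, ?_, ?_, ?_⟩, hg1⟩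
    · exact fun v => f'.f.map_gr _ _ (he.free.free.1 v)
    · intro D p q hq
      obtain ⟨k1, ⟨hk1, hk2⟩, -⟩ := he.free.free.2 D
        ⟨p.toFun.comp f.f.toFun, fun n x hx => p.map_gr _ _ (f.f.map_gr _ _ hx)⟩ q hq
      obtain ⟨k2, ⟨hk3, hk4⟩, -⟩ := hX.free.free.2 D k1 (pˡ ∘ₗ i) fun v =>
        p.map_gr _ _ (hc.free.free.1 v)
      have key : ∀ k : GCHom X'.Q.toGCAlg D, (∀ v, k (i' v) = p (i v)) → ((∀ s, k (g' s) = p s) ↔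
            ∀ s, k (f'.f (g.f s)) = p (f.f s)) := fun k hk =>
        ⟨fun h s => (congrArg k.toFun (hg1 s)).symm.trans (h _), fun h s => DFunLike.congr_fun
          (congrArg GCHom.toFun (hc.free.hom_ext (f := ⟨k.toFun.comp g'.toFun, fun n x hx =>
            k.map_gr _ _ (g'.map_gr _ _ hx)⟩) (g := p)
            (fun s => (congrArg k.toFun (hg1 s)).trans (h s))
            fun v => (congrArg k.toFun (hg2 v)).trans (hk v))) s⟩
      refine ⟨k2, ⟨(key k2 hk4).2 fun s => (hk3 _).trans (hk1 s), fun v => (hk3 _).trans (hk2 v)⟩,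
        fun k ⟨h1, h2⟩ => ?_⟩
      have h3 : ∀ v, k (i' v) = p (i v) := fun v => (congrArg k.toFun (hg2 v)).symm.trans (h1 _)
      refine hX.free.hom_ext (fun x => ?_) fun v => (h3 v).trans (hk4 v).symm
      refine DFunLike.congr_fun (congrArg GCHom.toFun (he.free.hom_ext
        (f := ⟨k.toFun.comp f'.f.toFun, fun n x hx => k.map_gr _ _ (f'.f.map_gr _ _ hx)⟩)
        (g := ⟨k2.toFun.comp f'.f.toFun, fun n x hx => k2.map_gr _ _ (f'.f.map_gr _ _ hx)⟩)
        (fun s => ?_) fun v => ?_)) x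
      · exact ((key k h3).1 h1 s).trans ((hk3 _).trans (hk1 s)).symm
      · exact (h2 v).trans ((hk3 _).trans (hk2 v)).symm
    · intro v
      refine (f'.f.map_d _).symm.trans ((congrArg f'.f.toFun (he.free.d_i v)).trans ?_)
      exact (hg1 _).symm
    · refine ⟨⟨g'.map_W, fun p v hv => f'.f.map_W _ _ _ (he.free.W_ext.1.2.1 p v hv),
        fun p q m l x hx y hy => X'.Q.mul_W _ _ _ _ _ _ hx hy⟩, fun U hU => ?_⟩
      refine mem_lowerBounds.1 hX.free.W_ext.2 U ⟨mem_lowerBounds.1 he.free.W_ext.2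
        (fun p j => (U p j).comap f'.fˡ) ⟨fun p j s hs => ?_, hU.2.1,
          fun p q j l x hx y hy => ?_⟩, fun p v hv => ?_, hU.2.2⟩
      · exact mem_of_eq (S := U p j) (hg1 s) (hU.1 _ _ _ (f.f.map_W _ _ _ hs))
      · exact mem_of_eq (S := U (p + q) (j + l)) (map_mul f'.f.toFun x y).symm
          (hU.2.2 _ _ _ _ _ hx _ hy)
      · exact (hg2 v) ▸ hU.1 _ _ _ (hc.free.W_ext.1.2.1 p v hv)
    · have hj : ∀ x, ((f'.fˡ ∘ₗ j)ˆ + g'°ˡ ∘ₗ (e.push f).a) x = f'.f° ((jˆ + g.f°ˡ ∘ₗ e.a) x) :=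
        fun x => by
          change (f'.fˡ ∘ₗ j)ˆ x + g'° (f.f° (e.a x)) = f'.f°.toFun (jˆ x + g.f° (e.a x))
          rw [map_add, hgC, baseChange_apply_comp]
          rfl
      refine ⟨⟨G.map_F, fun p x hx => ?_, fun p q m l x hx y hy => X'.F.mul_F _ _ _ _ _ _ hx hy⟩,
        fun U hU => ?_⟩
      · rw [hj]; exact f'.map_F _ _ _ (he.F_ext.1.2.1 p x hx)
      · refine mem_lowerBounds.1 hX.F_ext.2 U ⟨mem_lowerBounds.1 he.F_ext.2
          (fun p j => (U p j).comap f'.f°ˡ) ⟨fun p j s hs => ?_,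
            fun p x hx => ?_, fun p q j l x hx y hy => ?_⟩, fun p v hv => ?_, hU.2.2⟩
        · exact mem_of_eq (S := U p j) (hgC s) (hU.1 _ _ _ (f.map_F _ _ _ hs))
        · exact mem_of_eq (S := U p l) (hj x) (hU.2.1 p x hx)
        · exact mem_of_eq (S := U (p + q) (j + l))
            (map_mul f'.f°.toFun x y).symm (hU.2.2 _ _ _ _ _ hx _ hy)
        · have h1 := hU.1 _ _ _ (hc.F_ext.1.2.1 p v hv)
          exact hca v ▸ h1
    · exact fun v => (f'.ρQ _).trans (he.ρQ v)
    · intro v x; rw [baseChange_apply_comp]; exact (f'.ρ v _).trans (he.ρ v x)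
    · intro u x; rw [baseChange_apply_comp]; exact (f'.h u _).trans (he.h u x)
  · refine mem_lowerBounds.1 hc.F_ext.2 (fun q j => (X'.F.F q j).comap g'°ˡ)
      ⟨fun p j s hs => ?_, fun p v hv => ?_, fun p q j l x hx y hy => ?_⟩
    · exact mem_of_eq (S := X'.F.F p j) (hgC s).symm (f'.map_F _ _ _ (g.map_F _ _ _ hs))
    · exact mem_of_eq (S := X'.F.F p n) (hca v).symm (hX.F_ext.1.2.1 p v hv)
    · exact mem_of_eq (S := X'.F.F (p + q) (j + l)) (map_mul g'°.toFun x y).symm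
        (X'.F.mul_F _ _ _ _ _ _ hx hy)
  · exact fun x => DFunLike.congr_fun (congrArg GCHom.toFun (hc.free.hom_ext
      (f := ⟨X'.ρQ.toFun.comp g'.toFun, fun n x hx => X'.ρQ.map_gr _ _ (g'.map_gr _ _ hx)⟩)
      (g := S'.ρQ.toGCHom)
      (fun s => (congrArg X'.ρQ.toFun (hg1 s)).trans ((f'.ρQ _).trans ((g.ρQ s).trans (f.ρQ s).symm)))
      fun v => (congrArg X'.ρQ.toFun (hg2 v)).trans ((hX.ρQ v).trans (hc.ρQ v).symm))) x
  · exact fun x => (f'.ρ v _).trans ((g.ρ v x).trans (f.ρ v x).symm)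
  · exact fun x => (hX.ρ v x).trans (hc.ρ v x).symm
  · exact fun x => (f'.h u _).trans ((g.h u x).trans (f.h u x).symm)
  · exact fun x => (hX.h u x).trans (hc.h u x).symm

end IsStep

end

section

open Polynomial (coeff_add coeff_C derivative coeff_smul monomial eval_add eval_C coeff_monomial eval_monomial coeff_derivative)

/-! ## Integration along paths -/

section Path

variable {k : Type} [Field k] {D : FDGA.{u} k}

theorem eval_mem_of_polySub {S : Submodule k D} {P : D[X]} (hP : P ∈ polySub S)
    (c : k) : P.eval (algebraMap k D c) ∈ S := by
  rw [Polynomial.eval_eq_sum]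
  refine sum_mem fun i _ => ?_
  beta_reduce
  rw [← map_pow, ← Algebra.commutes, ← Algebra.smul_def]
  exact S.smul_mem _ (hP i)

theorem d_eval (P : D[X]) (c : k) : D.d (P.eval (algebraMap k D c)) =
    (D.pd P).eval (algebraMap k D c) := by
  induction P using Polynomial.induction_on' with
  | add P Q hP hQ => rw [eval_add, map_add, map_add, eval_add, hP, hQ]
  | monomial i a =>
    have h : D.pd (monomial i a) = monomial i (D.d a) := by
      ext j
      rw [FDGA.pd, coeff_polyMap, coeff_monomial, coeff_monomial]
      split_ifs <;> simp
    rw [h, eval_monomial, eval_monomial, ← map_pow, ← Algebra.commutes,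
      ← Algebra.commutes, ← Algebra.smul_def, ← Algebra.smul_def, map_smul]

theorem exists_antiderivative (q : D[X]) : ∃ P : D[X], P.coeff 0 = 0 ∧
    ∀ i, P.coeff (i + 1) = ((i : k) + 1)⁻¹ • q.coeff i := by
  induction q using Polynomial.induction_on' with
  | add q q' hq hq' =>
    obtain ⟨P, h1, h2⟩ := hq
    obtain ⟨P', h1', h2'⟩ := hq'
    exact ⟨P + P', by simp [h1, h1'], fun i => by simp [h2, h2']⟩
  | monomial j a =>
    refine ⟨monomial (j + 1) (((j : k) + 1)⁻¹ • a), ?_, fun i => ?_⟩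
    · rw [coeff_monomial, if_neg (Nat.succ_ne_zero j)]
    · rw [coeff_monomial, coeff_monomial]
      by_cases h : j = i
      · rw [if_pos (by rw [h]), if_pos h, h]
      · rw [if_neg (by omega), if_neg h, smul_zero]

theorem path_integral [CharZero k] {p : ℤ} {n : ℕ} {h : (D.path 1)}
    (hW : h ∈ (D.path 1).W p (n + 1)) (hd : (D.path 1).d h = 0) :
    ∃ I ∈ D.W (p + 1) n, D.d I = evalAt 1 h - evalAt 0 h ∧
      ∀ α₀ ∈ D.W (p + 1) n, ∀ α₁ ∈ D.W (p + 1) n, D.d α₀ = evalAt 0 h →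
        ∀ b ∈ shiftDeg (D.W (p + 2)) n, α₁ - α₀ - I = D.d b →
        ∃ β ∈ (D.path 1).W (p + 1) n, (D.path 1).d β = h ∧ evalAt 0 β = α₀ ∧
          evalAt 1 β = α₁ := by
  obtain ⟨P, Q⟩ := h
  have hP : P ∈ polySub (D.W p (n + 1)) := hW.1
  have hQ : Q ∈ polySub (D.W (p + 1) n) := hW.2
  have hQ' : Q ∈ polySub (D.gr n) := polySub_mono (D.W_le _ _) hQ
  have e0 : ∀ X : D[X], X.eval (algebraMap k D 0) = X.coeff 0 := fun X => by
    rw [map_zero, Polynomial.coeff_zero_eq_eval_zero]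
  have hs : ((-1 : k) ^ n) * (-1) ^ n = 1 := by rw [← mul_pow]; simp
  have key : ∀ i, P.coeff (i + 1) = ((i : k) + 1)⁻¹ • (-1 : k) ^ n • D.d (Q.coeff i) := by
    intro i
    have h1 : D.pd Q + D.psign (derivative P) = 0 := congrArg Prod.snd hd
    rw [D.psign_of_mem (polySub_mono (D.W_le _ _) (polySub_derivative _ hP))] at h1
    have h2 := congrArg (fun X => Polynomial.coeff X i) h1
    simp only [coeff_add, coeff_smul, coeff_derivative,
      FDGA.pd, coeff_polyMap, Polynomial.coeff_zero] at h2
    rw [← Nat.cast_succ, ← nsmul_eq_mul', ← Nat.cast_smul_eq_nsmul k] at h2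
    have h3 : ((i : k) + 1) ≠ 0 := Nat.cast_add_one_ne_zero i
    rw [add_eq_zero_iff_eq_neg.1 h2, ← neg_smul, smul_smul ((-1 : k) ^ n), pow_succ, mul_neg_one,
      neg_neg, hs, one_smul, Nat.cast_succ, smul_smul, inv_mul_cancel₀ h3, one_smul]
  obtain ⟨R, hR0, hR⟩ := exists_antiderivative ((-1 : k) ^ n • Q)
  have hRW : R ∈ polySub (D.W (p + 1) n) := by
    rintro (_ | i)
    · rw [hR0]; exact zero_mem _
    · rw [hR, coeff_smul]; exact smul_mem _ _ (smul_mem _ _ (hQ i))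
  have hdR : ∀ i, D.d (R.coeff (i + 1)) = P.coeff (i + 1) := fun i => by
    rw [hR, key, map_smul, coeff_smul, map_smul]
  refine ⟨R.eval (algebraMap k D 1), eval_mem_of_polySub hRW 1, ?_, ?_⟩
  · change _ = P.eval (algebraMap k D 1) - P.eval (algebraMap k D 0)
    have h1 : P = D.pd R + Polynomial.C (P.coeff 0) := by
      ext i
      rw [coeff_add, FDGA.pd, coeff_polyMap, coeff_C]
      cases i with
      | zero => rw [hR0, map_zero, zero_add, if_pos rfl]
      | succ i => rw [hdR, if_neg (Nat.succ_ne_zero i), add_zero]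
    rw [d_eval, e0]
    conv_rhs => rw [h1]
    rw [eval_add, eval_C, ← h1, add_sub_cancel_right]
  · intro α₀ h0 α₁ h1 hd0 b hb hI
    have hdb : D.d b ∈ D.W (p + 1) n := by
      rw [← hI]
      exact sub_mem (sub_mem h1 h0) (eval_mem_of_polySub hRW 1)
    set X : D[X] := Polynomial.C α₀ + R + monomial 1 (D.d b) with hX
    have hX0 : X.coeff 0 = α₀ := by
      rw [hX, coeff_add, coeff_add, coeff_C, if_pos rfl, hR0,
        coeff_monomial, if_neg one_ne_zero, add_zero, add_zero]
    have hX1 : ∀ i, X.coeff (i + 1) = R.coeff (i + 1) + if i = 0 then D.d b else 0 := fun i => by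
      rw [hX, coeff_add, coeff_add, coeff_C,
        if_neg (Nat.succ_ne_zero i), coeff_monomial, zero_add]
      congr 1
      by_cases hi : i = 0
      · rw [if_pos hi, if_pos (by rw [hi])]
      · rw [if_neg hi, if_neg (by omega)]
    have hXW : X ∈ polySub (D.W (p + 1) n) := by
      rintro (_ | i)
      · rw [hX0]; exact h0
      · rw [hX1]; refine add_mem (hRW _) ?_; split_ifs; exacts [hdb, zero_mem _]
    refine ⟨(X, Polynomial.C (-(-1 : k) ^ n • b)), ⟨hXW, fun i => ?_⟩, ?_, ?_, ?_⟩
    · change (Polynomial.C (-(-1 : k) ^ n • b)).coeff i ∈ shiftDeg (D.W (p + 1 + 1)) n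
      rw [coeff_C, add_assoc]
      split_ifs
      exacts [smul_mem _ _ hb, zero_mem _]
    · refine Prod.ext (Polynomial.ext fun i => ?_) (Polynomial.ext fun i => ?_)
      · change (D.pd X).coeff i = P.coeff i
        rw [FDGA.pd, coeff_polyMap]
        cases i with
        | zero => rw [hX0, hd0]; exact e0 P
        | succ i =>
          rw [hX1, map_add, hdR]
          split_ifs
          · rw [D.d_d, add_zero]
          · rw [map_zero, add_zero]
      · change (D.pd (Polynomial.C (-(-1 : k) ^ n • b)) + D.psign (derivative X)).coeff i =
          Q.coeff i
        rw [D.psign_of_mem (polySub_mono (D.W_le _ _) (polySub_derivative _ hXW)),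
          coeff_add, FDGA.pd, coeff_polyMap, coeff_smul,
          coeff_derivative, ← Nat.cast_succ, ← nsmul_eq_mul', ← Nat.cast_smul_eq_nsmul k,
          hX1, hR, coeff_C, coeff_smul, smul_add, smul_smul, Nat.cast_succ,
          mul_inv_cancel₀ (Nat.cast_add_one_ne_zero i), one_smul, smul_add, smul_smul, hs, one_smul]
        split_ifs with hi
        · subst hi; rw [Nat.cast_zero, zero_add, one_smul, map_smul, neg_smul]; abel
        · rw [map_zero, smul_zero, smul_zero, add_zero, zero_add]
    · exact (e0 X).trans hX0
    · change X.eval (algebraMap k D 1) = α₁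
      rw [hX, eval_add, eval_add, eval_C, eval_monomial,
        map_one, one_pow, mul_one, ← hI, map_one]
      abel

theorem path_ends [CharZero k] {n : ℕ} {h : (D.path 1)} (hh : h ∈ (D.path 1).cocycles n) :
    evalAt 1 h - evalAt 0 h ∈ D.coboundaries n := by
  obtain ⟨p, hp⟩ := (D.path 1).W_exhaustive n h hh.1
  cases n with
  | succ n => obtain ⟨I, hI, hdI, -⟩ := path_integral hp hh.2; exact ⟨I, D.W_le _ _ hI, hdI⟩
  | zero =>
    have h1 : D.pd h.2 + D.psign (derivative h.1) = 0 := congrArg Prod.snd hh.2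
    have h2 : h.2 = 0 := polySub_bot hp.2
    have h3 : derivative h.1 = 0 := by
      rw [h2, map_zero, zero_add, D.psign_of_mem (n := 0) (polySub_mono (D.W_le _ _)
        (polySub_derivative _ hp.1)), pow_zero, one_smul] at h1
      exact h1
    have h4 : h.1 = Polynomial.C (h.1.coeff 0) := by
      ext i
      rw [coeff_C]
      cases i with
      | zero => rw [if_pos rfl]
      | succ i =>
        have h5 := congrArg (fun X => Polynomial.coeff X i) h3
        simp only [coeff_derivative, Polynomial.coeff_zero] at h5
        rw [← Nat.cast_succ, ← nsmul_eq_mul', ← Nat.cast_smul_eq_nsmul k] at h5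
        rw [if_neg (Nat.succ_ne_zero i)]
        exact (smul_eq_zero.1 h5).resolve_left (Nat.cast_ne_zero.2 (Nat.succ_ne_zero i))
    have h6 : evalAt 1 h - evalAt 0 h = 0 := by
      change h.1.eval _ - h.1.eval _ = 0
      rw [h4, eval_C, eval_C, sub_self]
    rw [h6]
    exact zero_mem _

end Path

/-! ## The cohomology of a stage -/

namespace State

open HodgeDiagram IsMixedHodge

variable {m : ℕ} {A : HodgeDiagram.{u} m} (S : State A)

theorem coh {n : ℕ} {z} (hz : z ∈ S.Q°.cocycles n) : Coh A n fun v => S.ρ v z := by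
  refine ⟨fun v => (S.ρ v).map_cocycles n z hz, fun u => ?_⟩
  rw [← S.h_zero, ← S.h_one]
  exact path_ends ((S.h u).map_cocycles n z hz)

/-- The weight filtration on cocycles that induces the one of `H^n(S)`. -/
def hW (n : ℕ) (k : ℤ) : Submodule ℂ S.Q° :=
  ((S.Q.W (k - n) n)ˆ ⊓ (S.Q.cocycles n)ˆ) ⊔ (S.Q.coboundaries n)ˆ

/-- The Hodge filtration on cocycles that induces the one of `H^n(S)`. -/
def hF (n : ℕ) (q : ℤ) : Submodule ℂ S.Q° :=
  (S.F.F q n ⊓ (S.Q.cocycles n)ˆ) ⊔ (S.Q.coboundaries n)ˆ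

/-- The mixed Hodge structure on the cohomology of a stage. -/
theorem cmhs (n : ℕ) : CMHS (conjTensor S.Q) ((S.Q.coboundaries (n + 1))ˆ)
    ((S.Q.cocycles (n + 1))ˆ) (S.hW (n + 1)) (S.hF (n + 1)) := by
  have h1 := (S.isMH.mor_d (n + 1)).bigr_ker (S.isMH.cmhs (n + 1)) (S.isMH.cmhs (n + 2))
  have h2 := (S.isMH.mor_d n).bigr_map (S.isMH.cmhs n).bigr_T (S.isMH.cmhs (n + 1))
  have e1 : (S.Q.gr (n + 1))ˆ ⊓ (⊥ : Submodule ℂ _).comap S.Q°.d =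
      (S.Q.cocycles (n + 1))ˆ := baseChange_cocycles S.Q (n + 1)
  have e2 : ((S.Q.gr n)ˆ).map S.Q°.d ⊔ ⊥ = (S.Q.coboundaries (n + 1))ˆ := by
    rw [sup_bot_eq]
    exact baseChange_coboundaries S.Q (n + 1)
  rw [e1] at h1
  rw [e2] at h2
  have h3 := (S.isMH.cmhs (n + 1)).sub h1 bot_le
    (baseChange_mono ℂ inf_le_left) fun x hx => conjTensor_mem hx
  have hle : (S.Q.coboundaries (n + 1))ˆ ≤ (S.Q.cocycles (n + 1))ˆ :=
    baseChange_mono ℂ (S.Q.coboundaries_le (n + 1))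
  exact h3.quot ((S.isMH.cmhs (n + 1)).bigr_sub h2 h3 hle) bot_le hle fun x hx => conjTensor_mem hx

theorem mor (n : ℕ) : CMHS.Mor (conjTensor S.Q) (S.hW n) (S.hF n)
    (conjTensor A.Q) (A.HW n) (A.HF n) S.ρQ°ˡ := by
  have hB : ∀ z ∈ (S.Q.coboundaries n)ˆ, S.ρQ° z ∈
      (A.Q.coboundaries n)ˆ := baseChange_map_mem S.ρQˡ (S.ρQ.map_coboundaries n)
  refine ⟨fun x => (conjTensor_baseChange S.ρQˡ x).symm, fun k => ?_, fun q => ?_⟩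
  · have h1 : S.hW n k ≤ (A.HW n k).comap S.ρQ°ˡ := by
      refine sup_le ?_ fun z hz => baseChange_mono ℂ le_sup_right (hB z hz)
      rw [← baseChange_inf]
      have h3 : ∀ x ∈ S.Q.W (k - n) n ⊓ S.Q.cocycles n,
          S.ρQˡ x ∈ A.Q.cocycles n ⊓ A.Q.W (k - n) n :=
        fun x hx => ⟨S.ρQ.map_cocycles n x hx.2, S.ρQ.map_W _ _ _ hx.1⟩
      exact fun z hz => baseChange_mono ℂ le_sup_left (baseChange_map_mem S.ρQˡ h3 z hz)
    exact fun x hx => h1 hx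
  · have h1 : S.hF n q ≤ (A.HF n q).comap S.ρQ°ˡ := by
      refine sup_le (fun z hz => ?_) fun z hz => ⟨fun _ => 0, ?_, ?_, zero_mem _⟩
      · have h2 := S.coh (n := n) (z := z) (by rw [baseChange_cocycles]; exact hz.2)
        refine ⟨_, h2, ?_, S.ρ_F _ _ _ hz.1⟩
        rw [S.ρ_left]
        change S.ρQ° z - _ ∈ A.Q°.coboundaries n
        rw [sub_self]
        exact zero_mem _
      · exact ⟨fun _ => zero_mem _, fun u => by rw [map_zero, sub_zero]; exact zero_mem _⟩
      · rw [sub_zero]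
        change S.ρQ° z ∈ A.Q°.coboundaries n
        rw [baseChange_coboundaries]
        exact hB z hz
    exact fun x hx => h1 hx

end State

end

section

/-! ## Existence of cells -/

open HodgeDiagram IsMixedHodge

variable {m : ℕ} {A : HodgeDiagram.{u} m}

theorem State.exists_family (hA : A.IsMixedHodge) (S : State A) {n : ℕ} {p : ℤ}
    {c : S.Q°} (hc : c ∈ S.Q°.W p (n + 2)) (hdc : S.Q°.d c = 0)
    {I : ∀ u : ZArrow m, (A.node u.tgt)} (hI : ∀ u, I u ∈ (A.node u.tgt).W (p + 1) (n + 1))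
    (hdI : ∀ u, (A.node u.tgt).d (I u) = A.φ u (S.ρ u.src c) - S.ρ u.tgt c)
    {x : A.node .left} (hx : x ∈ (A.node .left).W (p + 1) (n + 1))
    (hdx : (A.node .left).d x = S.ρ .left c) :
    ∃ z : ∀ v, A.node v, z .left = x ∧ (∀ v, z v ∈ (A.node v).W (p + 1) (n + 1)) ∧
      (∀ v, (A.node v).d (z v) = S.ρ v c) ∧
      ∀ u, A.φ u (z u.src) - z u.tgt - I u ∈ (A.node u.tgt).coboundaries (n + 1) := by
  let X : ZVertex m → Type u := fun v =>
    {y : A.node v // y ∈ (A.node v).W (p + 1) (n + 1) ∧ (A.node v).d y = S.ρ v c}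
  let R : ∀ u : ZArrow m, X u.src → X u.tgt → Prop := fun u a b =>
    A.φ u a.1 - b.1 - I u ∈ (A.node u.tgt).coboundaries (n + 1)
  obtain ⟨z, hz, hR⟩ := ZVertex.exists_family_left (R := R)
    (fun u a => ⟨⟨A.φ u a.1 - I u, sub_mem ((A.φ u).map_W _ _ _ a.2.1) (hI u), by
        refine (map_sub _ _ _).trans ?_
        rw [hdI u, ← (A.φ u).map_d, show (A.node _).d a.1 = _ from a.2.2, sub_sub_cancel]⟩, by
        change A.φ u a.1 - (A.φ u a.1 - I u) - I u ∈ _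
        rw [sub_sub_cancel, sub_self]
        exact zero_mem _⟩)
    (fun u b => by
      obtain ⟨α, h1, h2, h3⟩ := hA.exists_rel_lift u (n := n + 1) (w := p + 1)
        (c := (S.ρ _).toFun c) (T := b.1 + I u)
        (by rw [add_sub_cancel_right]; exact (S.ρ _).map_W _ _ _ hc)
        (by rw [← (S.ρ _).map_d, hdc, map_zero]) (add_mem b.2.1 (hI u)) (by
          refine (map_add _ _ _).trans ?_
          rw [hdI u, show (A.node _).d b.1 = _ from b.2.2]
          exact add_sub_cancel _ _)
      exact ⟨⟨α, h1, h2⟩, by change A.φ u α - b.1 - I u ∈ _; rw [sub_sub]; exact h3⟩) ⟨x, hx, hdx⟩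
  exact ⟨fun v => (z v).1, congrArg Subtype.val hz, fun v => (z v).2.1, fun v => (z v).2.2, hR⟩

theorem State.exists_values (hA : A.IsMixedHodge) (S : State A) {n : ℕ} {p q : ℤ}
    {c : S.Q°} (hc : c ∈ S.Q°.W p (n + 2)) (hdc : S.Q°.d c = 0)
    {x : A.node .left} (hx : x ∈ (A.node .left).W (p + 1) (n + 1))
    (hdx : (A.node .left).d x = S.ρ .left c)
    (H : ∀ α ∈ (A.node .right).W (p + 1) (n + 1), (A.node .right).d α = S.ρ .right c →
      (c = 0 → ∃ z, Coh A (n + 1) z ∧ z .left = x ∧ z .right = α) →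
      ∃ a₀ ∈ S.Q°.W (p + 1) (n + 1), c + S.Q°.d a₀ ∈ S.F.F q (n + 2) ∧
      ∃ αC ∈ (A.node .right).W (p + 1) (n + 1), αC ∈ A.F.F q (n + 1) ∧
        (A.node .right).d αC = S.ρ .right (c + S.Q°.d a₀) ∧
        ∃ y ∈ S.Q°.cocycles (n + 1), α + S.ρ .right a₀ - αC - S.ρ .right y ∈
          (A.node .right).coboundaries (n + 1)) :
    ∃ a ∈ S.Q°.W (p + 1) (n + 1), c + S.Q°.d a ∈ S.F.F q (n + 2) ∧
    ∃ α : ∀ v, A.node v, α .left = x ∧ (∀ v, α v ∈ (A.node v).W (p + 1) (n + 1)) ∧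
      (∀ v, (A.node v).d (α v) = S.ρ v c) ∧
      α .right + S.ρ .right a ∈ A.F.F q (n + 1) ∧
    ∃ β : ∀ u : ZArrow m, ((A.node u.tgt).path 1),
      (∀ u, β u ∈ ((A.node u.tgt).path 1).W (p + 1) (n + 1)) ∧
      (∀ u, ((A.node u.tgt).path 1).d (β u) = S.h u c) ∧
      (∀ u, evalAt 0 (β u) = α u.tgt) ∧
      ∀ u, evalAt 1 (β u) = A.φ u (α u.src) := by
  choose I hI hdI hβ using fun u => path_integral ((S.h u).map_W p (n + 2) c hc)
    (by rw [← (S.h u).map_d, hdc, map_zero])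
  simp only [S.h_zero, S.h_one] at hdI hβ
  obtain ⟨z, hzx, hzW, hzd, hzI⟩ := S.exists_family hA hc hdc hI hdI hx hdx
  obtain ⟨a₀, ha₀, ha₀F, αC, hαC, hαCF, hαCd, y, hy, hδy⟩ := H _ (hzW .right) (hzd .right) fun h0 => by
    refine ⟨z, ⟨fun v => ⟨(A.node v).W_le _ _ (hzW v), ?_⟩, fun u => ?_⟩, hzx, rfl⟩
    · change (A.node v).d (z v) = 0; rw [hzd, h0, map_zero]
    · have hI0 : I u ∈ (A.node u.tgt).coboundaries (n + 1) := by
        obtain ⟨β, hβW, hβd, h2, h3⟩ := hβ u 0 (zero_mem _) (I u) (hI u)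
          (by rw [h0, map_zero, map_zero]) 0 (zero_mem _) (by rw [sub_zero, sub_self, map_zero])
        have h4 := path_ends (n := n + 1) (h := β) ⟨((A.node u.tgt).path 1).W_le _ _ hβW, by
          change ((A.node u.tgt).path 1).d β = 0
          rw [hβd, h0, map_zero]⟩
        rwa [h2, h3, sub_zero] at h4
      have := add_mem (hzI u) hI0
      rwa [sub_add_cancel] at this
  set δ := z .right + S.ρ .right a₀ - αC with hδ
  have hδW : δ ∈ (A.node .right).W (p + 1) (n + 1) :=
    sub_mem (add_mem (hzW _) ((S.ρ .right).map_W _ _ _ ha₀)) hαC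
  have hδd : (A.node .right).d δ = 0 := by
    rw [hδ, map_sub, map_add, hzd, hαCd, ← (S.ρ .right).map_d, map_add, sub_self]
  obtain ⟨D, hD, hDδ, hDW⟩ := hA.exists_coh_right hδW hδd
  have h1 := (hD.sub (S.coh hy)).exact hA (v := .right) (by rw [hDδ]; exact hδy) .left
  have e : p + 1 + (n + 1 : ℕ) - (n + 1 : ℕ) = p + 1 := add_sub_cancel_right _ _
  obtain ⟨y', hy', hyy'⟩ := (S.mor (n + 1)).exists_strict_W (S.cmhs n) (hA.cmhs (n + 1))
    (k := p + 1 + (n + 1 : ℕ)) (x := y) (by rw [← baseChange_cocycles]; exact hy)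
    (mem_HW.2 ⟨D .left, hD.cocycle _, by rw [e]; exact hDW _, by
      have h2 := neg_mem h1
      rw [neg_sub, S.ρ_left] at h2
      exact h2⟩)
  obtain ⟨w, ⟨hwW, hwZ⟩, b, hb, rfl⟩ := mem_sup.1 hy'
  rw [e] at hwW
  rw [← baseChange_cocycles] at hwZ
  rw [← baseChange_coboundaries] at hb hyy'
  have h3 : D .left - S.ρ .left w ∈ (A.node .left).coboundaries (n + 1) := by
    have h4 := S.ρQ°.map_coboundaries _ _ hb
    have h5 : S.ρQ° y - S.ρQ° (w + b) ∈ (A.node .left).coboundaries (n + 1) := hyy'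
    rw [S.ρ_left] at h1 ⊢
    have h6 := add_mem (add_mem h1 h5) h4
    rw [map_add] at h6
    refine mem_of_eq (S := (A.node .left).coboundaries (n + 1)) ?_ h6
    abel
  have h4 := (hD.sub (S.coh hwZ)).exact hA h3 .right
  have hwd : S.Q°.d w = 0 := hwZ.2
  obtain ⟨α, hαl, hαr, hαW, hαz⟩ : ∃ α : ∀ v, A.node v, α .left = x ∧
      α .right = αC - S.ρ .right (a₀ - w) ∧ (∀ v, α v ∈ (A.node v).W (p + 1) (n + 1)) ∧
      ∀ v, α v - z v ∈ (A.node v).coboundaries (n + 1) := by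
    refine ⟨fun | .left => z .left | .even i => z (.even i) | .odd i => z (.odd i)
                | .right => αC - S.ρ .right (a₀ - w), hzx, rfl, ?_, ?_⟩
    · rintro (_ | i | i | _)
      exacts [hzW _, hzW _, hzW _, sub_mem hαC ((S.ρ .right).map_W _ _ _ (sub_mem ha₀ hwW))]
    · rintro (_ | i | i | _)
      · change z .left - z .left ∈ _; rw [sub_self]; exact zero_mem _
      · change z (.even i) - z (.even i) ∈ _; rw [sub_self]; exact zero_mem _
      · change z (.odd i) - z (.odd i) ∈ _; rw [sub_self]; exact zero_mem _
      · have h5 := neg_mem h4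
        rw [hDδ] at h5
        refine mem_of_eq (S := (A.node .right).coboundaries (n + 1)) ?_ h5
        rw [hδ, map_sub]
        abel_nf
  have hαd : ∀ v, (A.node v).d (α v) = S.ρ v c := fun v => by
    have h5 : (A.node v).d (α v - z v) = 0 := ((A.node v).coboundaries_le _ (hαz v)).2
    rw [map_sub, hzd, sub_eq_zero] at h5
    exact h5
  have key : ∀ u : ZArrow m, ∃ β ∈ ((A.node u.tgt).path 1).W (p + 1) (n + 1),
      ((A.node u.tgt).path 1).d β = S.h u c ∧ evalAt 0 β = α u.tgt ∧
      evalAt 1 β = A.φ u (α u.src) := fun u => by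
    have h5 : A.φ u (α u.src) - α u.tgt - I u ∈ (A.node u.tgt).coboundaries (n + 1) := by
      have h6 := sub_mem (add_mem (hzI u) ((A.φ u).map_coboundaries _ _ (hαz u.src))) (hαz u.tgt)
      refine mem_of_eq ?_ h6
      rw [map_sub]
      abel
    obtain ⟨b, hb, hbd⟩ := hA.exact_W h5
      (sub_mem (sub_mem ((A.φ u).map_W _ _ _ (hαW _)) (hαW _)) (hI u))
    exact hβ u _ (hαW _) _ ((A.φ u).map_W _ _ _ (hαW _)) (hαd _) b
      (by rwa [show p + 2 = p + 1 + 1 by ring]) hbd.symm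
  choose β h5 h6 h7 h8 using key
  refine ⟨a₀ - w, sub_mem ha₀ hwW, ?_, α, hαl, hαW, hαd, ?_, β, h5, h6, h7, h8⟩
  · rw [map_sub, hwd, sub_zero]; exact ha₀F
  · rw [hαr, sub_add_cancel]; exact hαCF

end

section

open HodgeDiagram IsMixedHodge

variable {m : ℕ} {A : HodgeDiagram.{u} m}

theorem map_mem_of_span {k X Y ι : Type*} [Field k] [AddCommGroup X] [Module k X] [AddCommGroup Y]
    [Module k Y] {b : ι → X} {P : ι → Prop} {f : X →ₗ[k] Y} {U : Submodule k Y}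
    (h : ∀ i, P i → f (b i) ∈ U) {S : Submodule k X} (hS : S ≤ span k (b '' {i | P i}))
    {x : X} (hx : x ∈ S) : f x ∈ U :=
  (span_le.2 (by rintro _ ⟨i, hi, rfl⟩; exact h i hi) : span k (b '' {i | P i}) ≤ U.comap f) (hS hx)

/-- A cell exists as soon as the values on the generators can be chosen at the two ends. -/
theorem Cell.exists_of (hA : A.IsMixedHodge) (S : State A) {n : ℕ} {V : Type u} [AddCommGroup V]
    [Module ℚ V] [Module.Finite ℚ V] {WV : ℤ → Submodule ℚ V} {FV : ℤ → Submodule ℂ (ℂ ⊗[ℚ] V)}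
    (hV : CMHS (conjTensor V) ⊥ ⊤ (fun k => (WV (k - (n + 1 : ℕ)))ˆ) FV)
    (ξ : V →ₗ[ℚ] S.Q) (ξ_W : ∀ p v, v ∈ WV p → ξ v ∈ S.Q.W (p - 1) (n + 2))
    (d_ξ : ∀ v, S.Q.d (ξ v) = 0) (ξ_dec : ∀ v, ξ v ∈ S.Q.toGCAlg.decomposables (n + 2))
    (αQ : V →ₗ[ℚ] A.Q) (αQ_W : ∀ p v, v ∈ WV p → αQ v ∈ A.Q.W p (n + 1))
    (αQ_d : ∀ v, A.Q.d (αQ v) = S.ρQ (ξ v))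
    (H : ∀ p q x, x ∈ (WV (p + 1))ˆ → x ∈ FV q → ∀ α ∈ (A.node .right).W (p + 1) (n + 1),
      (A.node .right).d α = S.ρ .right (ξˆ x) →
      (ξˆ x = 0 → ∃ z, Coh A (n + 1) z ∧ z .left = αQˆ x ∧ z .right = α) →
      ∃ a₀ ∈ S.Q°.W (p + 1) (n + 1),
      ξˆ x + S.Q°.d a₀ ∈ S.F.F q (n + 2) ∧
      ∃ αC ∈ (A.node .right).W (p + 1) (n + 1), αC ∈ A.F.F q (n + 1) ∧
        (A.node .right).d αC = S.ρ .right (ξˆ x + S.Q°.d a₀) ∧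
        ∃ y ∈ S.Q°.cocycles (n + 1), α + S.ρ .right a₀ - αC - S.ρ .right y ∈
          (A.node .right).coboundaries (n + 1)) :
    ∃ (c : Cell S (n + 1)) (e : V →ₗ[ℚ] c.V), Function.Surjective e ∧ (∀ v, c.ξ (e v) = ξ v) ∧
      (∀ v, c.αQ (e v) = αQ v) ∧ ∀ p, c.WV p = (WV p).map e := by
  obtain ⟨b, τ, hb, hτ⟩ := hV.exists_typed_basis
  have hF : ∀ q, FV q ≤ span ℂ (b '' {i | q ≤ (τ i).1}) := fun q => (hV.F_eq q).le.trans (hτ _).le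
  have hW : ∀ p, (WV p)ˆ ≤ span ℂ (b '' {i | (τ i).1 + (τ i).2 ≤ p + (n + 1 : ℕ)}) := fun p => by
    have h1 := hV.W_eq (p + (n + 1 : ℕ))
    rw [add_sub_cancel_right, hτ] at h1
    exact h1.le
  have hbW : ∀ i, b i ∈ (WV ((τ i).1 + (τ i).2 - (n + 1 : ℕ)))ˆ := fun i => CMHS.I_le_W _ _ (hb i)
  set P : Fin (Module.finrank ℂ (ℂ ⊗[ℚ] V)) → ℤ := fun i => (τ i).1 + (τ i).2 - (n + 1 : ℕ) - 1 with hP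
  have hP1 : ∀ i, P i + 1 = (τ i).1 + (τ i).2 - (n + 1 : ℕ) := fun i => sub_add_cancel _ _
  have hbP : ∀ i, b i ∈ (WV (P i + 1))ˆ := fun i => by rw [hP1]; exact hbW i
  have hbF : ∀ i, b i ∈ FV (τ i).1 := fun i => CMHS.I_le_F _ _ (hb i)
  have hρQ := S.ρ_left
  choose a ha haF α hαl hαW hαd hαF β hβW hβd hβ0 hβ1 using fun i =>
    S.exists_values hA (n := n) (p := P i) (q := (τ i).1) (c := ξˆ (b i)) (x := αQˆ (b i))
      (baseChange_map_mem ξ (fun v hv => by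
        have := ξ_W _ v hv; rwa [add_sub_cancel_right] at this) _ (hbP i))
      (by
        have h1 := LinearMap.congr_fun (baseChange_hom_ext (f := S.Q.dˆ ∘ₗ ξˆ) (g := 0) fun v => by
            change (1 : ℂ) ⊗ₜ[ℚ] S.Q.d (ξ v) = 0
            rw [d_ξ, TensorProduct.tmul_zero]) (b i)
        exact h1)
      (baseChange_map_mem αQ (αQ_W _) _ (hbP i))
      (by
        rw [hρQ]
        exact LinearMap.congr_fun (baseChange_hom_ext (f := A.Q.dˆ ∘ₗ αQˆ)
          (g := S.ρQ°ˡ ∘ₗ ξˆ) fun v => by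
            change (1 : ℂ) ⊗ₜ[ℚ] A.Q.d (αQ v) = (1 : ℂ) ⊗ₜ[ℚ] S.ρQ (ξ v)
            rw [αQ_d]) (b i)) (H _ _ _ (hbP i) (hbF i))
  have hle : ∀ {p i}, (τ i).1 + (τ i).2 ≤ p + (n + 1 : ℕ) → P i + 1 ≤ p := fun {p i} h => by
    rw [hP1]; omega
  refine ⟨{
    V := V, WV := WV, FV := FV, cmhs := hV, pos := Nat.succ_pos n, ξ := ξ, ξ_W := ξ_W, d_ξ := d_ξ,
    ξ_dec := ξ_dec, a := b.constr ℂ a, αQ := αQ, αQ_W := αQ_W, αQ_d := αQ_d,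
    α := fun v => b.constr ℂ fun i => α i v, β := fun u => b.constr ℂ fun i => β i u,
    a_W := fun p x hx => map_mem_of_span (fun i hi => ?_) (hW p) hx,
    a_F := fun q x hx => map_mem_of_span
      (f := ξˆ + S.Q°.d ∘ₗ b.constr ℂ a) (fun i hi => ?_) (hF q) hx,
    α_left := b.ext fun i => ?_,
    α_W := fun v p x hx => map_mem_of_span (fun i hi => ?_) (hW p) hx,
    α_d := fun v => LinearMap.congr_fun (b.ext (f₁ := (A.node v).d ∘ₗ b.constr ℂ fun i => α i v)
      (f₂ := (S.ρ v)ˡ ∘ₗ ξˆ) fun i => ?_),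
    α_F := fun q x hx => map_mem_of_span (f := (b.constr ℂ fun i => α i .right) +
      (S.ρ .right)ˡ ∘ₗ b.constr ℂ a) (fun i hi => ?_) (hF q) hx,
    β_W := fun u p x hx => map_mem_of_span (fun i hi => ?_) (hW p) hx,
    β_d := fun u => LinearMap.congr_fun (b.ext
      (f₁ := ((A.node u.tgt).path 1).d ∘ₗ b.constr ℂ fun i => β i u)
      (f₂ := (S.h u)ˡ ∘ₗ ξˆ) fun i => ?_),
    β_zero := fun u => LinearMap.congr_fun (b.ext
      (f₁ := (FDGA.evalHom 0).toLinearMap ∘ₗ b.constr ℂ fun i => β i u)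
      (f₂ := b.constr ℂ fun i => α i u.tgt) fun i => ?_),
    β_one := fun u => LinearMap.congr_fun (b.ext
      (f₁ := (FDGA.evalHom 1).toLinearMap ∘ₗ b.constr ℂ fun i => β i u)
      (f₂ := (A.φ u)ˡ ∘ₗ b.constr ℂ fun i => α i u.src) fun i => ?_) },
    LinearMap.id, Function.surjective_id, fun _ => rfl, fun _ => rfl, fun p => (Submodule.map_id _).symm⟩
  · rw [b.constr_basis]; exact S.Q°.W_mono _ (hle hi) (ha i)
  · change ξˆ (b i) + S.Q°.d (b.constr ℂ a (b i)) ∈ S.F.F q (n + 2)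
    rw [b.constr_basis]
    exact S.F.F_anti _ hi (haF i)
  · rw [b.constr_basis]; exact hαl i
  · rw [b.constr_basis]; exact (A.node v).W_mono _ (hle hi) (hαW i v)
  · exact (congrArg (A.node v).d (b.constr_basis _ _ _)).trans (hαd i v)
  · change (b.constr ℂ fun i => α i .right) (b i) + S.ρ .right (b.constr ℂ a (b i)) ∈ A.F.F q (n + 1)
    rw [b.constr_basis, b.constr_basis]
    exact A.F.F_anti _ hi (hαF i)
  · rw [b.constr_basis]; exact ((A.node u.tgt).path 1).W_mono _ (hle hi) (hβW i u)
  · exact (congrArg ((A.node u.tgt).path 1).d (b.constr_basis _ _ _)).trans (hβd i u)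
  · rw [b.constr_basis]; exact (congrArg (evalAt 0) (b.constr_basis _ _ _)).trans (hβ0 i u)
  · refine (congrArg (evalAt 1) (b.constr_basis _ _ _)).trans ((hβ1 i u).trans ?_)
    exact (congrArg (A.φ u).toFun (b.constr_basis ℂ (fun i => α i u.src) i)).symm

end

section

open HodgeDiagram IsMixedHodge

variable {m : ℕ} {A : HodgeDiagram.{u} m}

/-- Solutions of a linear equation compatible with filtrations can be chosen linearly. -/
theorem exists_filtered_lift {k V Y X : Type*} [Field k] [AddCommGroup V] [Module k V]
    [Module.Finite k V] [AddCommGroup Y] [Module k Y] [AddCommGroup X] [Module k X]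
    {W : ℤ → Submodule k V} (hW : Monotone W) (h1 : ∃ a, W a = ⊥) (h2 : ∃ a, W a = ⊤)
    {G : ℤ → Submodule k Y} (hG : Monotone G) (g : Y →ₗ[k] X) (f : V →ₗ[k] X)
    (h : ∀ p v, v ∈ W p → ∃ y ∈ G p, g y = f v) :
    ∃ σ : V →ₗ[k] Y, (∀ v, g (σ v) = f v) ∧ ∀ p v, v ∈ W p → σ v ∈ G p := by
  obtain ⟨b, w, hb, hw⟩ := CMHS.exists_adapted_basis hW h1 h2
  choose y hy hyf using fun i => h _ _ (hb i)
  refine ⟨b.constr k y, LinearMap.congr_fun (b.ext (f₁ := g ∘ₗ b.constr k y) (f₂ := f) fun i => ?_),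
    fun p v hv => map_mem_of_span (fun i hi => ?_) (hw p).le hv⟩
  · change g (b.constr k y (b i)) = _; rw [b.constr_basis, hyf]
  · rw [b.constr_basis]; exact hG hi (hy i)

section Rational

variable {V : Type*} [AddCommGroup V] [Module ℚ V] {n : ℤ} {WV : ℤ → Submodule ℚ V}
  {FV : ℤ → Submodule ℂ (ℂ ⊗[ℚ] V)}

theorem CMHS.rational (hV : CMHS (conjTensor V) ⊥ ⊤ (fun k => (WV (k - n))ˆ) FV) :
    Monotone WV ∧ (∃ a, WV a = ⊥) ∧ ∃ a, WV a = ⊤ := by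
  refine ⟨fun p q hpq => baseChange_le_baseChange.1 ?_, ?_, ?_⟩
  · have := hV.W_mono (show p + n ≤ q + n by linarith); simpa using this
  · obtain ⟨l, hl⟩ := hV.W_bot
    exact ⟨l - n, le_bot_iff.1 (baseChange_le_baseChange.1 (by rw [baseChange_bot]; exact hl.le))⟩
  · obtain ⟨l, hl⟩ := hV.W_top
    exact ⟨l - n, top_le_iff.1 (baseChange_le_baseChange.1 (by rw [baseChange_top]; exact hl.ge))⟩

end Rational

theorem finite_subquotient {k X : Type*} [Field k] [AddCommGroup X] [Module k X]
    {T B U : Submodule k X} (h : Module.Finite k (↥T ⧸ B.submoduleOf T)) (hBU : B ≤ U) :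
    Module.Finite k (↥T ⧸ U.submoduleOf T) :=
  Module.Finite.of_surjective (Submodule.mapQ (B.submoduleOf T) (U.submoduleOf T) LinearMap.id
    fun _ hx => hBU hx) fun x => by
      obtain ⟨y, rfl⟩ := mkQ_surjective _ x
      exact ⟨(B.submoduleOf T).mkQ y, rfl⟩

/-- The mixed Hodge structure on a subquotient with a filtered section, for a filtration `G` that
induces the weight filtration. -/
theorem CMHS.exists_section {X : Type u} [AddCommGroup X] [Module ℚ X] {T B : Submodule ℚ X}
    {G : ℤ → Submodule ℚ X} {F : ℤ → Submodule ℂ (ℂ ⊗[ℚ] X)} {n : ℤ} (hG : Monotone G)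
    [Module.Finite ℚ (↥T ⧸ B.submoduleOf T)]
    (h : CMHS (conjTensor X) (Bˆ) (Tˆ) (fun k => (T ⊓ G (k - n) ⊔ B)ˆ) F) :
    ∃ (V : Type u) (_ : AddCommGroup V) (_ : Module ℚ V) (_ : Module.Finite ℚ V)
      (WV : ℤ → Submodule ℚ V) (FV : ℤ → Submodule ℂ (ℂ ⊗[ℚ] V)) (σ : V →ₗ[ℚ] X),
      CMHS (conjTensor V) ⊥ ⊤ (fun k => (WV (k - n))ˆ) FV ∧
      (∀ v, σ v ∈ T) ∧ (∀ v, σ v ∈ B → v = 0) ∧ (∀ x ∈ T, ∃ v, x - σ v ∈ B) ∧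
      (∀ p v, v ∈ WV p → σ v ∈ G p) ∧ (∀ q x, x ∈ FV q → σˆ x ∈ F q) ∧
      ∀ p, T ⊓ G p ≤ B → WV p = ⊥ := by
  set WV : ℤ → Submodule ℚ (↥T ⧸ B.submoduleOf T) := fun p =>
    ((T ⊓ G p ⊔ B).comap T.subtype).map (B.submoduleOf T).mkQ with hWV
  have hV := h.subquotient
  have hV' : CMHS (conjTensor _) ⊥ ⊤ (fun k => (WV (k - n))ˆ) _ := hV
  obtain ⟨h1, h2, h3⟩ := hV'.rational
  obtain ⟨σ, hσ, hσG⟩ := exists_filtered_lift h1 h2 h3 (G := fun p => (G p).comap T.subtype)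
    (fun p q hpq => comap_mono (hG hpq)) (B.submoduleOf T).mkQ LinearMap.id (by
      rintro p _ ⟨x, hx, rfl⟩
      obtain ⟨y, hy, b, hb, hyb⟩ := mem_sup.1 hx
      refine ⟨⟨y, hy.1⟩, hy.2, ?_⟩
      refine (Submodule.Quotient.eq _).2 ?_
      change y - T.subtype x ∈ B
      rw [← hyb, sub_add_cancel_left]
      exact neg_mem hb)
  refine ⟨_, _, _, inferInstance, WV, _, T.subtype ∘ₗ σ, hV', fun v => (σ v).2, fun v hv => ?_,
    fun x hx => ⟨(B.submoduleOf T).mkQ ⟨x, hx⟩, ?_⟩, hσG, ?_, fun p hp => ?_⟩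
  · exact (hσ v).symm.trans ((Submodule.Quotient.mk_eq_zero _).2 hv)
  · exact (Submodule.Quotient.eq (B.submoduleOf T)).1 (hσ ((B.submoduleOf T).mkQ ⟨x, hx⟩)).symm
  · rintro q _ ⟨y, hy, rfl⟩
    have h4 : T.subtypeˆ (y - σˆ ((B.submoduleOf T).mkQˆ y)) ∈ Bˆ := by
      rw [subtype_baseChange_mem_iff, map_sub, ← baseChange_apply_comp (B.submoduleOf T).mkQ σ,
        show (B.submoduleOf T).mkQ ∘ₗ σ = LinearMap.id from LinearMap.ext hσ, LinearMap.baseChange_id,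
        LinearMap.id_apply, sub_self]
    rw [baseChange_apply_comp]
    rw [map_sub] at h4
    exact mem_of_eq (S := F q) (sub_sub_cancel _ _) (sub_mem hy (h.B_le_F q h4))
  · rw [hWV]
    refine le_bot_iff.1 ?_
    rintro _ ⟨x, hx, rfl⟩
    exact (Submodule.Quotient.mk_eq_zero _).2 (sup_le hp le_rfl hx)

/-- A cell that makes the map in cohomology of degree `n + 1` surjective. -/
theorem State.exists_creation (hA : A.IsMixedHodge) (S : State A) (n : ℕ) :
    ∃ c : Cell S (n + 1), c.ξ = 0 ∧ (∀ z ∈ A.Q.cocycles (n + 1), ∃ y ∈ S.Q.cocycles (n + 1), ∃ v,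
        z - S.ρQ y - c.αQ v ∈ A.Q.coboundaries (n + 1)) ∧
      (∀ v, A.Q.d (c.αQ v) = 0) ∧
      (∀ y ∈ S.Q.cocycles (n + 1), ∀ v, S.ρQ y + c.αQ v ∈ A.Q.coboundaries (n + 1) → v = 0) ∧
      ∀ p, (∀ x ∈ A.Q.W p (n + 1), A.Q.d x = 0 → x ∈ A.Q.coboundaries (n + 1)) → c.WV p = ⊥ := by
  set U : Submodule ℚ A.Q := (S.Q.cocycles (n + 1)).map S.ρQˡ ⊔ A.Q.coboundaries (n + 1) with hU
  have hUZ : U ≤ A.Q.cocycles (n + 1) := sup_le (by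
    rintro _ ⟨y, hy, rfl⟩
    exact S.ρQ.map_cocycles _ _ hy) (A.Q.coboundaries_le _)
  have hUC : Uˆ = ((S.Q.cocycles (n + 1))ˆ).map S.ρQ°ˡ ⊔ (A.Q.coboundaries (n + 1))ˆ := by
    rw [hU, baseChange_sup, baseChange_map]
    rfl
  have hq := (hA.cmhs (n + 1)).quot (U := Uˆ)
    (by rw [hUC]; exact (S.mor (n + 1)).bigr_map (S.cmhs n).bigr_T (hA.cmhs (n + 1)))
    (baseChange_mono ℂ le_sup_right) (baseChange_mono ℂ hUZ)
    fun x hx => conjTensor_mem hx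
  have hW : (fun k => A.HW (n + 1) k ⊔ Uˆ) = fun k =>
      (A.Q.cocycles (n + 1) ⊓ A.Q.W (k - (n + 1 : ℕ)) (n + 1) ⊔ U)ˆ := funext fun k => by
    rw [HodgeDiagram.HW, ← baseChange_sup, sup_assoc, sup_eq_right.2 (le_sup_right : _ ≤ U)]
  have hid : CMHS.Mor (conjTensor A.Q) (A.HW (n + 1)) (A.HF (n + 1)) (conjTensor A.Q)
      (fun k => A.HW (n + 1) k ⊔ Uˆ) (fun q => A.HF (n + 1) q ⊔ Uˆ)
      LinearMap.id := ⟨fun _ => rfl, fun _ _ h => mem_sup_left h, fun _ _ h => mem_sup_left h⟩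
  have hq' := hq
  rw [hW] at hq'
  have := finite_subquotient (hA.finite (n + 1)) (le_sup_right : _ ≤ U)
  obtain ⟨V, _, _, _, WV, FV, σ, hV, hσZ, hσU, hσs, hσW, hσF, hbot⟩ :=
    hq'.exists_section (A.Q.W_mono (n + 1))
  obtain ⟨c, e, he, hξ, hα, hcW⟩ := Cell.exists_of hA S hV 0 (fun _ _ _ => zero_mem _)
    (fun _ => map_zero _) (fun _ => zero_mem _) σ hσW (fun v => by
      rw [LinearMap.zero_apply, map_zero]; exact (hσZ v).2) (by
    intro p q x hxW hxF α hα _ h0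
    rw [LinearMap.baseChange_zero, LinearMap.zero_apply] at h0 ⊢
    obtain ⟨z, hz, hzl, rfl⟩ := h0 rfl
    have h1 : σˆ x ∈ (A.Q.W (p + 1) (n + 1))ˆ := baseChange_map_mem σ (hσW _) _ hxW
    have h2 : σˆ x ∈ A.HW (n + 1) (p + 1 + (n + 1 : ℕ)) :=
      mem_HW.2 ⟨z .left, hz.cocycle _, by rw [add_sub_cancel_right, hzl]; exact h1, by
        rw [hzl, sub_self]; exact zero_mem _⟩
    obtain ⟨y, hy, hxy⟩ := hid.exists_strict_FW (hA.cmhs (n + 1)) hq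
      (x := σˆ x) ((hA.cmhs (n + 1)).W_le _ h2) (hσF q x hxF) (mem_sup_left h2)
    obtain ⟨D, hD, hDW, hDF, hyD⟩ := hA.exists_coh_F_W (k := p + 1 + (n + 1 : ℕ))
      (add_sub_cancel_right _ _) hy.1 hy.2
    rw [hUC] at hxy
    obtain ⟨_, ⟨t, ht, rfl⟩, b, hb, htb⟩ := mem_sup.1 hxy
    rw [← baseChange_coboundaries] at hb
    have ht' : t ∈ S.Q°.cocycles (n + 1) := by rw [baseChange_cocycles]; exact ht
    refine ⟨0, zero_mem _, by rw [map_zero, add_zero]; exact zero_mem _, D .right, hDW _, hDF, ?_, t,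
      ht', ?_⟩
    · rw [map_zero, add_zero, map_zero]; exact (hD.cocycle .right).2
    · rw [map_zero, add_zero]
      refine ((hz.sub hD).sub (S.coh ht')).exact hA (v := .left) ?_ .right
      have h3 : σˆ x - y = S.ρQ° t + b := htb.symm
      have h4 := add_mem hb hyD
      refine mem_of_eq (S := (A.node .left).coboundaries (n + 1)) ?_ h4
      rw [hzl, S.ρ_left, eq_sub_of_add_eq' h3.symm]
      abel)
  have h0 : c.ξ = 0 := LinearMap.ext fun v => by obtain ⟨v, rfl⟩ := he v; rw [hξ]; rfl
  refine ⟨c, h0, fun z hz => ?_, fun v => ?_, fun y hy v hv => ?_, fun p hp => ?_⟩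
  · obtain ⟨v, hv⟩ := hσs z hz
    obtain ⟨_, ⟨y, hy, rfl⟩, b, hb, hyb⟩ := mem_sup.1 hv
    refine ⟨y, hy, e v, ?_⟩
    rw [hα, sub_right_comm, ← hyb]
    change S.ρQ y + b - S.ρQ y ∈ _
    rwa [add_sub_cancel_left]
  · obtain ⟨v, rfl⟩ := he v; rw [hα]; exact (hσZ v).2
  · obtain ⟨v, rfl⟩ := he v
    rw [hα] at hv
    rw [hσU v, map_zero]
    have := sub_mem (mem_sup_right hv : _ ∈ U) (mem_sup_left ⟨y, hy, rfl⟩ : S.ρQ y ∈ U)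
    rwa [add_sub_cancel_left] at this
  · rw [hcW, hbot p fun x hx => mem_sup_right (hp x hx.2 hx.1.2), Submodule.map_bot]

end

section

open HodgeDiagram IsMixedHodge

variable {m : ℕ} {A : HodgeDiagram.{u} m}

/-- The cocycles that become exact in the diagram. -/
def State.ker (S : State A) (n : ℕ) : Submodule ℚ S.Q :=
  S.Q.cocycles n ⊓ (A.Q.coboundaries n).comap S.ρQˡ

theorem State.exists_adjust (S : State A) {n : ℕ} {p q : ℤ} {c : S.Q°}
    (hcW : c ∈ S.Q°.W p (n + 1)) (hcZ : c ∈ (S.Q.cocycles (n + 1))ˆ)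
    (hcF : c ∈ S.hF (n + 1) q) :
    ∃ a ∈ S.Q°.W (p + 1) n, c + S.Q°.d a ∈ S.F.F q (n + 1) := by
  have h1 := (S.isMH.mor_d (n + 1)).bigr_ker (S.isMH.cmhs (n + 1)) (S.isMH.cmhs (n + 2))
  have e1 : (S.Q.gr (n + 1))ˆ ⊓ (⊥ : Submodule ℂ _).comap S.Q°.d =
      (S.Q.cocycles (n + 1))ˆ := baseChange_cocycles S.Q (n + 1)
  rw [e1] at h1
  have h3 := (S.isMH.cmhs (n + 1)).sub h1 bot_le
    (baseChange_mono ℂ inf_le_left) fun x hx => conjTensor_mem hx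
  have hid : CMHS.Mor (conjTensor S.Q) (fun k => (S.Q.W (k - (n + 1 : ℕ)) (n + 1))ˆ ⊓
      (S.Q.cocycles (n + 1))ˆ) (fun q => S.F.F q (n + 1) ⊓
      (S.Q.cocycles (n + 1))ˆ) (conjTensor S.Q) (S.hW (n + 1)) (S.hF (n + 1))
      LinearMap.id := ⟨fun _ => rfl, fun _ _ h => mem_sup_left h, fun _ _ h => mem_sup_left h⟩
  have e2 : p + (n + 1 : ℕ) - (n + 1 : ℕ) = p := add_sub_cancel_right _ _
  have e3 : p + (n + 1 : ℕ) - n = p + 1 := by push_cast; ring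
  obtain ⟨y, hy, hcy⟩ := hid.exists_strict_FW h3 (S.cmhs n) (k := p + (n + 1 : ℕ)) hcZ hcF
    (mem_sup_left ⟨by rw [e2]; exact hcW, hcZ⟩)
  have hyW := hy.2.1
  rw [e2] at hyW
  rw [← baseChange_coboundaries] at hcy
  obtain ⟨b, hb, hbd⟩ := hcy
  obtain ⟨a, ha, had⟩ := (S.isMH.mor_d n).exists_strict_W (S.isMH.cmhs n) (S.isMH.cmhs (n + 1))
    (k := p + (n + 1 : ℕ)) hb (by rw [e2]; refine mem_of_eq hbd.symm (sub_mem hcW hyW))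
  rw [e3] at ha
  refine ⟨-a, neg_mem ha, ?_⟩
  have h4 : S.Q°.d b = S.Q°.d a := sub_eq_zero.1 ((mem_bot ℂ).1 had)
  have h5 : S.Q°.d b = c - y := hbd
  rw [map_neg, ← h4, h5, ← sub_eq_add_neg, sub_sub_cancel]
  exact hy.1.1

theorem StateHom.mor {S S' : State A} (f : StateHom S S') (n : ℕ) :
    CMHS.Mor (conjTensor S.Q) (S.hW n) (S.hF n) (conjTensor S'.Q) (S'.hW n) (S'.hF n) f.f°ˡ := by
  have hB : ∀ z ∈ (S.Q.coboundaries n)ˆ, f.f° z ∈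
      (S'.Q.coboundaries n)ˆ := baseChange_map_mem f.fˡ (f.f.map_coboundaries n)
  have hZ : ∀ z ∈ (S.Q.cocycles n)ˆ, f.f° z ∈ (S'.Q.cocycles n)ˆ := baseChange_map_mem f.fˡ
        (f.f.map_cocycles n)
  refine ⟨fun x => (conjTensor_baseChange f.fˡ x).symm, fun k => ?_, fun q => ?_⟩
  · have h1 : S.hW n k ≤ (S'.hW n k).comap f.f°ˡ :=
      sup_le (fun z hz => mem_sup_left ⟨f.f°.map_W _ _ _ hz.1, hZ z hz.2⟩)
        fun z hz => mem_sup_right (hB z hz)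
    exact fun x hx => h1 hx
  · have h1 : S.hF n q ≤ (S'.hF n q).comap f.f°ˡ :=
      sup_le (fun z hz => mem_sup_left ⟨f.map_F _ _ _ hz.1, hZ z hz.2⟩)
        fun z hz => mem_sup_right (hB z hz)
    exact fun x hx => h1 hx

/-- A cell that kills the image in `S'` of the kernel of the map in cohomology of `S`. -/
theorem StateHom.exists_killing (hA : A.IsMixedHodge) {S S' : State A} (f : StateHom S S') (n : ℕ)
    (hdec : S'.Q.gr (n + 2) ≤ S'.Q.toGCAlg.decomposables (n + 2))
    (hsurj : ∀ z ∈ A.Q.cocycles (n + 1), ∃ y ∈ S'.Q.cocycles (n + 1),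
      z - S'.ρQ y ∈ A.Q.coboundaries (n + 1)) :
    ∃ c : Cell S' (n + 1), (∀ v, ∃ y ∈ S.ker (n + 2), c.ξ v - f.f y ∈ S'.Q.coboundaries (n + 2)) ∧
      (∀ y ∈ S.ker (n + 2), ∃ v, f.f y - c.ξ v ∈ S'.Q.coboundaries (n + 2)) ∧
      (∀ v, c.ξ v ∈ S'.Q.coboundaries (n + 2) → v = 0) ∧
      ∀ p, S'.Q.W (p - 1) (n + 2) = ⊥ → c.WV p = ⊥ := by
  set B := S'.Q.coboundaries (n + 2) with hBdef
  set U : Submodule ℚ S'.Q := (S.ker (n + 2)).map f.fˡ ⊔ B with hU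
  have hBU : B ≤ U := le_sup_right
  have hUZ : U ≤ S'.Q.cocycles (n + 2) := sup_le (by
    rintro _ ⟨y, hy, rfl⟩
    exact f.f.map_cocycles _ _ hy.1) (S'.Q.coboundaries_le _)
  have hUρ : ∀ x ∈ U, S'.ρQ x ∈ A.Q.coboundaries (n + 2) := fun x hx => by
    obtain ⟨_, ⟨y, hy, rfl⟩, b, hb, rfl⟩ := mem_sup.1 hx
    rw [map_add]
    refine add_mem ?_ (S'.ρQ.map_coboundaries _ _ hb)
    have h1 : S'.ρQ (f.f y) = S.ρQ y := f.ρQ y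
    exact mem_of_eq (S := A.Q.coboundaries (n + 2)) h1.symm hy.2
  have hUC : Uˆ = (((S.Q.cocycles (n + 2))ˆ) ⊓ ((A.Q.coboundaries (n + 2))ˆ).comap S.ρQ°ˡ).map
      f.f°ˡ ⊔ Bˆ := by
    rw [hU, baseChange_sup, baseChange_map, State.ker, baseChange_inf, baseChange_comap]
    rfl
  have hs := (S'.cmhs (n + 1)).sub (U := Uˆ) (by
      rw [hUC]
      exact (f.mor (n + 2)).bigr_map ((S.mor (n + 2)).bigr_ker (S.cmhs (n + 1)) (hA.cmhs (n + 2)))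
        (S'.cmhs (n + 1)))
    (baseChange_mono ℂ hBU) (baseChange_mono ℂ hUZ)
    fun x hx => conjTensor_mem hx
  have hW : (fun k => S'.hW (n + 2) k ⊓ Uˆ) = fun k =>
      (U ⊓ S'.Q.W (k - (n + 1 : ℕ) - 1) (n + 2) ⊔ B)ˆ := funext fun k => by
    rw [State.hW, ← baseChange_inf, ← baseChange_sup, ← baseChange_inf]
    congr 1
    rw [show k - ((n + 2 : ℕ) : ℤ) = k - (n + 1 : ℕ) - 1 by push_cast; ring]
    refine le_antisymm ?_ ?_
    · rintro x ⟨hx, hxU⟩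
      obtain ⟨y, hy, b, hb, rfl⟩ := mem_sup.1 hx
      have := sub_mem hxU (hBU hb)
      rw [add_sub_cancel_right] at this
      exact add_mem_sup ⟨this, hy.1⟩ hb
    · exact sup_le (fun x hx => ⟨mem_sup_left ⟨hx.2, hUZ hx.1⟩, hx.1⟩)
        fun x hx => ⟨mem_sup_right hx, hBU hx⟩
  rw [hW] at hs
  have hfin : Module.Finite ℚ (↥U ⧸ B.submoduleOf U) := by
    have := S'.isMH.finite (n + 2)
    have : Module.Finite ℚ U := Submodule.finiteDimensional_of_le (hUZ.trans inf_le_left)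
    infer_instance
  obtain ⟨V, _, _, _, WV, FV, σ, hV, hσU, hσB, hσs, hσW, hσF, hbot⟩ :=
    hs.exists_section (n := (n + 1 : ℕ)) (G := fun p => S'.Q.W (p - 1) (n + 2))
      fun p q hpq => S'.Q.W_mono _ (by linarith)
  obtain ⟨h1, h2, h3⟩ := hV.rational
  obtain ⟨αQ, hαd, hαW⟩ := exists_filtered_lift h1 h2 h3 (G := fun p => A.Q.W p (n + 1))
    (A.Q.W_mono (n + 1)) A.Q.d (S'.ρQˡ ∘ₗ σ) fun p v hv => by
      obtain ⟨y, hy, hyd⟩ := hA.exact_Q (hUρ _ (hσU v)) (S'.ρQ.map_W _ _ _ (hσW p v hv))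
      rw [sub_add_cancel] at hy
      exact ⟨y, hy, hyd⟩
  obtain ⟨c, e, he, hξ, hα, hcW⟩ := Cell.exists_of hA S' hV σ hσW (fun v => (hUZ (hσU v)).2)
    (fun v => hdec (hUZ (hσU v)).1) αQ hαW hαd (by
    intro p q x hxW hxF α hα hαx _
    have hcW : σˆ x ∈ S'.Q°.W p (n + 2) := baseChange_map_mem σ (fun v hv => by
        have := hσW _ v hv; rwa [add_sub_cancel_right] at this) _ hxW
    have hcU : σˆ x ∈ Uˆ := by
      have : (⊤ : Submodule ℚ V) ≤ U.comap σ := fun v _ => hσU v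
      exact baseChange_map_mem (S := ⊤) σ (fun v _ => hσU v) x
        (by rw [baseChange_top]; trivial)
    have hcZ := baseChange_mono ℂ hUZ hcU
    obtain ⟨a, ha, haF⟩ := S'.exists_adjust hcW hcZ (hσF q x hxF).1
    have hρ : S'.ρ .right (σˆ x + S'.Q°.d a) = (A.node .right).d (α + S'.ρ .right a) := by
      rw [map_add, map_add, hαx, (S'.ρ .right).map_d]
    have haW := (S'.ρ .right).map_W _ _ _ ha
    obtain ⟨αC, hαC, hαCF, hαCd⟩ := hA.exact_W_F (n := n + 1) (p := p) (a := q)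
      (z := S'.ρ .right (σˆ x + S'.Q°.d a))
      ⟨_, (A.node .right).W_le _ _ (add_mem hα haW), hρ.symm⟩
      ((S'.ρ .right).map_W _ _ _ (add_mem hcW (by
        have h5 : S'.Q°.d a ∈ S'.Q°.W (p + 1 - 1) (n + 2) :=
          baseChange_map_mem S'.Q.d (S'.isMH.d_W (p + 1) (n + 1)) a ha
        rwa [add_sub_cancel_right] at h5))) (S'.ρ_F _ _ _ haF)
    refine ⟨a, ha, haF, αC, hαC, hαCF, hαCd, ?_⟩
    obtain ⟨D, hD, hDr, -⟩ := hA.exists_coh_right (sub_mem (add_mem hα haW) hαC) (by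
        rw [map_sub, ← hρ, sub_eq_zero]; exact hαCd.symm)
    have hZ : A.Q.cocycles (n + 1) ≤ (S'.Q.cocycles (n + 1)).map S'.ρQˡ ⊔
        A.Q.coboundaries (n + 1) := fun z hz => by
      obtain ⟨y, hy, hzy⟩ := hsurj z hz
      exact mem_sup.2 ⟨_, ⟨y, hy, rfl⟩, _, hzy, add_sub_cancel _ _⟩
    have hDl : D .left ∈ (A.Q.cocycles (n + 1))ˆ := by
      rw [← baseChange_cocycles]; exact hD.cocycle .left
    have hDl := baseChange_mono ℂ hZ hDl
    rw [baseChange_sup, baseChange_map, ← baseChange_coboundaries, ← baseChange_cocycles] at hDl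
    obtain ⟨_, ⟨y, hy, rfl⟩, b, hb, hyb⟩ := mem_sup.1 hDl
    refine ⟨y, hy, ?_⟩
    have h6 := (hD.sub (S'.coh hy)).exact hA (v := .left) (by
      rw [S'.ρ_left]
      refine mem_of_eq (S := (A.node .left).coboundaries (n + 1)) ?_ hb
      rw [← hyb]
      exact (add_sub_cancel_left _ _).symm) .right
    rw [hDr] at h6
    exact h6)
  refine ⟨c, fun v => ?_, fun y hy => ?_, fun v hv => ?_, fun p hp => ?_⟩
  · obtain ⟨v, rfl⟩ := he v
    rw [hξ]
    obtain ⟨_, ⟨y, hy, rfl⟩, b, hb, hyb⟩ := mem_sup.1 (hσU v)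
    refine ⟨y, hy, mem_of_eq ?_ hb⟩
    rw [← hyb]
    exact (add_sub_cancel_left _ _).symm
  · obtain ⟨v, hv⟩ := hσs _ (mem_sup_left ⟨y, hy, rfl⟩); refine ⟨e v, ?_⟩; rw [hξ]; exact hv
  · obtain ⟨v, rfl⟩ := he v; rw [hξ] at hv; rw [hσB v hv, map_zero]
  · rw [hcW, hbot p (by rw [hp, inf_bot_eq]; exact bot_le), Submodule.map_bot]

end

section

/-! ## Free extensions in low degrees -/

namespace IsFree

variable {S B : FDGA.{u} ℚ} {ι : FDGAHom S B} {n : ℕ} {V : Type u} [AddCommGroup V]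
  [Module ℚ V] {WV : ℤ → Submodule ℚ V} {ξ : V →ₗ[ℚ] S} {i : V →ₗ[ℚ] B}

theorem injective (h : IsFree ι n WV ξ i) : Function.Injective ι.toFun := by
  obtain ⟨k, ⟨hk, -⟩, -⟩ := h.free.2 S.toGCAlg (FDGAHom.id S).toGCHom 0 fun _ => zero_mem _
  exact Function.LeftInverse.injective hk

theorem gr_low (h : IsFree ι n WV ξ i) (hn : 1 ≤ n) (hconn : S.gr 0 ≤ span ℚ {1}) {m : ℕ}
    (hm : m ≤ n) {x : B} (hx : x ∈ B.gr m) :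
    ∃ s ∈ S.gr m, ∃ v, (m < n → v = 0) ∧ x = ι s + i v := by
  let U : ℕ → Submodule ℚ B := fun m => if m ≤ n then
    (S.gr m).map ιˡ ⊔ (if m = n then range i else ⊥) else ⊤
  have h0 : U 0 ≤ span ℚ {1} := by
    change (if 0 ≤ n then _ else _) ≤ _
    rw [if_pos (Nat.zero_le n), if_neg (by omega), sup_bot_eq]
    rintro _ ⟨s, hs, rfl⟩
    obtain ⟨q, rfl⟩ := mem_span_singleton.1 (hconn hs)
    refine mem_span_singleton.2 ⟨q, ?_⟩
    change _ = ι (q • 1)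
    rw [map_smul, map_one]
  have hlt : ∀ l, l < n → U l = (S.gr l).map ιˡ := fun l hl => by
    change (if l ≤ n then _ else _) = _
    rw [if_pos hl.le, if_neg hl.ne, sup_bot_eq]
  have key := h.gr_le U (fun l s hs => ?_) (fun v => ?_) (fun l l' x z hx hz => ?_) m hx
  · change x ∈ (if m ≤ n then _ else _ : Submodule ℚ B) at key
    rw [if_pos hm] at key
    obtain ⟨_, ⟨s, hs, rfl⟩, y, hy, rfl⟩ := mem_sup.1 key
    split_ifs at hy with hmn
    · obtain ⟨v, rfl⟩ := hy; exact ⟨s, hs, v, fun h => absurd hmn h.ne, rfl⟩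
    · exact ⟨s, hs, 0, fun _ => rfl, by rw [(mem_bot ℚ).1 hy, map_zero]; rfl⟩
  · change _ ∈ (if l ≤ n then _ else _ : Submodule ℚ B)
    split_ifs
    exacts [mem_sup_left ⟨s, hs, rfl⟩, mem_sup_left ⟨s, hs, rfl⟩, trivial]
  · change _ ∈ (if n ≤ n then _ else _ : Submodule ℚ B)
    rw [if_pos le_rfl, if_pos rfl]
    exact mem_sup_right ⟨v, rfl⟩
  · rcases Nat.eq_zero_or_pos l with rfl | hl
    · obtain ⟨q, rfl⟩ := mem_span_singleton.1 (h0 hx)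
      rw [smul_mul_assoc, one_mul, zero_add]
      exact smul_mem _ _ hz
    rcases Nat.eq_zero_or_pos l' with rfl | hl'
    · obtain ⟨q, rfl⟩ := mem_span_singleton.1 (h0 hz)
      rw [mul_smul_comm, mul_one]
      exact smul_mem _ _ hx
    change _ ∈ (if l + l' ≤ n then _ else _ : Submodule ℚ B)
    by_cases hll : l + l' ≤ n
    · rw [hlt l (by omega)] at hx
      rw [hlt l' (by omega)] at hz
      obtain ⟨s, hs, rfl⟩ := hx
      obtain ⟨t, ht, rfl⟩ := hz
      rw [if_pos hll]
      exact mem_sup_left ⟨s * t, SetLike.GradedMul.mul_mem hs ht, map_mul ι.toFun s t⟩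
    · rw [if_neg hll]; trivial

theorem gr_decomposables (h : IsFree ι n WV ξ i) (hconn : B.gr 0 ≤ span ℚ {1})
    (hS : ∀ m, n < m → S.gr m ≤ S.toGCAlg.decomposables m) {m : ℕ} (hm : n < m) :
    B.gr m ≤ B.toGCAlg.decomposables m := by
  let U : ℕ → Submodule ℚ B := fun m => B.gr m ⊓ if n < m then B.toGCAlg.decomposables m else ⊤
  have key := h.gr_le U (fun l s hs => ⟨ι.map_gr _ _ hs, ?_⟩) (fun v => ⟨h.free.1 v, ?_⟩)
    (fun l l' x z hx hz => ?_) m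
  · intro x hx; have := (key hx).2; rwa [if_pos hm] at this
  · split_ifs with hl
    exacts [ι.map_decomposables _ _ (hS _ hl hs), trivial]
  · rw [if_neg (lt_irrefl n)]; trivial
  · rcases Nat.eq_zero_or_pos l with rfl | hl
    · obtain ⟨q, rfl⟩ := mem_span_singleton.1 (hconn hx.1)
      rw [smul_mul_assoc, one_mul, zero_add]
      exact smul_mem _ _ hz
    rcases Nat.eq_zero_or_pos l' with rfl | hl'
    · obtain ⟨q, rfl⟩ := mem_span_singleton.1 (hconn hz.1)
      rw [mul_smul_comm, mul_one]
      exact smul_mem _ _ hx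
    refine ⟨SetLike.GradedMul.mul_mem hx.1 hz.1, ?_⟩
    split_ifs
    exacts [subset_span ⟨l, l', hl, hl', rfl, x, hx.1, z, hz.1, rfl⟩, trivial]

theorem W_eq_bot (h : IsFree ι n WV ξ i) {β : ℕ → ℕ} (hβ : ∀ m l, β m + β l ≤ β (m + l))
    (hS : ∀ (p : ℤ) m, p + m < -β m → S.W p m = ⊥) (hV : ∀ p : ℤ, p + n < -β n → WV p = ⊥)
    (p : ℤ) (m : ℕ) (hp : p + m < -β m) : B.W p m = ⊥ := by
  refine le_bot_iff.1 ((h.W_le (fun p m => if p + m < -(β m : ℤ) then ⊥ else ⊤) (fun p l s hs => ?_)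
    (fun p v hv => ?_) (fun p q l l' x z hx hz => ?_) p m).trans (if_pos hp).le)
  · split_ifs with hl
    · rw [hS p l hl, mem_bot] at hs; rw [hs, map_zero]; exact zero_mem _
    · trivial
  · split_ifs with hl
    · rw [hV p hl, mem_bot] at hv; rw [hv, map_zero]; exact zero_mem _
    · trivial
  · beta_reduce at hx hz ⊢
    split_ifs with hl
    · have h1 := hβ l l'
      by_cases h2 : p + l < -(β l : ℤ)
      · rw [if_pos h2, mem_bot] at hx; rw [hx, zero_mul]; exact zero_mem _
      · rw [if_pos (by push_cast at hl; omega), mem_bot] at hz; rw [hz, mul_zero]; exact zero_mem _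
    · trivial

end IsFree

/-! ## Paths of stages -/

variable {m : ℕ} {A : HodgeDiagram.{u} m}

/-- A stage obtained by attaching a cell. -/
structure Step (S S' : State A) where
  n : ℕ
  c : Cell S n
  f : StateHom S S'
  i : c.V →ₗ[ℚ] S'.Q
  step : IsStep c f i

inductive CellPath : State A → State A → Type (u + 1)
  | nil (S) : CellPath S S
  | cons {S S' X} (s : Step S S') (p : CellPath S' X) : CellPath S X

namespace CellPath

def map : ∀ {S X : State A}, CellPath S X → StateHom S X
  | _, _, nil S => StateHom.id S
  | _, _, cons s p => p.map.comp s.f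

def trans : ∀ {S X Y : State A}, CellPath S X → CellPath X Y → CellPath S Y
  | _, _, _, nil _, q => q
  | _, _, _, cons s p, q => cons s (p.trans q)

theorem map_trans {S X Y : State A} (p : CellPath S X) (q : CellPath X Y) (x : S.Q) :
    (p.trans q).map.f x = q.map.f (p.map.f x) := by
  induction p with
  | nil S => rfl
  | cons s p ih => exact ih q _

end CellPath

/-- The result of attaching to `S` the image of a cell `e` of `S₀`. -/
structure Attached {S₀ : State A} {n : ℕ} (e : Cell S₀ n) {S : State A} (f : StateHom S₀ S) where
  X : State A
  c : Cell S n
  g : StateHom S X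
  j : c.V →ₗ[ℚ] X.Q
  step : IsStep c g j
  φ : e.V →ₗ[ℚ] c.V
  surj : Function.Surjective φ
  ξ : ∀ v, c.ξ (φ v) = f.f (e.ξ v)
  αQ : ∀ v, c.αQ (φ v) = e.αQ v
  W : ∀ p, c.WV p = (e.WV p).map φ

theorem Attached.exists_path {S₀ : State A} {n : ℕ} {e : Cell S₀ n} {S S' : State A} (p : CellPath S S') :
    ∀ {f : StateHom S₀ S} (a : Attached e f), ∃ (a' : Attached e (p.map.comp f)) (q : CellPath a.X a'.X),
      ∀ x, a'.g.f (p.map.f x) = q.map.f (a.g.f x) := by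
  induction p with
  | nil S => exact fun a => ⟨⟨a.X, a.c, a.g, a.j, a.step, a.φ, a.surj, a.ξ, a.αQ, a.W⟩, .nil _, fun _ => rfl⟩
  | cons s p ih =>
    intro f a
    obtain ⟨X', f', i', g', h1, h2, h3⟩ := s.step.exists_push a.step
    obtain ⟨a', q, hq⟩ := ih (f := s.f.comp f) ⟨X', a.c.push s.f, g', _, h2, a.φ, a.surj, fun v =>
      congrArg s.f.f.toFun (a.ξ v), a.αQ, a.W⟩
    exact ⟨⟨a'.X, a'.c, a'.g, a'.j, a'.step, a'.φ, a'.surj, a'.ξ, a'.αQ, a'.W⟩,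
      .cons ⟨_, _, f', i', h1⟩ q, fun x => (hq _).trans (congrArg q.map.f.toFun (h3 x))⟩

end

section

/-! ## Towers of stages -/

theorem exists_dependent_seq {α : ℕ → Type*} {R : ∀ k, α k → α (k + 1) → Prop} (a₀ : α 0)
    (h : ∀ k a, ∃ b, R k a b) : ∃ a : ∀ k, α k, a 0 = a₀ ∧ ∀ k, R k (a k) (a (k + 1)) := by
  choose s hs using h
  exact ⟨fun k => Nat.rec a₀ s k, rfl, fun k => hs k _⟩

theorem exists_stable {k X : Type*} [Field k] [AddCommGroup X] [Module k X] (K : Submodule k X)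
    [Module.Finite k K] {P : ℕ → Submodule k X} (hP : Monotone P) :
    ∃ L, ∀ L' ≥ L, ∀ l, ∀ x ∈ K, x ∈ P l → x ∈ P L' := by
  obtain ⟨L, hL⟩ := monotone_stabilizes_iff_noetherian.2 (inferInstance : IsNoetherian k K)
    ⟨fun l => (P l).comap K.subtype, fun l l' h => comap_mono (hP h)⟩
  refine ⟨L, fun L' hL' l x hx hxl => ?_⟩
  have h1 : (⟨x, hx⟩ : K) ∈ (P (max L l)).comap K.subtype := hP (le_max_right L l) hxl
  have h2 : (⟨x, hx⟩ : K) ∈ (P L).comap K.subtype := by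
    have := hL _ (le_max_left L l)
    exact (show (P L).comap K.subtype = (P (max L l)).comap K.subtype from this) ▸ h1
  exact hP hL' h2

variable {m : ℕ} {A : HodgeDiagram.{u} m}

variable (A) in
structure Tower where
  X : ℕ → State A
  p : ∀ k, CellPath (X k) (X (k + 1))

namespace Tower

variable (T : Tower A)

@[reducible] def shift (L : ℕ) : Tower A := ⟨fun k => T.X (L + k), fun k => T.p (L + k)⟩

def map : ∀ k, StateHom (T.X 0) (T.X k)
  | 0 => StateHom.id _
  | k + 1 => (T.p k).map.comp (map k)

def path : ∀ k, CellPath (T.X 0) (T.X k)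
  | 0 => .nil _
  | k + 1 => (path k).trans (T.p k)

theorem path_map (k : ℕ) (x) : (T.path k).map.f x = (T.map k).f x := by
  induction k with
  | zero => rfl
  | succ k ih => exact (CellPath.map_trans _ _ _).trans (congrArg (T.p k).map.f.toFun ih)

theorem map_shift (L k : ℕ) (x) :
    ((T.shift L).map k).f ((T.map L).f x) = (T.map (L + k)).f x := by
  induction k with
  | zero => rfl
  | succ k ih => exact congrArg (T.p (L + k)).map.f.toFun ih

/-- The element `z` becomes exact along the tower. -/
inductive Dies (i : ℕ) : ∀ k, (T.X k).Q → Prop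
  | now {k z} : z ∈ (T.X k).Q.coboundaries i → Dies i k z
  | later {k z} : Dies i (k + 1) ((T.p k).map.f z) → Dies i k z

variable {T} in
theorem Dies.exists {i k : ℕ} {z} (h : T.Dies i k z) : ∀ x, z = (T.map k).f x →
    ∃ l, (T.map l).f x ∈ (T.X l).Q.coboundaries i := by
  induction h with
  | now h => rintro x rfl; exact ⟨_, h⟩
  | later _ ih => rintro x rfl; exact ih x rfl

variable {T} in
theorem Dies.shift {i k : ℕ} {z} (h : T.Dies i k z) : ∀ L j (_ : k = L + j) z', HEq z z' →
    (T.shift L).Dies i j z' := by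
  induction h with
  | now h => rintro L j rfl z' hz; exact .now ((eq_of_heq hz) ▸ h)
  | later _ ih => rintro L j rfl z' hz; exact .later (ih L (j + 1) rfl _ ((eq_of_heq hz) ▸ HEq.rfl))

/-- The elements of the initial stage that become exact at the stage `k`. -/
def dead (i k : ℕ) : Submodule ℚ (T.X 0).Q :=
  ((T.X k).Q.coboundaries i).comap (T.map k).fˡ

theorem dead_mono (i : ℕ) : Monotone (T.dead i) := monotone_nat_of_le_succ fun k _ hx =>
  (T.p k).map.f.map_coboundaries i _ hx

theorem exists_stable_dead (b : ℕ) : ∃ L, ∀ L' ≥ L, ∀ i ≤ b, ∀ l, ∀ x ∈ (T.X 0).ker i,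
    x ∈ T.dead i l → x ∈ T.dead i L' := by
  choose L hL using fun i => by
    have := (T.X 0).isMH.finite i
    have : Module.Finite ℚ ((T.X 0).ker i) :=
      Submodule.finiteDimensional_of_le (inf_le_left.trans inf_le_left)
    exact exists_stable ((T.X 0).ker i) (T.dead_mono i)
  exact ⟨(Finset.range (b + 1)).sup L, fun L' h i hi => hL i L' ((Finset.le_sup (by simp; omega)).trans h)⟩

/-- The bound for the weights in degree `i` at level `N`. -/
def bound (K : ℕ → ℕ) (N i : ℕ) : ℕ := K (min i N) * (i - if i ≤ N then 1 else 2)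

theorem bound_add {K : ℕ → ℕ} (hK : Monotone K) {N : ℕ} (hN : 1 ≤ N) (i j : ℕ) :
    bound K N i + bound K N j ≤ bound K N (i + j) := by
  have h0 : bound K N 0 = 0 := by simp [bound]
  rcases Nat.eq_zero_or_pos i with rfl | hi
  · rw [h0, zero_add, zero_add]
  rcases Nat.eq_zero_or_pos j with rfl | hj
  · rw [h0, add_zero, add_zero]
  have h1 : ∀ i' ≤ i + j, bound K N i' ≤ K (min (i + j) N) * (i' - if i' ≤ N then 1 else 2) :=
    fun i' h => Nat.mul_le_mul_right _ (hK (min_le_min_right N h))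
  refine (add_le_add (h1 i (by omega)) (h1 j (by omega))).trans ?_
  rw [← mul_add]
  refine Nat.mul_le_mul_left _ ?_
  split_ifs <;> omega

theorem bound_mono {K : ℕ → ℕ} (hK : Monotone K) (n i : ℕ) : bound K n i ≤ bound K (n + 1) i := by
  refine Nat.mul_le_mul (hK (min_le_min_left i (Nat.le_succ n))) ?_
  split_ifs <;> omega

theorem bound_le {K : ℕ → ℕ} (hK : Monotone K) (n i : ℕ) : bound K n i ≤ K i * i :=
  Nat.mul_le_mul (hK (min_le_left _ _)) (Nat.sub_le _ _)

variable (R : Prop) (K : ℕ → ℕ)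

/-- The inductive hypotheses: cohomology in degrees at most `a` is reached by the initial stage,
the kernels in degrees at most `b` die along the tower, and there are no generators in degrees
greater than `c`. -/
structure Good (a b c : ℕ) : Prop where
  surj : ∀ i ≤ a, ∀ z ∈ A.Q.cocycles i, ∃ y ∈ (T.X 0).Q.cocycles i,
    z - (T.X 0).ρQ y ∈ A.Q.coboundaries i
  dies : ∀ k, ∀ i ≤ b, ∀ z ∈ (T.X k).ker i, T.Dies i k z
  dec : ∀ k i, c < i → (T.X k).Q.gr i ≤ (T.X k).Q.toGCAlg.decomposables i
  bd : R → ∀ k (p : ℤ) (i : ℕ), p + i < -(bound K c i : ℤ) → (T.X k).Q.W p i = ⊥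

variable {T R K}

theorem exists_dead {a b c : ℕ} (h : T.Good R K a b c) : ∃ L, ∀ L' ≥ L, ∀ i ≤ b,
    ∀ x ∈ (T.X 0).ker i, (T.map L').f x ∈ (T.X L').Q.coboundaries i := by
  obtain ⟨L, hL⟩ := T.exists_stable_dead b
  refine ⟨L, fun L' hL' i hi x hx => ?_⟩
  obtain ⟨l, hl⟩ := (h.dies 0 i hi x hx).exists x rfl
  exact hL L' hL' i hi l x hx hl

theorem Good.mono {a b c a' b' c' : ℕ} (hK : Monotone K) (h : T.Good R K a b c) (ha : a' ≤ a)
    (hb : b' ≤ b) (hc : c ≤ c') (hc' : c' ≤ c + 1) : T.Good R K a' b' c' where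
  surj i hi := h.surj i (hi.trans ha)
  dies k i hi := h.dies k i (hi.trans hb)
  dec k i hi := h.dec k i (hc.trans_lt hi)
  bd hR k p i hp := h.bd hR k p i (by
    have h1 : bound K c i ≤ bound K c' i := by
      obtain rfl | rfl : c' = c ∨ c' = c + 1 := by omega
      exacts [le_rfl, bound_mono hK c i]
    omega)

theorem surj_map {a b c : ℕ} (h : T.Good R K a b c) (L : ℕ) : ∀ i ≤ a, ∀ z ∈ A.Q.cocycles i,
    ∃ y ∈ (T.X L).Q.cocycles i, z - (T.X L).ρQ y ∈ A.Q.coboundaries i := fun i hi z hz => by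
  obtain ⟨y, hy, hyz⟩ := h.surj i hi z hz
  exact ⟨_, (T.map L).f.map_cocycles _ _ hy, by rw [(T.map L).ρQ]; exact hyz⟩

theorem Good.shift {a b c : ℕ} (h : T.Good R K a b c) (L : ℕ) : (T.shift L).Good R K a b c where
  surj := surj_map h L
  dies k i hi z hz := (h.dies (L + k) i hi z hz).shift L k rfl z HEq.rfl
  dec k := h.dec (L + k)
  bd hR k := h.bd hR (L + k)

theorem Good.exists_attach {a N : ℕ} (hK : Monotone K) (h : T.Good R K a N N) (e : Cell (T.X 0) N)
    (hinj : ∀ k, ∀ z ∈ (T.X k).Q.gr N, ∀ v, (T.X k).Q.d z + (T.map k).f (e.ξ v) = 0 →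
      (T.X k).ρQ z + e.αQ v ∈ A.Q.coboundaries N → v = 0)
    (hbd : R → ∀ p : ℤ, p + N < -(bound K N N : ℤ) → e.WV p = ⊥) :
    ∃ (T' : Tower A) (f : StateHom (T.X 0) (T'.X 0)) (i : e.V →ₗ[ℚ] (T'.X 0).Q),
      IsStep e f i ∧ T'.Good R K a N N := by
  obtain ⟨Y, f, i, hY⟩ := e.exists_isStep
  obtain ⟨s, hs0, hs⟩ := exists_dependent_seq (α := fun k => Attached e (T.map k))
    (R := fun k s s' => ∃ q : CellPath s.X s'.X, ∀ x, s'.g.f ((T.p k).map.f x) =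
      q.map.f (s.g.f x))
    ⟨Y, e, f, i, hY, LinearMap.id, Function.surjective_id, fun _ => rfl, fun _ => rfl,
      fun p => (Submodule.map_id _).symm⟩ fun k s => s.exists_path (T.p k)
  choose q hq using hs
  let T' : Tower A := ⟨fun k => (s k).X, q⟩
  have hdies : ∀ i k z, T.Dies i k z → T'.Dies i k ((s k).g.f z) := fun i k z hz => by
    induction hz with
    | now h => exact .now ((s _).g.f.map_coboundaries _ _ h)
    | @later k z _ ih =>
      refine .later ?_
      have h1 : (q k).map.f ((s k).g.f z) = (s (k + 1)).g.f ((T.p k).map.f z) :=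
        (hq k z).symm
      exact h1 ▸ ih
  have hlow : ∀ k, ∀ j ≤ N, ∀ z ∈ (s k).X.ker j, ∃ x ∈ (T.X k).ker j, (s k).g.f x = z := by
    intro k j hj z hz
    obtain ⟨x, hx, v, hv, rfl⟩ := (s k).step.free.gr_low e.pos (T.X k).conn hj hz.1.1
    obtain ⟨v, rfl⟩ := (s k).surj v
    have h1 : (s k).X.Q.d _ = 0 := hz.1.2
    rw [map_add, (s k).step.free.d_i, ← (s k).g.f.map_d, ← map_add, (s k).ξ] at h1
    have h2 := (s k).step.free.injective (h1.trans (map_zero _).symm)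
    have h3 : (s k).X.ρQ _ ∈ A.Q.coboundaries j := hz.2
    rw [map_add, (s k).step.ρQ, (s k).g.ρQ, (s k).αQ] at h3
    have h4 : (s k).φ v = 0 := by
      rcases hj.lt_or_eq with hj | rfl
      · exact hv hj
      · rw [hinj k x hx v h2 h3, map_zero]
    rw [← (s k).ξ, h4, map_zero, add_zero] at h2
    rw [← (s k).αQ, h4, map_zero, add_zero] at h3
    exact ⟨x, ⟨⟨hx, h2⟩, h3⟩, by rw [h4, map_zero, add_zero]⟩
  have h0 : ∀ s : Attached e (T.map 0), s = ⟨Y, e, f, i, hY, LinearMap.id, Function.surjective_id,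
      fun _ => rfl, fun _ => rfl, fun p => (Submodule.map_id _).symm⟩ →
      ∃ (f : StateHom (T.X 0) s.X) (i : e.V →ₗ[ℚ] s.X.Q), IsStep e f i := by
    rintro _ rfl
    exact ⟨f, i, hY⟩
  obtain ⟨f', i', hY'⟩ := h0 _ hs0
  refine ⟨T', f', i', hY', fun j hj z hz => ?_, fun k j hj z hz => ?_, fun k j hj => ?_,
    fun hR k p j hp => ?_⟩
  · obtain ⟨y, hy, hyz⟩ := h.surj j hj z hz
    exact ⟨_, f'.f.map_cocycles _ _ hy, by rw [f'.ρQ]; exact hyz⟩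
  · obtain ⟨x, hx, rfl⟩ := hlow k j hj z hz; exact hdies _ _ _ (h.dies k j hj x hx)
  · exact (s k).step.free.gr_decomposables (s k).X.conn (fun l hl => h.dec k l hl) hj
  · refine (s k).step.free.W_eq_bot (bound_add hK e.pos) (h.bd hR k) (fun p hp => ?_) p j hp
    rw [(s k).W, hbd hR p hp, Submodule.map_bot]

/-- Reaching the cohomology in the next degree. -/
theorem Good.exists_creation (hA : A.IsMixedHodge) (hK : Monotone K) {n : ℕ}
    (hRK : R → ∀ p : ℤ, p + (n + 1 : ℕ) < -(K (n + 1) * n : ℕ) → ∀ x ∈ A.Q.W p (n + 1), A.Q.d x = 0 →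
      x ∈ A.Q.coboundaries (n + 1)) (h : T.Good R K n (n + 1) n) :
    ∃ (T' : Tower A) (S : State A) (p : CellPath (T.X 0) S) (s : Step S (T'.X 0)),
      s.c.ξ = 0 ∧ T'.Good R K (n + 1) (n + 1) (n + 1) ∧ ∀ i ≤ n + 1, ∀ z ∈ (T.X 0).ker i,
        s.f.f (p.map.f z) ∈ (T'.X 0).Q.coboundaries i := by
  obtain ⟨L₁, hL₁⟩ := exists_dead h
  let I : ℕ → Submodule ℚ (A.Q.H (n + 1)) := fun k => range ((T.X k).ρQ.mapH (n + 1))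
  have hI : ∀ k, ∀ z (hz : z ∈ A.Q.cocycles (n + 1)), Submodule.Quotient.mk ⟨z, hz⟩ ∈ I k ↔
      ∃ y ∈ (T.X k).Q.cocycles (n + 1), z - (T.X k).ρQ y ∈ A.Q.coboundaries (n + 1) := by
    intro k z hz
    constructor
    · rintro ⟨y, hy⟩
      obtain ⟨y, rfl⟩ := mkQ_surjective _ y
      exact ⟨y, y.2, (Submodule.Quotient.eq ((A.Q.coboundaries (n + 1)).submoduleOf _)).1 hy.symm⟩
    · rintro ⟨y, hy, hyz⟩
      exact ⟨Submodule.Quotient.mk ⟨y, hy⟩, ((Submodule.Quotient.eq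
        ((A.Q.coboundaries (n + 1)).submoduleOf (A.Q.cocycles (n + 1)))).2 hyz).symm⟩
  have hImono : Monotone I := monotone_nat_of_le_succ fun k x hx => by
    obtain ⟨⟨z, hz⟩, rfl⟩ := mkQ_surjective _ x
    obtain ⟨y, hy, hyz⟩ := (hI k z hz).1 hx
    exact (hI _ z hz).2 ⟨_, (T.p k).map.f.map_cocycles _ _ hy, by rw [(T.p k).map.ρQ]; exact hyz⟩
  have := hA.finite (n + 1)
  obtain ⟨L₂, hL₂⟩ := exists_stable (⊤ : Submodule ℚ (A.Q.H (n + 1))) hImono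
  set L := max L₁ L₂ with hL
  obtain ⟨c, hξ, hs, hd, hi, hW⟩ := (T.X L).exists_creation hA n
  obtain ⟨T', f, i, hc, hT'⟩ := ((h.mono hK le_rfl le_rfl (Nat.le_succ n) le_rfl).shift L).exists_attach
    hK c (fun k z hz v h1 h2 => by
      rw [hξ, LinearMap.zero_apply, map_zero, add_zero] at h1
      have hαZ : c.αQ v ∈ A.Q.cocycles (n + 1) := by
        obtain ⟨l, hl⟩ := c.exists_W
        exact ⟨A.Q.W_le _ _ (c.αQ_W l v (hl ▸ trivial)), hd v⟩
      obtain ⟨y, hy, hyz⟩ := (hI L _ hαZ).1 (hL₂ L (le_max_right _ _) (L + k) _ trivial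
        ((hI _ _ hαZ).2 ⟨-z, neg_mem ⟨hz, h1⟩, by
          rw [map_neg, sub_neg_eq_add]
          exact mem_of_eq (S := A.Q.coboundaries (n + 1)) (add_comm _ _) h2⟩))
      refine hi (-y) (neg_mem hy) v ?_
      rw [map_neg, neg_add_eq_sub]
      exact hyz)
    (fun hR p hp => hW p (hRK hR p (by simpa [bound] using hp)))
  refine ⟨T', T.X L, T.path L, ⟨_, c, f, i, hc⟩, hξ, ⟨fun j hj z hz => ?_, hT'.dies, hT'.dec, hT'.bd⟩,
    fun j hj z hz => ?_⟩
  · rcases Nat.le_succ_iff.1 hj with hj | rfl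
    · exact hT'.surj j hj z hz
    · obtain ⟨y, hy, v, hv⟩ := hs z hz
      refine ⟨f.f y + i v, add_mem (f.f.map_cocycles _ _ hy) ⟨hc.free.free.1 v, ?_⟩, ?_⟩
      · change (T'.X 0).Q.d (i v) = 0; rw [hc.free.d_i, hξ, LinearMap.zero_apply, map_zero]
      · rw [map_add, f.ρQ, hc.ρQ, ← sub_sub]; exact hv
  · rw [T.path_map]; exact f.f.map_coboundaries _ _ (hL₁ L (le_max_left _ _) j hj z hz)

/-- Killing the kernel of the initial stage in the next degree. -/
theorem Good.exists_killing (hA : A.IsMixedHodge) (hK : Monotone K) {n : ℕ}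
    (h : T.Good R K (n + 1) (n + 1) (n + 1)) :
    ∃ (T' : Tower A) (p : CellPath (T.X 0) (T'.X 0)), T'.Good R K (n + 1) (n + 1) (n + 1) ∧
      ∀ i ≤ n + 2, ∀ z ∈ (T.X 0).ker i, p.map.f z ∈ (T'.X 0).Q.coboundaries i := by
  obtain ⟨L₁, hL₁⟩ := exists_dead h
  obtain ⟨L₂, hL₂⟩ := T.exists_stable_dead (n + 2)
  set L := max L₁ L₂ with hL
  obtain ⟨c, hU, hs, hi, hW⟩ := (T.map L).exists_killing hA n (h.dec L _ (Nat.lt_succ_self _))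
    (surj_map h L _ le_rfl)
  obtain ⟨T', f, i, hc, hT'⟩ := (h.shift L).exists_attach hK c (fun k z hz v h1 _ => by
      obtain ⟨y, hy, hyv⟩ := hU v
      have h2 : ((T.shift L).map k).f (c.ξ v) ∈ (T.X (L + k)).Q.coboundaries (n + 2) :=
        ⟨-z, neg_mem hz, by rw [map_neg, eq_neg_of_add_eq_zero_right h1]⟩
      have h3 := sub_mem h2 (((T.shift L).map k).f.map_coboundaries _ _ hyv)
      rw [map_sub, sub_sub_cancel, T.map_shift] at h3
      have h4 : (T.map L).f y ∈ (T.X L).Q.coboundaries (n + 2) :=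
        hL₂ L (le_max_right _ _) _ le_rfl (L + k) y hy h3
      refine hi v ?_
      have := add_mem hyv h4
      rwa [sub_add_cancel] at this)
    (fun hR p hp => hW p (h.bd hR L _ _ (by
      simp only [bound, min_self, le_refl, if_true] at hp
      simp only [bound]
      rw [min_eq_right (Nat.le_succ _), if_neg (by omega)]
      push_cast at hp ⊢
      linarith)))
  refine ⟨T', (T.path L).trans (.cons ⟨_, c, f, i, hc⟩ (.nil _)), hT', fun j hj z hz => ?_⟩
  rw [CellPath.map_trans, T.path_map]
  change f.f ((T.map L).f z) ∈ _
  rcases Nat.le_succ_iff.1 hj with hj | rfl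
  · exact f.f.map_coboundaries _ _ (hL₁ L (le_max_left _ _) j hj z hz)
  · obtain ⟨v, hv⟩ := hs z hz
    have h1 := add_mem (f.f.map_coboundaries _ _ hv)
      (show f.f (c.ξ v) ∈ (T'.X 0).Q.coboundaries (n + 2) from
        ⟨i v, hc.free.free.1 v, hc.free.d_i v⟩)
    rwa [← map_add, sub_add_cancel] at h1

/-- The passage to the next degree. -/
theorem Good.exists_next (hA : A.IsMixedHodge) (hK : Monotone K) {n : ℕ}
    (hRK : R → ∀ p : ℤ, p + (n + 1 : ℕ) < -(K (n + 1) * n : ℕ) → ∀ x ∈ A.Q.W p (n + 1), A.Q.d x = 0 →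
      x ∈ A.Q.coboundaries (n + 1)) (h : T.Good R K n (n + 1) n) :
    ∃ (T' : Tower A) (S : State A) (p : CellPath (T.X 0) S) (s : Step S (T'.X 0)),
      T'.Good R K (n + 1) (n + 2) (n + 1) ∧ ∀ i ≤ n + 1, ∀ z ∈ (T.X 0).ker i,
        s.f.f (p.map.f z) ∈ (T'.X 0).Q.coboundaries i := by
  obtain ⟨T₀, S, p, s, -, hT₀, hp⟩ := h.exists_creation hA hK hRK
  obtain ⟨D, hD0, hD⟩ := exists_dependent_seq
    (α := fun _ => {T : Tower A // T.Good R K (n + 1) (n + 1) (n + 1)})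
    (R := fun _ T T' => ∃ p : CellPath (T.1.X 0) (T'.1.X 0), ∀ i ≤ n + 2, ∀ z ∈ (T.1.X 0).ker i,
      p.map.f z ∈ (T'.1.X 0).Q.coboundaries i) ⟨T₀, hT₀⟩ fun _ T => by
      obtain ⟨T', p, hT', hp⟩ := T.2.exists_killing hA hK
      exact ⟨⟨T', hT'⟩, p, hp⟩
  choose q hq using hD
  obtain rfl : T₀ = (D 0).1 := (congrArg Subtype.val hD0).symm
  exact ⟨⟨fun k => (D k).1.X 0, q⟩, S, p, s, ⟨(D 0).2.surj, fun k i hi z hz => .later (.now (hq k i hi z hz)),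
    fun k => (D k).2.dec 0, fun hR k => (D k).2.bd hR 0⟩, hp⟩

end Tower

end

section

/-! ## The initial stage -/

namespace FDGA

@[reducible] def unitGr (n : ℕ) : Submodule ℚ (ULift.{u} ℚ) := if n = 0 then ⊤ else ⊥

theorem mem_unitGr {n : ℕ} {x : ULift.{u} ℚ} (h : x ∈ unitGr n) : n = 0 ∨ x = 0 := by
  by_cases hn : n = 0
  · exact .inl hn
  · rw [unitGr, if_neg hn] at h; exact .inr h

instance : SetLike.GradedMonoid unitGr.{u} where
  one_mem := by rw [unitGr, if_pos rfl]; trivial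
  mul_mem i j x y hx hy := by
    rcases mem_unitGr hx with rfl | rfl
    · rcases mem_unitGr hy with rfl | rfl
      · rw [unitGr, if_pos rfl]; trivial
      · rw [mul_zero]; exact zero_mem _
    · rw [zero_mul]; exact zero_mem _

instance : GradedAlgebra unitGr.{u} :=
  GradedAlgebra.ofAlgHom unitGr ((Algebra.ofId ℚ _).comp ULift.algEquiv.toAlgHom)
    (AlgHom.ext fun x => by
      obtain ⟨q⟩ := x
      have h : (ULift.up q : ULift.{u} ℚ) = algebraMap ℚ _ q := rfl
      rw [h, AlgHom.commutes, AlgHom.commutes])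
    fun i x => by
      obtain ⟨x, hx⟩ := x
      rcases mem_unitGr hx with rfl | rfl
      · obtain ⟨q⟩ := x; rfl
      · have : (⟨0, hx⟩ : unitGr.{u} i) = 0 := rfl; rw [this, map_zero]; exact map_zero _

/-- The base field as a filtered dga. -/
@[reducible] def unit : FDGA.{u} ℚ where
  carrier := ULift.{u} ℚ
  gr := unitGr
  comm {n k x y} hx hy := by
    rcases mem_unitGr hx with rfl | rfl
    · rw [zero_mul, pow_zero, one_smul, mul_comm]
    · rw [zero_mul, mul_zero, smul_zero]
  d := 0
  d_gr _ _ _ := zero_mem _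
  d_d _ := rfl
  leibniz n x y _ := by simp
  W p n := if 0 ≤ p then unitGr n else ⊥
  W_le p n := by split_ifs; exacts [le_rfl, bot_le]
  W_mono n p q h := by beta_reduce; split_ifs; exacts [le_rfl, by omega, bot_le, le_rfl]
  W_exhaustive n x hx := ⟨0, by rwa [if_pos le_rfl]⟩
  one_W := by rw [if_pos le_rfl]; exact SetLike.GradedOne.one_mem
  mul_W p q n k x y hx hy := by
    split_ifs at hx hy with h1 h2
    · rw [if_pos (add_nonneg h1 h2)]; exact SetLike.GradedMul.mul_mem hx hy
    all_goals first | rw [(mem_bot ℚ).1 hx, zero_mul]; exact zero_mem _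
                    | rw [(mem_bot ℚ).1 hy, mul_zero]; exact zero_mem _
  d_W _ _ _ _ := zero_mem _

end FDGA

theorem CMHS.trivial {X : Type*} [AddCommGroup X] [Module ℂ X] {c : X →ₛₗ[starRingEnd ℂ] X}
    (hcc : ∀ x, c (c x) = x) {T : Submodule ℂ X} (hT : ∀ x ∈ T, c x ∈ T) :
    CMHS c ⊥ T (fun k => if 0 ≤ k then T else ⊥) (fun q => if q ≤ 0 then T else ⊥) where
  cc := hcc
  W_mono k l h := by beta_reduce; split_ifs; exacts [le_rfl, by omega, bot_le, le_rfl]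
  W_bot := ⟨-1, if_neg (by norm_num)⟩
  W_top := ⟨0, if_pos le_rfl⟩
  B_le_W _ := bot_le
  W_le k := by split_ifs; exacts [le_rfl, bot_le]
  c_W k x hx := by
    split_ifs at hx ⊢
    exacts [hT x hx, by rw [(mem_bot ℂ).1 hx, map_zero]; exact zero_mem _]
  F_anti k l h := by beta_reduce; split_ifs; exacts [le_rfl, by omega, bot_le, le_rfl]
  F_top := ⟨0, if_pos le_rfl⟩
  F_bot := ⟨1, if_neg (by norm_num)⟩
  B_le_F _ := bot_le
  F_le k := by split_ifs; exacts [le_rfl, bot_le]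
  split k p x hx := by
    by_cases hk : 0 ≤ k - 1
    · exact ⟨0, zero_mem _, 0, zero_mem _, by rwa [if_pos hk, map_zero, sub_zero, sub_zero,
        ← if_pos (c := 0 ≤ k) (t := T) (e := ⊥) (by omega)]⟩
    by_cases hk0 : 0 ≤ k
    · have hk1 : k = 0 := by omega
      rw [if_pos hk0] at hx
      rw [if_neg hk, if_pos hk0]
      by_cases hp : p ≤ 0
      · exact ⟨x, ⟨by rwa [if_pos hp], hx⟩, 0, zero_mem _, by
          rw [sub_self, map_zero, sub_zero]; exact zero_mem _⟩
      · exact ⟨0, zero_mem _, c x, ⟨by rw [if_pos (by omega)]; exact hT x hx, hT x hx⟩, by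
          rw [hcc, sub_zero, sub_self]; exact zero_mem _⟩
    · rw [if_neg hk0, mem_bot] at hx
      exact ⟨0, zero_mem _, 0, zero_mem _, by rw [hx, map_zero, sub_zero, sub_zero]; exact zero_mem _⟩
  disj k p x y hx hy hxy := by
    by_cases hk : 0 ≤ k - 1
    · rw [if_pos hk]; have := hx.2; rwa [if_pos (show 0 ≤ k by omega)] at this
    have hx0 : x = 0 := by
      rw [if_neg hk, mem_bot, sub_eq_zero] at hxy
      by_cases hk0 : 0 ≤ k
      · by_cases hp : p ≤ 0
        · have := hy.1; rw [if_neg (by omega)] at this; rw [hxy, show y = 0 from this, map_zero]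
        · have := hx.1; rwa [if_neg hp] at this
      · have := hx.2; rwa [if_neg hk0] at this
    rw [hx0]
    exact zero_mem _

namespace FDGA

theorem d_algebraMap {k : Type} [Field k] (D : FDGA.{u} k) (c : k) :
    D.d (algebraMap k D c) = 0 := (D.algebraMap_mem_cocycles c).2

theorem algebraMap_mem_W {k : Type} [Field k] (D : FDGA.{u} k) (c : k) {p : ℤ} (hp : 0 ≤ p) :
    algebraMap k D c ∈ D.W p 0 := by
  rw [Algebra.algebraMap_eq_smul_one]
  exact smul_mem _ _ (D.W_mono 0 hp D.one_W)

/-- The morphism from an algebra that is the base field in degree `0`. -/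
def unitHom {k : Type} [Field k] {U : FDGA.{u} k} (ε : U →ₐ[k] k)
    (hd : ∀ x, U.d x = 0) (hgr : ∀ n x, x ∈ U.gr n → n = 0 ∨ x = 0)
    (hW : ∀ p n x, x ∈ U.W p n → 0 ≤ p ∨ x = 0) (D : FDGA.{u} k) : FDGAHom U D where
  toFun := (Algebra.ofId k D).comp ε
  map_gr n x hx := by
    rcases hgr n x hx with rfl | rfl
    · exact (D.algebraMap_mem_cocycles _).1
    · rw [map_zero]; exact zero_mem _
  map_d x := by rw [hd, map_zero]; exact (D.d_algebraMap _).symm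
  map_W p n x hx := by
    rcases hgr n x (U.W_le _ _ hx) with rfl | rfl
    · rcases hW p 0 x hx with hp | rfl
      · exact D.algebraMap_mem_W _ hp
      · rw [map_zero]; exact zero_mem _
    · rw [map_zero]; exact zero_mem _

def augC : unit.{u}.baseChange ≃ₐ[ℂ] ℂ :=
  (Algebra.TensorProduct.congr AlgEquiv.refl ULift.algEquiv).trans (Algebra.TensorProduct.rid ℚ ℂ ℂ)

theorem eq_algebraMap (x : unit.{u}.baseChange) : x = algebraMap ℂ _ (augC x) :=
  augC.injective (AlgEquiv.commutes augC (augC x)).symm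

theorem unit_hom_ext {X : Type*} [Ring X] [Algebra ℂ X] (f g : unit.{u}.baseChange →ₐ[ℂ] X) (x) :
    f x = g x := by
  rw [eq_algebraMap x, AlgHom.commutes, AlgHom.commutes]

theorem mem_unitGr_C {n : ℕ} {x : unit.{u}.baseChange} (h : x ∈ unit.{u}.baseChange.gr n) :
    n = 0 ∨ x = 0 := by
  by_cases hn : n = 0
  · exact .inl hn
  · have h1 : x ∈ (unitGr.{u} n)ˆ := h; rw [unitGr, if_neg hn, baseChange_bot] at h1; exact .inr h1

theorem mem_unitW_C {p : ℤ} {n : ℕ} {x : unit.{u}.baseChange}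
    (h : x ∈ unit.{u}.baseChange.W p n) : 0 ≤ p ∨ x = 0 := by
  by_cases hp : 0 ≤ p
  · exact .inl hp
  · have h1 : x ∈ (if 0 ≤ p then unitGr.{u} n else ⊥)ˆ := h
    rw [if_neg hp, baseChange_bot] at h1
    exact .inr h1

def unitHomC (D : FDGA.{u} ℂ) : FDGAHom unit.{u}.baseChange D :=
  unitHom augC.toAlgHom (fun x => by rw [eq_algebraMap x]; exact d_algebraMap _ _)
    (fun _ _ => mem_unitGr_C) (fun _ _ _ => mem_unitW_C) D

@[reducible] def unitF : HodgeFil unit.{u}.baseChange where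
  F q n := if q ≤ 0 then (unitGr n)ˆ else ⊥
  F_le q n := by split_ifs; exacts [le_rfl, bot_le]
  F_anti n p q h := by beta_reduce; split_ifs; exacts [le_rfl, by omega, bot_le, le_rfl]
  one_F := by rw [if_pos le_rfl]; exact unit°.W_le _ _ unit°.one_W
  mul_F p q n k x y hx hy := by
    split_ifs at hx hy with h1 h2
    · rw [if_pos (add_nonpos h1 h2)]
      exact baseChange_mul_mem (fun x hx y hy => SetLike.GradedMul.mul_mem hx hy) x y hx hy
    all_goals first | rw [(mem_bot ℂ).1 hx, zero_mul]; exact zero_mem _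
                    | rw [(mem_bot ℂ).1 hy, mul_zero]; exact zero_mem _
  d_F q n x _ := by
    have h : unit.{u}.baseChange.d x = 0 := by rw [eq_algebraMap x]; exact d_algebraMap _ _
    rw [h]
    exact zero_mem _

theorem unit_isMH : IsMH unit.{u} unitF where
  d_W _ _ _ _ := zero_mem _
  finite n := inferInstance
  cmhs i := by
    have h := CMHS.trivial (c := conjTensor (ULift.{u} ℚ)) conjTensor_conjTensor
      (T := (unitGr i)ˆ) fun x hx => conjTensor_mem hx
    have e : (fun k : ℤ => if 0 ≤ k then (unitGr.{u} i)ˆ else ⊥) =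
        fun k : ℤ => (unit.{u}.W (k - i) i)ˆ := funext fun k => by
      change _ = (if 0 ≤ k - i then unitGr.{u} i else ⊥)ˆ
      by_cases hi : i = 0
      · subst hi; rw [Nat.cast_zero, sub_zero]; split_ifs; exacts [rfl, (baseChange_bot _).symm]
      · rw [unitGr, if_neg hi, ite_self, baseChange_bot, ite_self]
    rw [e] at h
    exact h

end FDGA

variable {m : ℕ} {A : HodgeDiagram.{u} m}

open FDGA in
variable (A) in
/-- The initial stage. -/
@[reducible] def State.unit : State A where
  Q := FDGA.unit
  F := unitF
  isMH := unit_isMH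
  conn x _ := mem_span_singleton.2 ⟨x.down, by change ULift.up (x.down * 1) = x; rw [mul_one]⟩
  ρQ := unitHom (U := FDGA.unit) ULift.algEquiv.toAlgHom (fun _ => rfl) (fun _ _ => mem_unitGr)
    (fun p n x hx => by
      by_cases hp : 0 ≤ p
      · exact .inl hp
      · have h1 : x ∈ (if 0 ≤ p then unitGr.{u} n else ⊥) := hx
        rw [if_neg hp] at h1
        exact .inr h1) A.Q
  ρ v := unitHomC (A.node v)
  ρ_left := FDGAHom.ext (AlgHom.ext fun x => unit_hom_ext _ _ x)
  ρ_F q n x hx := by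
    change x ∈ (if q ≤ 0 then (unitGr.{u} n)ˆ else ⊥) at hx
    split_ifs at hx with hq
    · rcases mem_unitGr_C hx with rfl | rfl
      · have h1 : algebraMap ℂ A.C (augC x) ∈ A.F.F q 0 := by
          rw [Algebra.algebraMap_eq_smul_one]
          exact smul_mem _ _ (A.F.F_anti 0 hq A.F.one_F)
        exact h1
      · rw [map_zero]; exact zero_mem _
    · rw [(mem_bot ℂ).1 hx, map_zero]; exact zero_mem _
  h u := unitHomC ((A.node u.tgt).path 1)
  h_zero u x := unit_hom_ext ((evalHom 0).comp (unitHomC _).toFun) (unitHomC _).toFun x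
  h_one u x := unit_hom_ext ((evalHom 1).comp (unitHomC _).toFun)
    ((A.φ u).toFun.comp (unitHomC _).toFun) x

theorem Tower.unit_good (h0 : A.IsZeroConnected) (R : Prop) (K : ℕ → ℕ) :
    (⟨fun _ => State.unit A, fun _ => .nil _⟩ : Tower A).Good R K 0 1 0 where
  surj i hi z hz := by
    obtain rfl : i = 0 := by omega
    obtain ⟨q, hq⟩ := h0.2 (Submodule.Quotient.mk ⟨z, hz⟩)
    exact ⟨algebraMap ℚ _ q, FDGA.unit.algebraMap_mem_cocycles q,
      (Submodule.Quotient.eq ((A.Q.coboundaries 0).submoduleOf (A.Q.cocycles 0))).1 hq.symm⟩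
  dies k i hi z hz := by
    have h1 : z = 0 := by
      rcases FDGA.mem_unitGr hz.1.1 with rfl | h1
      · obtain ⟨q⟩ := z
        have h2 : algebraMap ℚ A.Q q ∈ A.Q.coboundaries 0 := hz.2
        have h3 : q = 0 := h0.1 ((Submodule.Quotient.eq
          ((A.Q.coboundaries 0).submoduleOf (A.Q.cocycles 0))).2 (by
            change algebraMap ℚ A.Q q - algebraMap ℚ A.Q 0 ∈ A.Q.coboundaries 0
            rwa [map_zero, sub_zero]))
        rw [h3]; rfl
      · exact h1
    subst h1
    exact .now (zero_mem _)
  dec k i hi := by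
    intro x hx
    rcases FDGA.mem_unitGr hx with rfl | rfl
    · exact absurd hi (lt_irrefl _)
    · exact zero_mem _
  bd _ k p i hp := by
    change (if 0 ≤ p then FDGA.unitGr i else ⊥) = ⊥
    by_cases hi : i = 0
    · subst hi; rw [if_neg (by simp [Tower.bound] at hp; omega)]
    · rw [FDGA.unitGr, if_neg hi, ite_self]

end

section

/-! ## The sequence of attachments -/

variable {m : ℕ} {A : HodgeDiagram.{u} m}

namespace CellPath

theorem exists_head {S X Y : State A} (p : CellPath S X) (s : Step X Y) :
    ∃ (S' : State A) (s' : Step S S') (q : CellPath S' Y),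
      ∀ x, q.map.f (s'.f.f x) = s.f.f (p.map.f x) := by
  cases p with
  | nil => exact ⟨Y, s, .nil _, fun _ => rfl⟩
  | cons s' p => exact ⟨_, s', p.trans (.cons s (.nil _)), fun x => map_trans _ _ _⟩

theorem map_injective {S X : State A} (p : CellPath S X) : Function.Injective p.map.f.toFun := by
  induction p with
  | nil => exact Function.injective_id
  | cons s p ih => exact ih.comp s.step.free.injective

def length : ∀ {S X : State A}, CellPath S X → ℕ
  | _, _, nil _ => 0
  | _, _, cons _ p => p.length + 1

end CellPath

theorem StateHom.map_ker {S S' : State A} (f : StateHom S S') {i : ℕ} {z : S.Q}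
    (hz : z ∈ S.ker i) : f.f z ∈ S'.ker i :=
  ⟨f.f.map_cocycles _ _ hz.1, by change S'.ρQ (f.f z) ∈ A.Q.coboundaries i; rw [f.ρQ]; exact hz.2⟩

/-- Position inside a concatenation of paths. -/
structure Position (E : ℕ → State A) where
  n : ℕ
  S : State A
  q : CellPath S (E n)

structure Position.Next {E : ℕ → State A} (c c' : Position E) where
  step : Step c.S c'.S
  pos : 0 < c.q.length → c'.n = c.n ∧ c'.q.length < c.q.length ∧
    ∀ i z, c.q.map.f z ∈ (E c.n).Q.coboundaries i →
      c'.q.map.f (step.f.f z) ∈ (E c'.n).Q.coboundaries i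
  zero : c.q.length = 0 → c'.n = c.n + 1 ∧
    (∀ i z, c.q.map.f z ∈ (E c.n).Q.coboundaries i → z ∈ c.S.Q.coboundaries i) ∧
    (∀ i ≤ c.n, ∀ z ∈ A.Q.cocycles i, ∃ y ∈ c.S.Q.cocycles i, z - c.S.ρQ y ∈ A.Q.coboundaries i) ∧
    ∀ i ≤ c.n + 1, ∀ z ∈ c.S.ker i, c'.q.map.f (step.f.f z) ∈ (E c'.n).Q.coboundaries i

/-- Sequences of attachments. -/
structure Steps (A : HodgeDiagram.{u} m) where
  X : ℕ → State A
  s : ∀ k, Step (X k) (X (k + 1))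

@[reducible] def Steps.tower (T : Steps A) : Tower A := ⟨T.X, fun k => .cons (T.s k) (.nil _)⟩

/-- A sequence of attachments whose union computes the cohomology. -/
theorem HodgeDiagram.IsMixedHodge.exists_steps (hA : A.IsMixedHodge) (h0 : A.IsZeroConnected) :
    ∃ T : Steps A, T.X 0 = State.unit A ∧
      (∀ i, ∃ k, ∀ z ∈ A.Q.cocycles i, ∃ y ∈ (T.X k).Q.cocycles i,
        z - (T.X k).ρQ y ∈ A.Q.coboundaries i) ∧
      (∀ i k, ∀ z ∈ (T.X k).ker i, T.tower.Dies i k z) ∧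
      ((∀ x ∈ A.Q.W (-2) 1, A.Q.d x = 0 → x ∈ A.Q.coboundaries 1) →
        ∀ i, ∃ p, ∀ k, (T.X k).Q.W p i = ⊥) := by
  set R : Prop := ∀ x ∈ A.Q.W (-2) 1, A.Q.d x = 0 → x ∈ A.Q.coboundaries 1 with hR
  choose p₀ hp₀ using hA.regular_Q
  let K : ℕ → ℕ := fun N => ∑ i ∈ Finset.range (N + 1), (p₀ i).natAbs
  have hK : Monotone K := fun a b h => Finset.sum_le_sum_of_subset
    (Finset.range_subset_range.2 (by omega))
  have hKp : ∀ i, (p₀ i).natAbs ≤ K i := fun i =>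
    Finset.single_le_sum (f := fun i => (p₀ i).natAbs) (fun _ _ => Nat.zero_le _) (by simp)
  have hRK : ∀ n, R → ∀ p : ℤ, p + (n + 1 : ℕ) < -(K (n + 1) * n : ℕ) →
      ∀ x ∈ A.Q.W p (n + 1), A.Q.d x = 0 → x ∈ A.Q.coboundaries (n + 1) := by
    intro n hR p hp x hx hd
    rcases Nat.eq_zero_or_pos n with rfl | hn
    · exact hR x (A.Q.W_mono 1 (by simp at hp; omega) hx) hd
    · have h1 : K (n + 1) ≤ K (n + 1) * n := Nat.le_mul_of_pos_right _ hn
      have h2 := hKp (n + 1)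
      have h3 := A.Q.W_mono (n + 1) (show p ≤ p₀ (n + 1) by push_cast at hp h1; omega) hx
      beta_reduce at h3
      rw [hp₀, mem_bot] at h3
      rw [h3]
      exact zero_mem _
  obtain ⟨T, hT0, hT⟩ := exists_dependent_seq (α := fun n => {T : Tower A // T.Good R K n (n + 1) n})
    (R := fun n T T' => ∃ (S : State A) (p : CellPath (T.1.X 0) S) (s : Step S (T'.1.X 0)),
      ∀ i ≤ n + 1, ∀ z ∈ (T.1.X 0).ker i, s.f.f (p.map.f z) ∈ (T'.1.X 0).Q.coboundaries i)
    ⟨_, Tower.unit_good h0 R K⟩ fun n T => by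
      obtain ⟨T', S, p, s, hT', h⟩ := T.2.exists_next hA hK (hRK n)
      exact ⟨⟨T', hT'⟩, S, p, s, h⟩
  let E : ℕ → State A := fun n => (T n).1.X 0
  have hE0 : E 0 = State.unit A := by change (T 0).1.X 0 = _; rw [hT0]
  have hnext : ∀ c : Position E, ∃ c' : Position E, Nonempty (c.Next c') := by
    rintro ⟨n, S, q⟩
    cases q with
    | cons s q =>
      exact ⟨⟨n, _, q⟩, ⟨s, fun _ => ⟨rfl, Nat.lt_succ_self _, fun i z hz => hz⟩,
        fun h => absurd h (Nat.succ_ne_zero _)⟩⟩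
    | nil =>
      obtain ⟨S, p, s, h⟩ := hT n
      obtain ⟨S', s', q, hq⟩ := p.exists_head s
      exact ⟨⟨n + 1, S', q⟩, ⟨s', fun h => absurd h (lt_irrefl 0), fun _ => ⟨rfl, fun i z hz => hz,
        fun i hi z hz => (T n).2.surj i hi z hz, fun i hi z hz => by
          change q.map.f (s'.f.f z) ∈ _
          rw [hq]
          exact h i hi z hz⟩⟩⟩
  obtain ⟨c, hc0, hc⟩ := exists_dependent_seq (α := fun _ => Position E)
    (R := fun _ c c' => Nonempty (c.Next c')) ⟨0, E 0, .nil _⟩ fun _ c => hnext c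
  let N : ∀ k, (c k).Next (c (k + 1)) := fun k => (hc k).some
  let T' : Steps A := ⟨fun k => (c k).S, fun k => (N k).step⟩
  have hzero : ∀ L k, (c k).q.length = L → ∃ l, (c l).n = (c k).n ∧ (c l).q.length = 0 := by
    intro L
    induction L using Nat.strong_induction_on with
    | _ L ih =>
      intro k hk
      rcases Nat.eq_zero_or_pos (c k).q.length with h | h
      · exact ⟨k, rfl, h⟩
      · obtain ⟨h1, h2, -⟩ := (N k).pos h
        obtain ⟨l, hl, hl0⟩ := ih _ (hk ▸ h2) (k + 1) rfl
        exact ⟨l, hl.trans h1, hl0⟩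
  have hreach : ∀ n, ∃ k, (c k).n = n ∧ (c k).q.length = 0 := by
    intro n
    induction n with
    | zero => exact ⟨0, by rw [hc0], by rw [hc0]; rfl⟩
    | succ n ih =>
      obtain ⟨k, hk, hk0⟩ := ih
      obtain ⟨l, hl, hl0⟩ := hzero _ (k + 1) rfl
      exact ⟨l, by rw [hl, ((N k).zero hk0).1, hk], hl0⟩
  have hdies : ∀ i L k z, (c k).q.length = L →
      (c k).q.map.f z ∈ (E (c k).n).Q.coboundaries i → T'.tower.Dies i k z := by
    intro i L
    induction L using Nat.strong_induction_on with
    | _ L ih =>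
      intro k z hk hz
      rcases Nat.eq_zero_or_pos (c k).q.length with h | h
      · exact .now (((N k).zero h).2.1 i z hz)
      · obtain ⟨-, h2, h3⟩ := (N k).pos h; exact .later (ih _ (hk ▸ h2) (k + 1) _ rfl (h3 i z hz))
  have hdies' : ∀ i g L k z, i ≤ (c k).n + 1 + g → (c k).q.length = L → z ∈ (c k).S.ker i →
      T'.tower.Dies i k z := by
    intro i g
    induction g with
    | zero =>
      intro L
      induction L using Nat.strong_induction_on with
      | _ L ih =>
        intro k z hi hk hz
        rcases Nat.eq_zero_or_pos (c k).q.length with h | h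
        · exact .later (hdies i _ (k + 1) _ rfl (((N k).zero h).2.2.2 i hi z hz))
        · obtain ⟨h1, h2, -⟩ := (N k).pos h
          exact .later (ih _ (hk ▸ h2) (k + 1) _ (by omega) rfl ((N k).step.f.map_ker hz))
    | succ g ihg =>
      intro L
      induction L using Nat.strong_induction_on with
      | _ L ih =>
        intro k z hi hk hz
        rcases Nat.eq_zero_or_pos (c k).q.length with h | h
        · have h1 := ((N k).zero h).1
          exact .later (ihg _ (k + 1) _ (by omega) rfl ((N k).step.f.map_ker hz))
        · obtain ⟨h1, h2, -⟩ := (N k).pos h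
          exact .later (ih _ (hk ▸ h2) (k + 1) _ (by omega) rfl ((N k).step.f.map_ker hz))
  refine ⟨T', ?_, fun i => ?_, fun i k z hz => hdies' i i _ k z (by omega) rfl hz,
    fun hR i => ⟨-(K i * i : ℕ) - i - 1, fun k => ?_⟩⟩
  · change (c 0).S = _; rw [hc0]; exact hE0
  · obtain ⟨k, hk, hk0⟩ := hreach i; exact ⟨k, ((N k).zero hk0).2.2.1 i hk.ge⟩
  · refine (Submodule.eq_bot_iff _).2 fun x hx => ?_
    have h1 := (c k).q.map.f.map_W _ _ _ hx
    have h2 : (E (c k).n).Q.W (-(K i * i : ℕ) - i - 1) i = ⊥ := (T (c k).n).2.bd hR 0 _ _ (by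
      have := Tower.bound_le hK (c k).n i
      omega)
    rw [h2, mem_bot] at h1
    exact (c k).q.map_injective (h1.trans (map_zero _).symm)

end

/-! ## Increasing unions -/

/-- `M` is the increasing union of the spaces `D i`. -/
structure IsUnion {k : Type*} [Field k] {D : ℕ → Type*} {M : Type*} [∀ i, AddCommGroup (D i)]
    [∀ i, Module k (D i)] [AddCommGroup M] [Module k M] (f : ∀ i, D i →ₗ[k] D (i + 1))
    (j : ∀ i, D i →ₗ[k] M) : Prop where
  comp : ∀ i x, j (i + 1) (f i x) = j i x
  inj : ∀ i, Function.Injective (j i)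
  exists_eq : ∀ x, ∃ i y, j i y = x

namespace IsUnion

variable {k : Type*} [Field k] {D : ℕ → Type*} {M : Type*} [∀ i, AddCommGroup (D i)]
  [∀ i, Module k (D i)] [AddCommGroup M] [Module k M] {f : ∀ i, D i →ₗ[k] D (i + 1)}
  {j : ∀ i, D i →ₗ[k] M}

theorem monotone_map {X : Type*} [AddCommGroup X] [Module k X] {g : ∀ i, D i →ₗ[k] X}
    (hg : ∀ i x, g (i + 1) (f i x) = g i x) {P : ∀ i, Submodule k (D i)}
    (hP : ∀ i x, x ∈ P i → f i x ∈ P (i + 1)) : Monotone fun i => (P i).map (g i) :=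
  monotone_nat_of_le_succ fun i => by rintro _ ⟨x, hx, rfl⟩; exact ⟨f i x, hP i x hx, hg i x⟩

def sub (j : ∀ i, D i →ₗ[k] M) (P : ∀ i, Submodule k (D i)) : Submodule k M := ⨆ i, (P i).map (j i)

theorem mem_sub (h : IsUnion f j) {P : ∀ i, Submodule k (D i)}
    (hP : ∀ i x, x ∈ P i → f i x ∈ P (i + 1)) {x : M} : x ∈ sub j P ↔ ∃ i, ∃ y ∈ P i, j i y = x :=
  Submodule.mem_iSup_of_directed _ (monotone_map h.comp hP).directed_le

theorem sub_mono {P P' : ∀ i, Submodule k (D i)} (hP : ∀ i, P i ≤ P' i) : sub j P ≤ sub j P' :=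
  iSup_mono fun i => Submodule.map_mono (hP i)

theorem map_mem_sub {P : ∀ i, Submodule k (D i)} {i : ℕ} {x : D i} (hx : x ∈ P i) : j i x ∈ sub j P :=
  (le_iSup (fun i => (P i).map (j i)) i) ⟨x, hx, rfl⟩

theorem exists_common (h : IsUnion f j) {P P' : ∀ i, Submodule k (D i)}
    (hP : ∀ i x, x ∈ P i → f i x ∈ P (i + 1)) (hP' : ∀ i x, x ∈ P' i → f i x ∈ P' (i + 1)) {x x' : M}
    (hx : x ∈ sub j P) (hx' : x' ∈ sub j P') :
    ∃ i, ∃ y ∈ P i, ∃ y' ∈ P' i, j i y = x ∧ j i y' = x' := by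
  obtain ⟨i, hi⟩ := (h.mem_sub hP).1 hx
  obtain ⟨i', hi'⟩ := (h.mem_sub hP').1 hx'
  obtain ⟨y, hy, e⟩ := monotone_map h.comp hP (le_max_left i i') hi
  obtain ⟨y', hy', e'⟩ := monotone_map h.comp hP' (le_max_right i i') hi'
  exact ⟨_, y, hy, y', hy', e, e'⟩

theorem mem_sub_top (h : IsUnion f j) (x : M) : x ∈ sub j fun _ => ⊤ := by
  obtain ⟨i, y, rfl⟩ := h.exists_eq x
  exact map_mem_sub trivial

theorem exists_common_top (h : IsUnion f j) (x x' : M) : ∃ i y y', j i y = x ∧ j i y' = x' := by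
  obtain ⟨i, y, -, y', -, e⟩ := h.exists_common (P := fun _ => ⊤) (P' := fun _ => ⊤)
    (fun _ _ _ => trivial) (fun _ _ _ => trivial) (h.mem_sub_top x) (h.mem_sub_top x')
  exact ⟨i, y, y', e⟩

theorem mem_sub_iff (h : IsUnion f j) {P : ∀ i, Submodule k (D i)}
    (hP : ∀ i x, f i x ∈ P (i + 1) ↔ x ∈ P i) {i : ℕ} {x : D i} : j i x ∈ sub j P ↔ x ∈ P i := by
  refine ⟨fun hx => ?_, map_mem_sub⟩
  obtain ⟨l, y, hy, e⟩ := (h.mem_sub fun i x => (hP i x).2).1 hx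
  have key : ∀ d i l (_ : l ≤ i + d) (x : D i), ∀ y ∈ P l, j l y = j i x → x ∈ P i := by
    intro d
    induction d with
    | zero =>
      intro i l hl x y hy e
      obtain ⟨z, hz, ez⟩ := monotone_map h.comp (fun i x => (hP i x).2) hl ⟨y, hy, rfl⟩
      exact h.inj _ (ez.trans e) ▸ hz
    | succ d ih =>
      intro i l hl x y hy e
      exact (hP i x).1 (ih (i + 1) l (by omega) (f i x) y hy (e.trans (h.comp i x).symm))
  exact key l i l (Nat.le_add_left _ _) x y hy e

theorem exists_lift (h : IsUnion f j) {X : Type*} [AddCommGroup X] [Module k X] (g : ∀ i, D i →ₗ[k] X)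
    (hg : ∀ i x, g (i + 1) (f i x) = g i x) : ∃ G : M →ₗ[k] X, ∀ i x, G (j i x) = g i x := by
  choose i y e using h.exists_eq
  have key : ∀ l x, g _ (y (j l x)) = g l x := by
    intro l x
    have hm := monotone_map (f := f) (g := fun i => (j i).prod (g i))
      (fun i x => Prod.ext (h.comp i x) (hg i x)) (P := fun _ => ⊤) (fun _ _ _ => trivial)
    obtain ⟨z, -, ez⟩ := hm (le_max_left l (i (j l x))) ⟨x, trivial, rfl⟩
    obtain ⟨z', -, ez'⟩ := hm (le_max_right l (i (j l x))) ⟨y (j l x), trivial, rfl⟩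
    have h1 : z = z' := h.inj _ ((congrArg Prod.fst ez).trans ((e (j l x)).symm.trans
      (congrArg Prod.fst ez').symm))
    exact (congrArg Prod.snd ez').symm.trans (h1 ▸ congrArg Prod.snd ez)
  refine ⟨⟨⟨fun x => g _ (y x), fun x x' => ?_⟩, fun c x => ?_⟩, key⟩
  · obtain ⟨l, z, z', rfl, rfl⟩ := h.exists_common_top x x'; rw [← map_add, key, key, key, map_add]
  · obtain ⟨l, z, rfl⟩ := h.exists_eq x
    change g _ (y (c • j l z)) = c • g _ (y (j l z))
    rw [← map_smul, key, key, map_smul]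

end IsUnion

theorem exists_algebra_union {k : Type*} [Field k] {D : ℕ → Type u} [∀ i, Ring (D i)]
    [∀ i, Algebra k (D i)] (f : ∀ i, D i →ₐ[k] D (i + 1)) (hf : ∀ i, Function.Injective (f i)) :
    ∃ (M : Type u) (_ : Ring M) (_ : Algebra k M) (j : ∀ i, D i →ₐ[k] M),
      IsUnion (fun i => (f i).toLinearMap) (fun i => (j i).toLinearMap) := by
  let F : ∀ i l (_ : i ≤ l), D i →ₐ[k] D l := fun i l h =>
    Nat.leRec (motive := fun l _ => D i →ₐ[k] D l) (AlgHom.id k _) (fun l _ g => (f l).comp g) h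
  have hF0 : ∀ i h, F i i h = AlgHom.id k _ := fun i h => Nat.leRec_self _ _
  have hF1 : ∀ i l (h : i ≤ l) (h' : i ≤ l + 1), F i (l + 1) h' = (f l).comp (F i l h) := fun i l h h' =>
    Nat.leRec_succ _ _ _
  have : DirectedSystem D fun i l h => F i l h :=
    { map_self := fun i x => by rw [hF0]; rfl
      map_map := fun p l i h h' x => by
        induction p, h' using Nat.le_induction with
        | base => rw [hF0]; rfl
        | succ p h' ih => rw [hF1 l p h', hF1 i p (h.trans h'), AlgHom.comp_apply, ih]; rfl }
  have hinj : ∀ i l h, Function.Injective (F i l h) := fun i l h => by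
    induction l, h using Nat.le_induction with
    | base => rw [hF0]; exact Function.injective_id
    | succ l h ih => rw [hF1 i l h]; exact (hf l).comp ih
  refine ⟨DirectLimit D F, inferInstance, inferInstance, DirectLimit.Algebra.of D F, fun i x => ?_,
    fun i => DirectLimit.mk_injective F hinj i, fun x => ?_⟩
  · have := DirectLimit.Algebra.of_f (R := k) (f := F) (Nat.le_succ i) x
    rw [hF1 i i le_rfl, hF0] at this
    exact this
  · obtain ⟨i, y, rfl⟩ := DirectLimit.exists_eq_mk F x; exact ⟨i, y, rfl⟩

/-- `M` is the increasing union of the filtered dga's `D i`. -/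
structure FDGA.IsUnion {k : Type} [Field k] {D : ℕ → FDGA.{u} k} {M : FDGA.{u} k}
    (f : ∀ i, FDGAHom (D i) (D (i + 1))) (j : ∀ i, FDGAHom (D i) M) : Prop where
  union : _root_.IsUnion (fun i => (f i)ˡ) (fun i => (j i)ˡ)
  W : ∀ p n, M.W p n ≤ _root_.IsUnion.sub (fun i => (j i)ˡ) fun i => (D i).W p n

theorem IsUnion.exists_gradedAlgebra {k : Type} [Field k] {D : ℕ → FDGA.{u} k} {M : Type u} [Ring M]
    [Algebra k M] {f : ∀ i, FDGAHom (D i) (D (i + 1))} {j : ∀ i, (D i) →ₐ[k] M}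
    (h : IsUnion (fun i => (f i)ˡ) (fun i => (j i).toLinearMap)) :
    Nonempty (GradedAlgebra fun n => sub (fun i => (j i).toLinearMap) fun i => (D i).gr n) := by
  classical
  set gr : ℕ → Submodule k M := fun n => sub (fun i => (j i).toLinearMap) fun i => (D i).gr n with hgr
  have hst : ∀ n i x, x ∈ (D i).gr n → (f i)ˡ x ∈ (D (i + 1)).gr n :=
    fun n i x hx => (f i).map_gr n x hx
  have hm : SetLike.GradedMonoid gr :=
    { one_mem := mem_of_eq (S := gr 0) (map_one (j 0))
        (map_mem_sub (j := fun i => (j i).toLinearMap) (P := fun i => (D i).gr 0) (i := 0)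
          SetLike.GradedOne.one_mem)
      mul_mem := fun n l x y hx hy => by
        obtain ⟨i, a, ha, b, hb, rfl, rfl⟩ := h.exists_common (hst n) (hst l) hx hy
        exact mem_of_eq (S := gr (n + l)) (map_mul (j i) a b)
          (map_mem_sub (j := fun i => (j i).toLinearMap) (P := fun i => (D i).gr (n + l))
            (SetLike.GradedMul.mul_mem ha hb)) }
  have hj : ∀ i n x, x ∈ (D i).gr n → (j i).toLinearMap x ∈ gr n := fun i n x hx =>
    map_mem_sub (j := fun i => (j i).toLinearMap) (P := fun i => (D i).gr n) hx
  let g : ∀ i, (D i) →ₗ[k] DirectSum ℕ fun n => gr n := fun i =>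
    DirectSum.toModule k ℕ _ (fun n => DirectSum.lof k ℕ (fun n => gr n) n ∘ₗ
      (j i).toLinearMap.restrict (hj i n)) ∘ₗ (DirectSum.decomposeLinearEquiv (D i).gr).toLinearMap
  have hg : ∀ i n x (hx : x ∈ (D i).gr n),
      g i x = DirectSum.lof k ℕ (fun n => gr n) n ⟨j i x, hj i n x hx⟩ := by
    intro i n x hx
    change DirectSum.toModule k ℕ _ _ (DirectSum.decompose (D i).gr x) = _
    rw [DirectSum.decompose_of_mem _ hx]
    exact DirectSum.toModule_lof k n _
  obtain ⟨G, hG⟩ := h.exists_lift g fun i x => by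
    induction x using DirectSum.Decomposition.inductionOn (D i).gr with
    | zero => rw [map_zero, map_zero, map_zero]
    | @homogeneous n x =>
      rw [hg i n x x.2, hg (i + 1) n _ (hst n i x x.2)]
      congr 1
      exact Subtype.ext (h.comp i x)
    | add x y hx hy => rw [map_add, map_add, map_add, hx, hy]
  have dec : DirectSum.Decomposition gr := DirectSum.Decomposition.ofLinearMap gr G (by
    refine LinearMap.ext fun x => ?_
    obtain ⟨i, y, rfl⟩ := h.exists_eq x
    rw [LinearMap.comp_apply, hG, LinearMap.id_apply]
    induction y using DirectSum.Decomposition.inductionOn (D i).gr with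
    | zero => rw [map_zero, map_zero, map_zero]
    | @homogeneous n x => rw [hg i n x x.2]; exact DirectSum.coeLinearMap_lof gr n _
    | add x y hx hy => rw [map_add, map_add, map_add, hx, hy]) (by
    refine DirectSum.linearMap_ext k fun n => LinearMap.ext fun ⟨x, hx⟩ => ?_
    obtain ⟨i, y, hy, rfl⟩ := (h.mem_sub (hst n)).1 hx
    rw [LinearMap.comp_apply, LinearMap.comp_apply, DirectSum.coeLinearMap_lof, hG, hg i n y hy]
    rfl)
  exact ⟨{ hm, dec with }⟩

theorem FDGA.exists_isUnion {k : Type} [Field k] {D : ℕ → FDGA.{u} k}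
    (f : ∀ i, FDGAHom (D i) (D (i + 1))) (hf : ∀ i, Function.Injective (f i).toFun) :
    ∃ (M : FDGA.{u} k) (j : ∀ i, FDGAHom (D i) M), IsUnion f j := by
  obtain ⟨M, _, _, j, h⟩ := exists_algebra_union (fun i => (f i).toFun) hf
  obtain ⟨hgr⟩ := h.exists_gradedAlgebra
  obtain ⟨d, hd⟩ := h.exists_lift (fun i => (j i).toLinearMap ∘ₗ (D i).d) fun i x => by
    change j (i + 1) ((D (i + 1)).d (f i x)) = j i ((D i).d x)
    rw [← (f i).map_d]
    exact h.comp i _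
  replace hd : ∀ i x, d (j i x) = j i ((D i).d x) := hd
  have mem : ∀ {P : ∀ i, Submodule k (D i)} i x y, x ∈ P i → j i x = y →
      y ∈ _root_.IsUnion.sub (fun i => (j i).toLinearMap) P := by
    rintro P i x _ hx rfl
    exact _root_.IsUnion.map_mem_sub (j := fun i => (j i).toLinearMap) hx
  have hgr' : ∀ n i x, x ∈ (D i).gr n → (f i)ˡ x ∈ (D (i + 1)).gr n :=
    fun n i x hx => (f i).map_gr n x hx
  have hW : ∀ p n i x, x ∈ (D i).W p n → (f i)ˡ x ∈ (D (i + 1)).W p n :=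
    fun p n i x hx => (f i).map_W p n x hx
  let N : FDGA.{u} k :=
    { carrier := M
      gr := fun n => _root_.IsUnion.sub (fun i => (j i).toLinearMap) fun i => (D i).gr n
      graded := hgr
      comm := fun {n l x y} hx hy => by
        obtain ⟨i, a, ha, b, hb, rfl, rfl⟩ := h.exists_common (hgr' n) (hgr' l) hx hy
        change j i a * j i b = (-1 : k) ^ (n * l) • (j i b * j i a)
        rw [← map_mul, (D i).comm ha hb, map_smul, map_mul]
      d := d
      d_gr := fun n x hx => by
        obtain ⟨i, a, ha, rfl⟩ := (h.mem_sub (hgr' n)).1 hx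
        exact mem (P := fun i => (D i).gr (n + 1)) i _ _ ((D i).d_gr n a ha) (hd i a).symm
      d_d := fun x => by
        obtain ⟨i, a, rfl⟩ := h.exists_eq x
        exact (congrArg d (hd i a)).trans ((hd i _).trans (by rw [(D i).d_d, map_zero]))
      leibniz := fun n x y hx => by
        obtain ⟨i, a, ha, b, -, rfl, rfl⟩ := h.exists_common (P' := fun _ => ⊤) (hgr' n)
          (fun _ _ _ => trivial) hx (h.mem_sub_top y)
        change d (j i a * j i b) = d (j i a) * j i b + (-1 : k) ^ n • (j i a * d (j i b))
        rw [← map_mul, hd, hd, hd, (D i).leibniz n a b ha, map_add, map_smul, map_mul, map_mul]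
      W := fun p n => _root_.IsUnion.sub (fun i => (j i).toLinearMap) fun i => (D i).W p n
      W_le := fun p n => _root_.IsUnion.sub_mono fun i => (D i).W_le p n
      W_mono := fun n p q hpq => _root_.IsUnion.sub_mono fun i => (D i).W_mono n hpq
      W_exhaustive := fun n x hx => by
        obtain ⟨i, a, ha, rfl⟩ := (h.mem_sub (hgr' n)).1 hx
        obtain ⟨p, hp⟩ := (D i).W_exhaustive n a ha
        exact ⟨p, mem (P := fun i => (D i).W p n) i a _ hp rfl⟩
      one_W := mem (P := fun i => (D i).W 0 0) 0 1 _ (D 0).one_W (map_one (j 0))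
      mul_W := fun p q n l x y hx hy => by
        obtain ⟨i, a, ha, b, hb, rfl, rfl⟩ := h.exists_common (hW p n) (hW q l) hx hy
        exact mem (P := fun i => (D i).W (p + q) (n + l)) i _ _ ((D i).mul_W _ _ _ _ _ _ ha hb)
          (map_mul (j i) a b)
      d_W := fun p n x hx => by
        obtain ⟨i, a, ha, rfl⟩ := (h.mem_sub (hW p n)).1 hx
        exact mem (P := fun i => (D i).W p (n + 1)) i _ _ ((D i).d_W p n a ha) (hd i a).symm }
  exact ⟨N, fun i => ⟨⟨j i, fun n x hx => mem (P := fun i => (D i).gr n) i x _ hx rfl⟩,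
    fun x => (hd i x).symm, fun p n x hx => mem (P := fun i => (D i).W p n) i x _ hx rfl⟩,
    h, fun p n => le_rfl⟩

namespace FDGA.IsUnion

variable {k : Type} [Field k] {D : ℕ → FDGA.{u} k} {M : FDGA.{u} k}
    {f : ∀ i, FDGAHom (D i) (D (i + 1))} {j : ∀ i, FDGAHom (D i) M}

theorem exists_W (h : IsUnion f j) {p : ℤ} {n : ℕ} {x : M} (hx : x ∈ M.W p n) :
    ∃ i, ∃ y ∈ (D i).W p n, j i y = x :=
  (h.union.mem_sub fun i x hx => (f i).map_W p n x hx).1 (h.W p n hx)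

theorem exists_gr (h : IsUnion f j) {n : ℕ} {x : M} (hx : x ∈ M.gr n) :
    ∃ i, ∃ y ∈ (D i).gr n, j i y = x := by
  obtain ⟨p, hp⟩ := M.W_exhaustive n x hx
  obtain ⟨i, y, hy, e⟩ := h.exists_W hp
  exact ⟨i, y, (D i).W_le _ _ hy, e⟩

theorem exists_lift (h : IsUnion f j) {X : FDGA.{u} k} (g : ∀ i, FDGAHom (D i) X)
    (hg : ∀ i x, g (i + 1) (f i x) = g i x) :
    ∃ G : FDGAHom M X, ∀ i x, G (j i x) = g i x := by
  obtain ⟨G, hG⟩ := h.union.exists_lift (fun i => (g i)ˡ) hg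
  replace hG : ∀ i x, G (j i x) = g i x := hG
  refine ⟨⟨⟨AlgHom.ofLinearMap G ?_ fun x y => ?_, fun n x hx => ?_⟩, fun x => ?_, fun p n x hx => ?_⟩, hG⟩
  · rw [← map_one (j 0).toFun, hG, map_one]
  · obtain ⟨i, a, b, rfl, rfl⟩ := h.union.exists_common_top x y
    change G (j i a * j i b) = G (j i a) * G (j i b)
    rw [← map_mul, hG, hG, hG, map_mul]
  · obtain ⟨i, a, ha, rfl⟩ := h.exists_gr hx
    exact mem_of_eq (S := X.gr n) (hG i a).symm ((g i).map_gr n a ha)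
  · obtain ⟨i, a, rfl⟩ := h.union.exists_eq x
    change G (M.d (j i a)) = X.d (G (j i a))
    rw [← (j i).map_d, hG, hG, (g i).map_d]
  · obtain ⟨i, a, ha, rfl⟩ := h.exists_W hx
    exact mem_of_eq (S := X.W p n) (hG i a).symm ((g i).map_W p n a ha)

theorem hom_ext (h : IsUnion f j) {X : Type*} {a b : M → X}
    (hab : ∀ i x, a (j i x) = b (j i x)) (x) : a x = b x := by
  obtain ⟨i, y, rfl⟩ := h.union.exists_eq x
  exact hab i y

theorem exists_cocycle (h : IsUnion f j) {n : ℕ} {x : M} (hx : x ∈ M.cocycles n) :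
    ∃ i, ∃ y ∈ (D i).cocycles n, j i y = x := by
  obtain ⟨i, y, hy, rfl⟩ := h.exists_gr hx.1
  refine ⟨i, y, ⟨hy, h.union.inj i (?_ : j i ((D i).d y) = j i 0)⟩, rfl⟩
  rw [(j i).map_d, map_zero]
  exact hx.2

end FDGA.IsUnion

theorem FDGA.IsUnion.baseChange {D : ℕ → FDGA.{u} ℚ} {M : FDGA.{u} ℚ}
    {f : ∀ i, FDGAHom (D i) (D (i + 1))} {j : ∀ i, FDGAHom (D i) M} (h : IsUnion f j) :
    IsUnion (fun i => (f i)°) fun i => (j i)° := by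
  have key : ∀ (S : Submodule ℚ M) (P : ∀ i, Submodule ℚ (D i)),
      (∀ i x, x ∈ P i → f i x ∈ P (i + 1)) →
      S ≤ _root_.IsUnion.sub (fun i => (j i)ˡ) P →
      Sˆ ≤ _root_.IsUnion.sub (fun i => (j i)°ˡ) fun i => (P i)ˆ := by
    intro S P hP hS
    rw [baseChange_eq_span, span_le]
    rintro _ ⟨x, hx, rfl⟩
    obtain ⟨i, y, hy, rfl⟩ := (h.union.mem_sub hP).1 (hS hx)
    exact _root_.IsUnion.map_mem_sub (j := fun i => (j i)°ˡ)
      (P := fun i => (P i)ˆ) (i := i) (tmul_mem_baseChange_of_mem (1 : ℂ) hy)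
  have hcomp : ∀ i x, (j (i + 1))° ((f i)° x) = (j i)° x := fun i x => by
    rw [← FDGAHom.baseChange_comp]
    have : (j (i + 1)).comp (f i) = j i := FDGAHom.ext (AlgHom.ext (h.union.comp i))
    rw [this]
  refine ⟨⟨hcomp, fun i => ?_, fun x => ?_⟩, fun p n => key _ (fun i => (D i).W p n)
    (fun i x hx => (f i).map_W p n x hx) (h.W p n)⟩
  · have h1 := baseChange_ker (j i)ˡ
    rw [LinearMap.ker_eq_bot.2 (h.union.inj i), baseChange_bot] at h1
    exact LinearMap.ker_eq_bot.1 h1.symm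
  · have h1 := key ⊤ (fun _ => ⊤) (fun _ _ _ => trivial) (fun x _ => h.union.mem_sub_top x)
    rw [baseChange_top] at h1
    obtain ⟨i, hi⟩ := (Submodule.mem_iSup_of_directed _ (_root_.IsUnion.monotone_map
      (f := fun i => (f i)°ˡ) hcomp
      (P := fun i => (⊤ : Submodule ℚ (D i))ˆ) fun i x _ => by
        rw [baseChange_top]; trivial).directed_le).1 (h1 (Submodule.mem_top (x := x)))
    obtain ⟨y, -, e⟩ := hi
    exact ⟨i, y, e⟩

/-! ## The minimal model as a mixed Hodge dga -/

theorem CMHS.isFiniteMHS_restrict {V : Type*} [AddCommGroup V] [Module ℚ V] {W : ℤ → Submodule ℚ V}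
    {F : ℤ → Submodule ℂ (ℂ ⊗[ℚ] V)} {U : Submodule ℚ V} [Module.Finite ℚ U]
    (h : CMHS (conjTensor V) ⊥ (Uˆ) (fun k => (W k)ˆ ⊓ Uˆ) (fun q => F q ⊓ Uˆ)) :
    IsFiniteMHS U (fun p => (W p).comap U.subtype) fun q => (F q).comap (U.subtypeˆ) :=
  h.restrict.isFiniteMHS

theorem CMHS.isMHS {V : Type*} [AddCommGroup V] [Module ℚ V] [Module.Finite ℚ V]
    {W : ℤ → Submodule ℚ V} {F : ℤ → Submodule ℂ (ℂ ⊗[ℚ] V)}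
    (h : CMHS (conjTensor V) ⊥ ⊤ (fun k => (W k)ˆ) F) : IsMHS V W F where
  W_mono _ _ hkl := baseChange_le_baseChange.1 (h.W_mono hkl)
  F_anti := h.F_anti
  exists_le _ _ := ⟨⊤, le_top, by
    refine CMHS.isFiniteMHS_restrict ?_
    rw [baseChange_top]
    simpa only [inf_top_eq] using h⟩

theorem IsMH.cmhs_gr {S : FDGA.{u} ℚ} {F : HodgeFil S°} (h : IsMH S F) (n : ℕ) :
    CMHS (conjTensor (S.gr n)) ⊥ ⊤ (fun p => ((S.Dec p n).comap (S.gr n).subtype)ˆ)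
      (fun q => (F.F q n).comap ((S.gr n).subtypeˆ)) := by
  have e : ∀ p, S.Dec p n = S.W (p - n) n := fun p => inf_eq_left.2 fun x hx => h.d_W _ _ x hx
  simp only [e]
  refine CMHS.restrict (W := fun p => S.W (p - n) n) (F := fun q => F.F q n) ?_
  have h1 : ∀ k : ℤ, (S.W (k - n) n)ˆ ⊓ (S.gr n)ˆ =
      (S.W (k - n) n)ˆ := fun k => inf_eq_left.2 (baseChange_mono ℂ (S.W_le _ _))
  have h2 : ∀ q : ℤ, F.F q n ⊓ (S.gr n)ˆ = F.F q n := fun q => inf_eq_left.2 (F.F_le _ _)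
  simp only [h1, h2]
  exact h.cmhs n

theorem IsMH.mem_iff {S S' : FDGA.{u} ℚ} {F : HodgeFil S°} {F' : HodgeFil S'°}
    (h : IsMH S F) (h' : IsMH S' F') {f : FDGAHom S S'}
    (hf : ∀ q n x, x ∈ F.F q n → f° x ∈ F'.F q n) (hi : Function.Injective f.toFun) :
    (∀ n x, f x ∈ S'.gr n ↔ x ∈ S.gr n) ∧ (∀ p n x, f x ∈ S'.W p n ↔ x ∈ S.W p n) ∧
      ∀ q n x, f° x ∈ F'.F q n ↔ x ∈ F.F q n := by
  have hiC : Function.Injective f°.toFun := by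
    have h1 := baseChange_ker fˡ
    rw [LinearMap.ker_eq_bot.2 hi, baseChange_bot] at h1
    exact LinearMap.ker_eq_bot.1 h1.symm
  have hgr : ∀ n x, f x ∈ S'.gr n → x ∈ S.gr n := fun n x hx => by
    have h1 : f (DirectSum.decompose S.gr x n : S) = f x := by
      have key : ∀ x, f (DirectSum.decompose S.gr x n : S) =
          DirectSum.decompose S'.gr (f x) n := fun x => by
        induction x using DirectSum.Decomposition.inductionOn S.gr with
        | zero => simp
        | @homogeneous l x =>
          by_cases hl : l = n
          · subst hl
            rw [DirectSum.decompose_of_mem_same _ x.2,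
              DirectSum.decompose_of_mem_same _ (f.map_gr _ _ x.2)]
          · rw [DirectSum.decompose_of_mem_ne _ x.2 hl,
              DirectSum.decompose_of_mem_ne _ (f.map_gr _ _ x.2) hl, map_zero]
        | add x y hx hy =>
          rw [DirectSum.decompose_add, map_add f.toFun x y, DirectSum.decompose_add,
            DirectSum.add_apply, DirectSum.add_apply, Submodule.coe_add, Submodule.coe_add, map_add,
            hx, hy]
      rw [key, DirectSum.decompose_of_mem_same _ hx]
    exact hi h1 ▸ SetLike.coe_mem _
  have hgrC : ∀ n x, f° x ∈ S'°.gr n → x ∈ S°.gr n := by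
    intro n x hx
    have h1 : (S'.gr n).comap fˡ ≤ S.gr n := hgr n
    have h2 := baseChange_mono ℂ h1
    rw [baseChange_comap] at h2
    exact h2 hx
  have m : ∀ n : ℕ, CMHS.Mor (conjTensor S) (fun k => (S.W (k - n) n)ˆ)
      (fun q => F.F q n) (conjTensor S') (fun k => (S'.W (k - n) n)ˆ)
      (fun q => F'.F q n) f°ˡ := fun n =>
    ⟨fun x => (conjTensor_baseChange fˡ x).symm, fun k => f°.map_W _ n, fun q x hx => hf q n x hx⟩
  refine ⟨fun n x => ⟨hgr n x, f.map_gr n x⟩, fun p n x => ⟨fun hx => ?_, f.map_W p n x⟩,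
    fun q n x => ⟨fun hx => ?_, hf q n x⟩⟩
  · have h1 : f° (1 ⊗ₜ x) ∈ (S'.W (p + n - n) n)ˆ := by
      rw [add_sub_cancel_right]
      exact tmul_one_mem_baseChange.2 hx
    obtain ⟨y, hy, e⟩ := (m n).exists_strict_W (h.cmhs n) (h'.cmhs n) (k := p + n)
      (tmul_one_mem_baseChange.2 (hgr n x (S'.W_le _ _ hx))) h1
    rw [← map_sub, mem_bot] at e
    have e1 := hiC (e.trans (map_zero f°.toFun).symm)
    rw [add_sub_cancel_right, ← sub_eq_zero.1 e1] at hy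
    exact tmul_one_mem_baseChange.1 hy
  · obtain ⟨k, hk⟩ := (h'.cmhs n).W_top
    obtain ⟨y, hy, e⟩ := (m n).exists_strict_FW (h.cmhs n) (h'.cmhs n) (p := q) (k := k)
      (hgrC n x (F'.F_le _ _ hx)) hx (by
        have h2 : f° x ∈ (S'.gr n)ˆ := F'.F_le _ _ hx
        rw [← hk] at h2
        exact h2)
    rw [← map_sub, mem_bot] at e
    rw [sub_eq_zero.1 (hiC (e.trans (map_zero f°.toFun).symm))]
    exact hy.1

/-- The union of an increasing sequence of mixed Hodge dga's of finite type. -/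
theorem exists_union_hodgeFil {D : ℕ → FDGA.{u} ℚ} {F : ∀ i, HodgeFil (D i)°}
    (hF : ∀ i, IsMH (D i) (F i)) {f : ∀ i, FDGAHom (D i) (D (i + 1))}
    (hfF : ∀ i q n x, x ∈ (F i).F q n → (f i)° x ∈ (F (i + 1)).F q n)
    {M : FDGA.{u} ℚ} {j : ∀ i, FDGAHom (D i) M} (h : FDGA.IsUnion f j) :
    ∃ G : HodgeFil M°, (∀ n, IsMHS (M.gr n) (fun p => (M.Dec p n).comap (M.gr n).subtype)
        (fun q => (G.F q n).comap ((M.gr n).subtypeˆ))) ∧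
      (∀ i q n x, x ∈ (F i).F q n → (j i)° x ∈ G.F q n) ∧
      ∀ q n x, x ∈ G.F q n → ∃ i, ∃ y ∈ (F i).F q n, (j i)° y = x := by
  have hC := h.baseChange
  have mem : ∀ {P : ∀ i, Submodule ℂ (D i)°} i x y, x ∈ P i → (j i)° x = y →
      y ∈ IsUnion.sub (fun i => (j i)°ˡ) P := by
    rintro P i x _ hx rfl
    exact IsUnion.map_mem_sub (j := fun i => (j i)°ˡ) hx
  let G : HodgeFil M° :=
    { F := fun q n => IsUnion.sub (fun i => (j i)°ˡ) fun i => (F i).F q n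
      F_le := fun q n => iSup_le fun i => by
        rintro _ ⟨x, hx, rfl⟩
        exact (j i)°.map_gr n x ((F i).F_le q n hx)
      F_anti := fun n p q hpq => IsUnion.sub_mono fun i => (F i).F_anti n hpq
      one_F := mem (P := fun i => (F i).F 0 0) 0 1 _ (F 0).one_F (map_one _)
      mul_F := fun p q n l x y hx hy => by
        obtain ⟨i, a, ha, b, hb, rfl, rfl⟩ := hC.union.exists_common (fun i => hfF i p n)
          (fun i => hfF i q l) hx hy
        exact mem (P := fun i => (F i).F (p + q) (n + l)) i _ _ ((F i).mul_F _ _ _ _ _ _ ha hb)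
          (map_mul (j i)°.toFun a b)
      d_F := fun q n x hx => by
        obtain ⟨i, a, ha, rfl⟩ := (hC.union.mem_sub fun i => hfF i q n).1 hx
        exact mem (P := fun i => (F i).F q (n + 1)) i _ _ ((F i).d_F q n a ha) ((j i)°.map_d a) }
  have hmem := fun i => (hF i).mem_iff (hF (i + 1)) (hfF i) fun x y e => h.union.inj i
    ((h.union.comp i x).symm.trans ((congrArg (j (i + 1)).toFun e).trans (h.union.comp i y)))
  have hWiff : ∀ p n i x, j i x ∈ M.W p n ↔ x ∈ (D i).W p n := fun p n i x =>
    ⟨fun hx => (h.union.mem_sub_iff fun i x => (hmem i).2.1 p n x).1 (h.W p n hx), (j i).map_W p n x⟩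
  have hFiff : ∀ q n i x, (j i)° x ∈ G.F q n ↔ x ∈ (F i).F q n := fun q n i x =>
    hC.union.mem_sub_iff fun i x => (hmem i).2.2 q n x
  have hdW : ∀ p n, M.Dec p n = M.W (p - n) n := fun p n => inf_eq_left.2 fun x hx => by
    obtain ⟨i, y, hy, rfl⟩ := h.exists_W hx
    exact mem_of_eq (S := M.W (p - n - 1) (n + 1)) ((j i).map_d y)
      ((j i).map_W _ _ _ ((hF i).d_W _ _ y hy))
  refine ⟨G, fun n => ⟨fun p q hpq => comap_mono (inf_le_inf
    (M.W_mono n (by simpa using hpq)) (comap_mono (M.W_mono (n + 1) (by simpa using hpq)))),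
    fun p q hpq => comap_mono (G.F_anti n hpq), fun T hT => ?_⟩,
    fun i q n x hx => (hFiff q n i x).2 hx,
    fun q n x hx => (hC.union.mem_sub fun i => hfF i q n).1 hx⟩
  let φ : ∀ i, (D i).gr n →ₗ[ℚ] M.gr n := fun i => (j i)ˡ.restrict ((j i).map_gr n)
  have hφ : Monotone fun i => range (φ i) := monotone_nat_of_le_succ fun i => by
    rintro _ ⟨x, rfl⟩
    exact ⟨⟨f i x, (f i).map_gr n _ x.2⟩, Subtype.ext (h.union.comp i x)⟩
  obtain ⟨L, hL⟩ := exists_stable T hφ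
  refine ⟨range (φ L), fun x hx => ?_, ?_⟩
  · obtain ⟨i, y, hy, e⟩ := h.exists_gr x.2; exact hL L le_rfl i x hx ⟨⟨y, hy⟩, Subtype.ext e⟩
  have := (hF L).finite n
  refine CMHS.isFiniteMHS_restrict ?_
  have hinj : Function.Injective ((φ L)ˆ) := by
    rw [← ker_eq_bot, ← baseChange_ker, LinearMap.ker_eq_bot.2 fun x y e =>
      Subtype.ext (h.union.inj L (congrArg Subtype.val e)), baseChange_bot]
  have h1 := ((hF L).cmhs_gr n).map_injective hinj (c' := conjTensor (M.gr n))
    (fun x => (conjTensor_baseChange (φ L) x).symm) conjTensor_conjTensor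
  have hr : (range (φ L))ˆ = range ((φ L)ˆ) := by
    rw [LinearMap.range_eq_map, baseChange_map, baseChange_top, LinearMap.range_eq_map]
  have e1 : ∀ p, (((D L).Dec p n).comap ((D L).gr n).subtype)ˆ =
      (((M.Dec p n).comap (M.gr n).subtype)ˆ).comap ((φ L)ˆ) := fun p => by
    rw [← baseChange_comap]
    congr 1
    ext x
    rw [hdW]
    have h2 : (D L).Dec p n = (D L).W (p - n) n := inf_eq_left.2 fun x hx => (hF L).d_W _ _ x hx
    rw [h2]
    exact (hWiff _ n L x).symm
  have e2 : ∀ q, ((F L).F q n).comap (((D L).gr n).subtypeˆ) =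
      ((G.F q n).comap ((M.gr n).subtypeˆ)).comap ((φ L)ˆ) := fun q => by
    ext x
    have h2 : (M.gr n).subtypeˆ ((φ L)ˆ x) = (j L)° (((D L).gr n).subtypeˆ x) :=
      LinearMap.congr_fun (baseChange_hom_ext (f := (M.gr n).subtypeˆ ∘ₗ (φ L)ˆ)
        (g := (j L)°ˡ ∘ₗ ((D L).gr n).subtypeˆ)
        fun _ => rfl) x
    change _ ↔ (M.gr n).subtypeˆ ((φ L)ˆ x) ∈ G.F q n
    rw [h2]
    exact (hFiff q n L _).symm
  simp only [e1, e2, Submodule.map_comap_eq, Submodule.map_top] at h1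
  rw [hr]
  simpa only [inf_comm] using h1

section

/-! ## The minimal model -/

variable {m : ℕ} {A : HodgeDiagram.{u} m}

@[reducible] def State.toMHDga (S : State A) : MHDga.{u} where
  Q := S.Q
  F := S.F
  mhs n := have := S.isMH.finite n; (S.isMH.cmhs_gr n).isMHS

theorem State.unit_isBase : (State.unit A).toMHDga.IsBase where
  bijective := ULift.up_bijective
  W_top p hp := (if_pos hp).trans (if_pos rfl)
  W_bot p hp := if_neg (not_le.2 hp)
  F_top q hq := by
    change (if q ≤ 0 then (FDGA.unitGr 0)ˆ else ⊥) = ⊤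
    rw [if_pos hq, FDGA.unitGr, if_pos rfl, baseChange_top]
  F_bot q hq := if_neg (not_le.2 hq)

/-- Attaching a cell is a minimal mixed Hodge extension. -/
theorem Step.exists_isMinimal {S S' : State A} (s : Step S S') :
    ∃ e : MHExtension S.toMHDga S'.toMHDga ⟨s.f.f, s.f.map_F⟩ s.n, e.IsMinimal := by
  obtain ⟨l, hl⟩ := s.c.exists_W
  refine ⟨{
    V := s.c.V
    WV := s.c.WV
    FV := s.c.FV
    mhs := s.c.cmhs.isMHS
    ξ := s.c.ξ
    ξ_gr := fun v => S.Q.W_le _ _ (s.c.ξ_W l v (hl ▸ trivial))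
    d_ξ := s.c.d_ξ
    ξ_W := s.c.ξ_W
    i := s.i
    free := s.step.free.free
    d_i := s.step.free.d_i
    W_ext := s.step.free.W_ext
    j := s.iˆ + s.f.f°ˡ ∘ₗ s.c.a
    j_W := fun p x hx => ⟨s.c.a x, s.c.a_W p x hx, add_sub_cancel_right _ _⟩
    ξ_F := fun q x hx => ⟨_, s.c.a_F q x hx, ?_⟩
    F_ext := s.step.F_ext }, s.c.pos, s.c.ξ_dec⟩
  change S'.Q°.d (s.iˆ x + s.f.f° (s.c.a x)) = _
  rw [map_add, map_add, s.f.f°.map_d]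
  congr 1
  exact LinearMap.congr_fun (baseChange_hom_ext (f := S'.Q°.d ∘ₗ s.iˆ) (g := s.f.f°ˡ ∘ₗ s.c.ξˆ)
    fun v => congrArg (fun y => (1 : ℂ) ⊗ₜ[ℚ] y) (s.step.free.d_i v)) x

theorem FDGAHom.isQuasiIso_of {k : Type} [Field k] {X Y : FDGA.{u} k} {f : FDGAHom X Y}
    (hi : ∀ n, ∀ x ∈ X.cocycles n, f x ∈ Y.coboundaries n → x ∈ X.coboundaries n)
    (hs : ∀ n, ∀ z ∈ Y.cocycles n, ∃ y ∈ X.cocycles n, z - f y ∈ Y.coboundaries n) :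
    f.IsQuasiIso := by
  refine fun n => ⟨LinearMap.ker_eq_bot.1 ((Submodule.eq_bot_iff _).2 fun x hx => ?_), fun z => ?_⟩
  · obtain ⟨x, rfl⟩ := mkQ_surjective _ x
    exact (Submodule.Quotient.mk_eq_zero _).2 (hi n x x.2 ((Submodule.Quotient.mk_eq_zero
      ((Y.coboundaries n).submoduleOf (Y.cocycles n))).1 hx))
  · obtain ⟨z, rfl⟩ := mkQ_surjective _ z
    obtain ⟨y, hy, h⟩ := hs n z z.2
    exact ⟨Submodule.Quotient.mk ⟨y, hy⟩, ((Submodule.Quotient.eq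
      ((Y.coboundaries n).submoduleOf (Y.cocycles n))).2 h).symm⟩

/-- A family of maps to the nodes that is compatible in cohomology with the comparison morphisms
consists of quasi-isomorphisms if the rational component is one. -/
theorem HodgeDiagram.IsMixedHodge.isQuasiIso_node (hA : A.IsMixedHodge) {M : FDGA.{u} ℚ}
    {ρQ : FDGAHom M A.Q} {ρ : ∀ v, FDGAHom M° (A.node v)} (hρ : ρ .left = ρQ°)
    (hcoh : ∀ n, ∀ z ∈ M°.cocycles n, IsMixedHodge.Coh A n fun v => ρ v z)
    (hi : ∀ n, ∀ x ∈ M.cocycles n, ρQ x ∈ A.Q.coboundaries n → x ∈ M.coboundaries n)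
    (hs : ∀ n, ∀ z ∈ A.Q.cocycles n, ∃ y ∈ M.cocycles n, z - ρQ y ∈ A.Q.coboundaries n) (v) :
    (ρ v).IsQuasiIso := by
  refine FDGAHom.isQuasiIso_of (fun n x hx hxv => ?_) fun n => ?_
  · have h1 : ρQ° x ∈ A.Q°.coboundaries n := hρ ▸ (hcoh n x hx).exact hA hxv .left
    rw [baseChange_coboundaries] at h1 ⊢
    rw [baseChange_cocycles] at hx
    have h2 : M.cocycles n ⊓ (A.Q.coboundaries n).comap ρQˡ ≤ M.coboundaries n :=
      fun x hx => hi n x hx.1 hx.2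
    have h3 := baseChange_mono ℂ h2
    rw [baseChange_inf, baseChange_comap] at h3
    exact h3 ⟨hx, h1⟩
  · refine ZVertex.zigzag_induction (P := fun v => ∀ z ∈ (A.node v).cocycles n,
      ∃ y ∈ M°.cocycles n, z - ρ v y ∈ (A.node v).coboundaries n) ?_ (fun u => ?_) v
    · intro z hz
      change z ∈ A.Q°.cocycles n at hz
      rw [baseChange_cocycles] at hz
      have h2 : A.Q.cocycles n ≤ (M.cocycles n).map ρQˡ ⊔ A.Q.coboundaries n := by
        intro z hz
        obtain ⟨y, hy, h⟩ := hs n z hz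
        rw [← add_sub_cancel (ρQ y) z]
        exact add_mem_sup ⟨y, hy, rfl⟩ h
      have h3 := baseChange_mono ℂ h2 hz
      rw [baseChange_sup, baseChange_map] at h3
      obtain ⟨_, ⟨y, hy, rfl⟩, b, hb, e⟩ := mem_sup.1 h3
      rw [← baseChange_coboundaries] at hb
      refine ⟨y, by rw [baseChange_cocycles]; exact hy, ?_⟩
      rw [hρ, ← e]
      exact mem_of_eq (S := A.Q°.coboundaries n) (add_sub_cancel_left _ b).symm hb
    · refine ⟨fun h z hz => ?_, fun h z hz => ?_⟩
      · obtain ⟨p, hp⟩ := (A.node u.tgt).W_exhaustive n z hz.1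
        obtain ⟨x, hx, hdx, hxz⟩ := hA.exists_lift_cocycle u hp hz.2
        obtain ⟨y, hy, hxy⟩ := h x ⟨(A.node u.src).W_le _ _ hx, hdx⟩
        refine ⟨y, hy, ?_⟩
        have h1 := add_mem ((A.φ u).map_coboundaries n _ hxy) ((hcoh n y hy).compat u)
        rw [map_sub, sub_add_sub_cancel] at h1
        have h2 := sub_mem h1 hxz
        rwa [sub_sub_sub_cancel_left] at h2
      · obtain ⟨y, hy, hzy⟩ := h _ ((A.φ u).map_cocycles n z hz)
        refine ⟨y, hy, hA.exact_of_map u (sub_mem hz ((ρ u.src).map_cocycles n y hy)) ?_⟩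
        have h1 := sub_mem hzy ((hcoh n y hy).compat u)
        rwa [sub_sub_sub_cancel_right, ← map_sub] at h1

/-- The ho-morphism from the constant diagram of a mixed Hodge dga given by maps to the nodes and
homotopies. -/
theorem MHDga.exists_hoMorphism (M : MHDga.{u}) (ρQ : FDGAHom M.Q A.Q)
    (ρ : ∀ v, FDGAHom M.Q° (A.node v)) (hρ : ρ .left = ρQ°)
    (ρ_F : ∀ q n x, x ∈ M.F.F q n → ρ .right x ∈ A.F.F q n)
    (h : ∀ u : ZArrow m, FDGAHom M.Q° ((A.node u.tgt).path 1))
    (h_zero : ∀ u x, evalAt 0 (h u x) = ρ u.tgt x)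
    (h_one : ∀ u x, evalAt 1 (h u x) = A.φ u (ρ u.src x))
    (hQ : ρQ.IsQuasiIso) (hq : ∀ v, (ρ v).IsQuasiIso) :
    ∃ f : HoMorphism (M.toDiagram m) A, f.toPreMorphism.IsQuasiIso := by
  let f : PreMorphism (M.toDiagram m) A :=
    ⟨ρQ, ρ .right, ρ_F, fun i => ρ (.even i), fun i => ρ (.odd i)⟩
  have hf : ∀ v x, f.node v x = ρ v ((fromNode M.Q v).toFun x) := by
    intro v x
    cases v with
    | left => rw [hρ]; rfl
    | _ => rfl
  have hf' : ∀ v x, f.node v ((toNode M.Q v).toFun x) = ρ v x := by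
    intro v x
    cases v with
    | left => rw [hρ]; rfl
    | _ => rfl
  refine ⟨⟨f, fun u => ⟨(h u).comp (fromNode M.Q u.src), fun x => ?_, fun x => ?_⟩⟩, hQ, hq _, fun v => ?_⟩
  · exact (h_zero u _).trans (hf' u.tgt _).symm
  · exact (h_one u _).trans (congrArg (A.φ u).toFun (hf u.src x).symm)
  · cases v with
    | left => have h1 := hq .left; rw [hρ] at h1; exact h1
    | _ => exact hq _

theorem mainTheorem3 (m : ℕ) (A : HodgeDiagram.{u} m) (hA : A.IsMixedHodge)
    (h0 : A.IsZeroConnected) :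
    ∃ M : MHDga.{u}, M.IsMinimal ∧
      (∃ ρ : HoMorphism (M.toDiagram m) A, ρ.toPreMorphism.IsQuasiIso) ∧
      ((∀ x ∈ A.Q.W (-2) 1, A.Q.d x = 0 → x ∈ A.Q.coboundaries 1) → M.Q.IsRegular) := by
  obtain ⟨T, hT0, hsurj, hdies, hreg⟩ := hA.exists_steps h0
  obtain ⟨M, j, hM⟩ := FDGA.exists_isUnion (fun i => (T.s i).f.f) fun i => (T.s i).step.free.injective
  obtain ⟨G, hmhs, hjF, hGF⟩ := exists_union_hodgeFil (fun i => (T.X i).isMH) (fun i => (T.s i).f.map_F) hM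
  have hMC := hM.baseChange
  obtain ⟨ρQ, hρQ⟩ := hM.exists_lift (fun i => (T.X i).ρQ) fun i => (T.s i).f.ρQ
  choose ρ hρ using fun v => hMC.exists_lift (fun i => (T.X i).ρ v) fun i => (T.s i).f.ρ v
  choose h hh using fun u => hMC.exists_lift (fun i => (T.X i).h u) fun i => (T.s i).f.h u
  have hleft : ρ .left = ρQ° := FDGAHom.ext (AlgHom.ext (hMC.hom_ext fun i x => by
    rw [hρ, (T.X i).ρ_left, ← FDGAHom.baseChange_comp]
    have : ρQ.comp (j i) = (T.X i).ρQ := FDGAHom.ext (AlgHom.ext (hρQ i))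
    rw [this]))
  have hdie : ∀ {i k z}, T.tower.Dies i k z → j k z ∈ M.coboundaries i := by
    intro i k z hz
    induction hz with
    | now hz => exact (j _).map_coboundaries _ _ hz
    | @later k z _ ih => exact mem_of_eq (S := M.coboundaries i) (hM.union.comp k z) ih
  have hi : ∀ n, ∀ x ∈ M.cocycles n, ρQ x ∈ A.Q.coboundaries n → x ∈ M.coboundaries n := by
    intro n x hx hxQ
    obtain ⟨k, y, hy, rfl⟩ := hM.exists_cocycle hx
    exact hdie (hdies n k y ⟨hy, mem_of_eq (S := A.Q.coboundaries n) (hρQ k y) hxQ⟩)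
  have hs : ∀ n, ∀ z ∈ A.Q.cocycles n, ∃ y ∈ M.cocycles n, z - ρQ y ∈ A.Q.coboundaries n := by
    intro n z hz
    obtain ⟨k, hk⟩ := hsurj n
    obtain ⟨y, hy, hzy⟩ := hk z hz
    exact ⟨j k y, (j k).map_cocycles _ _ hy, by rw [hρQ]; exact hzy⟩
  refine ⟨⟨M, G, hmhs⟩, ⟨fun k => (T.X k).toMHDga, fun k => (T.s k).n, fun k => ⟨(T.s k).f.f, (T.s k).f.map_F⟩,
    fun k => ⟨j k, hjF k⟩, ?_, fun k => (T.s k).exists_isMinimal, hM.union.comp, hM.union.inj,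
    fun p n x hx => hM.exists_W hx, hGF⟩,
    MHDga.exists_hoMorphism ⟨M, G, hmhs⟩ ρQ ρ hleft (fun q n x hx => ?_) h (fun u => ?_) (fun u => ?_)
      (FDGAHom.isQuasiIso_of hi hs) (hA.isQuasiIso_node hleft (fun n z hz => ?_) hi hs),
    fun hR n => ?_⟩
  · beta_reduce; rw [hT0]; exact State.unit_isBase
  · obtain ⟨i, y, hy, rfl⟩ := hGF q n x hx; rw [hρ]; exact (T.X i).ρ_F q n y hy
  · exact hMC.hom_ext fun i x => by rw [hh, hρ, (T.X i).h_zero]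
  · exact hMC.hom_ext fun i x => by rw [hh, hρ, (T.X i).h_one]
  · obtain ⟨i, y, hy, rfl⟩ := hMC.exists_cocycle hz; simp only [hρ]; exact (T.X i).coh hy
  · obtain ⟨p, hp⟩ := hreg hR n
    refine ⟨p, (Submodule.eq_bot_iff _).2 fun x hx => ?_⟩
    obtain ⟨i, y, hy, rfl⟩ := hM.exists_W hx
    rw [hp i, mem_bot] at hy
    rw [hy, map_zero]

end
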